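/- **The source language HVK.** Fix constants (including distinct $\mathrm{true},\mathrm{false}$), labels, and operators on constants with a (partial) evaluation. Names, channels and variables are *names*; *values* $v$ are names, constants and labels; expressions $e$ are built from values by operators, and $e\downarrow v$ is evaluation (values evaluate to themselves). Processes are $$\begin{aligned}P::={}&\mathsf{request}\ a(k)\ \mathsf{in}\ P\mid \mathsf{accept}\ a(k)\ \mathsf{in}\ P\mid k![\vec e];P\mid k?(\vec x)\ \mathsf{in}\ P\mid k\lhd l;P\mid k\rhd\{l_1:P_1\parallel\dots\parallel l_n:P_n\}\\ \mid{}&\mathsf{throw}\ k[k'];P\mid \mathsf{catch}\ k(k')\ \mathsf{in}\ P\mid \mathsf{if}\ e\ \mathsf{then}\ P\ \mathsf{else}\ Q\mid P|Q\mid \mathbf 0\mid(\nu u)P\mid X[\vec e\,]\end{aligned}$$ with the $l_i$ pairwise distinct; names in round parentheses are bound. A program is $\mathsf{def}\ D\ \mathsf{in}\ P$ with $D$ a finite list of declarations $X_i(\vec x_i)=P_i$. Structural congruence $\equiv_h$ is the least congruence that contains renaming of bound names, the commutative monoid laws of $(|,\mathbf 0)$, $(\nu u)\mathbf 0\equiv\mathbf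 0$, $(\nu u)(\nu u')P\equiv(\nu u')(\nu u)P$ and $(\nu u)P\,|\,Q\equiv(\nu u)(P|Q)$ for $u$ not free in $Q$; it is extended to programs with the same $D$. A *redex* is a pair of processes (in either order) that reduces by one of 1. $\mathsf{request}\ a(k)\ \mathsf{in}\ P\,|\,\mathsf{accept}\ a(k)\ \mathsf{in}\ Q\to(\nu k)(P|Q)$; 2. $k![\vec e];P\,|\,k?(\vec x)\ \mathsf{in}\ Q\to P\,|\,Q[\vec v/\vec x]$ if $|\vec e|=|\vec x|$ and $\vec e\downarrow\vec v$; 3. $k\lhd l_i;P\,|\,k\rhd\{l_1:P_1\parallel\dots\parallel l_n:P_n\}\to P\,|\,P_i$; 4. $\mathsf{throw}\ k[k'];P\,|\,\mathsf{catch}\ k(x)\ \mathsf{in}\ Q\to P\,|\,Q[k'/x]$. Reduction $\to$ is generated by these rules, the two rules for conditionals, the unfolding $X[\vec e\,]\to P[\vec v/\vec x]$ for $X(\vec x)=P$ in $D$ and $\vec e\downarrow\vec v$, and closure under $|$, $\nu$, $\mathsf{def}\,D\,\mathsf{in}$ and $\equiv_h$. A program is in *normal form* if it is $\mathsf{def}\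 D\ \mathsf{in}\ \nu\vec u(Q_1|\cdots|Q_n)$, where no $Q_i$ has $\nu$, $|$ or a process variable as its top-level operator ($\mathbf 0$ is the case $n=0$ with no declarations). *Outermost reduction* $P\to_hP'$: $P\to^*\equiv_hP'$, $P\equiv_h\mathsf{def}\ D\ \mathsf{in}\ \nu\vec x(Q_1|\cdots|Q_n)$ in normal form, and $P'$ is, up to $\equiv_h$, the program obtained by reducing once every $Q_i$ that is a conditional that reduces and by reducing once every pair of a family of disjoint redexes $Q_i|Q_j$, where the remaining $Q_i$ are unchanged, are not conditionals that reduce, and form no redex with any $Q_j$. $P$ is *deterministic* if any two sequences $P\equiv_hP_1\to_h\cdots\to_hP_n$ and $P\equiv_hP_1'\to_h\cdots\to_hP_n'$ satisfy $P_i\equiv_hP_i'$ for all $i$. A program in normal form is *evenly paired* if each $Q_i$ forms a redex with at most one $Q_j$, and whenever $k\lhd l;Q$ and $k\rhd\{l_1:\cdots\parallel l_n:\cdots\}$ are among the $Q_i$, $l$ is one of $l_1,\dots,l_n$. **The target calculus utcc.** Constraints are first-order formulas over the constants, labels, operators and the uninterpreted predicates $\mathsf{req},\mathsf{acc},\mathsf{sel},\mathsf{out},\mathsf{outk},\mathsf{out}',\mathsf{call}_X$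 and their overlined versions $\overline p$; $c\vdash d$ means that $c\Rightarrow d$ is valid in the theory of the equations $o(\vec c)=c$ where the operator $o$ evaluates to $c$ on $\vec c$. Constraints are identified up to logical equivalence when they are stores. Processes are $$P::=\mathbf{skip}\mid\mathbf{tell}(c)\mid(\mathbf{abs}\ \vec x;c)P\mid P\parallel Q\mid(\mathbf{local}\ \vec x;c)P\mid\mathbf{next}\,P\mid\mathbf{unless}\ c\ \mathbf{next}\,P\mid{!P}.$$ $\equiv_u$ is the least congruence that contains renaming of bound names, the commutative monoid laws of $(\parallel,\mathbf{skip})$, $P\parallel(\mathbf{local}\ \vec x;c)Q\equiv(\mathbf{local}\ \vec x;c)(P\parallel Q)$ for $\vec x$ not free in $P$, and $(\mathbf{local}\ \vec x;c)(\mathbf{local}\ \vec y;d)P\equiv(\mathbf{local}\ \vec x\vec y;c\wedge d)P$ for disjoint $\vec x,\vec y$, with $\vec y$ not free in $c$ and $c\vdash\exists\vec y\,d$. Internal transitions, up to $\equiv_u$ and closed under $\parallel$, are $\langle\mathbf{tell}(c),d\rangle\to\langle\mathbf{skip},d\wedge c\rangle$; $\langle\mathbf{unless}\ c\ \mathbf{next}\,P,d\rangle\to\langle\mathbf{skip},d\rangle$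 if $d\vdash c$; $\langle{!P},d\rangle\to\langle P\parallel\mathbf{next}\,{!P},d\rangle$; $\langle(\mathbf{abs}\ \vec x;c)P,d\rangle\to\langle P[\vec t/\vec x]\parallel(\mathbf{abs}\ \vec x;c\wedge\vec x\neq\vec t)P,d\rangle$ if $d\vdash c[\vec t/\vec x]$, with $\vec t$ values and $\neq$ syntactic difference; and $\langle(\mathbf{local}\ \vec x;c)P,d\rangle\to\langle(\mathbf{local}\ \vec x;c')P',d\wedge\exists\vec x\,c'\rangle$ if $\langle P,c\wedge\exists\vec x\,d\rangle\to\langle P',c'\wedge\exists\vec x\,d\rangle$. If $\langle P,c\rangle\to^*\langle Q,d\rangle\not\to$ then $P\Longrightarrow^{(c,d)}F(Q)$, where $F$ maps $\mathbf{skip}$ and abstractions to $\mathbf{skip}$, commutes with $\parallel$, maps $(\mathbf{local}\ \vec x;c)Q$ to $(\mathbf{local}\ \vec x;\mathrm{true})F(Q)$, and maps $\mathbf{next}\,Q$ and $\mathbf{unless}\ c\ \mathbf{next}\,Q$ to $Q$. $P\Longrightarrow R$ means $P\Longrightarrow^{(\mathrm{true},d)}R$ for some $d$. The output behavior of $P$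 is the set of infinite sequences $c_1c_2\cdots$ with $P=P_1\Longrightarrow^{(\mathrm{true},c_1)}P_2\Longrightarrow^{(\mathrm{true},c_2)}\cdots$, and $P\approx Q$ means that $P\parallel{!\mathbf{tell}(\exists x\,\mathsf{out}'(x))}$ and $Q\parallel{!\mathbf{tell}(\exists x\,\mathsf{out}'(x))}$ have the same output behavior. **The encoding.** Write $\mathbf{when}\ c\ \mathbf{do}\ P$ for an abstraction on no variables and, with fresh $go,stop$, $$\begin{aligned}\underline{\mathbf{tell}}(c)&=(\mathbf{local}\ go,stop)(\mathbf{tell}(\mathsf{out}'(go))\parallel{!\mathbf{when}\ \mathsf{out}'(go)\ \mathbf{do}\ \mathbf{tell}(c)}\parallel{!\mathbf{unless}\ \mathsf{out}'(stop)\ \mathbf{next}\ \mathbf{tell}(\mathsf{out}'(go))}\\&\qquad\parallel{!\mathbf{when}\ \overline c\ \mathbf{do}\ {!\mathbf{tell}(\mathsf{out}'(stop))}}),\\ \underline{\mathbf{wait}}\ \vec x;c\ \mathbf{do}\ P&=(\mathbf{local}\ stop,go)(\mathbf{tell}(\mathsf{out}'(go))\parallel{!\mathbf{unless}\ \mathsf{out}'(stop)\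 \mathbf{next}\ \mathbf{tell}(\mathsf{out}'(go))}\\&\qquad\parallel{!(\mathbf{abs}\ \vec x;c\wedge\mathsf{out}'(go))(P\parallel\mathbf{tell}(\overline c)\parallel{!\mathbf{tell}(\mathsf{out}'(stop))})}),\end{aligned}$$ and $\underline{\mathbf{whenever}}\ c\ \mathbf{do}\ P$ for the latter without variables. Then $$\begin{aligned} [\![\mathsf{request}\ a(k)\ \mathsf{in}\ P]\!]&=(\mathbf{local}\ k)(\underline{\mathbf{tell}}(\mathsf{req}(a,k))\parallel\underline{\mathbf{whenever}}\ \mathsf{acc}(a,k)\ \mathbf{do}\ \mathbf{next}[\![P]\!]),\\ [\![\mathsf{accept}\ a(k)\ \mathsf{in}\ P]\!]&=\underline{\mathbf{wait}}\ k;\mathsf{req}(a,k)\ \mathbf{do}\ (\mathbf{tell}(\mathsf{acc}(a,k))\parallel\mathbf{next}[\![P]\!]),\\ [\![k![\vec e];P]\!]&=\underline{\mathbf{tell}}(\mathsf{out}(k,\vec e))\parallel\underline{\mathbf{whenever}}\ \overline{\mathsf{out}(k,\vec e)}\ \mathbf{do}\ \mathbf{next}[\![P]\!],\\ [\![k?(\vec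 x)\ \mathsf{in}\ P]\!]&=\underline{\mathbf{wait}}\ \vec x;\mathsf{out}(k,\vec x)\ \mathbf{do}\ \mathbf{next}[\![P]\!],\\ [\![k\lhd l;P]\!]&=\underline{\mathbf{tell}}(\mathsf{sel}(k,l))\parallel\underline{\mathbf{whenever}}\ \overline{\mathsf{sel}(k,l)}\ \mathbf{do}\ \mathbf{next}[\![P]\!],\\ [\![k\rhd\{l_i:P_i\}_{i\le n}]\!]&=\underline{\mathbf{wait}}\ l;\mathsf{sel}(k,l)\ \mathbf{do}\ \textstyle\prod_{i\le n}\mathbf{when}\ l=l_i\ \mathbf{do}\ \mathbf{next}[\![P_i]\!],\\ [\![\mathsf{throw}\ k[k'];P]\!]&=\underline{\mathbf{tell}}(\mathsf{outk}(k,k'))\parallel\underline{\mathbf{whenever}}\ \overline{\mathsf{outk}(k,k')}\ \mathbf{do}\ \mathbf{next}[\![P]\!],\\ [\![\mathsf{catch}\ k(k')\ \mathsf{in}\ P]\!]&=\underline{\mathbf{wait}}\ k';\mathsf{outk}(k,k')\ \mathbf{do}\ \mathbf{next}[\![P]\!],\\ [\![\mathsf{if}\ e\ \mathsf{then}\ P\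 \mathsf{else}\ Q]\!]&=\mathbf{when}\ e=\mathrm{true}\ \mathbf{do}\ \mathbf{next}[\![P]\!]\parallel\mathbf{when}\ e=\mathrm{false}\ \mathbf{do}\ \mathbf{next}[\![Q]\!],\\ [\![P|Q]\!]&=[\![P]\!]\parallel[\![Q]\!],\quad[\![\mathbf 0]\!]=\mathbf{skip},\quad[\![(\nu u)P]\!]=(\mathbf{local}\ u)[\![P]\!],\quad[\![X[\vec e\,]]\!]=\mathbf{tell}(\mathsf{call}_X(\vec e)),\\ [\![\mathsf{def}\ D\ \mathsf{in}\ P]\!]&=\textstyle\prod_{(X(\vec x)=B)\in D}{!(\mathbf{abs}\ \vec x;\mathsf{call}_X(\vec x))[\![B]\!]}\parallel[\![P]\!]. \end{aligned}$$ **Theorem (Operational Correspondence).** Let $P$ be a deterministic, evenly paired HVK program in normal form. 1. *Soundness.* For every program $Q$ with $P\to_hQ$ there is a utcc process $R$ with $[\![P]\!]\Longrightarrow R$ and $R\approx[\![Q]\!]$. 2. *Completeness.* For every utcc process $S$ with $[\![P]\!]\Longrightarrow S$ there is a deterministic program $Q$ with $P\to_hQ$ and $[\![Q]\!]\approx S$.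 -/

import Mathlib

universe u

/-! ## Values, constraints and expressions

Binders are represented by de Bruijn indices throughout, both in the source and in the target
language: index `0` is the innermost binder, a binder of `n` names occupies the indices
`0, …, n - 1`, and an index that exceeds all enclosing binders is a free name.  Processes that
differ only in the choice of bound names are therefore equal. -/

/-- The parameters of the session language: constants (with two booleans), labels, and operators of
expressions with their evaluation (partial, since an operator may be applied to constants of the
wrong kind). -/
structure Sig where
  Const : Type u
  Label : Type u
  Op : ℕ → Type u
  tt : Const
  ff : Const
  tt_ne_ff : tt ≠ ff
  interp : {n : ℕ} → Op n → (Fin n → Const) → Option Const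

/-- Function symbols of the constraint system: constants, labels and the operators. -/
inductive Fn (S : Sig.{u}) : ℕ → Type u
  | const (c : S.Const) : Fn S 0
  | label (l : S.Label) : Fn S 0
  | op {n : ℕ} (o : S.Op n) : Fn S n

/-- Predicate symbols of the constraint system, all of them uninterpreted.  `bar p` is the
overlined version of `p`, used for acknowledgements; `outp'` is the private predicate of the
persistent constructs; `call X n` is the predicate for calls of the `n`-ary procedure `X`. -/
inductive Pr : ℕ → Type
  | req : Pr 2
  | acc : Pr 2
  | out (n : ℕ) : Pr (n + 1)
  | sel : Pr 2
  | outk : Pr 2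
  | call (X n : ℕ) : Pr n
  | outp' : Pr 1
  | bar {n : ℕ} (p : Pr n) : Pr n

/-- The first-order signature. -/
def Lg (S : Sig.{u}) : FirstOrder.Language.{u, 0} := ⟨Fn S, Pr⟩

/-- Terms over the names; they are also the expressions of the session language. -/
abbrev Tm (S : Sig.{u}) : Type u := (Lg S).Term ℕ

/-- Constraints: first-order formulas whose free variables are the names. -/
abbrev Constr (S : Sig.{u}) : Type u := (Lg S).Formula ℕ

/-- Values: names (a name, a channel or a variable), constants and labels. -/
inductive Val (S : Sig.{u}) : Type u
  | var (i : ℕ) : Val S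
  | const (c : S.Const) : Val S
  | label (l : S.Label) : Val S

/-- A value as a term. -/
def Val.tm {S : Sig.{u}} : Val S → Tm S
  | .var i => FirstOrder.Language.Term.var i
  | .const c => FirstOrder.Language.Term.func (L := Lg S) (Fn.const c) Fin.elim0
  | .label l => FirstOrder.Language.Term.func (L := Lg S) (Fn.label l) Fin.elim0

/-- Evaluation of expressions, `e ↓ v`. -/
inductive Eval {S : Sig.{u}} : Tm S → Val S → Prop
  | var (i : ℕ) : Eval (FirstOrder.Language.Term.var i) (.var i)
  | const (c : S.Const) (ts : Fin 0 → Tm S) :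
      Eval (FirstOrder.Language.Term.func (L := Lg S) (Fn.const c) ts) (.const c)
  | label (l : S.Label) (ts : Fin 0 → Tm S) :
      Eval (FirstOrder.Language.Term.func (L := Lg S) (Fn.label l) ts) (.label l)
  | op {n : ℕ} (o : S.Op n) (ts : Fin n → Tm S) (cs : Fin n → S.Const) (c : S.Const)
      (hts : ∀ i, Eval (ts i) (.const (cs i))) (hc : S.interp o cs = some c) :
      Eval (FirstOrder.Language.Term.func (L := Lg S) (Fn.op o) ts) (.const c)

/-- The theory of the constraint system: the graph of the evaluation of the operators. -/
def theoryOf (S : Sig.{u}) : (Lg S).Theory :=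
  { φ | ∃ (n : ℕ) (o : S.Op n) (cs : Fin n → S.Const) (c : S.Const), S.interp o cs = some c ∧
      φ = FirstOrder.Language.Term.equal (L := Lg S) (α := Empty)
        (FirstOrder.Language.Term.func (L := Lg S) (Fn.op o)
          (fun i => FirstOrder.Language.Term.func (L := Lg S) (Fn.const (cs i)) Fin.elim0))
        (FirstOrder.Language.Term.func (L := Lg S) (Fn.const c) Fin.elim0) }

/-- Entailment `c ⊢ d`: the implication `c ⇒ d` is valid in the theory. -/
def Entails {S : Sig.{u}} (c d : Constr S) : Prop :=
  (theoryOf S).ModelsBoundedFormula (c.imp d)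

/-- Logical equivalence of constraints. -/
def CEquiv {S : Sig.{u}} (c d : Constr S) : Prop := Entails c d ∧ Entails d c

/-! ### Substitution -/

/-- The substitution that moves an object under `n` new binders. -/
def shiftS (S : Sig.{u}) (n : ℕ) : ℕ → Val S := fun i => .var (i + n)

/-- Simultaneous substitution in a value. -/
def Val.subst {S : Sig.{u}} (σ : ℕ → Val S) : Val S → Val S
  | .var i => σ i
  | .const c => .const c
  | .label l => .label l

/-- The substitution `σ` under `n` binders. -/
def upS {S : Sig.{u}} (n : ℕ) (σ : ℕ → Val S) : ℕ → Val S :=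
  fun i => if i < n then .var i else (σ (i - n)).subst (shiftS S n)

/-- The substitution `[t/x]` that removes a binder of `n` names. -/
def instS {S : Sig.{u}} {n : ℕ} (t : Fin n → Val S) : ℕ → Val S :=
  fun i => if h : i < n then t ⟨i, h⟩ else .var (i - n)

/-- Substitution in terms. -/
def substT {S : Sig.{u}} (σ : ℕ → Val S) (e : Tm S) : Tm S := e.subst (fun i => (σ i).tm)

/-- Substitution in constraints. -/
def substC {S : Sig.{u}} (σ : ℕ → Val S) (c : Constr S) : Constr S :=
  FirstOrder.Language.BoundedFormula.subst c (fun i => (σ i).tm)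

/-- The constraint `∃ x₀ … xₙ₋₁, c`, where the `xᵢ` are the `n` innermost names. -/
def exC {S : Sig.{u}} (n : ℕ) (c : Constr S) : Constr S :=
  FirstOrder.Language.BoundedFormula.exs (n := n)
    (FirstOrder.Language.BoundedFormula.relabel (n := n) (k := 0)
      (fun i : ℕ => if h : i < n then (Sum.inr ⟨i, h⟩ : ℕ ⊕ Fin n) else Sum.inl (i - n)) c)

/-- The atomic constraint `p(ts)`. -/
def atom {S : Sig.{u}} {n : ℕ} (p : Pr n) (ts : Fin n → Tm S) : Constr S :=
  FirstOrder.Language.Relations.formula (L := Lg S) p ts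

/-! ## The session language -/

/-- Processes without recursion declarations.  In `request a P`, `accept a P` and `deleg k P`
(reception of a channel) one name is bound in `P`, in `recv k n P` the names of the pattern
`x₀, …, xₙ₋₁` are bound, and in `nu P` one name.  A branching has pairwise distinct labels. -/
inductive HProc (S : Sig.{u}) : Type u
  | request (a : Val S) (P : HProc S)
  | accept (a : Val S) (P : HProc S)
  | send (k : Val S) (n : ℕ) (es : Fin n → Tm S) (P : HProc S)
  | recv (k : Val S) (n : ℕ) (P : HProc S)
  | select (k : Val S) (l : S.Label) (P : HProc S)
  | branch (k : Val S) (n : ℕ) (ls : Fin n ↪ S.Label) (Ps : Fin n → HProc S)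
  | throwCh (k k' : Val S) (P : HProc S)
  | catchCh (k : Val S) (P : HProc S)
  | ite (e : Tm S) (P Q : HProc S)
  | par (P Q : HProc S)
  | inact
  | nu (P : HProc S)
  | call (X : ℕ) (n : ℕ) (es : Fin n → Tm S)

namespace HProc

variable {S : Sig.{u}}

/-- Capture-avoiding substitution. -/
def subst (σ : ℕ → Val S) : HProc S → HProc S
  | request a P => request (a.subst σ) (P.subst (upS 1 σ))
  | accept a P => accept (a.subst σ) (P.subst (upS 1 σ))
  | send k n es P => send (k.subst σ) n (fun i => substT σ (es i)) (P.subst σ)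
  | recv k n P => recv (k.subst σ) n (P.subst (upS n σ))
  | select k l P => select (k.subst σ) l (P.subst σ)
  | branch k n ls Ps => branch (k.subst σ) n ls (fun i => (Ps i).subst σ)
  | throwCh k k' P => throwCh (k.subst σ) (k'.subst σ) (P.subst σ)
  | catchCh k P => catchCh (k.subst σ) (P.subst (upS 1 σ))
  | ite e P Q => ite (substT σ e) (P.subst σ) (Q.subst σ)
  | par P Q => par (P.subst σ) (Q.subst σ)
  | inact => inact
  | nu P => nu (P.subst (upS 1 σ))
  | call X n es => call X n (fun i => substT σ (es i))

/-- Structural congruence (renaming of bound names is built into the representation). -/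
inductive SC : HProc S → HProc S → Prop
  | refl (P) : SC P P
  | symm {P Q} : SC P Q → SC Q P
  | trans {P Q R} : SC P Q → SC Q R → SC P R
  | request {a P P'} : SC P P' → SC (request a P) (request a P')
  | accept {a P P'} : SC P P' → SC (accept a P) (accept a P')
  | send {k n es P P'} : SC P P' → SC (send k n es P) (send k n es P')
  | recv {k n P P'} : SC P P' → SC (recv k n P) (recv k n P')
  | select {k l P P'} : SC P P' → SC (select k l P) (select k l P')
  | branch {k n ls Ps Ps'} : (∀ i, SC (Ps i) (Ps' i)) → SC (branch k n ls Ps) (branch k n ls Ps')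
  | throwCh {k k' P P'} : SC P P' → SC (throwCh k k' P) (throwCh k k' P')
  | catchCh {k P P'} : SC P P' → SC (catchCh k P) (catchCh k P')
  | ite {e P P' Q Q'} : SC P P' → SC Q Q' → SC (ite e P Q) (ite e P' Q')
  | par {P P' Q Q'} : SC P P' → SC Q Q' → SC (par P Q) (par P' Q')
  | nu {P P'} : SC P P' → SC (nu P) (nu P')
  | par_inact (P) : SC (HProc.par P inact) P
  | par_comm (P Q) : SC (HProc.par P Q) (HProc.par Q P)
  | par_assoc (P Q R) : SC (HProc.par (HProc.par P Q) R) (HProc.par P (HProc.par Q R))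
  | nu_inact : SC (HProc.nu inact) inact
  | nu_swap (P) : SC (HProc.nu (HProc.nu P))
      (HProc.nu (HProc.nu (P.subst (fun i => .var (Equiv.swap 0 1 i)))))
  | nu_par (P Q) : SC (HProc.par (HProc.nu P) Q)
      (HProc.nu (HProc.par P (Q.subst (shiftS S 1))))

/-- `Comm A B R`: the composition of the complementary processes `A` and `B` reduces to `R`, by
session establishment, communication of data, label selection or passing of a channel. -/
inductive Comm : HProc S → HProc S → HProc S → Prop
  | link (a P Q) : Comm (request a P) (accept a Q) (nu (par P Q))
  | com (k n) (es : Fin n → Tm S) (cs : Fin n → Val S) (P Q) (h : ∀ i, Eval (es i) (cs i)) :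
      Comm (send k n es P) (recv k n Q) (par P (Q.subst (instS cs)))
  | label (k n) (ls : Fin n ↪ S.Label) (Ps) (i : Fin n) (P) :
      Comm (select k (ls i) P) (branch k n ls Ps) (par P (Ps i))
  | pass (k k' P Q) : Comm (throwCh k k' P) (catchCh k Q) (par P (Q.subst (instS ![k'])))

/-- Reduction of a conditional. -/
inductive IfStep : HProc S → HProc S → Prop
  | tt {e P Q} (h : Eval e (.const S.tt)) : IfStep (ite e P Q) P
  | ff {e P Q} (h : Eval e (.const S.ff)) : IfStep (ite e P Q) Q

/-- `A` and `B` form a redex, in either order. -/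
def Redex (A B : HProc S) : Prop := (∃ R, Comm A B R) ∨ (∃ R, Comm B A R)

/-- `ν x₁ … ν xₘ P`. -/
def nus : ℕ → HProc S → HProc S
  | 0, P => P
  | m + 1, P => nu (nus m P)

/-- `Q₁ | ⋯ | Qₙ`. -/
def prod (Qs : List (HProc S)) : HProc S := Qs.foldr par inact

/-- The parallel components of a process. -/
def comps : HProc S → List (HProc S)
  | par P Q => comps P ++ comps Q
  | P => [P]

/-- `Q` is neither a parallel composition, nor a hiding, nor a process variable. -/
def Guarded : HProc S → Prop
  | par _ _ => False
  | nu _ => False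
  | call _ _ _ => False
  | _ => True

end HProc

/-- A recursion declaration `X₁(x⃗₁) = P₁ and ⋯ and Xₘ(x⃗ₘ) = Pₘ`: the entry at position `X` holds
the number of the parameters of `X` and its body, where the parameters are bound. -/
abbrev Decl (S : Sig.{u}) : Type u := List (ℕ × HProc S)

/-- The declaration with its free names moved under one new binder. -/
def Decl.shift {S : Sig.{u}} (D : Decl S) : Decl S :=
  D.map (fun d => (d.1, d.2.subst (upS d.1 (shiftS S 1))))

/-- The reduction relation, for processes in the scope of the declaration `D`. -/
inductive Red {S : Sig.{u}} : Decl S → HProc S → HProc S → Prop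
  | comm {D A B R} : HProc.Comm A B R → Red D (.par A B) R
  | ite {D P P'} : HProc.IfStep P P' → Red D P P'
  | unfold {D : Decl S} {X n : ℕ} {es : Fin n → Tm S} {cs : Fin n → Val S} {P : HProc S}
      (hX : D[X]? = some (n, P)) (h : ∀ i, Eval (es i) (cs i)) :
      Red D (.call X n es) (P.subst (instS cs))
  | scop {D P P'} : Red D.shift P P' → Red D (.nu P) (.nu P')
  | par {D P P' Q} : Red D P P' → Red D (.par P Q) (.par P' Q)
  | str {D P P' Q' Q} : HProc.SC P P' → Red D P' Q' → HProc.SC Q' Q → Red D P Q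

/-- A program `def D in P`, where `P` holds no further recursion declarations. -/
structure Program (S : Sig.{u}) where
  decl : Decl S
  body : HProc S

namespace Program

variable {S : Sig.{u}}

/-- Structural congruence of programs. -/
def SC (P Q : Program S) : Prop := P.decl = Q.decl ∧ HProc.SC P.body Q.body

/-- Normal form: `def D in ν x₁ … ν xₘ (Q₁ | ⋯ | Qₙ)`, where no `Qᵢ` has a hiding, a parallel
composition or a process variable at its top level. -/
def NormalForm (P : Program S) : Prop :=
  ∃ m B, P.body = HProc.nus m B ∧ ∀ A ∈ B.comps, A.Guarded

/-- The outermost reduction relation.  The components `Q₁, …, Qₙ` of the source are listed in three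
groups: the conditionals `ifs` that reduce, the redexes `rdx`, and the components `idle` that do not
reduce and are in no redex with any component.  All of the first two groups reduce.  The name that
is created by a session establishment is bound in the reduct `R`; it can be moved to the outermost
position by structural congruence. -/
def Outermost (P Q : Program S) : Prop :=
  Q.decl = P.decl ∧
  (∃ P', Relation.ReflTransGen (Red P.decl) P.body P' ∧ HProc.SC P' Q.body) ∧
  ∃ (m : ℕ) (ifs : List (HProc S × HProc S)) (rdx : List (HProc S × HProc S × HProc S))
    (idle : List (HProc S)),
    HProc.SC P.body (HProc.nus m (.par (HProc.prod (ifs.map fun t => t.1))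
      (.par (HProc.prod (rdx.map fun t => .par t.1 t.2.1)) (HProc.prod idle)))) ∧
    HProc.SC Q.body (HProc.nus m (.par (HProc.prod (ifs.map fun t => t.2))
      (.par (HProc.prod (rdx.map fun t => t.2.2)) (HProc.prod idle)))) ∧
    (∀ t ∈ ifs, HProc.IfStep t.1 t.2) ∧
    (∀ t ∈ rdx, HProc.Comm t.1 t.2.1 t.2.2) ∧
    (∀ A ∈ idle, A.Guarded ∧ (∀ A', ¬ HProc.IfStep A A') ∧ (∀ B ∈ idle, ¬ HProc.Redex A B) ∧
      (∀ t ∈ rdx, ¬ HProc.Redex A t.1 ∧ ¬ HProc.Redex A t.2.1))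

/-- Determinacy: two sequences of outermost reductions of the same length lead to structurally
congruent programs at every position. -/
def Deterministic (P : Program S) : Prop :=
  ∀ (n : ℕ) (s t : ℕ → Program S), SC P (s 0) → SC P (t 0) →
    (∀ i < n, Outermost (s i) (s (i + 1))) → (∀ i < n, Outermost (t i) (t (i + 1))) →
    ∀ i ≤ n, SC (s i) (t i)

/-- The components of a program in normal form are evenly paired: every component forms a redex with
at most one other component, and a label that is selected on a channel is offered by every branching
on this channel. -/
def EvenlyPaired (P : Program S) : Prop :=
  ∀ m B, P.body = HProc.nus m B → (∀ A ∈ B.comps, A.Guarded) →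
    (∀ i j j' : Fin B.comps.length, HProc.Redex (B.comps.get i) (B.comps.get j) →
      HProc.Redex (B.comps.get i) (B.comps.get j') → j = j') ∧
    (∀ k l A n ls Ps, HProc.select k l A ∈ B.comps → HProc.branch k n ls Ps ∈ B.comps →
      ∃ i, ls i = l)

end Program

/-! ## The target calculus -/

/-- Processes of `utcc`.  `abs n c ex P` is the abstraction on the `n` innermost names under the
guard `c ∧ ⋀_{t ∈ ex} x⃗ ≠ t`, with `≠` denoting syntactic difference: `ex` lists the tuples that
are excluded, and these tuples live outside the scope of the binder.  `loc n c P` declares the `n`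
innermost names private to `P` under `c`; `unl c P` is `unless c next P`. -/
inductive UProc (S : Sig.{u}) : Type u
  | skip
  | tell (c : Constr S)
  | abs (n : ℕ) (c : Constr S) (ex : List (Fin n → Val S)) (P : UProc S)
  | par (P Q : UProc S)
  | loc (n : ℕ) (c : Constr S) (P : UProc S)
  | next (P : UProc S)
  | unl (c : Constr S) (P : UProc S)
  | bang (P : UProc S)

namespace UProc

variable {S : Sig.{u}}

/-- Capture-avoiding substitution. -/
def subst (σ : ℕ → Val S) : UProc S → UProc S
  | skip => skip
  | tell c => tell (substC σ c)
  | abs n c ex P => abs n (substC (upS n σ) c) (ex.map fun t i => (t i).subst σ)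
      (P.subst (upS n σ))
  | par P Q => par (P.subst σ) (Q.subst σ)
  | loc n c P => loc n (substC (upS n σ) c) (P.subst (upS n σ))
  | next P => next (P.subst σ)
  | unl c P => unl (substC σ c) (P.subst σ)
  | bang P => bang (P.subst σ)

/-- Structural congruence (renaming of bound names is built into the representation).  Two nested
local operators are merged, and a local operator is split, when the outer constraint has the
information that the inner one gives on the outer names. -/
inductive SC : UProc S → UProc S → Prop
  | refl (P) : SC P P
  | symm {P Q} : SC P Q → SC Q P
  | trans {P Q R} : SC P Q → SC Q R → SC P R
  | abs {n c ex P P'} : SC P P' → SC (abs n c ex P) (abs n c ex P')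
  | par {P P' Q Q'} : SC P P' → SC Q Q' → SC (par P Q) (par P' Q')
  | loc {n c P P'} : SC P P' → SC (loc n c P) (loc n c P')
  | next {P P'} : SC P P' → SC (next P) (next P')
  | unl {c P P'} : SC P P' → SC (unl c P) (unl c P')
  | bang {P P'} : SC P P' → SC (bang P) (bang P')
  | par_skip (P) : SC (UProc.par P skip) P
  | par_comm (P Q) : SC (UProc.par P Q) (UProc.par Q P)
  | par_assoc (P Q R) : SC (UProc.par P (UProc.par Q R)) (UProc.par (UProc.par P Q) R)
  | par_loc (P n c Q) : SC (UProc.par P (UProc.loc n c Q))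
      (UProc.loc n c (UProc.par (P.subst (shiftS S n)) Q))
  | loc_loc (n c m d P) (h : Entails c (exC m d)) : SC (UProc.loc n c (UProc.loc m d P))
      (UProc.loc (m + n) (substC (shiftS S m) c ⊓ d) P)

/-- The internal transition relation `⟨P, c⟩ ⟶ ⟨P', c'⟩`.  In an abstraction, the tuple `t` ranges
over evaluated terms.  Stores are taken up to logical equivalence. -/
inductive Step : UProc S → Constr S → UProc S → Constr S → Prop
  | tell (c d) : Step (tell c) d skip (d ⊓ c)
  | par {P Q P' c d} : Step P c P' d → Step (par P Q) c (par P' Q) d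
  | unl {c P d} : Entails d c → Step (unl c P) d skip d
  | loc {n c c' P P' d} :
      Step P (c ⊓ substC (shiftS S n) d) P' (c' ⊓ substC (shiftS S n) d) →
      Step (loc n c P) d (loc n c' P') (d ⊓ exC n c')
  | abs {n c ex P d} (t : Fin n → Val S) :
      Entails d (substC (instS t) c) → t ∉ ex →
      Step (abs n c ex P) d (par (P.subst (instS t)) (abs n c (t :: ex) P)) d
  | bang {P d} : Step (bang P) d (par P (next (bang P))) d
  | str {P₁ c₁ P₂ c₂ P₁' c₁' P₂' c₂'} : SC P₁ P₁' → CEquiv c₁ c₁' → SC P₂ P₂' → CEquiv c₂ c₂' →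
      Step P₁ c₁ P₂ c₂ → Step P₁' c₁' P₂' c₂'

/-- The residual process for the next time unit; `tell` and `bang` never occur unguarded in a
process that has no internal transition. -/
def future : UProc S → UProc S
  | skip => skip
  | abs _ _ _ _ => skip
  | par P Q => par P.future Q.future
  | loc n _ P => loc n ⊤ P.future
  | next P => P
  | unl _ P => P
  | tell _ => skip
  | bang _ => skip

/-- Finite sequences of internal transitions. -/
def Steps (γ γ' : UProc S × Constr S) : Prop :=
  Relation.ReflTransGen (fun γ γ' => Step γ.1 γ.2 γ'.1 γ'.2) γ γ'

/-- The observable transition `P ⟹^{(c,d)} R`, one time unit. -/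
def Obs (P : UProc S) (c d : Constr S) (R : UProc S) : Prop :=
  ∃ Q d', Steps (P, c) (Q, d') ∧ (∀ Q' e, ¬ Step Q d' Q' e) ∧ CEquiv d' d ∧ R = Q.future

/-- `P ⟹ R`: one time unit with the input `true`. -/
def TimeStep (P R : UProc S) : Prop := ∃ d, Obs P ⊤ d R

/-- The output behavior: the infinite sequences of outputs on the input `true.true.true…`. -/
def outputs (P : UProc S) : Set (ℕ → Constr S) :=
  { s | ∃ Ps : ℕ → UProc S, Ps 0 = P ∧ ∀ i, Obs (Ps i) ⊤ (s i) (Ps (i + 1)) }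

/-- Output equivalence. -/
def OutEquiv (P Q : UProc S) : Prop := outputs P = outputs Q

/-- The constraint `outp'(x)` for the name with index `i`. -/
def op' (i : ℕ) : Constr S := atom Pr.outp' ![FirstOrder.Language.Term.var i]

/-- Observable equivalence `≈`. -/
def ObsEquiv (P Q : UProc S) : Prop :=
  OutEquiv (par P (bang (tell (exC 1 (op' 0))))) (par Q (bang (tell (exC 1 (op' 0)))))

/-- `when c do P`. -/
def when (c : Constr S) (P : UProc S) : UProc S := abs 0 c [] P

/-- `P₁ ∥ ⋯ ∥ Pₙ`. -/
def prod (Ps : List (UProc S)) : UProc S := Ps.foldr par skip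

/-- The persistent output of the atom `p(ts)`; the private names are `go` (index 0) and `stop`
(index 1). -/
def tellP {n : ℕ} (p : Pr n) (ts : Fin n → Tm S) : UProc S :=
  let us : Fin n → Tm S := fun i => substT (shiftS S 2) (ts i)
  loc 2 ⊤ (par (tell (op' 0)) (par (bang (when (op' 0) (tell (atom p us))))
    (par (bang (unl (op' 1) (tell (op' 0))))
      (bang (when (atom (Pr.bar p) us) (bang (tell (op' 1))))))))

/-- The persistent input of the constraint `c` on the `n` innermost names, which are bound in `c`
and `P`; the private names are `go` and `stop`. -/
def waitC (n : ℕ) (c : Constr S) (P : UProc S) : UProc S :=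
  loc 2 ⊤ (par (tell (op' 0)) (par (bang (unl (op' 1) (tell (op' 0))))
    (bang (abs n (substC (upS n (shiftS S 2)) c ⊓ op' n) []
      (par (P.subst (upS n (shiftS S 2))) (bang (tell (op' (n + 1)))))))))

/-- The persistent input with acknowledgement of the atom `p(ts)`. -/
def waitP {m : ℕ} (n : ℕ) (p : Pr m) (ts : Fin m → Tm S) (P : UProc S) : UProc S :=
  waitC n (atom p ts) (par P (tell (atom (Pr.bar p) ts)))

/-- The persistent input with acknowledgement on no names. -/
def whenever {m : ℕ} (p : Pr m) (ts : Fin m → Tm S) (P : UProc S) : UProc S := waitP 0 p ts P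

end UProc

/-! ## The encoding -/

/-- The name with index `i` as a term. -/
def nm (S : Sig.{u}) (i : ℕ) : Tm S := FirstOrder.Language.Term.var i

/-- The encoding of processes.  Calls become `tell (call X es)`. -/
def enc {S : Sig.{u}} : HProc S → UProc S
  | .request a P =>
      let ts : Fin 2 → Tm S := ![substT (shiftS S 1) a.tm, nm S 0]
      .loc 1 ⊤ (.par (.tellP Pr.req ts) (.whenever Pr.acc ts (.next (enc P))))
  | .accept a P =>
      let ts : Fin 2 → Tm S := ![substT (shiftS S 1) a.tm, nm S 0]
      .waitP 1 Pr.req ts (.par (.tell (atom Pr.acc ts)) (.next (enc P)))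
  | .send k n es P =>
      let ts : Fin (n + 1) → Tm S := Fin.cons k.tm es
      .par (.tellP (Pr.out n) ts) (.whenever (Pr.bar (Pr.out n)) ts (.next (enc P)))
  | .recv k n P =>
      let ts : Fin (n + 1) → Tm S := Fin.cons (substT (shiftS S n) k.tm) (fun i => nm S i)
      .waitP n (Pr.out n) ts (.next (enc P))
  | .select k l P =>
      let ts : Fin 2 → Tm S := ![k.tm, (Val.label l).tm]
      .par (.tellP Pr.sel ts) (.whenever (Pr.bar Pr.sel) ts (.next (enc P)))
  | .branch k n ls Ps =>
      let ts : Fin 2 → Tm S := ![substT (shiftS S 1) k.tm, nm S 0]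
      .waitP 1 Pr.sel ts (UProc.prod (List.ofFn fun i : Fin n =>
        .when (FirstOrder.Language.Term.equal (nm S 0) (Val.label (ls i)).tm)
          (.next ((enc (Ps i)).subst (shiftS S 1)))))
  | .throwCh k k' P =>
      let ts : Fin 2 → Tm S := ![k.tm, k'.tm]
      .par (.tellP Pr.outk ts) (.whenever (Pr.bar Pr.outk) ts (.next (enc P)))
  | .catchCh k P =>
      let ts : Fin 2 → Tm S := ![substT (shiftS S 1) k.tm, nm S 0]
      .waitP 1 Pr.outk ts (.next (enc P))
  | .ite e P Q =>
      .par (.when (FirstOrder.Language.Term.equal e (Val.const S.tt).tm) (.next (enc P)))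
        (.when (FirstOrder.Language.Term.equal e (Val.const S.ff).tm) (.next (enc Q)))
  | .par P Q => .par (enc P) (enc Q)
  | .inact => .skip
  | .nu P => .loc 1 ⊤ (enc P)
  | .call X n es => .tell (atom (Pr.call X n) es)

/-- The encoding of a program `def D in P`: every declaration `X(x⃗) = B` becomes the replicated
abstraction on `x⃗` of the encoding of `B`, guarded by `call X x⃗`. -/
def Program.enc {S : Sig.{u}} (P : Program S) : UProc S :=
  .par (UProc.prod (P.decl.mapIdx fun X d =>
      .bang (.abs d.1 (atom (Pr.call X d.1) (fun i => nm S i)) [] (_root_.enc d.2))))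
    (_root_.enc P.body)

/-! One time unit of the encoding performs one whole round of reduction. The sender of a redex tells
its atom; the guard of the receiver opens on it; the receiver answers with an acknowledgement; this
releases the continuation of the sender, and both sides tell their stop names. The continuations
stand under `next`. A sender or receiver without partner tells its go name again and is found
unchanged in the next unit. Even pairing makes the redexes disjoint, so the components fall into
conditionals that reduce, redexes, and idle ones (`exists_split`). Reducing the first two groups is
an outermost reduction, and determinacy makes its result unique up to congruence. Both claims thus
follow from `timeStep_of_split`: the encoding has a time step, and each of its time steps leads to a
process equivalent to the encoding of that reduct.

Three difficulties are treated separately.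

Internal transitions work up to congruence and with nested local stores. `Dec` flattens a process
into a multiset of agents with explicit private names and one set of constraints. `Conf` is a
bisimulation between processes and an abstract machine on such multisets (`step_sim`, `fire_sim`),
so the output behavior is a set of machine traces (`Conf.outputs`). Entailment is decided in a term
model: an atom follows from a machine store only if the store holds it up to evaluation
(`sent_atom`).

The transitions of a time unit interleave in many ways. The final store is therefore guessed: it is
the set `L` of all constraints that the components are expected to tell. `Ev` evaluates a process
against `L` and is preserved by every transition, so no run tells anything outside `L`; `Will` shows
that a quiet state has told all of `L`. Hence all runs end with the same store and the same residual
processes (`EvM.tick`). The guess is consistent because an unexpected entailment would be a redex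
between components that are not partners (`store_calm`).

A time step leaves behind the replications of used constructs. Their go names are never told again
and their stop names are told forever, so they release nothing (`Gb.traces`). Their only trace in
the output is that `outp'` holds of something, which the process added in the definition of `≈`
makes true anyway.

Names are kept apart by residues: ambient names are even, the machine draws private names congruent
to 1 modulo 4, and names needed only for congruences are congruent to 3 modulo 4. -/

namespace Corr

open FirstOrder FirstOrder.Language

variable {S : Sig.{u}}

/-! ### Substitutions -/

abbrev Sub (S : Sig.{u}) : Type u := ℕ → Val S

/-- Composition of substitutions, `σ` first. -/
def cmp (σ τ : Sub S) : Sub S := fun i => (σ i).subst τ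

/-- The substitution that maps the innermost names to `vs` and the others by `σ`. -/
def ext (vs : List (Val S)) (σ : Sub S) : Sub S := fun i => (vs[i]?).getD (σ (i - vs.length))

theorem Val.subst_subst (σ τ : Sub S) (v : Val S) : (v.subst σ).subst τ = v.subst (cmp σ τ) := by
  cases v <;> rfl

theorem Val.subst_var (v : Val S) : v.subst Val.var = v := by cases v <;> rfl

theorem cmp_var (σ : Sub S) : cmp σ Val.var = σ := by
  funext i; simp [cmp, Val.subst_var]

theorem var_cmp (σ : Sub S) : cmp Val.var σ = σ := rfl

theorem ext_append (a b : List (Val S)) (σ : Sub S) : ext (a ++ b) σ = ext a (ext b σ) := by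
  funext i
  simp only [ext, List.length_append, List.getElem?_append]
  split_ifs with h
  · simp [h]
  · rw [List.getElem?_eq_none (l := a) (by omega)]
    simp only [Option.getD_none]
    congr 2; omega

theorem ext_lt (vs : List (Val S)) (σ : Sub S) {i : ℕ} (h : i < vs.length) :
    ext vs σ i = vs[i] := by simp [ext, h]

theorem ext_ge (vs : List (Val S)) (σ : Sub S) {i : ℕ} (h : vs.length ≤ i) :
    ext vs σ i = σ (i - vs.length) := by simp [ext, h]

theorem cmp_upS_ext (n : ℕ) (ρ τ : Sub S) (vs : List (Val S)) (h : vs.length = n) :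
    cmp (upS n ρ) (ext vs τ) = ext vs (cmp ρ τ) := by
  subst h
  funext i
  by_cases hi : i < vs.length
  · simp [cmp, upS, hi, Val.subst, ext_lt]
  · rw [ext_ge _ _ (by omega)]
    simp only [cmp, upS, hi, if_false, Val.subst_subst]
    congr 1
    funext j
    simp [cmp, shiftS, Val.subst, ext_ge]

theorem cmp_shiftS_ext (n : ℕ) (τ : Sub S) (vs : List (Val S)) (h : vs.length = n) :
    cmp (shiftS S n) (ext vs τ) = τ := by
  subst h
  funext j
  simp [cmp, shiftS, Val.subst, ext_ge]

theorem cmp_shiftS_upS (n : ℕ) (σ : Sub S) :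
    cmp (shiftS S n) (upS n σ) = cmp σ (shiftS S n) := by
  funext j
  simp [cmp, shiftS, Val.subst, upS]

theorem cmp_upS_upS (n : ℕ) (σ τ : Sub S) : cmp (upS n σ) (upS n τ) = upS n (cmp σ τ) := by
  funext i
  by_cases hi : i < n
  · simp [cmp, upS, hi, Val.subst]
  · simp only [cmp, upS, hi, if_false, Val.subst_subst]
    congr 1
    exact cmp_shiftS_upS n τ

theorem upS_var (n : ℕ) : upS n (Val.var : Sub S) = Val.var := by
  funext i
  by_cases hi : i < n
  · simp [upS, hi]
  · simp only [upS, hi, if_false, Val.subst, shiftS]; congr 1; omega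

theorem shiftS_zero : shiftS S 0 = Val.var := rfl

theorem upS_zero (σ : Sub S) : upS 0 σ = σ := by
  funext i; simp [upS, shiftS_zero, Val.subst_var]

theorem cmp_shiftS_shiftS (m n : ℕ) : cmp (shiftS S m) (shiftS S n) = shiftS S (m + n) := by
  funext i; simp [cmp, shiftS, Val.subst, Nat.add_assoc]

theorem upS_upS (m n : ℕ) (σ : Sub S) : upS m (upS n σ) = upS (m + n) σ := by
  funext i
  unfold upS
  by_cases h1 : i < m
  · simp [h1, show i < m + n by omega]
  · by_cases h2 : i < m + n
    · simp [h1, h2, show i - m < n by omega, Val.subst, shiftS]; omega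
    · simp only [h1, h2, show ¬ (i - m < n) by omega, if_false, Val.subst_subst, cmp_shiftS_shiftS]
      rw [Nat.add_comm n m, Nat.sub_sub]

theorem instS_eq_ext {n : ℕ} (t : Fin n → Val S) : instS t = ext (List.ofFn t) Val.var := by
  funext i
  by_cases h : i < n
  · rw [ext_lt _ _ (by simpa using h)]; simp [instS, h]
  · rw [ext_ge _ _ (by simpa using h)]; simp [instS, h]

theorem cmp_ext (vs : List (Val S)) (σ τ : Sub S) :
    cmp (ext vs σ) τ = ext (vs.map (Val.subst τ)) (cmp σ τ) := by
  funext i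
  by_cases h : i < vs.length
  · rw [ext_lt _ _ (by simpa using h)]; simp [cmp, ext_lt _ _ h]
  · rw [ext_ge _ _ (by simpa using h)]; simp [cmp, ext_ge _ _ (not_lt.1 h)]

/-- Instantiation commutes with a substitution that also acts on the inserted values. This is why
firing an abstraction commutes with renaming. -/
theorem cmp_instS {n : ℕ} (t : Fin n → Val S) (σ : Sub S) :
    cmp (instS t) σ = cmp (upS n σ) (instS fun i => (t i).subst σ) := by
  rw [instS_eq_ext, instS_eq_ext, cmp_upS_ext _ _ _ _ (by simp), cmp_ext, cmp_var, var_cmp]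
  congr 1
  simp [List.map_ofFn]; rfl

theorem cmp_shiftS_instS {n : ℕ} (t : Fin n → Val S) :
    cmp (shiftS S n) (instS t) = Val.var := by
  rw [instS_eq_ext, cmp_shiftS_ext _ _ _ (by simp)]

/-! ### Terms -/

theorem substT_var (σ : Sub S) (i : ℕ) :
    substT σ (Term.var i : Tm S) = (σ i).tm := rfl

theorem substT_tm (σ : Sub S) (v : Val S) : substT σ v.tm = (v.subst σ).tm := by
  cases v with
  | var i => rfl
  | const c => exact congrArg (Term.func (L := Lg S) (Fn.const c)) (funext fun i => i.elim0)
  | label c => exact congrArg (Term.func (L := Lg S) (Fn.label c)) (funext fun i => i.elim0)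

theorem substT_substT (σ τ : Sub S) (e : Tm S) : substT τ (substT σ e) = substT (cmp σ τ) e := by
  induction e with
  | var i => exact substT_tm τ (σ i)
  | func f ts ih => exact congrArg (Term.func (L := Lg S) f) (funext ih)

theorem substT_id (e : Tm S) : substT Val.var e = e := by
  induction e with
  | var i => rfl
  | func f ts ih => exact congrArg (Term.func (L := Lg S) f) (funext ih)

theorem tm_injective : Function.Injective (Val.tm (S := S)) := by
  intro a b h
  cases a <;> cases b <;> simp only [Val.tm, Term.var.injEq, reduceCtorEq] at h
  · rw [h]
  all_goals
    injection h with _ h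
    injection h
  all_goals simp_all

/-! ### Constraints -/

theorem Term.subst_subst' {α β γ : Type*} (L : Language) (t : L.Term α) (f : α → L.Term β)
    (g : β → L.Term γ) : (t.subst f).subst g = t.subst (fun a => (f a).subst g) := by
  induction t with
  | var i => rfl
  | func f ts ih => exact congrArg (Term.func f) (funext ih)

theorem Term.subst_relabel' {α β γ : Type*} (L : Language) (t : L.Term α) (f : α → β)
    (g : β → L.Term γ) : (t.relabel f).subst g = t.subst (fun a => g (f a)) := by
  induction t with
  | var i => rfl
  | func f ts ih => exact congrArg (Term.func f) (funext ih)

theorem Term.relabel_subst' {α β γ : Type*} (L : Language) (t : L.Term α) (f : α → L.Term β)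
    (g : β → γ) : (t.subst f).relabel g = t.subst (fun a => (f a).relabel g) := by
  induction t with
  | var i => rfl
  | func f ts ih => exact congrArg (Term.func f) (funext ih)

theorem Term.subst_id' {α : Type*} (L : Language) (t : L.Term α) : t.subst Term.var = t := by
  induction t with
  | var i => rfl
  | func f ts ih => exact congrArg (Term.func f) (funext ih)

theorem substC_substC (σ τ : Sub S) (c : Constr S) :
    substC τ (substC σ c) = substC (cmp σ τ) c := by
  unfold substC BoundedFormula.subst
  rw [BoundedFormula.mapTermRel_mapTermRel]
  congr 1
  funext n t
  simp only [Function.comp_apply, Term.subst_subst']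
  congr 1
  funext a
  cases a with
  | inl i =>
    simp only [Sum.elim_inl, Function.comp_apply, Term.subst_relabel']
    rw [cmp, ← substT_tm, substT, Term.relabel_subst']
  | inr i => rfl

theorem substC_id (c : Constr S) : substC Val.var c = c := by
  unfold substC BoundedFormula.subst
  conv_rhs => rw [← BoundedFormula.mapTermRel_id_id_id c]
  congr 1
  funext n t
  conv_rhs => rw [id, ← Term.subst_id' _ t]
  congr 1
  funext a
  cases a <;> rfl

theorem substC_atom {n : ℕ} (σ : Sub S) (p : Pr n) (ts : Fin n → Tm S) :
    substC σ (atom p ts) = atom p (fun i => substT σ (ts i)) := by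
  unfold atom substC Relations.formula
  refine congrArg (BoundedFormula.rel (L := Lg S) p) (funext fun i => ?_)
  simp only [Term.subst_relabel', substT, Term.relabel_subst']
  rfl

theorem substC_equal (σ : Sub S) (a b : Tm S) :
    substC σ (Term.equal (L := Lg S) a b) = Term.equal (L := Lg S) (substT σ a) (substT σ b) := by
  unfold Term.equal substC
  refine congrArg₂ (BoundedFormula.equal (L := Lg S)) ?_ ?_ <;>
  · simp only [Term.subst_relabel', substT, Term.relabel_subst']
    rfl

theorem substC_inf (σ : Sub S) (a b : Constr S) : substC σ (a ⊓ b) = substC σ a ⊓ substC σ b := rfl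

theorem substC_top (σ : Sub S) : substC σ (⊤ : Constr S) = ⊤ := rfl

/-! ### Processes of the target calculus -/

theorem UProc.subst_subst (P : UProc S) (σ τ : Sub S) :
    (P.subst σ).subst τ = P.subst (cmp σ τ) := by
  induction P generalizing σ τ with
  | skip => rfl
  | tell c => simp [UProc.subst, substC_substC]
  | abs n c ex P ih =>
    simp only [UProc.subst, substC_substC, cmp_upS_upS, ih, List.map_map]
    congr 1
    congr 1
    funext t i
    exact Val.subst_subst _ _ _
  | par P Q h1 h2 => simp [UProc.subst, h1, h2]
  | loc n c P ih => simp only [UProc.subst, substC_substC, cmp_upS_upS, ih]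
  | next P ih => simp [UProc.subst, ih]
  | unl c P ih => simp [UProc.subst, ih, substC_substC]
  | bang P ih => simp [UProc.subst, ih]

theorem UProc.subst_id (P : UProc S) : P.subst Val.var = P := by
  induction P with
  | skip => rfl
  | tell c => simp [UProc.subst, substC_id]
  | abs n c ex P ih => simp [UProc.subst, substC_id, upS_var, ih, Val.subst_var]
  | par P Q h1 h2 => simp [UProc.subst, h1, h2]
  | loc n c P ih => simp [UProc.subst, substC_id, upS_var, ih]
  | next P ih => simp [UProc.subst, ih]
  | unl c P ih => simp [UProc.subst, ih, substC_id]
  | bang P ih => simp [UProc.subst, ih]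

/-! ### Semantics of constraints -/

/-- The models of the constraint system. -/
abbrev Mdl (S : Sig.{u}) : Type (u + 1) := Theory.ModelType.{u, 0, u} (theoryOf S)

/-- The value of `v` under the valuation `w`. -/
def vev {M : Type*} [(Lg S).Structure M] (w : ℕ → M) (v : Val S) : M := v.tm.realize w

theorem vev_var {M : Type*} [(Lg S).Structure M] (w : ℕ → M) (i : ℕ) :
    vev w (Val.var i : Val S) = w i := rfl

theorem vev_subst {M : Type*} [(Lg S).Structure M] (w : ℕ → M) (σ : Sub S) (v : Val S) :
    vev w (v.subst σ) = vev (fun i => vev w (σ i)) v := by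
  unfold vev
  rw [← substT_tm, substT, Term.realize_subst]

theorem realize_substC {M : Type*} [(Lg S).Structure M] (w : ℕ → M) (σ : Sub S) (c : Constr S) :
    Formula.Realize (substC σ c) w ↔ Formula.Realize c (fun i => vev w (σ i)) := by
  unfold substC Formula.Realize
  exact BoundedFormula.realize_subst

theorem realize_atom {M : Type*} [(Lg S).Structure M] (w : ℕ → M) {n : ℕ} (p : Pr n)
    (ts : Fin n → Tm S) : Formula.Realize (atom p ts) w ↔
      Structure.RelMap (L := Lg S) p (fun i => (ts i).realize w) := Formula.realize_rel

theorem realize_exC {M : Type*} [(Lg S).Structure M] (w : ℕ → M) (n : ℕ) (c : Constr S) :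
    Formula.Realize (exC n c) w ↔
      ∃ x : Fin n → M, Formula.Realize c (fun i => if h : i < n then x ⟨i, h⟩ else w (i - n)) := by
  unfold exC
  rw [BoundedFormula.realize_exs]
  refine exists_congr fun x => ?_
  rw [BoundedFormula.realize_relabel, Formula.Realize]
  have : (Sum.elim w (x ∘ Fin.castAdd 0) ∘
      fun i : ℕ => if h : i < n then (Sum.inr ⟨i, h⟩ : ℕ ⊕ Fin n) else Sum.inl (i - n)) =
      (fun i => if h : i < n then x ⟨i, h⟩ else w (i - n)) := by
    funext i
    by_cases h : i < n <;> simp [h]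
  rw [this]
  exact iff_of_eq (congrArg _ (Subsingleton.elim _ _))

/-- Entailment from a set of constraints. -/
def SEnt (T : Set (Constr S)) (g : Constr S) : Prop :=
  ∀ (M : Mdl S) (w : ℕ → M), (∀ c ∈ T, Formula.Realize c w) → Formula.Realize g w

theorem entails_iff (c d : Constr S) : Entails c d ↔
    ∀ (M : Mdl S) (w : ℕ → M), Formula.Realize c w → Formula.Realize d w := by
  constructor
  · intro h M w
    have := Theory.ModelsBoundedFormula.realize_formula h M (v := w)
    simpa using this
  · intro h M w xs
    have : xs = default := Subsingleton.elim _ _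
    subst this
    exact fun hc => h M w hc

/-! ### Normal forms of terms -/

open Classical in
/-- The normal form of a function symbol applied to normal forms. -/
noncomputable def nfRoot : {n : ℕ} → Fn S n → (Fin n → Tm S) → Tm S
  | _, .const c, _ => (Val.const c).tm
  | _, .label l, _ => (Val.label l).tm
  | _, .op o, ts =>
    if h : ∃ c, ∃ cs, (∀ i, ts i = (Val.const (cs i)).tm) ∧ S.interp o cs = some c then
      (Val.const h.choose).tm
    else Term.func (L := Lg S) (Fn.op o) ts

/-- The normal form of a term. -/
noncomputable def nf : Tm S → Tm S
  | .var i => .var i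
  | .func f ts => nfRoot f fun i => nf (ts i)

/-- The choice made in `nfRoot` is harmless: distinct constants are distinct terms, so the arguments
determine the tuple of constants and with it the value. -/
theorem nfRoot_op {n : ℕ} (o : S.Op n) (cs : Fin n → S.Const) (c : S.Const)
    (h : S.interp o cs = some c) :
    nfRoot (Fn.op o) (fun i => (Val.const (cs i)).tm) = (Val.const c).tm := by
  have hex : ∃ c, ∃ cs' : Fin n → S.Const, (∀ i, (Val.const (cs i)).tm = (Val.const (cs' i)).tm) ∧
      S.interp o cs' = some c := ⟨c, cs, fun _ => rfl, h⟩
  rw [nfRoot, dif_pos hex]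
  obtain ⟨cs', h1, h2⟩ := hex.choose_spec
  have : cs' = cs := funext fun i => by
    have := tm_injective (h1 i)
    simpa using this.symm
  subst this
  rw [h] at h2
  simp only [Option.some.injEq] at h2
  rw [← h2]

theorem nf_func {n : ℕ} (f : Fn S n) (ts : Fin n → Tm S) :
    nf (Term.func (L := Lg S) f ts) = nfRoot f fun i => nf (ts i) := rfl

theorem nf_tm (v : Val S) : nf v.tm = v.tm := by cases v <;> rfl

theorem func_op_ne_tm {n : ℕ} (o : S.Op n) (ts : Fin n → Tm S) (v : Val S) :
    Term.func (L := Lg S) (Fn.op o) ts ≠ v.tm := by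
  intro h
  cases v with
  | var i => simp [Val.tm] at h
  | const c => injection h with h1 h2; subst h1; cases h2
  | label c => injection h with h1 h2; subst h1; cases h2

/-- With evaluation as an equation of normal forms, the evaluation of a message and the matching of
atoms in a store become the same condition. -/
theorem eval_iff (e : Tm S) (v : Val S) : Eval e v ↔ nf e = v.tm := by
  constructor
  · intro h
    induction h with
    | var i => rfl
    | const c ts => rfl
    | label l ts => rfl
    | op o ts cs c _ hc ih =>
      rw [nf_func]
      simp only [ih]
      exact nfRoot_op o cs c hc
  · intro h
    induction e generalizing v with
    | var i =>
      have : v = .var i := tm_injective h.symm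
      subst this
      exact Eval.var i
    | func f ts ih =>
      cases f with
      | const c =>
        have : v = .const c := tm_injective h.symm
        subst this
        exact Eval.const c ts
      | label c =>
        have : v = .label c := tm_injective h.symm
        subst this
        exact Eval.label c ts
      | op o =>
        rw [nf_func, nfRoot] at h
        split_ifs at h with hex
        · have : v = .const hex.choose := tm_injective h.symm
          subst this
          obtain ⟨cs, h1, h2⟩ := hex.choose_spec
          exact Eval.op o ts cs _ (fun i => ih i _ (h1 i)) h2
        · exact absurd h (func_op_ne_tm _ _ _)

/-- Operators evaluate to constants only, so evaluation never produces a name. -/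
theorem nf_eq_var {e : Tm S} {i : ℕ} (h : nf e = (Val.var i : Val S).tm) : e = Term.var i := by
  have := (eval_iff e (.var i)).2 h
  cases this
  rfl

theorem realize_func_const {M : Type*} [(Lg S).Structure M] (w : ℕ → M) (c : S.Const)
    (ts : Fin 0 → Tm S) : (Term.func (L := Lg S) (Fn.const c) ts).realize w =
      (Val.const c : Val S).tm.realize w :=
  congrArg (Structure.funMap (L := Lg S) (Fn.const c)) (funext fun i => i.elim0)

theorem realize_func_label {M : Type*} [(Lg S).Structure M] (w : ℕ → M) (c : S.Label)
    (ts : Fin 0 → Tm S) : (Term.func (L := Lg S) (Fn.label c) ts).realize w =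
      (Val.label c : Val S).tm.realize w :=
  congrArg (Structure.funMap (L := Lg S) (Fn.label c)) (funext fun i => i.elim0)

theorem realize_op (M : Mdl S) (w : ℕ → M) {n : ℕ} (o : S.Op n) (cs : Fin n → S.Const)
    (c : S.Const) (h : S.interp o cs = some c) :
    Structure.funMap (L := Lg S) (M := M) (Fn.op o) (fun i => (Val.const (cs i)).tm.realize w) =
      (Val.const c : Val S).tm.realize w := by
  have := Theory.realize_sentence_of_mem (M := M) (theoryOf S) ⟨n, o, cs, c, h, rfl⟩
  rw [Sentence.Realize, Formula.realize_equal] at this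
  rw [← realize_func_const w c Fin.elim0]
  convert this using 1
  · refine congrArg (Structure.funMap (L := Lg S) (Fn.op o)) (funext fun i => ?_)
    exact congrArg (Structure.funMap (L := Lg S) (Fn.const (cs i))) (funext fun i => i.elim0)
  · exact congrArg (Structure.funMap (L := Lg S) (Fn.const c)) (funext fun i => i.elim0)

/-- Each rewriting towards the normal form is an instance of an axiom of the theory. -/
theorem realize_nf (M : Mdl S) (w : ℕ → M) (e : Tm S) : (nf e).realize w = e.realize w := by
  induction e with
  | var i => rfl
  | func f ts ih =>
    cases f with
    | const c => exact (realize_func_const w c ts).symm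
    | label c => exact (realize_func_label w c ts).symm
    | op o =>
      rw [nf_func, nfRoot]
      split_ifs with hex
      · obtain ⟨cs, h1, h2⟩ := hex.choose_spec
        refine (realize_op M w o cs _ h2).symm.trans ?_
        refine congrArg (Structure.funMap (L := Lg S) (Fn.op o)) (funext fun i => ?_)
        rw [← h1, ih]
      · exact congrArg (Structure.funMap (L := Lg S) (Fn.op o)) (funext ih)

/-! ### The term model -/

/-- Interpretations of the predicates on terms. -/
abbrev RelI (S : Sig.{u}) : Type u := (n : ℕ) → Pr n → (Fin n → Tm S) → Prop

/-- The term model, with normalisation. -/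
def NF (_R : RelI S) : Type u := Tm S

noncomputable instance (R : RelI S) : (Lg S).Structure (NF R) where
  funMap f ts := nfRoot f ts
  RelMap {n} p ts := R n p ts

instance (R : RelI S) : Nonempty (NF R) := ⟨(Term.var 0 : Tm S)⟩

instance (R : RelI S) : (NF R) ⊨ theoryOf S := by
  constructor
  rintro φ ⟨n, o, cs, c, h, rfl⟩
  rw [Sentence.Realize, Formula.realize_equal]
  exact nfRoot_op o cs c h

/-- The term model as a bundled model. -/
noncomputable def nfM (R : RelI S) : Mdl S := Theory.ModelType.of (theoryOf S) (NF R)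

/-- The valuation of the names by themselves. -/
def nfV (R : RelI S) : ℕ → nfM R := fun i => (Term.var i : Tm S)

theorem realize_NF (R : RelI S) (e : Tm S) : e.realize (nfV R) = nf e := by
  induction e with
  | var i => rfl
  | func f ts ih => exact congrArg (nfRoot f) (funext ih)

/-- `p` is the private predicate. -/
def isOutp : {n : ℕ} → Pr n → Bool
  | _, .outp' => true
  | _, _ => false

/-- The closed constraint `∃ x, outp'(x)`. -/
def kf : Constr S := exC 1 (UProc.op' 0)

/-- The constraint `outp'(v)`. -/
def opv (v : Val S) : Constr S := atom Pr.outp' ![v.tm]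

theorem op'_eq (i : ℕ) : (UProc.op' i : Constr S) = opv (.var i) := rfl

theorem substC_opv (σ : Sub S) (v : Val S) : substC σ (opv v) = opv (v.subst σ) := by
  rw [opv, substC_atom]
  congr 1
  funext i
  fin_cases i
  exact substT_tm σ v

theorem substC_op' (σ : Sub S) (i : ℕ) : substC σ (UProc.op' i) = opv (σ i) := substC_opv σ (.var i)

theorem atom_inj {n : ℕ} {p : Pr n} {ts ts' : Fin n → Tm S} (h : atom p ts = atom p ts') :
    ts = ts' := by
  unfold atom Relations.formula at h
  injection h with _ _ _ h2
  funext i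
  have h3 := congrFun h2 i
  have inj : Function.Injective (Term.relabel (L := Lg S) (Sum.inl : ℕ → ℕ ⊕ Fin 0)) :=
    (Term.relabelEquiv (L := Lg S) (Equiv.sumEmpty ℕ (Fin 0)).symm).injective
  exact inj h3

theorem atom_pred_inj {n : ℕ} {p p' : Pr n} {ts ts' : Fin n → Tm S} (h : atom p ts = atom p' ts') :
    p = p' := by
  unfold atom Relations.formula at h
  injection h

theorem atom_arity_inj {n m : ℕ} {p : Pr n} {p' : Pr m} {ts : Fin n → Tm S} {ts' : Fin m → Tm S}
    (h : atom p ts = atom p' ts') : n = m := by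
  unfold atom Relations.formula at h
  injection h

theorem opv_inj {v v' : Val S} (h : opv v = opv v') : v = v' :=
  tm_injective (congrFun (atom_inj h) 0)

theorem substC_kf (σ : Sub S) : substC σ kf = (kf : Constr S) := by
  change (BoundedFormula.rel (L := Lg S) (n := 1) (α := ℕ) Pr.outp' _).ex =
    (BoundedFormula.rel (L := Lg S) (n := 1) (α := ℕ) Pr.outp' _).ex
  congr 2
  funext i
  fin_cases i
  rfl

/-- The constraints that occur in `tell`. -/
def TellOK (c : Constr S) : Prop := (∃ (n : ℕ) (p : Pr n) (ts : Fin n → Tm S), c = atom p ts) ∨ c = kf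

theorem TellOK.subst {c : Constr S} (h : TellOK c) (σ : Sub S) : TellOK (substC σ c) := by
  rcases h with ⟨n, p, ts, rfl⟩ | rfl
  · exact .inl ⟨n, p, _, substC_atom σ p ts⟩
  · exact .inr (substC_kf σ)

/-- The store `L` holds an atom that is equal to `p(ts)` up to evaluation. -/
def Has (L : Set (Constr S)) {n : ℕ} (p : Pr n) (ts : Fin n → Tm S) : Prop :=
  ∃ ts', atom p ts' ∈ L ∧ ∀ i, nf (ts i) = nf (ts' i)

/-- The least interpretation of the predicates that makes the told atoms true would violate `kf`,
which demands some element with `outp'`. One name `j`, free to choose, is added for this purpose. -/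
theorem nfM_sat {L : Set (Constr S)} (hL : ∀ c ∈ L, TellOK c) (j : ℕ) :
    ∀ c ∈ L, Formula.Realize c (nfV (fun _ p ts => (∃ ts', atom p ts' ∈ L ∧
      ∀ i, ts i = nf (ts' i)) ∨ (isOutp p = true ∧ ∀ i, ts i = Term.var j) : RelI S)) := by
  intro c hc
  rcases hL c hc with ⟨n, p, ts, rfl⟩ | rfl
  · rw [realize_atom]
    exact .inl ⟨ts, hc, fun i => realize_NF _ _⟩
  · rw [kf, realize_exC]
    refine ⟨fun _ => (Term.var j : Tm S), ?_⟩
    rw [UProc.op', realize_atom]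
    refine .inr ⟨rfl, fun i => ?_⟩
    fin_cases i
    rfl

/-- An atom that is not in the store up to evaluation fails in a term model; the name that witnesses
`kf` there is chosen different from the argument of the atom. -/
theorem sent_atom {L : Set (Constr S)} (hL : ∀ c ∈ L, TellOK c) {n : ℕ} (p : Pr n)
    (ts : Fin n → Tm S) : SEnt L (atom p ts) ↔ Has L p ts := by
  constructor
  · intro h
    -- The argument has one normal form, so one of the names `0` and `1` differs from it.
    obtain ⟨j, hj⟩ : ∃ j : ℕ, ¬ (isOutp p = true ∧ ∀ i, nf (ts i) = Term.var j) := by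
      by_cases h0 : isOutp p = true ∧ ∀ i, nf (ts i) = Term.var 0
      · refine ⟨1, fun h1 => ?_⟩
        cases p <;> simp [isOutp] at h0 h1
        have := h0.symm.trans h1
        simp at this
      · exact ⟨0, h0⟩
    have h2 := h (nfM _) (nfV _) (nfM_sat hL j)
    rw [realize_atom] at h2
    rcases h2 with ⟨ts', h3, h4⟩ | ⟨h3, h4⟩
    · exact ⟨ts', h3, fun i => (realize_NF _ _).symm.trans (h4 i)⟩
    · exact absurd ⟨h3, fun i => (realize_NF _ _).symm.trans (h4 i)⟩ hj
  · rintro ⟨ts', h, h2⟩ M w hw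
    have := hw _ h
    rw [realize_atom] at this ⊢
    convert this using 2 with i
    rw [← realize_nf, h2, realize_nf]

/-- The store is irrelevant: it constrains predicates only, and the term model separates distinct
normal forms. -/
theorem sent_equal {L : Set (Constr S)} (hL : ∀ c ∈ L, TellOK c) (a b : Tm S) :
    SEnt L (Term.equal (L := Lg S) a b) ↔ nf a = nf b := by
  constructor
  · intro h
    have h2 := h (nfM _) (nfV _) (nfM_sat hL 0)
    rw [Formula.realize_equal] at h2
    exact ((realize_NF _ a).symm.trans h2).trans (realize_NF _ b)
  · intro h M w _
    rw [Formula.realize_equal, ← realize_nf, h, realize_nf]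

theorem sent_inf {L : Set (Constr S)} (a b : Constr S) :
    SEnt L (a ⊓ b) ↔ SEnt L a ∧ SEnt L b := by
  constructor
  · intro h
    exact ⟨fun M w hw => ((Formula.realize_inf).1 (h M w hw)).1,
      fun M w hw => ((Formula.realize_inf).1 (h M w hw)).2⟩
  · intro h M w hw
    exact Formula.realize_inf.2 ⟨h.1 M w hw, h.2 M w hw⟩

theorem SEnt.mono {L L' : Set (Constr S)} {g : Constr S} (h : SEnt L g) (hl : L ⊆ L') : SEnt L' g :=
  fun M w hw => h M w fun c hc => hw c (hl hc)

theorem SEnt.subst {L : Set (Constr S)} {g : Constr S} (h : SEnt L g) (σ : Sub S) :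
    SEnt (substC σ '' L) (substC σ g) := by
  intro M w hw
  rw [realize_substC]
  refine h M _ fun c hc => ?_
  rw [← realize_substC]
  exact hw _ ⟨c, hc, rfl⟩

theorem entails_iff_sent (c d : Constr S) : Entails c d ↔ SEnt {c} d := by
  rw [entails_iff]
  simp [SEnt]

/-- The constraints that occur as guards, with `n` bound names.  The bound names are arguments of
the atom, hence determined by the atom. -/
inductive GuardOK : ℕ → Constr S → Prop
  | base {n m : ℕ} (p : Pr m) (ts : Fin m → Tm S)
      (h : n = 0 ∨ (isOutp p = false ∧ ∀ j < n, ∃ i, ts i = Term.var j)) : GuardOK n (atom p ts)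
  | atGo {n m : ℕ} (p : Pr m) (ts : Fin m → Tm S) (v : Val S)
      (h : n = 0 ∨ (isOutp p = false ∧ ∀ j < n, ∃ i, ts i = Term.var j)) :
      GuardOK n (atom p ts ⊓ opv v)
  | eq (a b : Tm S) : GuardOK 0 (Term.equal (L := Lg S) a b)

theorem det_subst {n m : ℕ} {p : Pr m} {ts : Fin m → Tm S}
    (h : n = 0 ∨ (isOutp p = false ∧ ∀ j < n, ∃ i, ts i = Term.var j)) (σ : Sub S) :
    n = 0 ∨ (isOutp p = false ∧ ∀ j < n, ∃ i, substT (upS n σ) (ts i) = Term.var j) := by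
  refine h.imp_right fun h => ⟨h.1, fun j hj => ?_⟩
  obtain ⟨i, hi⟩ := h.2 j hj
  refine ⟨i, ?_⟩
  rw [hi, substT_var]
  simp [upS, hj, Val.tm]

theorem GuardOK.subst {n : ℕ} {c : Constr S} (h : GuardOK n c) (σ : Sub S) :
    GuardOK n (substC (upS n σ) c) := by
  cases h with
  | base p ts h => rw [substC_atom]; exact .base p _ (det_subst h σ)
  | atGo p ts v h =>
    rw [substC_inf, substC_atom, substC_opv]; exact .atGo p _ _ (det_subst h σ)
  | eq a b => rw [substC_equal]; exact .eq _ _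

/-! ### Names of a set -/

open Classical in
/-- The retraction onto the names of the set `X`. -/
noncomputable def ret (X : Set ℕ) : Sub S := fun i => if i ∈ X then .var i else .const S.tt

theorem ret_var_iff {X : Set ℕ} {i : ℕ} : (ret X i : Val S) = .var i ↔ i ∈ X := by
  unfold ret; split_ifs with h <;> simp [h]

theorem Val.subst_ret_iff {X : Set ℕ} {v : Val S} :
    v.subst (ret X) = v ↔ ∀ i, v = .var i → i ∈ X := by
  cases v with
  | var i => simp [Val.subst, ret_var_iff]
  | const c => simp [Val.subst]
  | label c => simp [Val.subst]

/-- The abstracted names are arguments of the atom in the guard, so the tuple can be read off from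
an atom of the store; by `nf_eq_var` its names occur there literally. -/
theorem guard_supp {X : Set ℕ} {L : Set (Constr S)} (hL : ∀ c ∈ L, TellOK c)
    (hX : ∀ c ∈ L, substC (ret X) c = c) {n : ℕ} {c : Constr S} (hc : GuardOK n c)
    (t : Fin n → Val S) (h : SEnt L (substC (instS t) c)) (j : Fin n) :
    (t j).subst (ret X) = t j := by
  have key : ∀ {m : ℕ} (p : Pr m) (ts : Fin m → Tm S),
      (n = 0 ∨ (isOutp p = false ∧ ∀ j < n, ∃ i, ts i = Term.var j)) →
      SEnt L (substC (instS t) (atom p ts)) → (t j).subst (ret X) = t j := by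
    intro m p ts hd h
    rw [substC_atom, sent_atom hL] at h
    obtain ⟨ts', h1, h2⟩ := h
    rcases hd with rfl | ⟨-, hd⟩
    · exact j.elim0
    · obtain ⟨i, hi⟩ := hd j j.2
      have h3 := h2 i
      simp only [hi, substT_var] at h3
      simp only [instS, j.2, dif_pos, Fin.eta, nf_tm] at h3
      rw [Val.subst_ret_iff]
      intro x hx
      rw [hx] at h3
      have h4 := nf_eq_var h3.symm
      have h5 := hX _ h1
      rw [substC_atom] at h5
      have h6 := congrFun (atom_inj h5) i
      rw [h4, substT_var] at h6
      exact ret_var_iff.1 (tm_injective h6)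
  cases hc with
  | base p ts hd => exact key p ts hd h
  | atGo p ts v hd => rw [substC_inf, sent_inf] at h; exact key p ts hd h.1
  | eq a b => exact j.elim0

/-! ### Static congruence of target processes -/

/-- A valid constraint. -/
def Valid (c : Constr S) : Prop := ∀ (M : Mdl S) (w : ℕ → M), Formula.Realize c w

/-- The substitution that exchanges the two innermost names. -/
def swapS (S : Sig.{u}) : Sub S := fun i => .var (Equiv.swap 0 1 i)

/-- A congruence that extends structural congruence by the exchange and the removal of private
names; the excluded tuples of an abstraction count as a set. -/
inductive Cg : UProc S → UProc S → Prop
  | refl (P) : Cg P P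
  | symm {P Q} : Cg P Q → Cg Q P
  | trans {P Q R} : Cg P Q → Cg Q R → Cg P R
  | abs {n c ex ex' P P'} : (∀ t, t ∈ ex ↔ t ∈ ex') → Cg P P' → Cg (.abs n c ex P) (.abs n c ex' P')
  | par {P P' Q Q'} : Cg P P' → Cg Q Q' → Cg (.par P Q) (.par P' Q')
  | loc {n c P P'} : Cg P P' → Cg (.loc n c P) (.loc n c P')
  | next {P P'} : Cg P P' → Cg (.next P) (.next P')
  | unl {c P P'} : Cg P P' → Cg (.unl c P) (.unl c P')
  | bang {P P'} : Cg P P' → Cg (.bang P) (.bang P')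
  | par_skip (P) : Cg (.par P .skip) P
  | par_comm (P Q) : Cg (.par P Q) (.par Q P)
  | par_assoc (P Q R) : Cg (.par P (.par Q R)) (.par (.par P Q) R)
  | par_loc (P n c Q) : Cg (.par P (.loc n c Q)) (.loc n c (.par (P.subst (shiftS S n)) Q))
  | loc_loc (n c m d P) (h : Entails c (exC m d)) : Cg (.loc n c (.loc m d P))
      (.loc (m + n) (substC (shiftS S m) c ⊓ d) P)
  | loc_skip (n c) (h : Valid c) : Cg (.loc n c .skip) .skip
  | loc_swap (P) : Cg (.loc 1 ⊤ (.loc 1 ⊤ P)) (.loc 1 ⊤ (.loc 1 ⊤ (P.subst (swapS S))))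

theorem Cg.of_SC {P Q : UProc S} (h : UProc.SC P Q) : Cg P Q := by
  induction h with
  | refl P => exact .refl P
  | symm _ ih => exact .symm ih
  | trans _ _ h1 h2 => exact .trans h1 h2
  | abs _ ih => exact .abs (fun _ => Iff.rfl) ih
  | par _ _ h1 h2 => exact .par h1 h2
  | loc _ ih => exact .loc ih
  | next _ ih => exact .next ih
  | unl _ ih => exact .unl ih
  | bang _ ih => exact .bang ih
  | par_skip P => exact .par_skip P
  | par_comm P Q => exact .par_comm P Q
  | par_assoc P Q R => exact .par_assoc P Q R
  | par_loc P n c Q => exact .par_loc P n c Q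
  | loc_loc n c m d P h => exact .loc_loc n c m d P h

/-- The valuation `x` on the `n` innermost names, and `w` on the others. -/
def extV {M : Type*} {n : ℕ} (x : Fin n → M) (w : ℕ → M) : ℕ → M :=
  fun i => if h : i < n then x ⟨i, h⟩ else w (i - n)

theorem extV_shift {M : Type*} [(Lg S).Structure M] {n : ℕ} (x : Fin n → M) (w : ℕ → M) :
    (fun i => vev (extV x w) (shiftS S n i)) = w := by
  funext i
  simp [shiftS, vev_var, extV]

theorem extV_upS {M : Type*} [(Lg S).Structure M] {n : ℕ} (x : Fin n → M) (w : ℕ → M)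
    (σ : Sub S) : (fun i => vev (extV x w) (upS n σ i)) = extV x (fun i => vev w (σ i)) := by
  funext i
  by_cases h : i < n
  · simp [upS, h, vev_var, extV]
  · simp only [upS, h, if_false, vev_subst, extV_shift]
    simp [extV, h]

theorem realize_exC_substC {M : Type*} [(Lg S).Structure M] (w : ℕ → M) (σ : Sub S) (n : ℕ)
    (c : Constr S) : Formula.Realize (exC n (substC (upS n σ) c)) w ↔
      Formula.Realize (exC n c) (fun i => vev w (σ i)) := by
  rw [realize_exC, realize_exC]
  refine exists_congr fun x => ?_
  rw [realize_substC]
  exact iff_of_eq (congrArg _ (extV_upS x w σ))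

theorem Valid.subst {c : Constr S} (h : Valid c) (σ : Sub S) : Valid (substC σ c) :=
  fun M w => (realize_substC w σ c).2 (h M _)

theorem valid_shift {c : Constr S} {n : ℕ} : Valid (substC (shiftS S n) c) ↔ Valid c := by
  refine ⟨fun h M w => ?_, fun h => h.subst _⟩
  have := h M (extV (n := n) (fun _ => w 0) w)
  rwa [realize_substC, extV_shift] at this

theorem Cg.subst {P Q : UProc S} (h : Cg P Q) (σ : Sub S) : Cg (P.subst σ) (Q.subst σ) := by
  induction h generalizing σ with
  | refl P => exact .refl _
  | symm _ ih => exact .symm (ih σ)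
  | trans _ _ h1 h2 => exact .trans (h1 σ) (h2 σ)
  | abs h _ ih =>
    refine .abs (fun t => ?_) (ih _)
    simp only [List.mem_map, h]
  | par _ _ h1 h2 => exact .par (h1 σ) (h2 σ)
  | loc _ ih => exact .loc (ih _)
  | next _ ih => exact .next (ih σ)
  | unl _ ih => exact .unl (ih σ)
  | bang _ ih => exact .bang (ih σ)
  | par_skip P => exact .par_skip _
  | par_comm P Q => exact .par_comm _ _
  | par_assoc P Q R => exact .par_assoc _ _ _
  | par_loc P n c Q =>
    have := Cg.par_loc (P.subst σ) n (substC (upS n σ) c) (Q.subst (upS n σ))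
    rw [UProc.subst_subst, ← cmp_shiftS_upS, ← UProc.subst_subst] at this
    exact this
  | loc_loc n c m d P h =>
    have := Cg.loc_loc n (substC (upS n σ) c) m (substC (upS m (upS n σ)) d)
      (P.subst (upS m (upS n σ))) (by
        rw [entails_iff] at h ⊢
        intro M w hc
        rw [realize_exC_substC]
        exact h M _ ((realize_substC _ _ _).1 hc))
    rw [substC_substC, ← cmp_shiftS_upS, ← substC_substC, ← substC_inf, upS_upS] at this
    rw [← upS_upS] at this
    simp only [UProc.subst]
    rw [← upS_upS]
    exact this
  | loc_skip n c h => exact .loc_skip _ _ (h.subst _)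
  | loc_swap P =>
    have := Cg.loc_swap (P.subst (upS 1 (upS 1 σ)))
    rw [UProc.subst_subst] at this
    have e : cmp (swapS S) (upS 1 (upS 1 σ)) = cmp (upS 1 (upS 1 σ)) (swapS S) := by
      funext i
      rcases i with _ | _ | i
      · simp [cmp, swapS, upS, Val.subst, shiftS]
      · simp [cmp, swapS, upS, Val.subst, shiftS]
      · have h1 : Equiv.swap 0 1 (i + 1 + 1) = i + 1 + 1 :=
          Equiv.swap_apply_of_ne_of_ne (by omega) (by omega)
        have h2 : upS (1 + 1) σ (i + 1 + 1) = (σ i).subst (shiftS S 2) := by simp [upS]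
        have h3 : cmp (shiftS S 2) (swapS S) = shiftS S 2 := by
          funext j
          have h4 : Equiv.swap 0 1 (j + 2) = j + 2 :=
            Equiv.swap_apply_of_ne_of_ne (by omega) (by omega)
          simp [cmp, shiftS, swapS, Val.subst, h4]
        have h5 : swapS S (i + 1 + 1) = .var (i + 1 + 1) := congrArg Val.var h1
        rw [upS_upS, cmp, h5, cmp, h2, Val.subst_subst, h3]
        exact h2
    rw [← e] at this
    simp only [UProc.subst, substC_top, UProc.subst_subst]
    exact this

/-! ### Agents -/

/-- The processes that are neither compositions nor local declarations. -/
def IsAgent : UProc S → Prop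
  | .skip => False
  | .par _ _ => False
  | .loc _ _ _ => False
  | _ => True

/-- Agents with the same head and congruent bodies. -/
inductive Ag : UProc S → UProc S → Prop
  | tell (c) : Ag (.tell c) (.tell c)
  | abs {n c ex ex' P P'} : (∀ t, t ∈ ex ↔ t ∈ ex') → Cg P P' → Ag (.abs n c ex P) (.abs n c ex' P')
  | next {P P'} : Cg P P' → Ag (.next P) (.next P')
  | unl {c P P'} : Cg P P' → Ag (.unl c P) (.unl c P')
  | bang {P P'} : Cg P P' → Ag (.bang P) (.bang P')

theorem Ag.refl {a : UProc S} (h : IsAgent a) : Ag a a := by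
  cases a <;> first | exact h.elim | constructor
  all_goals first | exact Cg.refl _ | exact fun _ => Iff.rfl

theorem Ag.symm {a b : UProc S} (h : Ag a b) : Ag b a := by
  cases h with
  | tell c => exact .tell c
  | abs h1 h2 => exact .abs (fun t => (h1 t).symm) h2.symm
  | next h => exact .next h.symm
  | unl h => exact .unl h.symm
  | bang h => exact .bang h.symm

theorem Ag.trans {a b c : UProc S} (h : Ag a b) (h' : Ag b c) : Ag a c := by
  cases h with
  | tell c => exact h'
  | abs h1 h2 => cases h' with
    | abs h3 h4 => exact .abs (fun t => (h1 t).trans (h3 t)) (h2.trans h4)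
  | next h => cases h' with
    | next h2 => exact .next (h.trans h2)
  | unl h => cases h' with
    | unl h2 => exact .unl (h.trans h2)
  | bang h => cases h' with
    | bang h2 => exact .bang (h.trans h2)

theorem Ag.subst {a b : UProc S} (h : Ag a b) (σ : Sub S) : Ag (a.subst σ) (b.subst σ) := by
  cases h with
  | tell c => exact .tell _
  | abs h1 h2 => exact .abs (fun t => by simp only [List.mem_map, h1]) (h2.subst _)
  | next h => exact .next (h.subst σ)
  | unl h => exact .unl (h.subst σ)
  | bang h => exact .bang (h.subst σ)

theorem IsAgent.subst {a : UProc S} (h : IsAgent a) (σ : Sub S) : IsAgent (a.subst σ) := by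
  cases a <;> first | exact h.elim | trivial

theorem Ag.isAgent {a b : UProc S} (h : Ag a b) : IsAgent a := by cases h <;> trivial

/-- Multisets of agents that are related componentwise. -/
abbrev MAg (A B : Multiset (UProc S)) : Prop := Multiset.Rel Ag A B

theorem MAg.trans {A B C : Multiset (UProc S)} (h : MAg A B) (h' : MAg B C) : MAg A C := by
  have : IsTrans (UProc S) Ag := ⟨fun _ _ _ => Ag.trans⟩
  exact Multiset.Rel.trans Ag h h'

theorem MAg.refl {A : Multiset (UProc S)} (h : ∀ a ∈ A, IsAgent a) : MAg A A :=
  Multiset.rel_refl_of_refl_on fun a ha => Ag.refl (h a ha)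

/-! ### Decomposition into agents -/

/-- All constraints in `C` hold under `w`. -/
def Sat {M : Mdl S} (w : ℕ → M) (C : Set (Constr S)) : Prop := ∀ c ∈ C, Formula.Realize c w

theorem sat_union {M : Mdl S} (w : ℕ → M) (C D : Set (Constr S)) :
    Sat w (C ∪ D) ↔ Sat w C ∧ Sat w D := by
  simp only [Sat, Set.mem_union, or_imp, forall_and]

theorem sat_insert {M : Mdl S} (w : ℕ → M) (c : Constr S) (D : Set (Constr S)) :
    Sat w (insert c D) ↔ Formula.Realize c w ∧ Sat w D := by
  simp [Sat]

theorem sat_singleton {M : Mdl S} (w : ℕ → M) (c : Constr S) :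
    Sat w {c} ↔ Formula.Realize c w := by
  simp [Sat]

theorem sat_empty {M : Mdl S} (w : ℕ → M) : Sat w ∅ := by simp [Sat]

/-- Equivalence of sets of constraints. -/
def SEqv (C D : Set (Constr S)) : Prop := ∀ (M : Mdl S) (w : ℕ → M), Sat w C ↔ Sat w D

theorem SEqv.refl (C : Set (Constr S)) : SEqv C C := fun _ _ => Iff.rfl

theorem SEqv.symm {C D : Set (Constr S)} (h : SEqv C D) : SEqv D C := fun M w => (h M w).symm

theorem SEqv.trans {C D E : Set (Constr S)} (h : SEqv C D) (h' : SEqv D E) : SEqv C E :=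
  fun M w => (h M w).trans (h' M w)

theorem SEqv.sent {C D : Set (Constr S)} (h : SEqv C D) {g : Constr S} (hg : SEnt C g) : SEnt D g :=
  fun M w hw => hg M w ((h M w).2 hw)

/-- `Dec P σ A ν C`: under the environment `σ`, the process `P` decomposes into the agents `A`, with
the private names `ν` and the constraints `C` on them. -/
inductive Dec : UProc S → Sub S → Multiset (UProc S) → List ℕ → Set (Constr S) → Prop
  | skip (σ) : Dec .skip σ 0 [] ∅
  | agent {a} (σ) (h : IsAgent a) : Dec a σ {a.subst σ} [] ∅
  | par {P Q σ A B ν μ C D} : Dec P σ A ν C → Dec Q σ B μ D →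
      Dec (.par P Q) σ (A + B) (ν ++ μ) (C ∪ D)
  | loc {n c P σ A ν C} (τ : List ℕ) (h : τ.length = n) : Dec P (ext (τ.map Val.var) σ) A ν C →
      Dec (.loc n c P) σ A (τ ++ ν) (insert (substC (ext (τ.map Val.var) σ) c) C)

theorem dec_skip_iff {σ : Sub S} {A ν C} : Dec .skip σ A ν C ↔ A = 0 ∧ ν = [] ∧ C = ∅ := by
  constructor
  · intro h
    cases h with
    | skip => exact ⟨rfl, rfl, rfl⟩
    | agent _ h => exact h.elim
  · rintro ⟨rfl, rfl, rfl⟩; exact .skip σ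

theorem dec_agent_iff {a : UProc S} (ha : IsAgent a) {σ : Sub S} {A ν C} :
    Dec a σ A ν C ↔ A = {a.subst σ} ∧ ν = [] ∧ C = ∅ := by
  constructor
  · intro h
    cases h with
    | agent => exact ⟨rfl, rfl, rfl⟩
    | skip => exact ha.elim
    | par => exact ha.elim
    | loc => exact ha.elim
  · rintro ⟨rfl, rfl, rfl⟩; exact .agent σ ha

theorem dec_par_iff {P Q : UProc S} {σ : Sub S} {A ν C} : Dec (.par P Q) σ A ν C ↔
    ∃ A1 A2 ν1 ν2 C1 C2, Dec P σ A1 ν1 C1 ∧ Dec Q σ A2 ν2 C2 ∧ A = A1 + A2 ∧ ν = ν1 ++ ν2 ∧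
      C = C1 ∪ C2 := by
  constructor
  · intro h
    cases h with
    | agent _ h => exact h.elim
    | par h1 h2 => exact ⟨_, _, _, _, _, _, h1, h2, rfl, rfl, rfl⟩
  · rintro ⟨_, _, _, _, _, _, h1, h2, rfl, rfl, rfl⟩; exact .par h1 h2

theorem dec_loc_iff {n : ℕ} {c : Constr S} {P : UProc S} {σ : Sub S} {A ν C} :
    Dec (.loc n c P) σ A ν C ↔ ∃ τ ν1 C1, τ.length = n ∧ Dec P (ext (τ.map Val.var) σ) A ν1 C1 ∧
      ν = τ ++ ν1 ∧ C = insert (substC (ext (τ.map Val.var) σ) c) C1 := by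
  constructor
  · intro h
    cases h with
    | agent _ h => exact h.elim
    | loc τ h h1 => exact ⟨τ, _, _, h, h1, rfl, rfl⟩
  · rintro ⟨τ, _, _, h, h1, rfl, rfl⟩; exact .loc τ h h1

/-- Decomposition carries an environment, which absorbs substitutions; no induction on substituted
processes is needed later. -/
theorem dec_subst {P : UProc S} {ρ σ : Sub S} {A ν C} :
    Dec (P.subst ρ) σ A ν C ↔ Dec P (cmp ρ σ) A ν C := by
  induction P generalizing ρ σ A ν C with
  | skip => simp [UProc.subst, dec_skip_iff]
  | par P Q h1 h2 => simp only [UProc.subst, dec_par_iff, h1, h2]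
  | loc n c P ih =>
    simp only [UProc.subst, dec_loc_iff, ih, substC_substC]
    refine exists_congr fun τ => exists_congr fun ν1 => exists_congr fun C1 =>
      and_congr_right fun h => ?_
    rw [cmp_upS_ext _ _ _ _ (by simpa using h)]
  | tell c => rw [dec_agent_iff (by trivial), dec_agent_iff (by trivial), UProc.subst_subst]
  | abs n c ex P _ =>
    rw [dec_agent_iff (by trivial), dec_agent_iff (by trivial), UProc.subst_subst]
  | next P _ => rw [dec_agent_iff (by trivial), dec_agent_iff (by trivial), UProc.subst_subst]
  | unl c P _ => rw [dec_agent_iff (by trivial), dec_agent_iff (by trivial), UProc.subst_subst]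
  | bang P _ => rw [dec_agent_iff (by trivial), dec_agent_iff (by trivial), UProc.subst_subst]

theorem Dec.isAgent {P : UProc S} {σ : Sub S} {A ν C} (h : Dec P σ A ν C) : ∀ a ∈ A, IsAgent a := by
  induction h with
  | skip => simp
  | agent σ h => simpa using h.subst σ
  | par _ _ h1 h2 =>
    intro a ha
    rcases Multiset.mem_add.1 ha with h | h
    exacts [h1 a h, h2 a h]
  | loc _ _ _ ih => exact ih

/-- The renaming `ρ` as a substitution. -/
def ren (S : Sig.{u}) (ρ : ℕ → ℕ) : Sub S := fun i => .var (ρ i)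

/-! ### Fresh names -/

/-- The names `ν` are distinct, private, and not in `F`. -/
def Fresh (F : Finset ℕ) (ν : List ℕ) : Prop := ν.Nodup ∧ ∀ x ∈ ν, x % 2 = 1 ∧ x ∉ F

theorem fresh_nil (F : Finset ℕ) : Fresh F [] := by simp [Fresh]

theorem fresh_append {F : Finset ℕ} {a b : List ℕ} :
    Fresh F (a ++ b) ↔ Fresh F a ∧ Fresh (F ∪ a.toFinset) b := by
  simp only [Fresh, List.nodup_append', List.mem_append, Finset.mem_union, List.mem_toFinset]
  constructor
  · rintro ⟨⟨h1, h2, h3⟩, h4⟩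
    exact ⟨⟨h1, fun x hx => h4 x (.inl hx)⟩, h2, fun x hx => ⟨(h4 x (.inr hx)).1, fun h =>
      h.elim (h4 x (.inr hx)).2 fun h => h3 h hx⟩⟩
  · rintro ⟨⟨h1, h4⟩, h2, h5⟩
    exact ⟨⟨h1, h2, fun x h hx => (h5 x hx).2 (.inr h)⟩, fun x hx => hx.elim (h4 x) fun h =>
      ⟨(h5 x h).1, fun h' => (h5 x h).2 (.inl h')⟩⟩

theorem fresh_perm {F : Finset ℕ} {a b : List ℕ} (h : a.Perm b) : Fresh F a ↔ Fresh F b := by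
  simp only [Fresh, h.nodup_iff, h.mem_iff]

theorem Fresh.mono {F F' : Finset ℕ} {a : List ℕ} (h : Fresh F a) (h' : F' ⊆ F) : Fresh F' a :=
  ⟨h.1, fun x hx => ⟨(h.2 x hx).1, fun hf => (h.2 x hx).2 (h' hf)⟩⟩

theorem exists_fresh (F : Finset ℕ) (n : ℕ) {r : ℕ} (hr : r = 1 ∨ r = 3) :
    ∃ τ : List ℕ, τ.length = n ∧ Fresh F τ ∧ ∀ x ∈ τ, x % 4 = r := by
  -- Names beyond the maximum of `F`, in the class `r` modulo `4`; both admissible classes are odd.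
  have key : ∀ x ∈ (List.range n).map (fun i => 4 * (F.sup id + i) + r), x % 4 = r ∧ x ∉ F := by
    intro x hx
    obtain ⟨i, _, rfl⟩ := List.mem_map.1 hx
    refine ⟨by omega, fun h => ?_⟩
    have := Finset.le_sup (f := id) h
    simp only [id] at this
    omega
  refine ⟨(List.range n).map (fun i => 4 * (F.sup id + i) + r), by simp, ⟨?_, fun x hx => ?_⟩,
    fun x hx => (key x hx).1⟩
  · exact List.Nodup.map (fun a b h => by simp at h; omega) List.nodup_range
  · exact ⟨by have := (key x hx).1; omega, (key x hx).2⟩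

theorem exists_dec (P : UProc S) (σ : Sub S) (F : Finset ℕ) {r : ℕ} (hr : r = 1 ∨ r = 3) :
    ∃ A ν C, Dec P σ A ν C ∧ Fresh F ν ∧ ∀ x ∈ ν, x % 4 = r := by
  induction P generalizing σ F with
  | skip => exact ⟨_, _, _, .skip σ, fresh_nil F, by simp⟩
  | par P Q h1 h2 =>
    obtain ⟨A, ν, C, h3, h4, h5⟩ := h1 σ F
    obtain ⟨B, μ, D, h6, h7, h8⟩ := h2 σ (F ∪ ν.toFinset)
    exact ⟨_, _, _, .par h3 h6, fresh_append.2 ⟨h4, h7⟩, fun x hx =>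
      (List.mem_append.1 hx).elim (h5 x) (h8 x)⟩
  | loc n c P ih =>
    obtain ⟨τ, h1, h2, h5⟩ := exists_fresh F n hr
    obtain ⟨A, ν, C, h3, h4, h8⟩ := ih (ext (τ.map Val.var) σ) (F ∪ τ.toFinset)
    exact ⟨_, _, _, .loc τ h1 h3, fresh_append.2 ⟨h2, h4⟩, fun x hx =>
      (List.mem_append.1 hx).elim (h5 x) (h8 x)⟩
  | tell c => exact ⟨_, _, _, .agent σ (by trivial), fresh_nil F, by simp⟩
  | abs => exact ⟨_, _, _, .agent σ (by trivial), fresh_nil F, by simp⟩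
  | next => exact ⟨_, _, _, .agent σ (by trivial), fresh_nil F, by simp⟩
  | unl => exact ⟨_, _, _, .agent σ (by trivial), fresh_nil F, by simp⟩
  | bang => exact ⟨_, _, _, .agent σ (by trivial), fresh_nil F, by simp⟩

/-! ### Decompositions of congruent processes -/

/-- Every decomposition of `P` is matched by one of `Q`; the names that are not needed in `P` are
taken from the class of `3` modulo `4`. -/
def DecSim (P Q : UProc S) : Prop := ∀ σ A ν C F, Dec P σ A ν C → Fresh F ν →
  ∃ A' ν' C', Dec Q σ A' ν' C' ∧ Fresh F ν' ∧ (∀ x ∈ ν', x ∈ ν ∨ x % 4 = 3) ∧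
    MAg A A' ∧ SEqv C C'

theorem DecSim.agent {a b : UProc S} (h : Ag a b) : DecSim a b := by
  intro σ A ν C F hd hF
  obtain ⟨rfl, rfl, rfl⟩ := (dec_agent_iff h.isAgent).1 hd
  exact ⟨_, _, _, .agent σ h.symm.isAgent, hF, by simp,
    Multiset.rel_cons_left.2 ⟨_, 0, h.subst σ, Multiset.Rel.zero, rfl⟩, .refl _⟩

theorem sat_congr_union {C C' D D' : Set (Constr S)} (h : SEqv C C') (h' : SEqv D D') :
    SEqv (C ∪ D) (C' ∪ D') := by
  intro M w
  rw [sat_union, sat_union, h, h']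

/-- Nearly all rules permute the list of private names and regroup the constraints. Only the removal
of a declaration over `skip`, read backwards, has to invent names. In a composition the names of one
side are chosen away from those of the other. -/
theorem decSim_of_cg {P Q : UProc S} (h : Cg P Q) : DecSim P Q ∧ DecSim Q P := by
  induction h with
  | refl P =>
    have : DecSim P P := fun σ A ν C F hd hF => ⟨A, ν, C, hd, hF, fun _ => .inl,
      .refl hd.isAgent, .refl C⟩
    exact ⟨this, this⟩
  | symm _ ih => exact ih.symm
  | trans _ _ h1 h2 =>
    have key : ∀ {P Q R : UProc S}, DecSim P Q → DecSim Q R → DecSim P R := by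
      intro P Q R h1 h2 σ A ν C F hd hF
      obtain ⟨A1, ν1, C1, h3, h4, n1, h5, h6⟩ := h1 σ A ν C F hd hF
      obtain ⟨A2, ν2, C2, h7, h8, n2, h9, h10⟩ := h2 σ A1 ν1 C1 F h3 h4
      exact ⟨A2, ν2, C2, h7, h8, fun x hx => (n2 x hx).elim (n1 x) .inr, h5.trans h9, h6.trans h10⟩
    exact ⟨key h1.1 h2.1, key h2.2 h1.2⟩
  | abs h1 h2 _ => exact ⟨.agent (.abs h1 h2), .agent (Ag.abs h1 h2).symm⟩
  | next h _ => exact ⟨.agent (.next h), .agent (Ag.next h).symm⟩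
  | unl h _ => exact ⟨.agent (.unl h), .agent (Ag.unl h).symm⟩
  | bang h _ => exact ⟨.agent (.bang h), .agent (Ag.bang h).symm⟩
  | par _ _ h1 h2 =>
    have key : ∀ {P P' Q Q' : UProc S}, DecSim P P' → DecSim Q Q' →
        DecSim (.par P Q) (.par P' Q') := by
      intro P P' Q Q' h1 h2 σ A ν C F hd hF
      obtain ⟨A1, A2, ν1, ν2, C1, C2, h3, h4, rfl, rfl, rfl⟩ := dec_par_iff.1 hd
      rw [fresh_perm List.perm_append_comm, fresh_append] at hF
      obtain ⟨B1, μ1, D1, h5, h6, n1, h7, h8⟩ := h1 σ _ _ _ _ h3 hF.2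
      have hF2 := fresh_append.2 ⟨hF.1, h6⟩
      rw [fresh_perm List.perm_append_comm, fresh_append] at hF2
      obtain ⟨B2, μ2, D2, h9, h10, n2, h11, h12⟩ := h2 σ _ _ _ _ h4 hF2.2
      refine ⟨_, _, _, .par h5 h9, fresh_append.2 ⟨hF2.1, h10⟩, ?_, h7.add h11, sat_congr_union h8 h12⟩
      grind
    exact ⟨key h1.1 h2.1, key h1.2 h2.2⟩
  | @loc n c _ _ _ ih =>
    have key : ∀ {P P' : UProc S}, DecSim P P' → DecSim (.loc n c P) (.loc n c P') := by
      intro P P' h σ A ν C F hd hF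
      obtain ⟨τ, ν1, C1, h1, h2, rfl, rfl⟩ := dec_loc_iff.1 hd
      rw [fresh_append] at hF
      obtain ⟨A', ν', C', h3, h4, n1, h5, h6⟩ := h _ _ _ _ _ h2 hF.2
      refine ⟨_, _, _, .loc τ h1 h3, fresh_append.2 ⟨hF.1, h4⟩, by grind, h5, fun M w => ?_⟩
      rw [sat_insert, sat_insert, h6]
    exact ⟨key ih.1, key ih.2⟩
  | par_skip P =>
    constructor
    · intro σ A ν C F hd hF
      obtain ⟨A1, A2, ν1, ν2, C1, C2, h3, h4, rfl, rfl, rfl⟩ := dec_par_iff.1 hd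
      obtain ⟨rfl, rfl, rfl⟩ := dec_skip_iff.1 h4
      simp only [add_zero, List.append_nil, Set.union_empty] at hF ⊢
      exact ⟨_, _, _, h3, hF, fun _ => .inl, .refl h3.isAgent, .refl _⟩
    · intro σ A ν C F hd hF
      have := Dec.par hd (.skip σ)
      simp only [add_zero, List.append_nil, Set.union_empty] at this
      exact ⟨_, _, _, this, hF, fun _ => .inl, .refl hd.isAgent, .refl _⟩
  | par_comm P Q =>
    have key : ∀ P Q : UProc S, DecSim (.par P Q) (.par Q P) := by
      intro P Q σ A ν C F hd hF
      obtain ⟨A1, A2, ν1, ν2, C1, C2, h3, h4, rfl, rfl, rfl⟩ := dec_par_iff.1 hd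
      refine ⟨_, _, _, .par h4 h3, (fresh_perm List.perm_append_comm).1 hF, by grind,
        ?_, ?_⟩
      · rw [add_comm]; exact .refl (Dec.par h4 h3).isAgent
      · rw [Set.union_comm]; exact .refl _
    exact ⟨key P Q, key Q P⟩
  | par_assoc P Q R =>
    constructor
    · intro σ A ν C F hd hF
      obtain ⟨A1, _, ν1, _, C1, _, h3, h4, rfl, rfl, rfl⟩ := dec_par_iff.1 hd
      obtain ⟨A2, A3, ν2, ν3, C2, C3, h5, h6, rfl, rfl, rfl⟩ := dec_par_iff.1 h4
      refine ⟨_, _, _, .par (.par h3 h5) h6, by simpa using hF, by grind, ?_, ?_⟩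
      · rw [add_assoc]; exact .refl hd.isAgent
      · rw [Set.union_assoc]; exact .refl _
    · intro σ A ν C F hd hF
      obtain ⟨_, A1, _, ν1, _, C1, h3, h4, rfl, rfl, rfl⟩ := dec_par_iff.1 hd
      obtain ⟨A2, A3, ν2, ν3, C2, C3, h5, h6, rfl, rfl, rfl⟩ := dec_par_iff.1 h3
      refine ⟨_, _, _, .par h5 (.par h6 h4), by simpa using hF, by grind, ?_, ?_⟩
      · rw [← add_assoc]; exact .refl hd.isAgent
      · rw [← Set.union_assoc]; exact .refl _
  | par_loc P n c Q =>
    constructor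
    · intro σ A ν C F hd hF
      obtain ⟨A1, A2, ν1, _, C1, _, h3, h4, rfl, rfl, rfl⟩ := dec_par_iff.1 hd
      obtain ⟨τ, ν2, C2, h5, h6, rfl, rfl⟩ := dec_loc_iff.1 h4
      refine ⟨_, _, _, .loc τ h5 (.par (ν := ν1) (C := C1) (dec_subst.2 ?_) h6), ?_,
        by grind, .refl hd.isAgent, ?_⟩
      · rw [cmp_shiftS_ext _ _ _ (by simpa using h5)]; exact h3
      · refine (fresh_perm ?_).1 hF
        rw [← List.append_assoc, ← List.append_assoc]
        exact List.Perm.append_right _ List.perm_append_comm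
      · intro M w
        simp only [sat_union, sat_insert]
        tauto
    · intro σ A ν C F hd hF
      obtain ⟨τ, _, _, h5, h6, rfl, rfl⟩ := dec_loc_iff.1 hd
      obtain ⟨A1, A2, ν1, ν2, C1, C2, h3, h4, rfl, rfl, rfl⟩ := dec_par_iff.1 h6
      rw [dec_subst, cmp_shiftS_ext _ _ _ (by simpa using h5)] at h3
      refine ⟨_, _, _, .par h3 (.loc τ h5 h4), ?_, by grind, .refl hd.isAgent, ?_⟩
      · refine (fresh_perm ?_).1 hF
        rw [← List.append_assoc, ← List.append_assoc]
        exact List.Perm.append_right _ List.perm_append_comm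
      · intro M w
        simp only [sat_union, sat_insert]
        tauto
  | loc_loc n c m d P h =>
    constructor
    · intro σ A ν C F hd hF
      obtain ⟨τ1, _, _, h1, h2, rfl, rfl⟩ := dec_loc_iff.1 hd
      obtain ⟨τ2, ν, C, h3, h4, rfl, rfl⟩ := dec_loc_iff.1 h2
      rw [← ext_append, ← List.map_append] at h4
      refine ⟨_, _, _, .loc (τ2 ++ τ1) (by simp [h1, h3]) h4, ?_, by grind, .refl hd.isAgent, ?_⟩
      · refine (fresh_perm ?_).1 hF
        rw [← List.append_assoc]
        exact List.Perm.append_right _ List.perm_append_comm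
      · intro M w
        rw [substC_inf, substC_substC, List.map_append, ext_append,
          cmp_shiftS_ext _ _ _ (by simpa using h3)]
        simp only [sat_insert, Formula.realize_inf]
        tauto
    · intro σ A ν C F hd hF
      obtain ⟨τ, ν, C, h1, h2, rfl, rfl⟩ := dec_loc_iff.1 hd
      obtain ⟨τ2, τ1, rfl, h3, h4⟩ : ∃ τ2 τ1 : List ℕ, τ = τ2 ++ τ1 ∧ τ2.length = m ∧
          τ1.length = n := ⟨τ.take m, τ.drop m, by simp, by simp [h1], by simp [h1]⟩
      rw [List.map_append, ext_append] at h2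
      refine ⟨_, _, _, .loc τ1 h4 (.loc τ2 h3 h2), ?_, by grind, .refl hd.isAgent, ?_⟩
      · refine (fresh_perm ?_).1 hF
        rw [← List.append_assoc]
        exact List.Perm.append_right _ List.perm_append_comm
      · intro M w
        rw [substC_inf, substC_substC, List.map_append, ext_append,
          cmp_shiftS_ext _ _ _ (by simpa using h3)]
        simp only [sat_insert, Formula.realize_inf]
        tauto
  | loc_skip n c h =>
    constructor
    · intro σ A ν C F hd hF
      obtain ⟨τ, ν, C, h1, h2, rfl, rfl⟩ := dec_loc_iff.1 hd
      obtain ⟨rfl, rfl, rfl⟩ := dec_skip_iff.1 h2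
      refine ⟨_, _, _, .skip σ, fresh_nil F, by simp, .zero, fun M w => ?_⟩
      rw [sat_insert]
      simp [h.subst _ M w, sat_empty]
    · intro σ A ν C F hd hF
      obtain ⟨rfl, rfl, rfl⟩ := dec_skip_iff.1 hd
      -- Names for a declaration that the other process lacks come from the spare class.
      obtain ⟨τ, h1, h2, n1⟩ := exists_fresh F n (.inr rfl)
      refine ⟨_, _, _, .loc τ h1 (.skip _), by simpa using h2, by grind, .zero, fun M w => ?_⟩
      rw [sat_insert]
      simp [h.subst _ M w, sat_empty]
  | loc_swap P =>
    have swap_ext : ∀ (a b : ℕ) (σ : Sub S), cmp (swapS S) (ext [Val.var a] (ext [Val.var b] σ)) =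
        ext [Val.var b] (ext [Val.var a] σ) := by
      intro a b σ
      rw [← ext_append, ← ext_append]
      funext i
      rcases i with _ | _ | i
      · simp [cmp, swapS, Val.subst, ext]
      · simp [cmp, swapS, Val.subst, ext]
      · have h1 : Equiv.swap 0 1 (i + 1 + 1) = i + 1 + 1 :=
          Equiv.swap_apply_of_ne_of_ne (by omega) (by omega)
        simp [cmp, swapS, Val.subst, ext, h1]
    constructor
    · intro σ A ν C F hd hF
      obtain ⟨τ1, _, _, h1, h2, rfl, rfl⟩ := dec_loc_iff.1 hd
      obtain ⟨τ2, ν, C, h3, h4, rfl, rfl⟩ := dec_loc_iff.1 h2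
      obtain ⟨b, rfl⟩ := List.length_eq_one_iff.1 h1
      obtain ⟨a, rfl⟩ := List.length_eq_one_iff.1 h3
      simp only [List.map_cons, List.map_nil] at h4
      rw [← swap_ext, ← dec_subst] at h4
      refine ⟨_, _, _, .loc [a] rfl (.loc [b] rfl h4), ?_, by grind, .refl hd.isAgent, ?_⟩
      · exact (fresh_perm (List.Perm.swap _ _ _)).1 hF
      · intro M w
        simp only [substC_top]
    · intro σ A ν C F hd hF
      obtain ⟨τ1, _, _, h1, h2, rfl, rfl⟩ := dec_loc_iff.1 hd
      obtain ⟨τ2, ν, C, h3, h4, rfl, rfl⟩ := dec_loc_iff.1 h2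
      obtain ⟨b, rfl⟩ := List.length_eq_one_iff.1 h1
      obtain ⟨a, rfl⟩ := List.length_eq_one_iff.1 h3
      simp only [List.map_cons, List.map_nil] at h4
      rw [dec_subst, swap_ext] at h4
      refine ⟨_, _, _, .loc [a] rfl (.loc [b] rfl h4), ?_, by grind, .refl hd.isAgent, ?_⟩
      · exact (fresh_perm (List.Perm.swap _ _ _)).1 hF
      · intro M w
        simp only [substC_top]

/-! ### Well-formed target processes -/

/-- The shape of the processes in the image of the encoding and of their derivatives.  Local
declarations carry valid constraints if they are guarded, or if `b` holds. -/
def Good : Bool → UProc S → Prop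
  | _, .skip => True
  | _, .tell c => TellOK c
  | _, .abs n c _ P => GuardOK n c ∧ Good true P
  | b, .par P Q => Good b P ∧ Good b Q
  | b, .loc _ c P => (b = true → Valid c) ∧ Good b P
  | _, .next P => Good true P
  | _, .unl c P => (∃ v, c = opv v) ∧ Good true P
  | _, .bang P => Good true P

theorem Good.weaken {P : UProc S} (h : Good true P) (b : Bool) : Good b P := by
  induction P with
  | par P Q h1 h2 => exact ⟨h1 h.1, h2 h.2⟩
  | loc n c P ih => exact ⟨fun _ => h.1 rfl, ih h.2⟩
  | _ => exact h

theorem Good.subst {P : UProc S} {b : Bool} (h : Good b P) (σ : Sub S) : Good b (P.subst σ) := by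
  induction P generalizing b σ with
  | skip => trivial
  | tell c => exact TellOK.subst h σ
  | abs n c ex P ih => exact ⟨h.1.subst σ, ih h.2 _⟩
  | par P Q h1 h2 => exact ⟨h1 h.1 σ, h2 h.2 σ⟩
  | loc n c P ih => exact ⟨fun hb => (h.1 hb).subst _, ih h.2 _⟩
  | next P ih => exact ih (b := true) h σ
  | unl c P ih =>
    obtain ⟨⟨v, rfl⟩, h⟩ := h
    exact ⟨⟨_, substC_opv σ v⟩, ih h σ⟩
  | bang P ih => exact ih (b := true) h σ

theorem valid_inf {c d : Constr S} : Valid (c ⊓ d) ↔ Valid c ∧ Valid d := by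
  simp only [Valid, Formula.realize_inf, forall_and]

theorem good_subst_shift {P : UProc S} {b : Bool} {n : ℕ} :
    Good b (P.subst (shiftS S n)) ↔ Good b P := by
  refine ⟨fun h => ?_, fun h => h.subst _⟩
  have := h.subst (instS (n := n) fun _ => .var 0)
  rwa [UProc.subst_subst, cmp_shiftS_instS, UProc.subst_id] at this

theorem good_subst_swap {P : UProc S} {b : Bool} :
    Good b (P.subst (swapS S)) ↔ Good b P := by
  refine ⟨fun h => ?_, fun h => h.subst _⟩
  have := h.subst (swapS S)
  have e : cmp (swapS S) (swapS S) = Val.var := by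
    funext i; simp [cmp, swapS, Val.subst]
  rwa [UProc.subst_subst, e, UProc.subst_id] at this

theorem good_cg {P Q : UProc S} (h : Cg P Q) (b : Bool) : Good b P ↔ Good b Q := by
  induction h generalizing b with
  | refl P => exact Iff.rfl
  | symm _ ih => exact (ih b).symm
  | trans _ _ h1 h2 => exact (h1 b).trans (h2 b)
  | abs _ _ ih => exact and_congr_right fun _ => ih true
  | par _ _ h1 h2 => exact and_congr (h1 b) (h2 b)
  | loc _ ih => exact and_congr_right fun _ => ih b
  | next _ ih => exact ih true
  | unl _ ih => exact and_congr_right fun _ => ih true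
  | bang _ ih => exact ih true
  | par_skip P => simp [Good]
  | par_comm P Q => exact and_comm
  | par_assoc P Q R => exact and_assoc.symm
  | par_loc P n c Q => simp only [Good, good_subst_shift]; tauto
  | loc_loc n c m d P h => simp only [Good, valid_inf, valid_shift]; tauto
  | loc_skip n c h => simp [Good, h]
  | loc_swap P => simp only [Good, good_subst_swap]

theorem Dec.good {P : UProc S} {σ : Sub S} {A ν C} (h : Dec P σ A ν C) {b : Bool} (hP : Good b P) :
    (∀ a ∈ A, Good true a) ∧ (b = true → ∀ c ∈ C, Valid c) := by
  induction h with
  | skip => simp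
  | @agent a σ h =>
    refine ⟨?_, by simp⟩
    simp only [Multiset.mem_singleton, forall_eq]
    refine Good.subst ?_ σ
    cases a <;> first | exact h.elim | exact hP
  | par _ _ h1 h2 =>
    refine ⟨fun a ha => ?_, fun hb c hc => ?_⟩
    · exact (Multiset.mem_add.1 ha).elim ((h1 hP.1).1 a) ((h2 hP.2).1 a)
    · exact hc.elim ((h1 hP.1).2 hb c) ((h2 hP.2).2 hb c)
  | loc τ h _ ih =>
    refine ⟨(ih hP.2).1, fun hb c hc => ?_⟩
    rcases hc with rfl | hc
    · exact (hP.1 hb).subst _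
    · exact (ih hP.2).2 hb c hc

/-! ### Names of processes -/

/-- The free names of `P` are in `X`. -/
def Supp (X : Set ℕ) (P : UProc S) : Prop := P.subst (ret X) = P

/-- The free names of `c` are in `X`. -/
def SuppC (X : Set ℕ) (c : Constr S) : Prop := substC (ret X) c = c

/-- The names of `v` are in `X`. -/
def SuppV (X : Set ℕ) (v : Val S) : Prop := v.subst (ret X) = v

theorem suppV_var {X : Set ℕ} {i : ℕ} : SuppV X (.var i : Val S) ↔ i ∈ X := ret_var_iff

theorem cmp_ret_mono {X Y : Set ℕ} (h : X ⊆ Y) : cmp (ret X) (ret Y) = (ret X : Sub S) := by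
  funext i
  by_cases hi : i ∈ X
  · simp [cmp, ret, hi, Val.subst, h hi]
  · simp [cmp, ret, hi, Val.subst]

theorem Supp.mono {X Y : Set ℕ} {P : UProc S} (hP : Supp X P) (h : X ⊆ Y) : Supp Y P := by
  unfold Supp at hP ⊢
  rw [← hP, UProc.subst_subst, cmp_ret_mono h]

theorem SuppC.mono {X Y : Set ℕ} {c : Constr S} (hP : SuppC X c) (h : X ⊆ Y) : SuppC Y c := by
  unfold SuppC at hP ⊢
  rw [← hP, substC_substC, cmp_ret_mono h]

theorem SuppV.mono {X Y : Set ℕ} {v : Val S} (hP : SuppV X v) (h : X ⊆ Y) : SuppV Y v := by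
  unfold SuppV at hP ⊢
  rw [← hP, Val.subst_subst, cmp_ret_mono h]

/-- The retraction replaces all other names by a constant, so their values cannot matter. -/
theorem SuppC.realize_congr {X : Set ℕ} {c : Constr S} (hP : SuppC X c) {M : Mdl S} {w w' : ℕ → M}
    (h : ∀ i ∈ X, w i = w' i) : Formula.Realize c w ↔ Formula.Realize c w' := by
  rw [← hP, realize_substC, realize_substC]
  refine iff_of_eq (congrArg _ (funext fun i => ?_))
  by_cases hi : i ∈ X
  · simp [ret, hi, vev_var, h i hi]
  · simp only [ret, hi, if_false]
    exact congrArg (Structure.funMap (L := Lg S) _) (funext fun i => i.elim0)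

theorem Supp.subst {X : Set ℕ} (P : UProc S) {σ : Sub S} (h : ∀ i, SuppV X (σ i)) :
    Supp X (P.subst σ) := by
  unfold Supp
  rw [UProc.subst_subst]
  congr 1
  funext i
  exact h i

theorem SuppC.subst {X : Set ℕ} (P : Constr S) {σ : Sub S} (h : ∀ i, SuppV X (σ i)) :
    SuppC X (substC σ P) := by
  unfold SuppC
  rw [substC_substC]
  congr 1
  funext i
  exact h i

theorem suppV_ext {X : Set ℕ} {vs : List (Val S)} {σ : Sub S} (h : ∀ v ∈ vs, SuppV X v)
    (h' : ∀ i, SuppV X (σ i)) (i : ℕ) : SuppV X (ext vs σ i) := by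
  by_cases hi : i < vs.length
  · rw [ext_lt _ _ hi]; exact h _ (List.getElem_mem hi)
  · rw [ext_ge _ _ (not_lt.1 hi)]; exact h' _

theorem suppV_ret (X : Set ℕ) (i : ℕ) : SuppV X (ret X i : Val S) := by
  by_cases h : i ∈ X <;> simp [SuppV, ret, h, Val.subst]

theorem Dec.supp' {X : Set ℕ} {P : UProc S} {σ : Sub S} {A ν C} (h : Dec P σ A ν C)
    (hσ : ∀ i, SuppV X (σ i)) (hν : ∀ x ∈ ν, x ∈ X) :
    (∀ a ∈ A, Supp X a) ∧ (∀ c ∈ C, SuppC X c) := by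
  induction h with
  | skip => simp
  | agent σ h =>
    simp only [Multiset.mem_singleton, forall_eq, Set.mem_empty_iff_false, false_imp_iff,
      implies_true, and_true]
    exact Supp.subst _ hσ
  | par _ _ h1 h2 =>
    obtain ⟨h3, h4⟩ := h1 hσ fun x hx => hν x (List.mem_append_left _ hx)
    obtain ⟨h5, h6⟩ := h2 hσ fun x hx => hν x (List.mem_append_right _ hx)
    exact ⟨fun a ha => (Multiset.mem_add.1 ha).elim (h3 a) (h5 a),
      fun c hc => hc.elim (h4 c) (h6 c)⟩
  | loc τ h _ ih =>
    have hσ' := suppV_ext (X := X) (vs := τ.map Val.var) (by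
      intro v hv
      obtain ⟨x, hx, rfl⟩ := List.mem_map.1 hv
      exact suppV_var.2 (hν x (List.mem_append_left _ hx))) hσ
    obtain ⟨h1, h2⟩ := ih hσ' fun x hx => hν x (List.mem_append_right _ hx)
    refine ⟨h1, fun c hc => ?_⟩
    rcases hc with rfl | hc
    · exact SuppC.subst _ hσ'
    · exact h2 c hc

theorem Dec.supp {X Y : Set ℕ} {P : UProc S} {A ν C} (h : Dec P Val.var A ν C) (hP : Supp X P)
    (hX : X ⊆ Y) (hν : ∀ x ∈ ν, x ∈ Y) :
    (∀ a ∈ A, Supp Y a) ∧ (∀ c ∈ C, SuppC Y c) := by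
  unfold Supp at hP
  -- Since `P` is fixed by the retraction, it may be decomposed under the retraction instead of the
  -- identity.
  rw [← hP, dec_subst, cmp_var] at h
  exact h.supp' (fun i => (suppV_ret X i).mono hX) hν

theorem Supp.abs_body {X : Set ℕ} {n : ℕ} {c : Constr S} {ex : List (Fin n → Val S)} {P : UProc S}
    (h : Supp X (.abs n c ex P)) {t : Fin n → Val S} (ht : ∀ i, SuppV X (t i)) :
    Supp X (P.subst (instS t)) := by
  unfold Supp at h ⊢
  simp only [UProc.subst, UProc.abs.injEq, true_and, heq_eq_eq] at h
  have e : (fun i => (t i).subst (ret X)) = t := funext ht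
  rw [UProc.subst_subst, cmp_instS, e, ← UProc.subst_subst, h.2.2]

theorem Supp.abs_ex {X : Set ℕ} {n : ℕ} {c : Constr S} {ex : List (Fin n → Val S)} {P : UProc S}
    (h : Supp X (.abs n c ex P)) {t : Fin n → Val S} (ht : ∀ i, SuppV X (t i)) :
    Supp X (.abs n c (t :: ex) P) := by
  unfold Supp at h ⊢
  simp only [UProc.subst, UProc.abs.injEq, true_and, heq_eq_eq, List.map_cons] at h ⊢
  refine ⟨h.1, ?_, h.2.2⟩
  rw [h.2.1]
  congr 1
  exact funext ht

/-! ### Coherence of local constraints -/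

/-- Semantic stores. -/
abbrev Store (S : Sig.{u}) : Type (u + 1) := (M : Mdl S) → (ℕ → M) → Prop

/-- The semantic store of a constraint. -/
def stC (d : Constr S) : Store S := fun _ w => Formula.Realize d w

/-- The store has the information that the local declarations of `P` give on the outer names. -/
def Coh : UProc S → Store S → Prop
  | .loc n c P, s => (∀ M w, s M w → ∃ x : Fin n → M, Formula.Realize c (extV x w)) ∧
      Coh P (fun M w => Formula.Realize c w ∧ s M (fun i => w (i + n)))
  | .par P Q, s => Coh P s ∧ Coh Q s
  | _, _ => True

theorem Coh.mono {P : UProc S} {s s' : Store S} (h : Coh P s) (hs : ∀ M w, s' M w → s M w) :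
    Coh P s' := by
  induction P generalizing s s' with
  | par P Q h1 h2 => exact ⟨h1 h.1 hs, h2 h.2 hs⟩
  | loc n c P ih => exact ⟨fun M w hw => h.1 M w (hs M w hw), ih h.2 fun M w hw => ⟨hw.1, hs _ _ hw.2⟩⟩
  | _ => trivial

theorem coh_congr {P : UProc S} {s s' : Store S} (hs : ∀ M w, s' M w ↔ s M w) :
    Coh P s ↔ Coh P s' :=
  ⟨fun h => h.mono fun M w => (hs M w).1, fun h => h.mono fun M w => (hs M w).2⟩

theorem extV_shift' {M : Type*} {n : ℕ} (x : Fin n → M) (w : ℕ → M) :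
    (fun i => extV x w (i + n)) = w := by
  funext i
  simp [extV]

theorem extV_eta {M : Type*} {n : ℕ} (w : ℕ → M) :
    extV (fun i : Fin n => w i) (fun i => w (i + n)) = w := by
  funext i
  by_cases h : i < n
  · simp [extV, h]
  · simp only [extV, h, dif_neg, not_false_eq_true]; congr 1; omega

/-- The store is pulled back along `σ`: the valuations that `P` sees are those induced by valuations
of the new names. -/
theorem coh_subst {P : UProc S} {σ : Sub S} {s : Store S} : Coh (P.subst σ) s ↔
    Coh P (fun M v => ∃ v', (fun i => vev v' (σ i)) = v ∧ s M v') := by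
  induction P generalizing σ s with
  | par P Q h1 h2 => exact and_congr h1 h2
  | loc n c P ih =>
    refine and_congr ?_ (ih.trans (coh_congr fun M u => ?_))
    · constructor
      · rintro h M _ ⟨v', rfl, hv'⟩
        obtain ⟨x, hx⟩ := h M v' hv'
        rw [realize_substC, extV_upS] at hx
        exact ⟨x, hx⟩
      · intro h M v' hv'
        obtain ⟨x, hx⟩ := h M _ ⟨v', rfl, hv'⟩
        refine ⟨x, ?_⟩
        rw [realize_substC, extV_upS]
        exact hx
    · constructor
      · rintro ⟨h, v', h1, h2⟩
        have e : (fun i => vev (extV (fun i : Fin n => u i) v') (upS n σ i)) = u := by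
          rw [extV_upS, h1, extV_eta]
        refine ⟨extV (fun i : Fin n => u i) v', e, ?_, ?_⟩
        · rw [realize_substC, e]; exact h
        · rw [extV_shift']; exact h2
      · rintro ⟨u', rfl, h1, h2⟩
        rw [realize_substC] at h1
        refine ⟨h1, fun i => u' (i + n), funext fun i => ?_, h2⟩
        simp only [upS, show ¬ (i + n < n) by omega, if_false, vev_subst, Nat.add_sub_cancel]
        rfl
  | _ => exact Iff.rfl

theorem Good.coh {P : UProc S} (h : Good true P) (s : Store S) : Coh P s := by
  induction P generalizing s with
  | par P Q h1 h2 => exact ⟨h1 h.1 s, h2 h.2 s⟩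
  | loc n c P ih => exact ⟨fun M w _ => ⟨fun _ => w 0, h.1 rfl M _⟩, ih h.2 _⟩
  | _ => trivial

/-- Scope extrusion moves `P` below a declaration without changing the valuations it sees, since the
condition on the declaration extends each of them to the private names. Splitting a declaration uses
the side condition of the merge rule. -/
theorem coh_SC {P Q : UProc S} (h : UProc.SC P Q) (s : Store S) : Coh P s ↔ Coh Q s := by
  induction h generalizing s with
  | refl P => exact Iff.rfl
  | symm _ ih => exact (ih s).symm
  | trans _ _ h1 h2 => exact (h1 s).trans (h2 s)
  | abs _ _ => exact Iff.rfl
  | par _ _ h1 h2 => exact and_congr (h1 s) (h2 s)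
  | loc _ ih => exact and_congr_right fun _ => ih _
  | next _ _ => exact Iff.rfl
  | unl _ _ => exact Iff.rfl
  | bang _ _ => exact Iff.rfl
  | par_skip P => simp [Coh]
  | par_comm P Q => exact and_comm
  | par_assoc P Q R => exact and_assoc.symm
  | par_loc P n c Q =>
    simp only [Coh, coh_subst]
    rw [← and_assoc, and_comm (a := Coh P s), and_assoc]
    refine and_congr_right fun h => and_congr_left fun _ => coh_congr fun M v => ?_
    constructor
    · rintro ⟨v', rfl, h1, h2⟩
      exact h2
    · intro hv
      obtain ⟨x, hx⟩ := h M v hv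
      exact ⟨extV x v, extV_shift x v, hx, by rw [extV_shift']; exact hv⟩
  | loc_loc n c m d P h =>
    simp only [Coh]
    rw [← and_assoc]
    have e : ∀ {M : Mdl S} (w : ℕ → M), (fun i => vev w (shiftS S m i)) = fun i => w (i + m) :=
      fun w => rfl
    refine and_congr ?_ (coh_congr fun M w => ?_)
    · constructor
      · rintro ⟨h1, h2⟩ M w hw
        obtain ⟨x, hx⟩ := h1 M w hw
        obtain ⟨y, hy⟩ := h2 M _ ⟨hx, by rw [extV_shift']; exact hw⟩
        refine ⟨fun i => extV y (extV x w) i, ?_⟩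
        have : extV (fun i : Fin (m + n) => extV y (extV x w) i) w = extV y (extV x w) := by
          conv_rhs => rw [← extV_eta (n := m + n) (extV y (extV x w))]
          congr 1
          funext i
          simp [extV, show ¬ (i + (m + n) < m) by omega, show ¬ (i + (m + n) - m < n) by omega]
          congr 1; omega
        rw [this, Formula.realize_inf, realize_substC, extV_shift]
        exact ⟨hx, hy⟩
      · intro h1
        refine ⟨fun M w hw => ?_, fun M w hw => ?_⟩
        · obtain ⟨x, hx⟩ := h1 M w hw
          rw [Formula.realize_inf, realize_substC, e] at hx
          refine ⟨fun i => x ⟨i + m, by omega⟩, ?_⟩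
          convert hx.1 using 1
          funext i
          by_cases hi : i < n
          · simp [extV, hi, show i + m < m + n by omega]
          · simp only [extV, hi, show ¬ (i + m < m + n) by omega, dif_neg, not_false_eq_true]
            congr 1; omega
        -- The side condition of the merge rule supplies values for the inner names.
        · have := (entails_iff _ _).1 h M w hw.1
          rw [realize_exC] at this
          exact this
    · rw [Formula.realize_inf, realize_substC, e]
      simp only [Nat.add_assoc, Nat.add_comm m n]
      tauto

/-! ### Valuations that satisfy all local constraints -/

theorem dec_sat_congr {P : UProc S} {σ : Sub S} {A ν C} (h : Dec P σ A ν C) {M : Mdl S}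
    {w w' : ℕ → M} (hσ : ∀ i, vev w (σ i) = vev w' (σ i)) (hν : ∀ x ∈ ν, w x = w' x) :
    Sat w C ↔ Sat w' C := by
  induction h with
  | skip => simp [Sat]
  | agent => simp [Sat]
  | par _ _ h1 h2 =>
    rw [sat_union, sat_union, h1 hσ fun x hx => hν x (List.mem_append_left _ hx),
      h2 hσ fun x hx => hν x (List.mem_append_right _ hx)]
  | @loc n c P σ A ν C τ h _ ih =>
    have hσ' : ∀ i, vev w (ext (τ.map Val.var) σ i) = vev w' (ext (τ.map Val.var) σ i) := by
      intro i
      by_cases hi : i < τ.length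
      · rw [ext_lt _ _ (by simpa using hi), List.getElem_map, vev_var, vev_var]
        exact hν _ (List.mem_append_left _ (List.getElem_mem hi))
      · rw [ext_ge _ _ (by simpa using hi)]; exact hσ _
    rw [sat_insert, sat_insert, ih hσ' fun x hx => hν x (List.mem_append_right _ hx),
      realize_substC, realize_substC]
    simp only [hσ']

/-- Coherence gives values to the private names one declaration at a time, under the store that
includes the constraints of the enclosing declarations. The names outside of `ν` keep their values.
-/
theorem coh_sat {P : UProc S} {σ : Sub S} {A ν C} (h : Dec P σ A ν C) {s : Store S} (hs : Coh P s)
    (hν : ν.Nodup) (hσ : ∀ i x, σ i = .var x → x ∉ ν) {M : Mdl S} (w : ℕ → M)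
    (hw : s M (fun i => vev w (σ i))) : ∃ w' : ℕ → M, (∀ x ∉ ν, w' x = w x) ∧ Sat w' C := by
  have agree : ∀ {ν : List ℕ} {σ : Sub S} {w w' : ℕ → M}, (∀ i x, σ i = .var x → x ∉ ν) →
      (∀ x ∉ ν, w' x = w x) → ∀ i, vev w' (σ i) = vev w (σ i) := by
    intro ν σ w w' h1 h2 i
    cases hi : σ i with
    | var x => exact h2 x (h1 i x hi)
    | const c => exact congrArg (Structure.funMap (L := Lg S) _) (funext fun i => i.elim0)
    | label c => exact congrArg (Structure.funMap (L := Lg S) _) (funext fun i => i.elim0)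
  induction h generalizing s w with
  | skip => exact ⟨w, fun _ _ => rfl, by simp [Sat]⟩
  | agent => exact ⟨w, fun _ _ => rfl, by simp [Sat]⟩
  | @par P Q σ A B ν μ C D hd1 hd2 h1 h2 =>
    rw [List.nodup_append'] at hν
    have hσ1 : ∀ i x, σ i = .var x → x ∉ ν := fun i x hi hx =>
      hσ i x hi (List.mem_append_left _ hx)
    have hσ2 : ∀ i x, σ i = .var x → x ∉ μ := fun i x hi hx =>
      hσ i x hi (List.mem_append_right _ hx)
    obtain ⟨w1, h3, h4⟩ := h1 hs.1 hν.1 hσ1 w hw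
    obtain ⟨w2, h5, h6⟩ := h2 hs.2 hν.2.1 hσ2 w hw
    -- The two valuations are glued; this is possible because the private names of the two sides are
    -- disjoint.
    refine ⟨fun x => if x ∈ ν then w1 x else w2 x, fun x hx => ?_, ?_⟩
    · rw [List.mem_append, not_or] at hx
      simp [hx.1, h5 x hx.2]
    · have hv : ∀ i, vev (fun x => if x ∈ ν then w1 x else w2 x) (σ i) = vev w (σ i) :=
        agree hσ fun x hx => by
          rw [List.mem_append, not_or] at hx
          simp [hx.1, h5 x hx.2]
      rw [sat_union]
      constructor
      · refine (dec_sat_congr hd1 (fun i => ?_) fun x hx => ?_).1 h4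
        · rw [hv]; exact agree hσ1 h3 i
        · simp [hx]
      · refine (dec_sat_congr hd2 (fun i => ?_) fun x hx => ?_).1 h6
        · rw [hv]; exact agree hσ2 h5 i
        · simp [show x ∉ ν from fun h => hν.2.2 h hx]
  | @loc n c P σ A ν C τ hτ hd ih =>
    subst hτ
    rw [List.nodup_append'] at hν
    obtain ⟨x, hx⟩ := hs.1 M _ hw
    classical
    let w1 : ℕ → M := fun y => if h : y ∈ τ then x ⟨τ.idxOf y, List.idxOf_lt_length_iff.2 h⟩ else w y
    have hw1 : ∀ i, vev w1 (σ i) = vev w (σ i) := agree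
      (fun i x hi hx => hσ i x hi (List.mem_append_left _ hx)) fun y hy => by simp [w1, hy]
    have e : (fun i => vev w1 (ext (τ.map Val.var) σ i)) = extV x (fun i => vev w (σ i)) := by
      funext i
      by_cases hi : i < τ.length
      · rw [ext_lt _ _ (by simpa using hi), List.getElem_map, vev_var]
        simp only [w1, List.getElem_mem, dif_pos, extV, hi]
        congr 2
        exact hν.1.idxOf_getElem i hi
      · rw [ext_ge _ _ (by simpa using hi), hw1]
        simp [extV, hi]
    have hσ' : ∀ i y, ext (τ.map Val.var) σ i = .var y → y ∉ ν := by
      intro i y hy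
      by_cases hi : i < τ.length
      · rw [ext_lt _ _ (by simpa using hi), List.getElem_map] at hy
        obtain rfl : τ[i] = y := by simpa using hy
        exact fun h => hν.2.2 (List.getElem_mem hi) h
      · rw [ext_ge _ _ (by simpa using hi)] at hy
        exact fun h => hσ _ y hy (List.mem_append_right _ h)
    obtain ⟨w2, h1, h2⟩ := ih hs.2 hν.2.1 hσ' w1 (by
      rw [e]
      refine ⟨hx, ?_⟩
      rw [extV_shift']
      exact hw)
    refine ⟨w2, fun y hy => ?_, ?_⟩
    · rw [List.mem_append, not_or] at hy
      rw [h1 y hy.2]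
      simp [w1, hy.1]
    · rw [sat_insert, realize_substC]
      refine ⟨?_, h2⟩
      have e2 : (fun i => vev w2 (ext (τ.map Val.var) σ i)) =
          (fun i => vev w1 (ext (τ.map Val.var) σ i)) := funext (agree hσ' h1)
      rw [e2, e]
      exact hx

/-! ### Transitions of agents -/

/-- `Fire T a Q e`: in the store `T`, the agent `a` becomes `Q` and tells `e`. -/
inductive Fire (T : Set (Constr S)) : UProc S → UProc S → Set (Constr S) → Prop
  | tell (c) : Fire T (.tell c) .skip {c}
  | unl {c P} : SEnt T c → Fire T (.unl c P) .skip ∅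
  | bang {P} : Fire T (.bang P) (.par P (.next (.bang P))) ∅
  | abs {n c ex P} (t : Fin n → Val S) : SEnt T (substC (instS t) c) → t ∉ ex →
      Fire T (.abs n c ex P) (.par (P.subst (instS t)) (.abs n c (t :: ex) P)) ∅

theorem Fire.mono {T T' : Set (Constr S)} {a Q : UProc S} {e} (h : Fire T a Q e)
    (hT : ∀ g, SEnt T g → SEnt T' g) : Fire T' a Q e := by
  cases h with
  | tell c => exact .tell c
  | unl h => exact .unl (hT _ h)
  | bang => exact .bang
  | abs t h h' => exact .abs t (hT _ h) h'

theorem Fire.ag {T : Set (Constr S)} {a a' Q : UProc S} {e} (h : Fire T a Q e) (ha : Ag a a') :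
    ∃ Q', Fire T a' Q' e ∧ Cg Q Q' := by
  cases h with
  | tell c => cases ha; exact ⟨_, .tell c, .refl _⟩
  | unl h => cases ha; exact ⟨_, .unl h, .refl _⟩
  | bang => cases ha with | bang h => exact ⟨_, .bang, .par h (.next (.bang h))⟩
  | abs t h h' => cases ha with
    | abs h1 h2 =>
      refine ⟨_, .abs t h (fun h => h' ((h1 t).2 h)), .par (h2.subst _) (.abs (fun s => ?_) h2)⟩
      simp [h1]

theorem Fire.good {T : Set (Constr S)} {a Q : UProc S} {e} (h : Fire T a Q e) (ha : Good true a) :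
    Good true Q ∧ ∀ c ∈ e, TellOK c := by
  cases h with
  | tell c => exact ⟨trivial, fun d hd => hd ▸ ha⟩
  | unl h => exact ⟨trivial, by simp⟩
  | bang => exact ⟨⟨ha, ha⟩, by simp⟩
  | abs t h h' => exact ⟨⟨ha.2.subst _, ha⟩, by simp⟩

/-! ### Simulation of transitions by transitions of agents -/

/-- The map of names that sends the innermost names to `τ` and the others by `s`. -/
def extN (τ : List ℕ) (s : ℕ → ℕ) : ℕ → ℕ := fun i => (τ[i]?).getD (s (i - τ.length))

theorem ext_ren (τ : List ℕ) (s : ℕ → ℕ) :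
    ext (τ.map Val.var) (ren S s) = ren S (extN τ s) := by
  funext i
  by_cases h : i < τ.length <;> simp [ext, ren, extN, h]

/-- Fresh names are odd and outside of `F`, whereas the values of `s` are even or in `F`. -/
theorem extN_injective {τ : List ℕ} {s : ℕ → ℕ} {F : Finset ℕ} (hs : Function.Injective s)
    (hF : ∀ i, s i % 2 = 0 ∨ s i ∈ F) (hτ : Fresh F τ) : Function.Injective (extN τ s) := by
  have key : ∀ i < τ.length, ∀ j, τ[i]? ≠ some (s j) := by
    intro i hi j h
    rw [List.getElem?_eq_getElem hi, Option.some.injEq] at h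
    have h1 := hτ.2 _ (List.getElem_mem hi)
    rcases hF j with h2 | h2
    · rw [← h] at h2; omega
    · exact h1.2 (h ▸ h2)
  have lt : ∀ {i}, i < τ.length → τ[i]? = some (extN τ s i) := fun {i} hi => by simp [extN, hi]
  have ge : ∀ {i}, ¬ i < τ.length → extN τ s i = s (i - τ.length) := fun {i} hi => by
    simp [extN, List.getElem?_eq_none (not_lt.1 hi)]
  intro i j h
  by_cases hi : i < τ.length <;> by_cases hj : j < τ.length
  · have := (lt hi).trans ((congrArg some h).trans (lt hj).symm)
    rw [List.getElem?_eq_getElem hi, List.getElem?_eq_getElem hj, Option.some.injEq] at this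
    exact hτ.1.getElem_inj_iff.1 this
  · exact absurd ((lt hi).trans (by rw [h, ge hj])) (key i hi (j - τ.length))
  · exact absurd ((lt hj).trans (by rw [← h, ge hi])) (key j hj (i - τ.length))
  · have := hs ((ge hi).symm.trans (h.trans (ge hj)))
    omega

theorem extN_mem {τ : List ℕ} {s : ℕ → ℕ} {F : Finset ℕ} 
    (hF : ∀ i, s i % 2 = 0 ∨ s i ∈ F) (i : ℕ) :
    extN τ s i % 2 = 0 ∨ extN τ s i ∈ F ∪ τ.toFinset := by
  by_cases hi : i < τ.length
  · right
    simp [extN, hi]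
  · simp only [extN, List.getElem?_eq_none (not_lt.1 hi), Option.getD_none]
    exact (hF _).imp_right fun h => Finset.mem_union_left _ h

theorem Val.subst_ren_injective {s : ℕ → ℕ} (hs : Function.Injective s) :
    Function.Injective (Val.subst (ren S s)) := by
  intro a b h
  cases a <;> cases b <;> simp [Val.subst, ren] at h
  · exact congrArg Val.var (hs h)
  · rw [h]
  · rw [h]

theorem map_subst_mem {n : ℕ} {ex : List (Fin n → Val S)} {t : Fin n → Val S} {s : ℕ → ℕ}
    (hs : Function.Injective s) :
    (fun i => (t i).subst (ren S s)) ∈ ex.map (fun t i => (t i).subst (ren S s)) ↔ t ∈ ex := by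
  rw [List.mem_map]
  constructor
  · rintro ⟨t', h, h'⟩
    have : t' = t := funext fun i => Val.subst_ren_injective hs (congrFun h' i)
    exact this ▸ h
  · intro h
    exact ⟨t, h, rfl⟩

/-! ### Invariants of internal transitions -/

theorem step_good {P P' : UProc S} {d d'} (h : UProc.Step P d P' d') (hP : Good false P) :
    Good false P' := by
  induction h with
  | tell => trivial
  | par _ ih => exact ⟨ih hP.1, hP.2⟩
  | unl => trivial
  | loc _ ih => exact ⟨by simp, ih hP.2⟩
  | abs t => exact ⟨(hP.2.weaken _).subst _, hP⟩
  | bang => exact ⟨Good.weaken hP _, hP⟩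
  | str h1 _ h2 _ _ ih => exact (good_cg (.of_SC h2) _).1 (ih ((good_cg (.of_SC h1) _).2 hP))

theorem step_mono {P P' : UProc S} {d d'} (h : UProc.Step P d P' d') : Entails d' d := by
  rw [entails_iff]
  induction h with
  | tell c d => intro M w h; exact (Formula.realize_inf.1 h).1
  | par _ ih => exact ih
  | unl => exact fun _ _ h => h
  | loc _ ih => intro M w h; exact (Formula.realize_inf.1 h).1
  | abs t => exact fun _ _ h => h
  | bang => exact fun _ _ h => h
  | str _ h1 _ h2 _ ih =>
    intro M w h
    exact (entails_iff _ _).1 h1.1 M w (ih M w ((entails_iff _ _).1 h2.2 M w h))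

theorem realize_shift {M : Type*} [(Lg S).Structure M] (w : ℕ → M) (n : ℕ) (c : Constr S) :
    Formula.Realize (substC (shiftS S n) c) w ↔ Formula.Realize c (fun i => w (i + n)) :=
  realize_substC w _ c

/-- After a transition below a declaration the outer store receives the existential closure of the
new local constraint, so the condition holds by construction. Processes released by abstractions and
replications were guarded, so their local constraints are valid. -/
theorem step_coh {P P' : UProc S} {d d'} (h : UProc.Step P d P' d') (hP : Good false P)
    (hC : Coh P (stC d)) : Coh P' (stC d') := by
  induction h with
  | tell => trivial
  | par h ih => exact ⟨ih hP.1 hC.1, hC.2.mono ((entails_iff _ _).1 (step_mono h))⟩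
  | unl => trivial
  | @loc n c c' P P' d h ih =>
    refine ⟨fun M w hw => ?_, ?_⟩
    · exact (realize_exC w n c').1 (Formula.realize_inf.1 hw).2
    · refine (ih hP.2 (hC.2.mono fun M w hw => ?_)).mono fun M w hw => ?_
      · simp only [stC, Formula.realize_inf, realize_shift] at hw ⊢
        exact hw
      · simp only [stC, Formula.realize_inf, realize_shift] at hw ⊢
        exact ⟨hw.1, hw.2.1⟩
  | abs t => exact ⟨(hP.2.subst _).coh _, trivial⟩
  | bang => exact ⟨Good.coh hP _, trivial⟩
  | str h1 h3 h2 h4 _ ih =>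
    have := ih ((good_cg (.of_SC h1) _).2 hP) (((coh_SC h1 _).2 hC).mono fun M w h =>
      (entails_iff _ _).1 h3.1 M w h)
    exact ((coh_SC h2 _).1 this).mono fun M w h => (entails_iff _ _).1 h4.2 M w h

theorem sent_subst_singleton {c d : Constr S} (h : Entails c d) (σ : Sub S) :
    SEnt {substC σ c} (substC σ d) := by
  have := ((entails_iff_sent c d).1 h).subst σ
  rwa [Set.image_singleton] at this

theorem sent_insert_subst {c d : Constr S} (h : Entails c d) (σ : Sub S) (C : Set (Constr S)) :
    SEnt (insert (substC σ c) C) (substC σ d) :=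
  (sent_subst_singleton h σ).mono (by simp)

theorem sat_valid {C : Set (Constr S)} (h : ∀ c ∈ C, Valid c) {M : Mdl S} (w : ℕ → M) : Sat w C :=
  fun c hc => h c hc M w

theorem cequiv_realize {c d : Constr S} (h : CEquiv c d) {M : Mdl S} (w : ℕ → M) :
    Formula.Realize c w ↔ Formula.Realize d w :=
  ⟨(entails_iff _ _).1 h.1 M w, (entails_iff _ _).1 h.2 M w⟩

theorem realize_exC_of_extN {n : ℕ} {τ : List ℕ} {s : ℕ → ℕ} {c : Constr S} (hτ : τ.length = n)
    {M : Type*} [(Lg S).Structure M] (w : ℕ → M)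
    (h : Formula.Realize (substC (ren S (extN τ s)) c) w) :
    Formula.Realize (substC (ren S s) (exC n c)) w := by
  subst hτ
  rw [realize_substC] at h ⊢
  rw [realize_exC]
  refine ⟨fun i => w τ[i], ?_⟩
  convert h using 1
  funext i
  by_cases hi : i < τ.length <;> simp [extN, hi, vev_var, ren]

theorem loc_store_iff {c c' d x C C' e : Prop} (h : (c' ∧ d) ∧ C' ↔ ((c ∧ d) ∧ C) ∧ e)
    (h' : c' → x) : (d ∧ x) ∧ c' ∧ C' ↔ (d ∧ c ∧ C) ∧ e := by tauto

/-- `P'` with the store `d'` decomposes into the agents `A0` and the agents of `Q`, with the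
constraints `T`.  The names `ν` are kept, those of `Q` are chosen freely. -/
def Follows (s : ℕ → ℕ) (F : Finset ℕ) (ν : List ℕ) (P' : UProc S) (d' : Constr S)
    (A0 : Multiset (UProc S)) (Q : UProc S) (T : Set (Constr S)) : Prop :=
  ∃ W : Finset ℕ, (∀ x ∈ W, x % 4 = 3) ∧ ∀ B μ D, Dec Q Val.var B μ D →
    Fresh (F ∪ ν.toFinset ∪ W) μ → ∃ A' ν' C', Dec P' (ren S s) A' ν' C' ∧ Fresh F ν' ∧
      (∀ x ∈ ν', x ∈ ν ∨ x ∈ μ ∨ x % 4 = 3) ∧ MAg (B + A0) A' ∧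
      SEqv (insert (substC (ren S s) d') C') T

theorem Fresh.append_of {F : Finset ℕ} {ν μ : List ℕ} {W : Finset ℕ} (hν : Fresh F ν)
    (hμ : Fresh (F ∪ ν.toFinset ∪ W) μ) : Fresh F (μ ++ ν) :=
  (fresh_perm List.perm_append_comm).1
    (fresh_append.2 ⟨hν, hμ.mono Finset.subset_union_left⟩)

theorem Follows.congr {s : ℕ → ℕ} {F : Finset ℕ} {ν ν₁ : List ℕ} {P P' : UProc S}
    {d d' : Constr S} {A0 A1 : Multiset (UProc S)} {Q Q' : UProc S} {T T' : Set (Constr S)}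
    (h : Follows s F ν P d A0 Q T) (hP : Cg P P') (hd : CEquiv d d') (hA : MAg A1 A0)
    (hQ : Cg Q' Q) (hT : SEqv T T') (hν : ∀ x ∈ ν, x ∈ ν₁ ∨ x % 4 = 3) :
    Follows s F ν₁ P' d' A1 Q' T' := by
  obtain ⟨W, hW, h⟩ := h
  -- A name of `ν` that is missing in `ν₁` is of the spare class; adding these to `W` keeps the
  -- names chosen for the new process away from all of `ν`.
  refine ⟨W ∪ ν.toFinset.filter fun x => x % 4 = 3, by grind, fun B μ D hB hμ => ?_⟩
  obtain ⟨B', μ', D', h1, h2, h3, h4, h5⟩ := (decSim_of_cg hQ).1 _ _ _ _ _ hB hμ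
  obtain ⟨A', ν', C', h6, h7, h8, h9, h10⟩ := h _ _ _ h1 (h2.mono (by
    intro x hx
    simp only [Finset.mem_union, List.mem_toFinset, Finset.mem_filter] at hx ⊢
    grind))
  obtain ⟨A'', ν'', C'', h11, h12, h13, h14, h15⟩ := (decSim_of_cg hP).1 _ _ _ _ _ h6 h7
  refine ⟨A'', ν'', C'', h11, h12, by grind, ?_, ?_⟩
  · exact MAg.trans (Multiset.Rel.add h4 hA) (MAg.trans h9 h14)
  · intro M w
    have := (h10.trans hT) M w
    simp only [sat_insert, ← h15 M w, realize_substC, cequiv_realize hd] at this ⊢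
    exact this

/-- Every derivation of a transition contains one axiom, and the agent of this axiom is what moves.
The contextual rules only enlarge the store it sees: that store amounts to the outer store together
with all local constraints. Uses of congruence are absorbed by `decSim_of_cg`. -/
theorem step_sim {P P' : UProc S} {d d'} (h : UProc.Step P d P' d') (hP : Good false P)
    {s : ℕ → ℕ} (hs : Function.Injective s) {F : Finset ℕ} (hF : ∀ i, s i % 2 = 0 ∨ s i ∈ F)
    {A ν C} (hd : Dec P (ren S s) A ν C) (hν : Fresh F ν) :
    ∃ a A0 Q e, A = a ::ₘ A0 ∧ Fire (insert (substC (ren S s) d) C) a Q e ∧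
      Follows s F ν P' d' A0 Q (insert (substC (ren S s) d) C ∪ e) := by
  induction h generalizing s F A ν C with
  | tell c d =>
    obtain ⟨rfl, rfl, rfl⟩ := (dec_agent_iff (by trivial)).1 hd
    refine ⟨_, 0, _, _, rfl, .tell _, ∅, by simp, fun B μ D hB hμ => ?_⟩
    obtain ⟨rfl, rfl, rfl⟩ := dec_skip_iff.1 hB
    refine ⟨0, [], ∅, .skip _, hν, by simp, .zero, fun M w => ?_⟩
    rw [substC_inf, sat_union, sat_insert, sat_insert, Formula.realize_inf, sat_singleton]
    simp [sat_empty]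
  | @par P Q P' c d _ ih =>
    obtain ⟨A1, A2, ν1, ν2, C1, C2, h1, h2, rfl, rfl, rfl⟩ := dec_par_iff.1 hd
    rw [fresh_perm List.perm_append_comm, fresh_append] at hν
    obtain ⟨a, A0, R, e, rfl, h3, W, hW, h4⟩ :=
      ih hP.1 hs (fun i => (hF i).imp_right fun h => Finset.mem_union_left _ h) h1 hν.2
    refine ⟨a, A0 + A2, R, e, by simp, ?_, W, hW, fun B μ D hB hμ => ?_⟩
    · exact h3.mono fun g hg => hg.mono (Set.insert_subset_insert Set.subset_union_left)
    obtain ⟨A', ν', C', h6, h7, n1, h8, h9⟩ := h4 B μ D hB (hμ.mono (by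
      intro x hx
      simp only [Finset.mem_union, List.mem_toFinset, List.mem_append] at hx ⊢
      tauto))
    refine ⟨A' + A2, ν' ++ ν2, C' ∪ C2, .par h6 h2, ?_, by grind, ?_, ?_⟩
    · rw [fresh_perm List.perm_append_comm, fresh_append]; exact ⟨hν.1, h7⟩
    · rw [← add_assoc]; exact Multiset.Rel.add h8 (MAg.refl h2.isAgent)
    · intro M w
      have := h9 M w
      simp only [sat_union, sat_insert] at this ⊢
      tauto
  | @unl c P d h =>
    obtain ⟨rfl, rfl, rfl⟩ := (dec_agent_iff (by trivial)).1 hd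
    refine ⟨_, 0, _, _, rfl, .unl (sent_insert_subst h _ _), ∅, by simp, fun B μ D hB hμ => ?_⟩
    obtain ⟨rfl, rfl, rfl⟩ := dec_skip_iff.1 hB
    refine ⟨0, [], ∅, .skip _, hν, by simp, .zero, fun M w => ?_⟩
    rw [Set.union_empty]
  | @loc n c c' P P' d _ ih =>
    obtain ⟨τ, ν1, C1, h1, h2, rfl, rfl⟩ := dec_loc_iff.1 hd
    rw [fresh_append] at hν
    rw [ext_ren] at h2 hd ⊢
    obtain ⟨a, A0, R, e, rfl, h3, W, hW, h4⟩ :=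
      ih hP.2 (extN_injective hs hF hν.1) (extN_mem hF) h2 hν.2
    have e1 : cmp (shiftS S n) (ren S (extN τ s)) = ren S s := by
      rw [← ext_ren, cmp_shiftS_ext _ _ _ (by simpa using h1)]
    refine ⟨a, A0, R, e, rfl, ?_, W, hW, fun B μ D hB hμ => ?_⟩
    · refine h3.mono fun g hg => SEqv.sent (fun M w => ?_) hg
      rw [substC_inf, substC_substC, e1]
      simp only [sat_insert, Formula.realize_inf]
      tauto
    obtain ⟨A', ν', C', h6, h7, n1, h8, h9⟩ := h4 B μ D hB (hμ.mono (by
      intro x hx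
      simp only [Finset.mem_union, List.mem_toFinset, List.mem_append] at hx ⊢
      tauto))
    rw [← ext_ren] at h6
    refine ⟨A', _, _, .loc τ h1 h6, fresh_append.2 ⟨hν.1, h7⟩, by grind, h8, ?_⟩
    intro M w
    have := h9 M w
    rw [substC_inf, substC_inf, substC_substC, e1] at this
    rw [substC_inf, ext_ren]
    simp only [sat_union, sat_insert, Formula.realize_inf] at this ⊢
    -- The outer store gains the existential closure of `c'`, which adds nothing beside `c'` itself.
    exact loc_store_iff this (realize_exC_of_extN h1 w)
  | @abs n c ex P d t h h' =>
    obtain ⟨rfl, rfl, rfl⟩ := (dec_agent_iff (by trivial)).1 hd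
    have hg : Good true (.par (P.subst (instS t)) (.abs n c (t :: ex) P)) := ⟨hP.2.subst _, hP⟩
    refine ⟨_, 0, UProc.subst (ren S s) (.par (P.subst (instS t)) (.abs n c (t :: ex) P)), ∅, rfl,
      ?_, ∅, by simp, fun B μ D hB hμ => ?_⟩
    · have := Fire.abs (T := insert (substC (ren S s) d) ∅) (c := substC (upS n (ren S s)) c)
        (ex := ex.map fun t i => (t i).subst (ren S s)) (P := P.subst (upS n (ren S s)))
        (fun i => (t i).subst (ren S s)) ?_ ?_
      · simpa only [UProc.subst, UProc.subst_subst, cmp_instS, List.map_cons] using this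
      · rw [substC_substC, ← cmp_instS, ← substC_substC]
        exact sent_insert_subst h _ _
      -- An injective renaming identifies no new tuple with an excluded one.
      · rwa [map_subst_mem hs]
    · rw [dec_subst, cmp_var] at hB
      refine ⟨B, μ, D, hB, ?_, by grind, ?_, ?_⟩
      · exact hμ.mono (by grind)
      · rw [add_zero]; exact MAg.refl hB.isAgent
      · intro M w
        simp [sat_insert, sat_valid ((hB.good hg).2 rfl), sat_singleton]
  | @bang P d =>
    obtain ⟨rfl, rfl, rfl⟩ := (dec_agent_iff (by trivial)).1 hd
    have hg : Good true (.par P (.next (.bang P))) := ⟨hP, hP⟩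
    refine ⟨_, 0, UProc.subst (ren S s) (.par P (.next (.bang P))), ∅, rfl, .bang,
      ∅, by simp, fun B μ D hB hμ => ?_⟩
    rw [dec_subst, cmp_var] at hB
    refine ⟨B, μ, D, hB, hμ.mono (by grind), by grind, ?_, ?_⟩
    · rw [add_zero]; exact MAg.refl hB.isAgent
    · intro M w
      simp [sat_insert, sat_valid ((hB.good hg).2 rfl), sat_singleton]
  | @str P₁ c₁ P₂ c₂ P₁' c₁' P₂' c₂' h1 h2 h3 h4 _ ih =>
    obtain ⟨A1, ν1, C1, h5, h6, n1, h7, h8⟩ := (decSim_of_cg (.of_SC h1)).2 _ _ _ _ _ hd hν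
    obtain ⟨a, A0, Q, e, rfl, h9, h10⟩ := ih ((good_cg (.of_SC h1) _).2 hP) hs hF h5 h6
    obtain ⟨a', A0', ha, hA, rfl⟩ := Multiset.rel_cons_right.1 h7
    have hT : SEqv (insert (substC (ren S s) c₁) C1) (insert (substC (ren S s) c₁') C) := by
      intro M w
      rw [sat_insert, sat_insert, h8 M w, realize_substC, realize_substC, cequiv_realize h2]
    obtain ⟨Q', h16, h17⟩ := (h9.mono fun g => hT.sent).ag ha.symm
    exact ⟨a', A0', Q', e, rfl, h16, h10.congr (.of_SC h3) h4 hA h17.symm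
      (sat_congr_union hT (.refl _)) n1⟩

/-! ### Progress -/

/-- Nested local declarations. -/
def wrap (ws : List (ℕ × Constr S)) (X : UProc S) : UProc S :=
  ws.foldr (fun x P => .loc x.1 x.2 P) X

/-- The store inside of nested local declarations. -/
def inner : List (ℕ × Constr S) → Constr S → Constr S
  | [], d => d
  | x :: ws, d => inner ws (x.2 ⊓ substC (shiftS S x.1) d)

theorem wrap_par (ws : List (ℕ × Constr S)) (X : UProc S) :
    ∃ N, ∀ R, UProc.SC (.par R (wrap ws X)) (wrap ws (.par (R.subst (shiftS S N)) X)) := by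
  induction ws with
  | nil => exact ⟨0, fun R => by rw [shiftS_zero, UProc.subst_id]; exact .refl _⟩
  | cons x ws ih =>
    obtain ⟨N, h⟩ := ih
    refine ⟨x.1 + N, fun R => (UProc.SC.par_loc _ _ _ _).trans (.loc ?_)⟩
    rw [← cmp_shiftS_shiftS, ← UProc.subst_subst]
    exact h _

theorem wrap_congr (ws : List (ℕ × Constr S)) {X Y : UProc S} (h : UProc.SC X Y) :
    UProc.SC (wrap ws X) (wrap ws Y) := by
  induction ws with
  | nil => exact h
  | cons x ws ih => exact .loc ih

theorem wrap_append (ws ws' : List (ℕ × Constr S)) (X : UProc S) :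
    wrap (ws ++ ws') X = wrap ws (wrap ws' X) := by simp [wrap]

theorem prod_append_SC (A B : List (UProc S)) :
    UProc.SC (.par (UProc.prod A) (UProc.prod B)) (UProc.prod (A ++ B)) := by
  induction A with
  | nil => exact (UProc.SC.par_comm _ _).trans (.par_skip _)
  | cons a A ih => exact (UProc.SC.par_assoc _ _ _).symm.trans (.par (.refl _) ih)

theorem prod_subst (A : List (UProc S)) (σ : Sub S) :
    (UProc.prod A).subst σ = UProc.prod (A.map (UProc.subst σ)) := by
  induction A with
  | nil => rfl
  | cons a A ih => exact congrArg (UProc.par _) ih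

theorem exists_wrap_agent {a : UProc S} (h : IsAgent a) (ρ : Sub S) : ∃ ws A,
    (∀ a ∈ A, IsAgent a) ∧ UProc.SC (a.subst ρ) (wrap ws (UProc.prod A)) :=
  ⟨[], [a.subst ρ], by simpa using h.subst ρ, (UProc.SC.par_skip _).symm⟩

/-- Prenex form: scope extrusion brings all declarations to the front, which exposes every agent to
the transition rules. -/
theorem exists_wrap (P : UProc S) (ρ : Sub S) : ∃ ws A, (∀ a ∈ A, IsAgent a) ∧
    UProc.SC (P.subst ρ) (wrap ws (UProc.prod A)) := by
  induction P generalizing ρ with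
  | skip => exact ⟨[], [], by simp, .refl _⟩
  | par P Q h1 h2 =>
    obtain ⟨ws1, A1, h3, h4⟩ := h1 ρ
    obtain ⟨N, hN⟩ := wrap_par ws1 (UProc.prod A1)
    obtain ⟨ws2, A2, h5, h6⟩ := h2 (cmp ρ (shiftS S N))
    obtain ⟨N', hN'⟩ := wrap_par ws2 (UProc.prod A2)
    refine ⟨ws1 ++ ws2, A1.map (UProc.subst (shiftS S N')) ++ A2, ?_, ?_⟩
    · intro a ha
      rcases List.mem_append.1 ha with h | h
      · obtain ⟨b, hb, rfl⟩ := List.mem_map.1 h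
        exact (h3 b hb).subst _
      · exact h5 a h
    · refine (UProc.SC.par h4 (.refl _)).trans ((UProc.SC.par_comm _ _).trans ((hN _).trans ?_))
      rw [wrap_append, UProc.subst_subst]
      refine wrap_congr ws1 ((UProc.SC.par h6 (.refl _)).trans ((UProc.SC.par_comm _ _).trans ?_))
      refine (hN' _).trans (wrap_congr ws2 ?_)
      rw [prod_subst]
      exact prod_append_SC _ _
  | loc n c P ih =>
    obtain ⟨ws, A, h1, h2⟩ := ih (upS n ρ)
    exact ⟨(n, substC (upS n ρ) c) :: ws, A, h1, .loc h2⟩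
  | tell c => exact exists_wrap_agent (by trivial) ρ
  | abs => exact exists_wrap_agent (by trivial) ρ
  | next => exact exists_wrap_agent (by trivial) ρ
  | unl => exact exists_wrap_agent (by trivial) ρ
  | bang => exact exists_wrap_agent (by trivial) ρ

theorem cequiv_of {c d : Constr S}
    (h : ∀ (M : Mdl S) (w : ℕ → M), Formula.Realize c w ↔ Formula.Realize d w) : CEquiv c d :=
  ⟨(entails_iff _ _).2 fun M w => (h M w).1, (entails_iff _ _).2 fun M w => (h M w).2⟩

theorem CEquiv.rfl' (c : Constr S) : CEquiv c c := cequiv_of fun _ _ => Iff.rfl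

/-- A transition below the prefix of declarations lifts through it. The names of the prefix stay
fixed and only those of the matrix change, so decompositions before and after remain aligned. -/
theorem wrap_sim {ws : List (ℕ × Constr S)} {X : UProc S} {s : ℕ → ℕ} (hs : Function.Injective s)
    {F : Finset ℕ} (hF : ∀ i, s i % 2 = 0 ∨ s i ∈ F) {A ν C} (hd : Dec (wrap ws X) (ren S s) A ν C)
    (hν : Fresh F ν) (d : Constr S) : ∃ (s' : ℕ → ℕ) (F' : Finset ℕ) (ν1 ν' : List ℕ)
      (C' : Set (Constr S)), ν = ν1 ++ ν' ∧ Function.Injective s' ∧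
      (∀ i, s' i % 2 = 0 ∨ s' i ∈ F') ∧ Dec X (ren S s') A ν' C' ∧
      SEqv (insert (substC (ren S s) d) C) (insert (substC (ren S s') (inner ws d)) C') ∧
      ∀ X' e, UProc.Step X (inner ws d) X' e → ∃ P' d', UProc.Step (wrap ws X) d P' d' ∧
        ∀ A' μ D, Dec X' (ren S s') A' μ D → ∃ C3, Dec P' (ren S s) A' (ν1 ++ μ) C3 ∧
          SEqv (insert (substC (ren S s) d') C3) (insert (substC (ren S s') e) D) := by
  induction ws generalizing s F ν C d with
  | nil =>
    exact ⟨s, F, [], ν, C, rfl, hs, hF, hd, .refl _, fun X' e h => ⟨X', e, h, fun A' μ D h =>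
      ⟨D, h, .refl _⟩⟩⟩
  | cons x ws ih =>
    obtain ⟨τ, ν1, C1, h1, h2, rfl, rfl⟩ := dec_loc_iff.1 hd
    rw [fresh_append] at hν
    rw [ext_ren] at h2 ⊢
    obtain ⟨s', F', ν1, ν', C', rfl, h3, h4, h5, h6, h7⟩ := ih (extN_injective hs hF hν.1)
      (extN_mem hF) h2 hν.2 (x.2 ⊓ substC (shiftS S x.1) d)
    have e1 : cmp (shiftS S x.1) (ren S (extN τ s)) = ren S s := by
      rw [← ext_ren, cmp_shiftS_ext _ _ _ (by simpa using h1)]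
    refine ⟨s', F', τ ++ ν1, ν', C', by simp, h3, h4, h5, SEqv.trans (fun M w => ?_) h6, ?_⟩
    · rw [substC_inf, substC_substC, e1]
      simp only [sat_insert, Formula.realize_inf]
      tauto
    · intro X' e h
      obtain ⟨P1, d1, h8, h9⟩ := h7 X' e h
      have h10 := (entails_iff _ _).1 (step_mono h8)
      -- The rule asks for a new store of the form `c' ⊓ d`. Stores only grow, so the whole inner
      -- store `d1` can serve as the new local constraint.
      refine ⟨_, _, .loc (c' := d1) (.str (.refl _) (CEquiv.rfl' _) (.refl _) ?_ h8), ?_⟩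
      · exact cequiv_of fun M w => ⟨fun h => Formula.realize_inf.2 ⟨h, (Formula.realize_inf.1
          (h10 M w h)).2⟩, fun h => (Formula.realize_inf.1 h).1⟩
      · intro A' μ D hD
        obtain ⟨C3, h11, h12⟩ := h9 A' μ D hD
        rw [← ext_ren] at h11
        refine ⟨_, by rw [List.append_assoc]; exact .loc τ h1 h11, fun M w => ?_⟩
        rw [← h12 M w, ext_ren]
        simp only [sat_insert, substC_inf, Formula.realize_inf]
        have h13 : Formula.Realize (substC (ren S (extN τ s)) d1) w →
            Formula.Realize (substC (ren S s) d) w := by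
          intro h
          rw [realize_substC] at h
          have := (Formula.realize_inf.1 (h10 M _ h)).2
          rw [realize_substC] at this
          rw [realize_substC, ← e1]
          convert this using 1
          funext i
          simp only [cmp, vev_subst]
        have h14 := realize_exC_of_extN (S := S) (s := s) (c := d1) h1 w
        tauto

theorem dec_prod {As : List (UProc S)} (h : ∀ a ∈ As, IsAgent a) {σ : Sub S} {A ν C}
    (hd : Dec (UProc.prod As) σ A ν C) : A = ↑(As.map (UProc.subst σ)) ∧ ν = [] ∧ C = ∅ := by
  induction As generalizing A ν C with
  | nil => obtain ⟨rfl, rfl, rfl⟩ := dec_skip_iff.1 hd; simp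
  | cons a As ih =>
    obtain ⟨A1, A2, ν1, ν2, C1, C2, h1, h2, rfl, rfl, rfl⟩ := dec_par_iff.1 hd
    obtain ⟨rfl, rfl, rfl⟩ := (dec_agent_iff (h a (by simp))).1 h1
    obtain ⟨rfl, rfl, rfl⟩ := ih (fun b hb => h b (by simp [hb])) h2
    simp

/-- Every valuation is induced along an injective renaming, so the renaming can be cancelled. -/
theorem entails_of_ren {s : ℕ → ℕ} (hs : Function.Injective s) {c g : Constr S}
    (h : SEnt {substC (ren S s) c} (substC (ren S s) g)) : Entails c g := by
  rw [entails_iff]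
  intro M w hw
  let w' : ℕ → M := fun i => w (Function.invFun s i)
  have e : (fun i => vev w' (ren S s i)) = w := by
    funext i
    simp only [ren, vev_var, w', Function.leftInverse_invFun hs i]
  have := h M w' (by
    intro d hd
    rw [Set.mem_singleton_iff] at hd
    subst hd
    rw [realize_substC, e]; exact hw)
  rwa [realize_substC, e] at this

/-- The ambient names and the private names in `F`. -/
def Nm (F : Finset ℕ) : Set ℕ := {i | i % 2 = 0 ∨ i ∈ F}

theorem prod_cons_SC {As : List (UProc S)} {a : UProc S} (ha : a ∈ As) :
    ∃ l1 l2, As = l1 ++ a :: l2 ∧ UProc.SC (.par a (UProc.prod (l1 ++ l2))) (UProc.prod As) := by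
  obtain ⟨l1, l2, rfl⟩ := List.append_of_mem ha
  refine ⟨l1, l2, rfl, ?_⟩
  have h1 : UProc.SC (.par a (UProc.par (UProc.prod l1) (UProc.prod l2)))
      (UProc.prod (l1 ++ a :: l2)) := by
    refine ((UProc.SC.par_assoc _ _ _).trans ?_).trans (prod_append_SC _ _)
    exact (UProc.SC.par (.par_comm _ _) (.refl _)).trans (UProc.SC.par_assoc _ _ _).symm
  exact (UProc.SC.par (.refl _) (prod_append_SC _ _).symm).trans h1

/-- A transition of an agent that is an instance of `a0` comes from a transition of `a0`. -/
theorem fire_agent {a0 : UProc S} {s : ℕ → ℕ} (hs : Function.Injective s) {F1 : Finset ℕ}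
    (hg : Good true a0) {d : Constr S} {L : Set (Constr S)}
    (hL : SEqv L {substC (ren S s) d}) (hL1 : ∀ c ∈ L, TellOK c)
    (hL2 : ∀ c ∈ L, SuppC (Nm F1) c) {Q : UProc S} {e} (hf : Fire L (a0.subst (ren S s)) Q e) :
    ∃ Q0 d0, UProc.Step a0 d Q0 d0 ∧ Q = Q0.subst (ren S s) ∧ Good true Q0 ∧
      SEqv {substC (ren S s) d0} (L ∪ e) := by
  cases a0 with
  | skip => cases hf
  | par => cases hf
  | loc => cases hf
  | next => cases hf
  | tell c =>
    cases hf
    refine ⟨_, _, .tell _ _, rfl, trivial, fun M w => ?_⟩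
    rw [sat_union, hL M w]
    simp only [sat_singleton, substC_inf, Formula.realize_inf]
  | bang => cases hf; exact ⟨_, _, .bang, rfl, ⟨hg, hg⟩, by rw [Set.union_empty]; exact hL.symm⟩
  | unl c P0 =>
    cases hf with
    | unl h => exact ⟨_, _, .unl (entails_of_ren hs (hL.sent h)), rfl, trivial, by
        rw [Set.union_empty]; exact hL.symm⟩
  | abs n c ex P0 =>
    cases hf with
    | abs t' h h' =>
      -- A name of the tuple outside the range of `s` occurs neither in the guard nor in the store.
      -- Replacing it by a fresh `y` would preserve the entailment, although by `guard_supp` the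
      -- tuple has only names of the store.
      have hsupp : ∀ i x, t' i = .var x → x ∈ Set.range s := by
        intro i x hx
        by_contra hxs
        obtain ⟨τ, hτ1, hτ2, -⟩ := exists_fresh F1 1 (.inl rfl)
        obtain ⟨y, rfl⟩ := List.length_eq_one_iff.1 hτ1
        have hy := hτ2.2 y (by simp)
        let θ : Sub S := fun i => if i = x then .var y else .var i
        have hθ : cmp (ren S s) θ = ren S s := by
          funext j
          have : s j ≠ x := fun h => hxs ⟨j, h⟩
          simp [cmp, ren, Val.subst, θ, this]
        have h10 := (hL.sent h).subst θ
        have e1 : substC θ (substC (instS t') (substC (upS n (ren S s)) c)) =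
            substC (instS fun i => (t' i).subst θ) (substC (upS n (ren S s)) c) := by
          rw [substC_substC (instS t') θ, cmp_instS, ← substC_substC,
            substC_substC (upS n (ren S s)) (upS n θ), cmp_upS_upS, hθ]
        rw [Set.image_singleton, substC_substC (ren S s) θ, hθ, e1] at h10
        have h11 := guard_supp hL1 hL2 (hg.1.subst _) _ (hL.symm.sent h10) i
        rw [hx] at h11
        have h12 : SuppV (Nm F1) (Val.var y : Val S) := by
          have : (Val.var x : Val S).subst θ = .var y := by simp [Val.subst, θ]
          rwa [this] at h11
        rcases suppV_var.1 h12 with h13 | h13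
        · omega
        · exact hy.2 h13
      have hex : ∀ i, ∃ v : Val S, v.subst (ren S s) = t' i := by
        intro i
        cases hi : t' i with
        | var x =>
          obtain ⟨j, rfl⟩ := hsupp i x hi
          exact ⟨.var j, rfl⟩
        | const c => exact ⟨.const c, rfl⟩
        | label c => exact ⟨.label c, rfl⟩
      choose t ht using hex
      obtain rfl : (fun i => (t i).subst (ren S s)) = t' := funext ht
      refine ⟨.par (P0.subst (instS t)) (.abs n c (t :: ex) P0), _, .abs t ?_ ?_, ?_,
        ⟨hg.2.subst _, hg⟩, ?_⟩
      · rw [substC_substC, ← cmp_instS, ← substC_substC] at h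
        exact entails_of_ren hs (hL.sent h)
      · exact fun h => h' ((map_subst_mem hs).2 h)
      · simp only [UProc.subst, UProc.subst_subst, cmp_instS, List.map_cons]
      · rw [Set.union_empty]; exact hL.symm

/-- Converse of `step_sim`: the process is brought into prenex form, the agent is moved to the front
of the matrix, and its transition is lifted through the prefix. -/
theorem fire_sim {P : UProc S} {d : Constr S} (hP : Good false P) {s : ℕ → ℕ}
    (hs : Function.Injective s) {F : Finset ℕ} (hF : ∀ i, s i % 2 = 0 ∨ s i ∈ F)
    {A ν C} (hd : Dec P (ren S s) A ν C) (hν : Fresh F ν) {L : Set (Constr S)}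
    (hL : SEqv L (insert (substC (ren S s) d) C)) (hL1 : ∀ c ∈ L, TellOK c) {F1 : Finset ℕ}
    (hL2 : ∀ c ∈ L, SuppC (Nm F1) c) {a Q : UProc S} {A1 : Multiset (UProc S)} {e}
    (hA : MAg (a ::ₘ A1) A) (hf : Fire L a Q e) :
    ∃ P' d', UProc.Step P d P' d' ∧ Follows s F ν P' d' A1 Q (L ∪ e) := by
  obtain ⟨ws, As, hAs, hsc⟩ := exists_wrap P Val.var
  rw [UProc.subst_id] at hsc
  obtain ⟨A', ν', C', h1, h2, n1, h3, h4⟩ := (decSim_of_cg (.of_SC hsc)).1 _ _ _ _ _ hd hν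
  obtain ⟨a', A0, haa, hA0, rfl⟩ := Multiset.rel_cons_left.1 (MAg.trans hA h3)
  obtain ⟨Q', hf', hQ⟩ := hf.ag haa
  obtain ⟨s', F', ν1, ν2, C1, rfl, h5, h6, h7, h8, h9⟩ := wrap_sim hs hF h1 h2 d
  have hgood := ((h1.good ((good_cg (.of_SC hsc) _).1 hP)).1 a' (by simp))
  obtain ⟨h10, rfl, rfl⟩ := dec_prod hAs h7
  have hT : SEqv L {substC (ren S s') (inner ws d)} := by
    refine hL.trans (SEqv.trans (fun M w => ?_) (h8.trans (fun M w => ?_)))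
    · rw [sat_insert, sat_insert, h4 M w]
    · simp
  have hmem : a' ∈ (As.map (UProc.subst (ren S s')) : Multiset (UProc S)) := by rw [← h10]; simp
  rw [Multiset.mem_coe, List.mem_map] at hmem
  obtain ⟨a0, ha0, rfl⟩ := hmem
  have hg0 : Good true a0 := by
    have hg1 : Good false (wrap ws (UProc.prod As)) := (good_cg (.of_SC hsc) _).1 hP
    have hg2 : Good false (UProc.prod As) := by
      clear * - hg1
      induction ws with
      | nil => exact hg1
      | cons x ws ih => exact ih hg1.2
    obtain ⟨l1, l2, -, hsc'⟩ := prod_cons_SC ha0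
    have := ((good_cg (.of_SC hsc') _).2 hg2).1
    have hag := hAs a0 ha0
    cases a0 <;> first | exact hag.elim | exact this
  obtain ⟨Q0, d0, h11, rfl, hgQ, h12⟩ := fire_agent h5 hg0 hT hL1 hL2 hf'
  obtain ⟨l1, l2, rfl, hsc'⟩ := prod_cons_SC ha0
  obtain ⟨P', d', h13, h14⟩ := h9 _ _ (.str hsc' (CEquiv.rfl' _) (.refl _) (CEquiv.rfl' _)
    (.par (Q := UProc.prod (l1 ++ l2)) h11))
  have hrest : A0 = ↑((l1 ++ l2).map (UProc.subst (ren S s'))) := by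
    have : (a0.subst (ren S s')) ::ₘ A0 = (a0.subst (ren S s')) ::ₘ
        (↑((l1 ++ l2).map (UProc.subst (ren S s'))) : Multiset (UProc S)) := by
      rw [h10, Multiset.cons_coe, Multiset.coe_eq_coe, List.map_append, List.map_append]
      exact List.perm_middle
    exact (Multiset.cons_inj_right _).1 this
  have hdl : Dec (UProc.prod (l1 ++ l2)) (ren S s') A0 [] ∅ := by
    obtain ⟨A5, ν5, C5, h15, -⟩ := exists_dec (UProc.prod (l1 ++ l2)) (ren S s') ∅ (.inl rfl)
    obtain ⟨rfl, rfl, rfl⟩ := dec_prod (fun b hb => hAs b (by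
      rw [List.mem_append] at hb ⊢; rw [List.mem_cons]; tauto)) h15
    rw [hrest]; exact h15
  refine ⟨P', d', .str hsc.symm (CEquiv.rfl' _) (.refl _) (CEquiv.rfl' _) h13, ?_⟩
  rw [List.append_nil] at n1 h2
  have hfol : Follows s F ν1 P' d' A0 (Q0.subst (ren S s')) (L ∪ e) := by
    refine ⟨∅, by simp, fun B μ D hB hμ => ?_⟩
    rw [dec_subst, cmp_var] at hB
    obtain ⟨C3, h15, h16⟩ := h14 _ _ _ (.par hB hdl)
    rw [List.append_nil] at h15
    refine ⟨_, _, _, h15, (fresh_perm List.perm_append_comm).1 (h2.append_of hμ), by grind,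
      MAg.refl h15.isAgent, h16.trans ?_⟩
    refine SEqv.trans (fun M w => ?_) h12
    rw [Set.union_empty, sat_insert, sat_singleton]
    exact and_iff_left fun c hc => (hB.good hgQ).2 rfl c hc M w
  exact hfol.congr (.refl _) (CEquiv.rfl' _) hA0 hQ (.refl _) n1

/-! ### The abstract machine -/

/-- States of the abstract machine: the agents, the constraints told so far, and the private names
that are in use. -/
structure MS (S : Sig.{u}) where
  A : Multiset (UProc S)
  L : Set (Constr S)
  N : Finset ℕ

/-- A transition of the machine. -/
def MStep (X Y : MS S) : Prop := ∃ a A0 Q e B ν C, X.A = a ::ₘ A0 ∧ Fire X.L a Q e ∧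
  Dec Q Val.var B ν C ∧ Fresh X.N ν ∧ (∀ x ∈ ν, x % 4 = 1) ∧
  Y = ⟨B + A0, X.L ∪ e, X.N ∪ ν.toFinset⟩

/-- No agent has a transition. -/
def Quiet (X : MS S) : Prop := ∀ a ∈ X.A, ∀ Q e, ¬ Fire X.L a Q e

/-- The passage to the next time unit. -/
def Tick (X Y : MS S) : Prop := ∃ (l : List (UProc S)) (ν : List ℕ) (C : Set (Constr S)), (↑l : Multiset (UProc S)) = X.A ∧
  Dec (UProc.prod (l.map UProc.future)) Val.var Y.A ν C ∧ Fresh X.N ν ∧ (∀ x ∈ ν, x % 4 = 1) ∧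
  Y.L = ∅ ∧ Y.N = X.N ∪ ν.toFinset

/-- The constraint `d` on the ambient names describes the store of `X`. -/
def Out (X : MS S) (d : Constr S) : Prop := ∀ (M : Mdl S) (v : ℕ → M), Formula.Realize d v ↔
  ∃ w : ℕ → M, (∀ i, w (2 * i) = v i) ∧ Sat w X.L

/-- One time unit of the machine. -/
def ObsM (X : MS S) (d : Constr S) (X' : MS S) : Prop :=
  ∃ Y, Relation.ReflTransGen MStep X Y ∧ Quiet Y ∧ Out Y d ∧ Tick Y X'

/-- The infinite sequences of observations from `a`. -/
def tr {α β : Type*} (O : α → β → α → Prop) (a : α) : Set (ℕ → β) :=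
  { s | ∃ f : ℕ → α, f 0 = a ∧ ∀ i, O (f i) (s i) (f (i + 1)) }

/-- A simulation gives inclusion of traces by dependent choice along the run. -/
theorem tr_subset {α α' β : Type*} {O : α → β → α → Prop} {O' : α' → β → α' → Prop}
    (R : α → α' → Prop) (h : ∀ a b c a', R a b → O a c a' → ∃ b', O' b c b' ∧ R a' b')
    {a : α} {b : α'} (hab : R a b) : tr O a ⊆ tr O' b := by
  rintro s ⟨f, rfl, hf⟩
  let g : (i : ℕ) → { b : α' // R (f i) b } := fun i => Nat.rec ⟨b, hab⟩
    (fun i b => ⟨(h _ _ _ _ b.2 (hf i)).choose, (h _ _ _ _ b.2 (hf i)).choose_spec.2⟩) i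
  exact ⟨fun i => (g i).1, rfl, fun i => (h _ _ _ _ (g i).2 (hf i)).choose_spec.1⟩

/-- Well-formed states. -/
def WF (X : MS S) : Prop := (∀ a ∈ X.A, Good true a ∧ Supp (Nm X.N) a) ∧
  ∀ c ∈ X.L, TellOK c ∧ SuppC (Nm X.N) c

theorem Nm.mono {F F' : Finset ℕ} (h : F ⊆ F') : Nm F ⊆ Nm F' := fun _ hi => hi.imp_right (h ·)

theorem Fire.supp {X : Set ℕ} {L : Set (Constr S)} (hL : ∀ c ∈ L, TellOK c ∧ SuppC X c)
    {a Q : UProc S} {e} (h : Fire L a Q e) (ha : Good true a) (hs : Supp X a) :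
    Supp X Q ∧ ∀ c ∈ e, SuppC X c := by
  cases h with
  | tell c =>
    refine ⟨rfl, fun d hd => ?_⟩
    rw [hd]
    unfold Supp at hs
    exact UProc.tell.inj hs
  | unl h => exact ⟨rfl, by simp⟩
  | bang =>
    refine ⟨?_, by simp⟩
    unfold Supp at hs ⊢
    simp only [UProc.subst, UProc.bang.injEq] at hs ⊢
    rw [hs]
  | abs t h h' =>
    refine ⟨?_, by simp⟩
    have ht := guard_supp (fun c hc => (hL c hc).1) (fun c hc => (hL c hc).2) ha.1 t h
    have h1 := hs.abs_body ht
    have h2 := hs.abs_ex ht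
    unfold Supp at h1 h2 ⊢
    rw [UProc.subst, h1, h2]

theorem WF.dec {X : MS S} {Q : UProc S} {B ν C} (hd : Dec Q Val.var B ν C) (hQ : Good true Q)
    (hs : Supp (Nm X.N) Q) {N : Finset ℕ} (hN : X.N ∪ ν.toFinset ⊆ N) :
    ∀ a ∈ B, Good true a ∧ Supp (Nm N) a := by
  intro a ha
  refine ⟨(hd.good hQ).1 a ha, (hd.supp hs (Nm.mono ?_) fun x hx => .inr (hN ?_)).1 a ha⟩
  · exact fun x hx => hN (Finset.mem_union_left _ hx)
  · simp [hx]

theorem MStep.wf {X Y : MS S} (h : MStep X Y) (hX : WF X) : WF Y := by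
  obtain ⟨a, A0, Q, e, B, ν, C, hA, hf, hd, hν, -, rfl⟩ := h
  have ha := hX.1 a (by rw [hA]; simp)
  have h1 := hf.supp hX.2 ha.1 ha.2
  have h2 := hf.good ha.1
  refine ⟨fun b hb => ?_, fun c hc => ?_⟩
  · rcases Multiset.mem_add.1 hb with hb | hb
    · exact WF.dec hd h2.1 h1.1 (Finset.Subset.refl _) b hb
    · have := hX.1 b (by rw [hA]; simp [hb])
      exact ⟨this.1, this.2.mono (Nm.mono Finset.subset_union_left)⟩
  · rcases hc with hc | hc
    · exact ⟨(hX.2 c hc).1, (hX.2 c hc).2.mono (Nm.mono Finset.subset_union_left)⟩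
    · exact ⟨h2.2 c hc, (h1.2 c hc).mono (Nm.mono Finset.subset_union_left)⟩

/-! ### Passage to the next time unit -/

theorem future_subst (P : UProc S) (σ : Sub S) : (P.subst σ).future = P.future.subst σ := by
  induction P generalizing σ with
  | par P Q h1 h2 => simp only [UProc.subst, UProc.future, h1, h2]
  | loc n c P ih => simp only [UProc.subst, UProc.future, ih]; rfl
  | _ => rfl

theorem Good.future {P : UProc S} {b : Bool} (h : Good b P) : Good true P.future := by
  induction P with
  | par P Q h1 h2 => exact ⟨h1 h.1, h2 h.2⟩
  | loc n c P ih => exact ⟨fun _ _ _ => id, ih h.2⟩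
  | next P => exact h
  | unl c P => exact h.2
  | _ => trivial

theorem Ag.future {a b : UProc S} (h : Ag a b) : Cg a.future b.future := by
  cases h with
  | next h => exact h
  | unl h => exact h
  | _ => exact .refl _

theorem prod_perm {l l' : List (UProc S)} (h : l.Perm l') : Cg (UProc.prod l) (UProc.prod l') := by
  induction h with
  | nil => exact .refl _
  | cons a _ ih => exact .par (.refl _) ih
  | swap a b l =>
    exact (Cg.par_assoc _ _ _).trans ((Cg.par (.par_comm _ _) (.refl _)).trans
      (Cg.par_assoc _ _ _).symm)
  | trans _ _ h1 h2 => exact h1.trans h2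

theorem MAg.future {l l' : List (UProc S)}
    (h : MAg (l : Multiset (UProc S)) (l' : Multiset (UProc S))) :
    Cg (UProc.prod (l.map UProc.future)) (UProc.prod (l'.map UProc.future)) := by
  induction l generalizing l' with
  | nil =>
    rw [Multiset.coe_nil, MAg, Multiset.rel_zero_left, Multiset.coe_eq_zero] at h
    rw [h]; exact .refl _
  | cons a l ih =>
    rw [← Multiset.cons_coe] at h
    obtain ⟨b, B, h1, h2, h3⟩ := Multiset.rel_cons_left.1 h
    have h4 : l'.Perm (b :: B.toList) := by
      rw [← Multiset.coe_eq_coe, h3, ← Multiset.cons_coe, Multiset.coe_toList]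
    refine Cg.trans ?_ (prod_perm (h4.map _)).symm
    exact .par h1.future (ih (by rwa [Multiset.coe_toList]))

/-- `future` keeps the local declarations, with trivial constraints, so the old private names remain
in scope while the unguarded continuations add new ones. Flattening therefore commutes with the
passage to the next unit. -/
theorem Dec.future {P : UProc S} {σ : Sub S} {A ν C} (h : Dec P σ A ν C) {F : Finset ℕ}
    (hν : Fresh F ν) {l : List (UProc S)} (hl : (↑l : Multiset (UProc S)) = A) {B μ D}
    (hB : Dec (UProc.prod (l.map UProc.future)) Val.var B μ D) (hμ : Fresh (F ∪ ν.toFinset) μ) :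
    ∃ A' ν' C', Dec P.future σ A' ν' C' ∧ Fresh F ν' ∧
      (∀ x ∈ ν', x ∈ ν ∨ x ∈ μ ∨ x % 4 = 3) ∧ MAg B A' := by
  induction h generalizing F l B μ D with
  | skip σ =>
    rw [Multiset.coe_eq_zero] at hl
    subst hl
    obtain ⟨rfl, rfl, rfl⟩ := dec_skip_iff.1 hB
    exact ⟨_, _, _, .skip σ, hν, by simp, .zero⟩
  | @agent a σ h =>
    obtain rfl : l = [a.subst σ] := by simpa using hl
    obtain ⟨A1, A2, ν1, ν2, C1, C2, h1, h2, rfl, rfl, rfl⟩ := dec_par_iff.1 hB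
    obtain ⟨rfl, rfl, rfl⟩ := dec_skip_iff.1 h2
    rw [future_subst, dec_subst, cmp_var] at h1
    refine ⟨_, _, _, h1, by simpa using hμ, fun x hx => by simp [hx], ?_⟩
    rw [add_zero]; exact .refl h1.isAgent
  | @par P Q σ A1 A2 ν1 ν2 C1 C2 hP hQ h1 h2 =>
    have hl' : l.Perm (A1.toList ++ A2.toList) := by
      rw [← Multiset.coe_eq_coe, hl, ← Multiset.coe_add, Multiset.coe_toList, Multiset.coe_toList]
    have hcg := (prod_perm (hl'.map UProc.future)).trans (by
      rw [List.map_append]; exact (Cg.of_SC (prod_append_SC _ _)).symm)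
    obtain ⟨B', μ', D', h3, h4, n1, h5, -⟩ := (decSim_of_cg hcg).1 _ _ _ _ _ hB hμ
    obtain ⟨B1, B2, μ1, μ2, D1, D2, h6, h7, rfl, rfl, rfl⟩ := dec_par_iff.1 h3
    have hν' := (fresh_perm List.perm_append_comm).1 hν
    rw [fresh_append] at hν'
    have h4' := (fresh_perm List.perm_append_comm).1 h4
    rw [fresh_append] at h4'
    -- The left part must avoid all names of the right part, old and new; afterwards the right part
    -- only has to avoid what was chosen on the left.
    obtain ⟨A1', ν1', C1', h8, h9, n2, h10⟩ := h1 (F := F ∪ ν2.toFinset ∪ μ2.toFinset) (by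
      refine ⟨hν'.2.1, fun x hx => ⟨(hν'.2.2 x hx).1, ?_⟩⟩
      have := (hν'.2.2 x hx).2
      have h11 := h4'.1.2
      simp only [Finset.mem_union, List.mem_toFinset, List.mem_append] at *
      grind) (Multiset.coe_toList _) h6 (by
      refine ⟨h4'.2.1, fun x hx => ⟨(h4'.2.2 x hx).1, ?_⟩⟩
      have := (h4'.2.2 x hx).2
      simp only [Finset.mem_union, List.mem_toFinset, List.mem_append] at *
      grind)
    obtain ⟨A2', ν2', C2', h11, h12, n3, h13⟩ := h2 (F := F ∪ ν1'.toFinset) (by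
      refine ⟨hν'.1.1, fun x hx => ⟨(hν'.1.2 x hx).1, ?_⟩⟩
      have := (hν'.1.2 x hx).2
      have h14 := h9.2
      simp only [Finset.mem_union, List.mem_toFinset, List.mem_append] at *
      grind) (Multiset.coe_toList _) h7 (by
      refine ⟨h4'.1.1, fun x hx => ⟨(h4'.1.2 x hx).1, ?_⟩⟩
      have := (h4'.1.2 x hx).2
      have h14 := h9.2
      simp only [Finset.mem_union, List.mem_toFinset, List.mem_append] at *
      grind)
    refine ⟨_, _, _, .par h8 h11, fresh_append.2 ⟨h9.mono (by grind [List.mem_toFinset]), h12⟩, by grind [List.mem_toFinset],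
      MAg.trans h5 (Multiset.Rel.add h10 h13)⟩
  | @loc n c P σ A ν C τ h _ ih =>
    rw [fresh_append] at hν
    obtain ⟨A', ν', C', h1, h2, n1, h3⟩ := ih hν.2 hl hB (hμ.mono (by grind [List.mem_toFinset]))
    exact ⟨A', _, _, .loc τ h h1, fresh_append.2 ⟨hν.1, h2⟩, by grind [List.mem_toFinset], h3⟩

theorem Tick.wf {X Y : MS S} (h : Tick X Y) (hX : WF X) : WF Y := by
  obtain ⟨l, ν, C, h1, h2, -, -, h3, h4⟩ := h
  have hl : ∀ a ∈ l, Good true a ∧ Supp (Nm X.N) a := fun a ha => hX.1 a (by rw [← h1]; exact ha)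
  refine ⟨?_, by simp [h3]⟩
  have h5 : Good true (UProc.prod (l.map UProc.future)) ∧
      Supp (Nm X.N) (UProc.prod (l.map UProc.future)) := by
    clear h1 h2
    induction l with
    | nil => exact ⟨trivial, rfl⟩
    | cons a l ih =>
      have h6 := ih fun b hb => hl b (by simp [hb])
      have h7 := hl a (by simp)
      refine ⟨⟨h7.1.future, h6.1⟩, ?_⟩
      have h8 : Supp (Nm X.N) a.future := by
        unfold Supp
        rw [← future_subst, h7.2]
      exact congrArg₂ UProc.par h8 h6.2
  exact WF.dec h2 h5.1 h5.2 h4.ge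

theorem exists_tick (X : MS S) : ∃ Y, Tick X Y := by
  obtain ⟨A, ν, C, h1, h2, h3⟩ := exists_dec (UProc.prod (X.A.toList.map UProc.future)) Val.var X.N
    (.inl rfl)
  exact ⟨⟨A, ∅, X.N ∪ ν.toFinset⟩, X.A.toList, ν, C, Multiset.coe_toList _, h1, h2, h3, rfl, rfl⟩

/-! ### Processes as states of the machine -/

/-- The ambient names are the even numbers. -/
def ev (S : Sig.{u}) : Sub S := ren S (2 * ·)

/-- The state `X` represents the process `P` with the store `d`. -/
def Conf (P : UProc S) (d : Constr S) (X : MS S) : Prop :=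
  ∃ A ν C, Dec P (ev S) A ν C ∧ Fresh ∅ ν ∧ (∀ x ∈ ν, x ∈ X.N ∨ x % 4 = 3) ∧ MAg X.A A ∧
    SEqv X.L (insert (substC (ev S) d) C) ∧ Good false P ∧ Coh P (stC d) ∧ WF X

theorem ev_injective : Function.Injective (2 * · : ℕ → ℕ) := fun a b h => by simpa using h

theorem ev_even (i : ℕ) : 2 * i % 2 = 0 ∨ 2 * i ∈ (∅ : Finset ℕ) := .inl (by omega)

/-- Here the residue classes pay off. The machine draws names congruent to 1 modulo 4 outside of
`X.N`, while the names of the process outside of `X.N` and those in `W` are congruent to 3, so they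
never clash. -/
theorem Conf.of_follows {P : UProc S} {d : Constr S} {X Y : MS S} {Q : UProc S}
    {A0 B : Multiset (UProc S)} {ν μ : List ℕ} {C} {e : Set (Constr S)}
    (h : Follows (2 * ·) ∅ ν P d A0 Q (X.L ∪ e)) (hν : ∀ x ∈ ν, x ∈ X.N ∨ x % 4 = 3)
    (hP : Good false P) (hC : Coh P (stC d)) (hd : Dec Q Val.var B μ C) (hμ : Fresh X.N μ)
    (hμ1 : ∀ x ∈ μ, x % 4 = 1) (hY : Y = ⟨B + A0, X.L ∪ e, X.N ∪ μ.toFinset⟩) (hW : WF Y) :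
    Conf P d Y := by
  subst hY
  obtain ⟨W, hW3, h⟩ := h
  obtain ⟨A', ν', C', h1, h2, h3, h4, h5⟩ := h B μ C hd ⟨hμ.1, fun x hx =>
    ⟨(hμ.2 x hx).1, by
      have h6 := hμ1 x hx
      have h7 := (hμ.2 x hx).2
      have h8 := hW3 x
      have h9 := hν x
      simp only [Finset.mem_union, Finset.notMem_empty, List.mem_toFinset, false_or]
      rintro (h10 | h10)
      · have := h9 h10; simp only [h7, false_or] at this; omega
      · have := h8 h10; omega⟩⟩
  refine ⟨A', ν', C', h1, h2, fun x hx => ?_, h4, h5.symm, hP, hC, hW⟩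
  have := h3 x hx
  have := hν x
  simp only [Finset.mem_union, List.mem_toFinset]
  tauto

/-- With `Conf.mstep`, this makes `Conf` a bisimulation between processes and states of the machine.
-/
theorem Conf.step {P P' : UProc S} {d d' : Constr S} {X : MS S} (h : Conf P d X)
    (hs : UProc.Step P d P' d') : ∃ Y, MStep X Y ∧ Conf P' d' Y := by
  obtain ⟨A, ν, C, h1, h2, h3, h4, h5, h6, h7, h8⟩ := h
  obtain ⟨a, A0, Q, e, rfl, h9, h10⟩ := step_sim hs h6 ev_injective ev_even h1 h2
  obtain ⟨a', A0', ha, hA, hX⟩ := Multiset.rel_cons_right.1 h4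
  obtain ⟨Q', h11, h12⟩ := (h9.mono fun g => h5.symm.sent).ag ha.symm
  have h13 := h10.congr (.refl _) (CEquiv.rfl' _) hA h12.symm
    (sat_congr_union h5.symm (.refl _)) fun x hx => .inl hx
  obtain ⟨B, μ, D, h14, h15, h16⟩ := exists_dec Q' Val.var X.N (.inl rfl)
  have hst : MStep X ⟨B + A0', X.L ∪ e, X.N ∪ μ.toFinset⟩ :=
    ⟨a', A0', Q', e, B, μ, D, hX, h11, h14, h15, h16, rfl⟩
  exact ⟨_, hst, .of_follows h13 h3 (step_good hs h6) (step_coh hs h6 h7) h14 h15 h16 rfl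
    (hst.wf h8)⟩

theorem Conf.mstep {P : UProc S} {d : Constr S} {X Y : MS S} (h : Conf P d X) (hs : MStep X Y) :
    ∃ P' d', UProc.Step P d P' d' ∧ Conf P' d' Y := by
  obtain ⟨A, ν, C, h1, h2, h3, h4, h5, h6, h7, h8⟩ := h
  have hY := hs.wf h8
  obtain ⟨a, A0, Q, e, B, μ, D, hA, hf, hd, hμ, hμ1, rfl⟩ := hs
  rw [hA] at h4
  obtain ⟨P', d', h9, h10⟩ := fire_sim h6 ev_injective ev_even h1 h2 h5 (fun c hc => (h8.2 c hc).1)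
    (fun c hc => (h8.2 c hc).2) h4 hf
  exact ⟨P', d', h9, .of_follows h10 h3 (step_good h9 h6) (step_coh h9 h6 h7) hd hμ hμ1 rfl hY⟩

theorem Conf.quiet {P : UProc S} {d : Constr S} {X : MS S} (h : Conf P d X) :
    (∀ P' d', ¬ UProc.Step P d P' d') ↔ Quiet X := by
  constructor
  · intro hq a ha Q e hf
    obtain ⟨A0, hA⟩ := Multiset.exists_cons_of_mem ha
    obtain ⟨B, μ, D, h1, h2, h3⟩ := exists_dec Q Val.var X.N (.inl rfl)
    obtain ⟨P', d', h4, -⟩ := h.mstep ⟨a, A0, Q, e, B, μ, D, hA, hf, h1, h2, h3, rfl⟩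
    exact hq _ _ h4
  · intro hq P' d' hs
    obtain ⟨Y, ⟨a, A0, Q, e, B, μ, D, hA, hf, -⟩, -⟩ := h.step hs
    exact hq a (by rw [hA]; simp) Q e hf

/-- The outer store is the projection of the machine store to the ambient names. That nothing is
lost by projecting is coherence, in the form of `coh_sat`. -/
theorem Conf.out {P : UProc S} {d : Constr S} {X : MS S} (h : Conf P d X) : Out X d := by
  obtain ⟨A, ν, C, h1, h2, h3, h4, h5, h6, h7, h8⟩ := h
  intro M v
  constructor
  · intro hv
    obtain ⟨w, hw, hw2⟩ := coh_sat h1 h7 h2.1 (fun i x hi hx => by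
        have := (h2.2 x hx).1
        simp only [ev, ren, Val.var.injEq] at hi
        omega) (M := M) (fun i => v (i / 2)) (by
        have : (fun i => vev (fun i => v (i / 2)) (ev S i)) = v := by
          funext i
          simp [ev, ren, vev_var]
        rw [this]; exact hv)
    have hw3 : ∀ i, w (2 * i) = v i := fun i => by
      rw [hw _ fun hx => by have := (h2.2 _ hx).1; omega]; simp
    refine ⟨w, hw3, (h5 M w).2 ?_⟩
    rw [sat_insert, realize_substC]
    refine ⟨?_, hw2⟩
    have : (fun i => vev w (ev S i)) = v := funext hw3
    rw [this]; exact hv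
  · rintro ⟨w, hw, hw2⟩
    have h9 := ((sat_insert _ _ _).1 ((h5 M w).1 hw2)).1
    rw [realize_substC] at h9
    have : (fun i => vev w (ev S i)) = v := funext hw
    rwa [this] at h9

theorem Out.cequiv {X : MS S} {d d' : Constr S} (h : Out X d) (h' : Out X d') : CEquiv d d' :=
  cequiv_of fun M v => (h M v).trans (h' M v).symm

theorem Out.congr {X : MS S} {d d' : Constr S} (h : Out X d) (h' : CEquiv d d') : Out X d' :=
  fun M v => (cequiv_realize h' v).symm.trans (h M v)

theorem Conf.tick {P : UProc S} {d : Constr S} {X Y : MS S} (h : Conf P d X) (ht : Tick X Y) :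
    Conf P.future ⊤ Y := by
  have hY := ht.wf
  obtain ⟨A, ν, C, h1, h2, h3, h4, h5, h6, h7, h8⟩ := h
  obtain ⟨l, μ, D, h9, h10, h11, h12, h13, h14⟩ := ht
  rw [← h9, ← Multiset.coe_toList A] at h4
  obtain ⟨B', μ', D', h15, h16, n1, h17, -⟩ := (decSim_of_cg h4.future).1 _ _ _ _
    (∅ ∪ ν.toFinset) h10 ⟨h11.1, fun x hx => ⟨(h11.2 x hx).1, by
      have h18 := (h11.2 x hx).2
      have h19 := h12 x hx
      have h20 := h3 x
      simp only [Finset.mem_union, Finset.notMem_empty, List.mem_toFinset, false_or]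
      intro h21
      have := h20 h21
      simp only [h18, false_or] at this
      omega⟩⟩
  obtain ⟨A', ν', C', h18, h19, n2, h20⟩ := h1.future h2 (Multiset.coe_toList A) h15 h16
  have hg := h6.future
  refine ⟨A', ν', C', h18, h19, fun x hx => ?_, MAg.trans h17 h20, fun M w => ?_,
    hg.weaken _, hg.coh _, hY h8⟩
  · have := n2 x hx
    have := n1 x
    have := h3 x
    rw [h14]
    simp only [Finset.mem_union, List.mem_toFinset]
    tauto
  · rw [h13, sat_insert, substC_top]
    exact ⟨fun _ => ⟨id, fun c hc => (h18.good hg).2 rfl c hc M w⟩, fun _ => sat_empty w⟩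

theorem Conf.steps {P P' : UProc S} {d d' : Constr S} {X : MS S} (h : Conf P d X)
    (hs : UProc.Steps (P, d) (P', d')) : ∃ Y, Relation.ReflTransGen MStep X Y ∧ Conf P' d' Y := by
  unfold UProc.Steps at hs
  generalize hγ : (P', d') = γ at hs
  induction hs generalizing P' d' with
  | refl => cases hγ; exact ⟨X, .refl, h⟩
  | @tail γ1 γ2 _ h1 ih =>
    subst hγ
    obtain ⟨Y, h2, h3⟩ := ih rfl
    obtain ⟨Z, h4, h5⟩ := h3.step h1
    exact ⟨Z, h2.tail h4, h5⟩

theorem Conf.msteps {P : UProc S} {d : Constr S} {X Y : MS S} (h : Conf P d X)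
    (hs : Relation.ReflTransGen MStep X Y) : ∃ P' d', UProc.Steps (P, d) (P', d') ∧ Conf P' d' Y := by
  induction hs with
  | refl => exact ⟨P, d, .refl, h⟩
  | tail _ h1 ih =>
    obtain ⟨P1, d1, h2, h3⟩ := ih
    obtain ⟨P2, d2, h4, h5⟩ := h3.mstep h1
    exact ⟨P2, d2, .tail h2 h4, h5⟩

theorem Conf.obs {P R : UProc S} {c d : Constr S} {X : MS S} (h : Conf P c X)
    (ho : UProc.Obs P c d R) : ∃ Y, Relation.ReflTransGen MStep X Y ∧ Quiet Y ∧ Out Y d ∧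
      ∀ X', Tick Y X' → Conf R ⊤ X' := by
  obtain ⟨Q, d', h1, h2, h3, rfl⟩ := ho
  obtain ⟨Y, h4, h5⟩ := h.steps h1
  exact ⟨Y, h4, h5.quiet.1 h2, h5.out.congr h3, fun X' ht => h5.tick ht⟩

theorem Conf.obsM {P : UProc S} {c d : Constr S} {X X' : MS S} (h : Conf P c X)
    (ho : ObsM X d X') : ∃ R, UProc.Obs P c d R ∧ Conf R ⊤ X' := by
  obtain ⟨Y, h1, h2, h3, h4⟩ := ho
  obtain ⟨P', d', h5, h6⟩ := h.msteps h1
  exact ⟨_, ⟨P', d', h5, h6.quiet.2 h2, h6.out.cequiv h3, rfl⟩, h6.tick h4⟩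

/-- Bisimilarity holds for entire time units, so from here on output behavior is computed on the
machine alone. -/
theorem Conf.outputs {P : UProc S} {X : MS S} (h : Conf P ⊤ X) : UProc.outputs P = tr ObsM X := by
  apply Set.Subset.antisymm
  · refine tr_subset (O := fun P c R => UProc.Obs P ⊤ c R) (fun P X => Conf P ⊤ X) ?_ h
    intro P X d R h ho
    obtain ⟨Y, h1, h2, h3, h4⟩ := h.obs ho
    obtain ⟨X', h5⟩ := exists_tick Y
    exact ⟨X', ⟨Y, h1, h2, h3, h5⟩, h4 X' h5⟩
  · refine tr_subset (O' := fun P c R => UProc.Obs P ⊤ c R) (fun X P => Conf P ⊤ X) ?_ h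
    intro X P d X' h ho
    exact h.obsM ho

theorem Conf.of_dec {P : UProc S} (hP : Good true P) {A ν C} (hd : Dec P (ev S) A ν C)
    (hν : Fresh ∅ ν) {A' : Multiset (UProc S)} (hA : MAg A' A) {N : Finset ℕ}
    (hN : ∀ x ∈ ν, x ∈ N ∨ x % 4 = 3) (hW : WF (⟨A', ∅, N⟩ : MS S)) : Conf P ⊤ ⟨A', ∅, N⟩ := by
  refine ⟨A, ν, C, hd, hν, hN, hA, fun M w => ?_, hP.weaken _, hP.coh _, hW⟩
  rw [sat_insert, substC_top]
  exact ⟨fun _ => ⟨id, fun c hc => (hd.good hP).2 rfl c hc M w⟩, fun _ => sat_empty w⟩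

theorem WF.of_dec {P : UProc S} (hP : Good true P) {A ν C} (hd : Dec P (ev S) A ν C)
    {N : Finset ℕ} (hN : ∀ x ∈ ν, x ∈ N) : WF (⟨A, ∅, N⟩ : MS S) := by
  refine ⟨fun a ha => ⟨(hd.good hP).1 a ha, (hd.supp' (fun i => ?_) fun x hx => .inr (hN x hx)).1 a
    ha⟩, by simp⟩
  exact suppV_var.2 (.inl (by simp))

/-! ### Persistent tells -/

/-- The constraint `c` is told in every time unit. -/
def Act (c : Constr S) (A : Multiset (UProc S)) (L : Set (Constr S)) : Prop :=
  .bang (.tell c) ∈ A ∨ (.next (.bang (.tell c)) ∈ A ∧ (.tell c ∈ A ∨ c ∈ L))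

/-- Unfolding the replication leaves a copy under `next` and a `tell`, which stays pending until its
constraint is in the store. -/
theorem Act.step {c : Constr S} {X Y : MS S} (h : Act c X.A X.L) (hs : MStep X Y) :
    Act c Y.A Y.L := by
  obtain ⟨a, A0, Q, e, B, ν, C, hA, hf, hd, -, -, rfl⟩ := hs
  have hsub : X.L ⊆ X.L ∪ e := Set.subset_union_left
  simp only [Act, Multiset.mem_add] at h ⊢
  rw [hA] at h
  simp only [Multiset.mem_cons] at h
  by_cases h1 : UProc.bang (.tell c) = a
  · subst h1
    cases hf
    obtain ⟨A1, A2, ν1, ν2, C1, C2, h3, h4, rfl, rfl, rfl⟩ := dec_par_iff.1 hd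
    obtain ⟨rfl, rfl, rfl⟩ := (dec_agent_iff (by trivial)).1 h3
    obtain ⟨rfl, rfl, rfl⟩ := (dec_agent_iff (by trivial)).1 h4
    right
    rw [UProc.subst_id, UProc.subst_id]
    simp
  · rcases h with h | ⟨h2, h3⟩
    · left; right; exact h.resolve_left h1
    · right
      have h4 : UProc.next (.bang (.tell c)) ≠ a := by rintro rfl; cases hf
      refine ⟨.inr (h2.resolve_left h4), ?_⟩
      rcases h3 with (h3 | h3) | h3
      · subst h3
        cases hf
        exact .inr (.inr rfl)
      · exact .inl (.inr h3)
      · exact .inr (hsub h3)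

theorem Act.of_quiet {c : Constr S} {X : MS S} (h : Act c X.A X.L) (hq : Quiet X) :
    .next (.bang (.tell c)) ∈ X.A ∧ c ∈ X.L := by
  rcases h with h | ⟨h1, h2 | h2⟩
  · exact absurd .bang (hq _ h _ _)
  · exact absurd (.tell _) (hq _ h2 _ _)
  · exact ⟨h1, h2⟩

theorem dec_prod_mem {l : List (UProc S)} {σ : Sub S} {A ν C} (h : Dec (UProc.prod l) σ A ν C)
    {a : UProc S} (ha : a ∈ l) : ∃ B μ D, Dec a σ B μ D ∧ B ≤ A ∧ μ ⊆ ν := by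
  induction l generalizing A ν C with
  | nil => simp at ha
  | cons b l ih =>
    obtain ⟨A1, A2, ν1, ν2, C1, C2, h3, h4, rfl, rfl, rfl⟩ := dec_par_iff.1 h
    rcases List.mem_cons.1 ha with rfl | ha
    · exact ⟨_, _, _, h3, Multiset.le_add_right _ _, List.subset_append_left _ _⟩
    · obtain ⟨B, μ, D, h5, h6, h7⟩ := ih h4 ha
      exact ⟨B, μ, D, h5, h6.trans (Multiset.le_add_left _ _),
        List.Subset.trans h7 (List.subset_append_right _ _)⟩

theorem Act.tick {c : Constr S} {X Y : MS S} (h : Act c X.A X.L) (hq : Quiet X) (ht : Tick X Y) :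
    Act c Y.A Y.L := by
  obtain ⟨l, ν, C, h1, h2, -⟩ := ht
  have h3 := (h.of_quiet hq).1
  rw [← h1, Multiset.mem_coe] at h3
  obtain ⟨B, μ, D, h4, h5, -⟩ := dec_prod_mem h2 (List.mem_map_of_mem (f := UProc.future) h3)
  obtain ⟨rfl, rfl, rfl⟩ := (dec_agent_iff (by trivial)).1 h4
  refine .inl (Multiset.mem_of_le h5 ?_)
  rw [UProc.subst_id]
  exact Multiset.mem_singleton_self _

/-! ### Residuals of persistent constructs -/

/-- The guard `c` is never entailed if the names in `D` are not told. -/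
def Dead (D : Finset ℕ) (n : ℕ) (c : Constr S) : Prop := ∀ L : Set (Constr S),
  (∀ c ∈ L, TellOK c) → (∀ g ∈ D, opv (.var g) ∉ L) → ∀ t : Fin n → Val S,
    ¬ SEnt L (substC (instS t) c)

/-- The residuals of persistent constructs that have been used. -/
inductive Residual (D T : Finset ℕ) : UProc S → Prop
  | dead {n c ex P} : Dead D n c → Residual D T (.abs n c ex P)
  | unl {s Q} : s ∈ T → Residual D T (.unl (opv (.var s)) Q)
  | tell {s} : s ∈ T → Residual D T (.tell (opv (.var s)))
  | ack {c ex s} : s ∈ T → Residual D T (.abs 0 c ex (.bang (.tell (opv (.var s)))))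

/-- Residuals, their replications, and the suspensions of these. -/
def Garbage (D T : Finset ℕ) (a : UProc S) : Prop :=
  Residual D T a ∨ ∃ b, Residual D T b ∧ (a = .bang b ∨ a = .next (.bang b))

/-- An upper bound for the number of transitions of a residual. -/
def weight : UProc S → ℕ
  | .tell _ => 1
  | .unl _ _ => 1
  | .bang P => weight P + 1
  | .abs _ _ [] P => weight P + 1
  | _ => 0

theorem Residual.isAgent {D T : Finset ℕ} {a : UProc S} (h : Residual D T a) : IsAgent a := by
  cases h <;> trivial

theorem dec_par_agents {a b : UProc S} (ha : IsAgent a) (hb : IsAgent b) {B ν C}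
    (h : Dec (.par a b) Val.var B ν C) : B = {a, b} ∧ ν = [] := by
  obtain ⟨A1, A2, ν1, ν2, C1, C2, h3, h4, rfl, rfl, rfl⟩ := dec_par_iff.1 h
  obtain ⟨rfl, rfl, rfl⟩ := (dec_agent_iff ha).1 h3
  obtain ⟨rfl, rfl, rfl⟩ := (dec_agent_iff hb).1 h4
  rw [UProc.subst_id, UProc.subst_id]
  exact ⟨rfl, rfl⟩

/-- Guards that need a name of `D` stay closed, and the remaining residuals can only tell names in
`T`. The decrease of the weight excludes infinite activity of residuals. -/
theorem Garbage.fire {D T : Finset ℕ} {L : Set (Constr S)} (hL : ∀ c ∈ L, TellOK c)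
    (hD : ∀ g ∈ D, opv (.var g) ∉ L) {a Q : UProc S} {e} (ha : Garbage D T a) (hf : Fire L a Q e)
    {B ν C} (hd : Dec Q Val.var B ν C) : ν = [] ∧ (∀ b ∈ B, Garbage D T b) ∧
      (∀ c ∈ e, ∃ s ∈ T, c = opv (.var s)) ∧ (B.map weight).sum < weight a := by
  rcases ha with ha | ⟨b, hb, rfl | rfl⟩
  · cases ha with
    | dead h => cases hf with
      | abs t h1 _ => exact absurd h1 (h L hL hD t)
    | unl h =>
      cases hf
      obtain ⟨rfl, rfl, rfl⟩ := dec_skip_iff.1 hd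
      simp [weight]
    | tell h =>
      cases hf
      obtain ⟨rfl, rfl, rfl⟩ := dec_skip_iff.1 hd
      refine ⟨rfl, by simp, fun c hc => ⟨_, h, hc⟩, by simp [weight]⟩
    | @ack c ex s h => cases hf with
      | abs t h1 h2 =>
        obtain ⟨rfl, rfl⟩ := dec_par_agents (by trivial) (by trivial) hd
        -- The empty tuple is the only instance of an abstraction on no variables, so it fires only
        -- while nothing is excluded, and only then is its weight positive.
        have hex : ex = [] := by
          cases ex with
          | nil => rfl
          | cons u ex => exact absurd (List.mem_cons.2 (.inl (Subsingleton.elim _ _))) h2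
        subst hex
        have e1 : UProc.subst (instS t) (.bang (.tell (opv (Val.var s)))) =
            .bang (.tell (opv (Val.var s))) := by
          have : instS t = Val.var := by funext i; simp [instS]
          rw [this, UProc.subst_id]
        rw [e1]
        refine ⟨rfl, ?_, by simp, by simp [weight]⟩
        intro b hb
        simp only [Multiset.insert_eq_cons, Multiset.mem_cons, Multiset.mem_singleton] at hb
        rcases hb with rfl | rfl
        · exact .inr ⟨_, .tell h, .inl rfl⟩
        · exact .inl (.ack h)
  · cases hf
    obtain ⟨rfl, rfl⟩ := dec_par_agents hb.isAgent (by trivial) hd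
    refine ⟨rfl, ?_, by simp, by simp [weight]⟩
    intro c hc
    simp only [Multiset.insert_eq_cons, Multiset.mem_cons, Multiset.mem_singleton] at hc
    rcases hc with rfl | rfl
    · exact .inl hb
    · exact .inr ⟨_, hb, .inr rfl⟩
  · cases hf

/-- The names in `T` are told, so an `unless` on such a name is discharged within the time unit and
its continuation never reaches the next one. -/
theorem Garbage.future {D T : Finset ℕ} {L : Set (Constr S)} (hT : ∀ s ∈ T, opv (.var s) ∈ L)
    {a : UProc S} (ha : Garbage D T a) (hq : ∀ Q e, ¬ Fire L a Q e) {B ν C}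
    (hd : Dec a.future Val.var B ν C) : ν = [] ∧ ∀ b ∈ B, Garbage D T b := by
  rcases ha with ha | ⟨b, hb, rfl | rfl⟩
  · cases ha with
    | dead h => obtain ⟨rfl, rfl, rfl⟩ := dec_skip_iff.1 hd; simp
    | unl h =>
      exact absurd (.unl fun M w hw => hw _ (hT _ h)) (hq _ _)
    | tell h => exact absurd (.tell _) (hq _ _)
    | ack h => obtain ⟨rfl, rfl, rfl⟩ := dec_skip_iff.1 hd; simp
  · exact absurd .bang (hq _ _)
  · obtain ⟨rfl, rfl, rfl⟩ := (dec_agent_iff (by trivial)).1 hd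
    refine ⟨rfl, fun c hc => ?_⟩
    rw [UProc.subst_id, Multiset.mem_singleton] at hc
    exact .inr ⟨b, hb, .inl hc⟩

/-! ### Stores with private information -/

/-- The additional facts concern `outp'` at names foreign to `X`. A guard over `X` could use them
only if one of its arguments evaluated to such a name, which `nf_eq_var` excludes. -/
theorem sent_core {X : Set ℕ} {L L' : Set (Constr S)} (hL : ∀ c ∈ L, TellOK c ∧ SuppC X c)
    (hL' : ∀ c ∈ L', ∃ s, s ∉ X ∧ c = opv (.var s)) {n : ℕ} {c : Constr S} (hc : GuardOK n c)
    (hs : substC (upS n (ret X)) c = c) (t : Fin n → Val S)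
    (h : SEnt (L ∪ L') (substC (instS t) c)) : SEnt L (substC (instS t) c) := by
  have hL1 : ∀ c ∈ L, TellOK c := fun c hc => (hL c hc).1
  have hU : ∀ c ∈ L ∪ L', TellOK c := by
    rintro c (hc | hc)
    · exact hL1 c hc
    · obtain ⟨s, -, rfl⟩ := hL' c hc
      exact .inl ⟨_, _, _, rfl⟩
  have opv_mem : ∀ s, (∃ u, SuppV X u ∧ u = (.var s : Val S)) → s ∈ X := by
    rintro s ⟨u, hu, rfl⟩
    exact suppV_var.1 hu
  have key : ∀ {m : ℕ} (p : Pr m) (ts : Fin m → Tm S), substC (upS n (ret X)) (atom p ts) =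
      atom p ts → (n = 0 ∨ (isOutp p = false ∧ ∀ j < n, ∃ i, ts i = Term.var j)) →
      SEnt (L ∪ L') (substC (instS t) (atom p ts)) → SEnt L (substC (instS t) (atom p ts)) := by
    intro m p ts hs hd h
    rw [substC_atom, sent_atom hU] at h
    rw [substC_atom, sent_atom hL1]
    obtain ⟨ts', h1 | h1, h2⟩ := h
    · exact ⟨ts', h1, h2⟩
    · exfalso
      obtain ⟨s, hs1, hs2⟩ := hL' _ h1
      obtain rfl := atom_arity_inj hs2
      obtain rfl := atom_pred_inj hs2
      obtain rfl := atom_inj hs2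
      rcases hd with rfl | ⟨h3, -⟩
      · have e1 : instS t = Val.var := by funext i; simp [instS]
        have h4 : nf (substT (instS t) (ts 0)) = nf (Val.var s : Val S).tm := h2 0
        rw [e1, substT_id] at h4
        have h5 := nf_eq_var (e := ts 0) (i := s) (h4.trans (nf_tm _))
        rw [upS_zero, substC_atom] at hs
        have h6 := congrFun (atom_inj hs) 0
        rw [h5, substT_var] at h6
        exact hs1 (ret_var_iff.1 (tm_injective h6))
      · simp [isOutp] at h3
  cases hc with
  | base p ts hd => exact key p ts hs hd h
  | atGo p ts v hd =>
    rw [substC_inf] at hs h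
    rw [sent_inf] at h
    have hs1 : substC (upS n (ret X)) (atom p ts) = atom p ts ∧
        substC (upS n (ret X)) (opv v) = opv v := by
      have hs' : (substC (upS n (ret X)) (atom p ts) ⊓ substC (upS n (ret X)) (opv v) :
        (Lg S).Formula ℕ) = atom p ts ⊓ opv v := hs
      simpa [BoundedFormula.instMin, min, BoundedFormula.not] using hs'
    have h1 := key p ts hs1.1 hd h.1
    rw [substC_inf, sent_inf]
    refine ⟨h1, ?_⟩
    -- The atom of the guard comes from the core store and fixes the tuple, so the go name of the
    -- guard also lies in `X` after instantiation.
    have ht : ∀ i, SuppV X (t i) := guard_supp hL1 (fun c hc => (hL c hc).2) (.base p ts hd) t h1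
    have h2 := h.2
    rw [substC_opv, opv, sent_atom hU] at h2
    rw [substC_opv, opv, sent_atom hL1]
    obtain ⟨ts', h3 | h3, h4⟩ := h2
    · exact ⟨ts', h3, h4⟩
    · exfalso
      obtain ⟨s, hs3, hs2⟩ := hL' _ h3
      obtain rfl := atom_inj hs2
      have h5 : nf (v.subst (instS t)).tm = nf (Val.var s : Val S).tm := h4 0
      have h6 : v.subst (instS t) = .var s := tm_injective ((nf_tm _).symm.trans (h5.trans (nf_tm _)))
      have h7 : v.subst (upS n (ret X)) = v := opv_inj ((substC_opv _ _).symm.trans hs1.2)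
      refine hs3 (opv_mem s ⟨_, ?_, h6⟩)
      have e : (fun i => (t i).subst (ret X)) = t := funext ht
      unfold SuppV
      rw [Val.subst_subst, cmp_instS, e, ← Val.subst_subst, h7]
  | eq a b =>
    rw [substC_equal, sent_equal hU] at h
    rw [substC_equal, sent_equal hL1]
    exact h

theorem Fire.core {X : Set ℕ} {L L' : Set (Constr S)} (hL : ∀ c ∈ L, TellOK c ∧ SuppC X c)
    (hL' : ∀ c ∈ L', ∃ s, s ∉ X ∧ c = opv (.var s)) {a Q : UProc S} {e} (ha : Good true a)
    (hs : Supp X a) (h : Fire (L ∪ L') a Q e) : Fire L a Q e := by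
  cases h with
  | tell c => exact .tell c
  | bang => exact .bang
  | @unl c P h =>
    refine .unl ?_
    obtain ⟨⟨v, rfl⟩, -⟩ := ha
    have h1 : substC (upS 0 (ret X)) (opv v) = opv v := by
      rw [upS_zero]
      exact (UProc.unl.inj hs).1
    have e1 : ∀ t : Fin 0 → Val S, instS t = Val.var := fun t => by funext i; simp [instS]
    have := sent_core hL hL' (.base (n := 0) Pr.outp' ![v.tm] (.inl rfl)) h1 Fin.elim0
    rw [e1, substC_id] at this
    exact this h
  | @abs n c ex P t h h' =>
    exact .abs t (sent_core hL hL' ha.1 (by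
      unfold Supp at hs
      simp only [UProc.subst, UProc.abs.injEq, true_and, heq_eq_eq] at hs
      exact hs.1) t h) h'

/-! ### States with residuals -/

/-- The state `X` consists of `X0` and the residuals `G`, for the private names in `D` and `T`. -/
structure Gb (D T : Finset ℕ) (X0 : MS S) (G : Multiset (UProc S)) (X : MS S) : Prop where
  agents : X.A = X0.A + G
  store : ∃ Lg, X.L = X0.L ∪ Lg ∧ ∀ c ∈ Lg, ∃ s ∈ T, c = opv (.var s)
  garbage : ∀ a ∈ G, Garbage D T a
  names : X.N = X0.N
  -- Names in `D` and `T` do not occur in the core.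
  wf : WF (⟨X0.A, X0.L, X0.N \ (D ∪ T)⟩ : MS S)
  odd : ∀ x ∈ D ∪ T, x % 2 = 1 ∧ x ∈ X0.N
  disj : Disjoint D T
  halts : ∀ s ∈ T, Act (opv (.var s)) X.A X.L
  clock : Act kf X0.A X0.L

theorem Gb.not_mem {D T : Finset ℕ} {X0 X : MS S} {G} (h : Gb D T X0 G X) {x : ℕ}
    (hx : x ∈ D ∪ T) : x ∉ Nm (X0.N \ (D ∪ T)) := by
  rintro (h1 | h1)
  · have := (h.odd x hx).1; omega
  · exact (Finset.mem_sdiff.1 h1).2 hx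

theorem Gb.tellOK {D T : Finset ℕ} {X0 X : MS S} {G} (h : Gb D T X0 G X) : ∀ c ∈ X.L, TellOK c := by
  obtain ⟨Lg, h1, h2⟩ := h.store
  rw [h1]
  rintro c (hc | hc)
  · exact (h.wf.2 c hc).1
  · obtain ⟨s, -, rfl⟩ := h2 c hc
    exact .inl ⟨_, _, _, rfl⟩

theorem suppC_opv {X : Set ℕ} {v : Val S} : SuppC X (opv v) ↔ SuppV X v := by
  unfold SuppC SuppV
  rw [substC_opv]
  exact ⟨opv_inj, fun h => by rw [h]⟩

theorem Gb.not_told {D T : Finset ℕ} {X0 X : MS S} {G} (h : Gb D T X0 G X) :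
    ∀ g ∈ D, opv (.var g) ∉ X.L := by
  obtain ⟨Lg, h1, h2⟩ := h.store
  rw [h1]
  rintro g hg (hc | hc)
  · exact h.not_mem (Finset.mem_union_left _ hg) (suppV_var.1 (suppC_opv.1 (h.wf.2 _ hc).2))
  · obtain ⟨s, hs, h3⟩ := h2 _ hc
    obtain rfl : g = s := by simpa using opv_inj h3
    exact Finset.disjoint_left.1 h.disj hg hs

/-- Facts told by residuals concern names absent from the core, hence open no guard of the core. -/
theorem Gb.fire_core {D T : Finset ℕ} {X0 X : MS S} {G} (h : Gb D T X0 G X) {a Q : UProc S} {e}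
    (ha : a ∈ X0.A) : Fire X.L a Q e ↔ Fire X0.L a Q e := by
  obtain ⟨Lg, h1, h2⟩ := h.store
  rw [h1]
  constructor
  · intro hf
    refine Fire.core h.wf.2 (fun c hc => ?_) (h.wf.1 a ha).1 (h.wf.1 a ha).2 hf
    obtain ⟨s, hs, rfl⟩ := h2 c hc
    exact ⟨s, h.not_mem (Finset.mem_union_right _ hs), rfl⟩
  · intro hf
    exact hf.mono fun g hg => hg.mono Set.subset_union_left

theorem Gb.core {D T : Finset ℕ} {X0 Y0 X Y : MS S} {G} (h : Gb D T X0 G X)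
    {a Q : UProc S} {A0 B : Multiset (UProc S)} {e : Set (Constr S)} {ν C} (hA : X0.A = a ::ₘ A0)
    (hf : Fire X0.L a Q e) (hd : Dec Q Val.var B ν C) (hν : Fresh X0.N ν)
    (hν1 : ∀ x ∈ ν, x % 4 = 1) (hY0 : Y0 = ⟨B + A0, X0.L ∪ e, X0.N ∪ ν.toFinset⟩)
    (hY : Y = ⟨B + (A0 + G), X.L ∪ e, X.N ∪ ν.toFinset⟩) :
    MStep X0 Y0 ∧ MStep X Y ∧ Gb D T Y0 G Y := by
  have hst : MStep X Y := ⟨a, A0 + G, Q, e, B, ν, C, by rw [h.agents, hA, Multiset.cons_add],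
    (h.fire_core (by rw [hA]; simp)).2 hf, hd, by rw [h.names]; exact hν, hν1, hY⟩
  have hst0 : MStep X0 Y0 := ⟨a, A0, Q, e, B, ν, C, hA, hf, hd, hν, hν1, hY0⟩
  refine ⟨hst0, hst, ?_⟩
  obtain ⟨Lg, h1, h2⟩ := h.store
  have hwf : WF (⟨Y0.A, Y0.L, Y0.N \ (D ∪ T)⟩ : MS S) := by
    have := MStep.wf (X := ⟨X0.A, X0.L, X0.N \ (D ∪ T)⟩) ⟨a, A0, Q, e, B, ν, C, hA, hf, hd,
      hν.mono Finset.sdiff_subset, hν1, rfl⟩ h.wf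
    have e1 : (X0.N ∪ ν.toFinset) \ (D ∪ T) = X0.N \ (D ∪ T) ∪ ν.toFinset := by
      rw [Finset.union_sdiff_distrib]
      congr 1
      rw [Finset.sdiff_eq_self_iff_disjoint, Finset.disjoint_left]
      intro x hx hx'
      exact (hν.2 x (List.mem_toFinset.1 hx)).2 (h.odd x hx').2
    rw [hY0]
    simp only [e1]
    exact this
  subst hY0
  refine ⟨?_, ⟨Lg, ?_, h2⟩, h.garbage, ?_, hwf, fun x hx => ⟨(h.odd x hx).1,
    Finset.mem_union_left _ (h.odd x hx).2⟩, h.disj, fun s hs => (h.halts s hs).step hst,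
    h.clock.step hst0⟩
  · rw [hY, add_assoc]
  · rw [hY, h1, Set.union_right_comm]
  · rw [hY, h.names]

theorem Gb.core_step {D T : Finset ℕ} {X0 Y0 X : MS S} {G} (h : Gb D T X0 G X)
    (hs : MStep X0 Y0) : ∃ Y, MStep X Y ∧ Gb D T Y0 G Y := by
  obtain ⟨a, A0, Q, e, B, ν, C, hA, hf, hd, hν, hν1, hY⟩ := hs
  exact ⟨_, (h.core hA hf hd hν hν1 hY rfl).2⟩

theorem Gb.garbage_step {D T : Finset ℕ} {X0 X Y : MS S} {G G0 : Multiset (UProc S)}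
    (h : Gb D T X0 G X) {a Q : UProc S} {B : Multiset (UProc S)} {e : Set (Constr S)} {ν C}
    (hG : G = a ::ₘ G0) (hf : Fire X.L a Q e) (hd : Dec Q Val.var B ν C)
    (hY : Y = ⟨B + (X0.A + G0), X.L ∪ e, X.N ∪ ν.toFinset⟩) :
    MStep X Y ∧ ∃ G', Gb D T X0 G' Y ∧ (G'.map weight).sum < (G.map weight).sum := by
  obtain ⟨rfl, h1, h2, h3⟩ := (h.garbage a (by rw [hG]; simp)).fire h.tellOK h.not_told hf hd
  have hst : MStep X Y := ⟨a, X0.A + G0, Q, e, B, [], C, by rw [h.agents, hG]; simp, hf, hd,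
    fresh_nil _, by simp, hY⟩
  refine ⟨hst, B + G0, ?_, by rw [hG]; simpa using h3⟩
  obtain ⟨Lg, h4, h5⟩ := h.store
  refine ⟨?_, ⟨Lg ∪ e, ?_, fun c hc => hc.elim (h5 c) (h2 c)⟩, fun b hb => ?_, ?_, h.wf, h.odd,
    h.disj, fun s hs => (h.halts s hs).step hst, h.clock⟩
  · rw [hY]; exact add_left_comm _ _ _
  · rw [hY, h4, Set.union_assoc]
  · rcases Multiset.mem_add.1 hb with hb | hb
    · exact h1 b hb
    · exact h.garbage b (by rw [hG]; simp [hb])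
  · rw [hY, h.names]; simp

theorem Gb.step {D T : Finset ℕ} {X0 X Y : MS S} {G} (h : Gb D T X0 G X) (hs : MStep X Y) :
    ∃ Y0 G', Relation.ReflTransGen MStep X0 Y0 ∧ Gb D T Y0 G' Y := by
  obtain ⟨a, A1, Q, e, B, ν, C, hA, hf, hd, hν, hν1, hY⟩ := hs
  have ha : a ∈ X0.A + G := by rw [← h.agents, hA]; simp
  rcases Multiset.mem_add.1 ha with ha | ha
  · obtain ⟨A0, hA0⟩ := Multiset.exists_cons_of_mem ha
    obtain rfl : A1 = A0 + G := by
      have := hA.symm.trans h.agents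
      rw [hA0, Multiset.cons_add] at this
      exact (Multiset.cons_inj_right _).1 this
    rw [h.fire_core ha] at hf
    rw [h.names] at hν
    obtain ⟨h1, -, h2⟩ := h.core hA0 hf hd hν hν1 rfl hY
    exact ⟨_, G, .single h1, h2⟩
  · obtain ⟨G0, hG⟩ := Multiset.exists_cons_of_mem ha
    obtain rfl : A1 = X0.A + G0 := by
      have := hA.symm.trans h.agents
      rw [hG, Multiset.add_cons] at this
      exact (Multiset.cons_inj_right _).1 this
    obtain ⟨-, G', h1, -⟩ := h.garbage_step hG hf hd hY
    exact ⟨X0, G', .refl, h1⟩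

/-- The total weight of the residuals decreases with each of their transitions. -/
theorem Gb.settle {D T : Finset ℕ} {X0 X : MS S} {G} (h : Gb D T X0 G X) :
    ∃ Y G', Relation.ReflTransGen MStep X Y ∧ Gb D T X0 G' Y ∧
      ∀ a ∈ G', ∀ Q e, ¬ Fire Y.L a Q e := by
  generalize hn : (G.map weight).sum = n
  induction n using Nat.strong_induction_on generalizing G X with
  | _ n ih =>
    by_cases hq : ∀ a ∈ G, ∀ Q e, ¬ Fire X.L a Q e
    · exact ⟨X, G, .refl, h, hq⟩
    · push Not at hq
      obtain ⟨a, ha, Q, e, hf⟩ := hq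
      obtain ⟨G0, hG⟩ := Multiset.exists_cons_of_mem ha
      obtain ⟨B, ν, C, hd, -⟩ := exists_dec Q Val.var ∅ (.inl rfl)
      obtain ⟨h1, G', h2, h3⟩ := h.garbage_step hG hf hd rfl
      obtain ⟨Y, G'', h4, h5, h6⟩ := ih _ (hn ▸ h3) h2 rfl
      exact ⟨Y, G'', .head h1 h4, h5, h6⟩

theorem Gb.quiet {D T : Finset ℕ} {X0 X : MS S} {G} (h : Gb D T X0 G X) :
    Quiet X ↔ Quiet X0 ∧ ∀ a ∈ G, ∀ Q e, ¬ Fire X.L a Q e := by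
  constructor
  · intro hq
    refine ⟨fun a ha Q e hf => hq a ?_ Q e ((h.fire_core ha).2 hf), fun a ha => hq a ?_⟩
    all_goals rw [h.agents]; simp [ha]
  · rintro ⟨h1, h2⟩ a ha Q e hf
    rw [h.agents, Multiset.mem_add] at ha
    rcases ha with ha | ha
    · exact h1 a ha Q e ((h.fire_core ha).1 hf)
    · exact h2 a ha Q e hf

theorem realize_opv {M : Type*} [(Lg S).Structure M] (w : ℕ → M) (i : ℕ) :
    Formula.Realize (opv (.var i) : Constr S) w ↔
      Structure.RelMap (L := Lg S) (M := M) Pr.outp' ![w i] := by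
  rw [opv, realize_atom]
  refine iff_of_eq (congrArg _ (funext fun j => ?_))
  fin_cases j
  rfl

/-- The stop names are private and absent from the core store, so their values may be chosen freely.
The witness of `kf` is a suitable value; without `kf` the residuals could be detected in the output.
-/
theorem Gb.out {D T : Finset ℕ} {X0 X : MS S} {G} (h : Gb D T X0 G X) (hk : kf ∈ X0.L)
    {d : Constr S} : Out X d ↔ Out X0 d := by
  obtain ⟨Lg, h1, h2⟩ := h.store
  refine forall_congr' fun M => forall_congr' fun v => ?_
  refine iff_congr Iff.rfl ⟨?_, ?_⟩
  · rintro ⟨w, hw, hs⟩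
    rw [h1, sat_union] at hs
    exact ⟨w, hw, hs.1⟩
  · rintro ⟨w, hw, hs⟩
    have h3 := hs _ hk
    rw [kf, realize_exC] at h3
    obtain ⟨x, hx⟩ := h3
    rw [op'_eq, realize_opv] at hx
    -- All stop names receive the witness of `kf`.
    refine ⟨fun i => if i ∈ T then x 0 else w i, fun i => ?_, ?_⟩
    · have hi : 2 * i ∉ T := fun hi => by
        have := (h.odd _ (Finset.mem_union_right _ hi)).1
        omega
      simp only [hi, if_false, hw]
    · rw [h1, sat_union]
      constructor
      · intro c hc
        refine ((h.wf.2 c hc).2.realize_congr fun i hi => ?_).2 (hs c hc)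
        rw [if_neg fun hT => h.not_mem (Finset.mem_union_right _ hT) hi]
      · intro c hc
        obtain ⟨s, hs, rfl⟩ := h2 c hc
        rw [realize_opv, if_pos hs]
        exact hx

/-! ### Residuals at the end of a time unit -/

theorem dec_prod_append {l l' : List (UProc S)} {σ : Sub S} {A ν C} :
    Dec (UProc.prod (l ++ l')) σ A ν C ↔ ∃ A1 A2 ν1 ν2 C1 C2, Dec (UProc.prod l) σ A1 ν1 C1 ∧
      Dec (UProc.prod l') σ A2 ν2 C2 ∧ A = A1 + A2 ∧ ν = ν1 ++ ν2 ∧ C = C1 ∪ C2 := by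
  induction l generalizing A ν C with
  | nil =>
    constructor
    · intro h
      exact ⟨0, A, [], ν, ∅, C, .skip _, h, by simp, by simp, by simp⟩
    · rintro ⟨_, _, _, _, _, _, h1, h2, rfl, rfl, rfl⟩
      obtain ⟨rfl, rfl, rfl⟩ := dec_skip_iff.1 h1
      simpa using h2
  | cons a l ih =>
    change Dec (.par a (UProc.prod (l ++ l'))) σ A ν C ↔ _
    rw [dec_par_iff]
    constructor
    · rintro ⟨A1, A2, ν1, ν2, C1, C2, h1, h2, rfl, rfl, rfl⟩
      obtain ⟨A3, A4, ν3, ν4, C3, C4, h3, h4, rfl, rfl, rfl⟩ := ih.1 h2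
      exact ⟨_, _, _, _, _, _, .par h1 h3, h4, (add_assoc _ _ _).symm,
        (List.append_assoc _ _ _).symm, (Set.union_assoc _ _ _).symm⟩
    · rintro ⟨A1, A2, ν1, ν2, C1, C2, h1, h2, rfl, rfl, rfl⟩
      obtain ⟨A3, A4, ν3, ν4, C3, C4, h3, h4, rfl, rfl, rfl⟩ := dec_par_iff.1 h1
      exact ⟨_, _, _, _, _, _, h3, ih.2 ⟨_, _, _, _, _, _, h4, h2, rfl, rfl, rfl⟩, add_assoc _ _ _,
        List.append_assoc _ _ _, Set.union_assoc _ _ _⟩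

theorem dec_prod_perm {l l' : List (UProc S)} (hl : l.Perm l') {σ : Sub S} {A ν C}
    (h : Dec (UProc.prod l) σ A ν C) : ∃ ν' C', Dec (UProc.prod l') σ A ν' C' ∧ ν.Perm ν' := by
  induction hl generalizing A ν C with
  | nil => exact ⟨_, _, h, .refl _⟩
  | cons a _ ih =>
    obtain ⟨A1, A2, ν1, ν2, C1, C2, h1, h2, rfl, rfl, rfl⟩ := dec_par_iff.1 h
    obtain ⟨ν', C', h3, h4⟩ := ih h2
    exact ⟨_, _, .par h1 h3, h4.append_left _⟩
  | swap a b l =>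
    obtain ⟨A1, A2, ν1, ν2, C1, C2, h1, h2, rfl, rfl, rfl⟩ := dec_par_iff.1 h
    obtain ⟨A3, A4, ν3, ν4, C3, C4, h3, h4, rfl, rfl, rfl⟩ := dec_par_iff.1 h2
    refine ⟨_, _, by rw [add_left_comm]; exact .par h3 (.par h1 h4), ?_⟩
    rw [← List.append_assoc, ← List.append_assoc]
    exact List.perm_append_comm.append_right _
  | trans _ _ h1 h2 =>
    obtain ⟨ν', C', h3, h4⟩ := h1 h
    obtain ⟨ν'', C'', h5, h6⟩ := h2 h3
    exact ⟨_, _, h5, h4.trans h6⟩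

theorem garbage_future {D T : Finset ℕ} {L : Set (Constr S)} (hT : ∀ s ∈ T, opv (.var s) ∈ L)
    {l : List (UProc S)} (hl : ∀ a ∈ l, Garbage D T a) (hq : ∀ a ∈ l, ∀ Q e, ¬ Fire L a Q e)
    {B ν C} (hd : Dec (UProc.prod (l.map UProc.future)) Val.var B ν C) :
    ν = [] ∧ ∀ b ∈ B, Garbage D T b := by
  induction l generalizing B ν C with
  | nil => obtain ⟨rfl, rfl, rfl⟩ := dec_skip_iff.1 hd; simp
  | cons a l ih =>
    obtain ⟨A1, A2, ν1, ν2, C1, C2, h1, h2, rfl, rfl, rfl⟩ := dec_par_iff.1 hd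
    obtain ⟨rfl, h3⟩ := (hl a (by simp)).future hT (hq a (by simp)) h1
    obtain ⟨rfl, h4⟩ := ih (fun b hb => hl b (by simp [hb])) (fun b hb => hq b (by simp [hb])) h2
    exact ⟨rfl, fun b hb => (Multiset.mem_add.1 hb).elim (h3 b) (h4 b)⟩

theorem Gb.of_tick {D T : Finset ℕ} {X0 X Y0 Y : MS S} {G B} (h : Gb D T X0 G X) (hq : Quiet X)
    (h0 : Tick X0 Y0) (h1 : Tick X Y) (hA : Y.A = Y0.A + B) (hB : ∀ b ∈ B, Garbage D T b)
    (hN : Y.N = Y0.N) : Gb D T Y0 B Y := by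
  have hwf : WF (⟨Y0.A, Y0.L, Y0.N \ (D ∪ T)⟩ : MS S) := by
    obtain ⟨l, ν, C, h2, h3, h4, h5, h6, h7⟩ := h0
    refine Tick.wf (X := ⟨X0.A, X0.L, X0.N \ (D ∪ T)⟩) ⟨l, ν, C, h2, h3,
      h4.mono Finset.sdiff_subset, h5, h6, ?_⟩ h.wf
    simp only [h7]
    rw [Finset.union_sdiff_distrib]
    congr 1
    rw [Finset.sdiff_eq_self_iff_disjoint, Finset.disjoint_left]
    intro x hx hx'
    exact (h4.2 x (List.mem_toFinset.1 hx)).2 (h.odd x hx').2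
  refine ⟨hA, ⟨∅, ?_, by simp⟩, hB, hN, hwf, fun x hx => ⟨(h.odd x hx).1, ?_⟩, h.disj,
    fun s hs => (h.halts s hs).tick hq h1, h.clock.tick (h.quiet.1 hq).1 h0⟩
  · obtain ⟨_, _, _, _, _, _, _, h2, _⟩ := h0
    obtain ⟨_, _, _, _, _, _, _, h3, _⟩ := h1
    rw [h2, h3, Set.union_empty]
  · obtain ⟨_, _, _, _, _, _, _, _, h2⟩ := h0
    rw [h2]
    exact Finset.mem_union_left _ (h.odd x hx).2

theorem Gb.tick {D T : Finset ℕ} {X0 X Y0 : MS S} {G} (h : Gb D T X0 G X) (hq : Quiet X)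
    (ht : Tick X0 Y0) : ∃ Y G', Tick X Y ∧ Gb D T Y0 G' Y := by
  have hT : ∀ s ∈ T, opv (.var s) ∈ X.L := fun s hs => ((h.halts s hs).of_quiet hq).2
  obtain ⟨B, ν', C', h1, -⟩ := exists_dec (UProc.prod (G.toList.map UProc.future)) Val.var ∅
    (.inl rfl)
  obtain ⟨rfl, h2⟩ := garbage_future hT (fun a ha => h.garbage a (Multiset.mem_toList.1 ha))
    (fun a ha => (h.quiet.1 hq).2 a (Multiset.mem_toList.1 ha)) h1
  obtain ⟨l, ν, C, h3, h4, h5, h6, h7, h8⟩ := id ht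
  have hY : Tick X ⟨Y0.A + B, ∅, X.N ∪ ν.toFinset⟩ := by
    refine ⟨l ++ G.toList, ν, C ∪ C', ?_, ?_, by rw [h.names]; exact h5, h6, rfl, rfl⟩
    · rw [← Multiset.coe_add, h3, Multiset.coe_toList, h.agents]
    · rw [List.map_append]
      exact dec_prod_append.2 ⟨_, _, _, _, _, _, h4, h1, rfl, by simp, rfl⟩
  exact ⟨_, B, hY, h.of_tick hq ht hY rfl h2 (by rw [h.names, h8])⟩

theorem Gb.tick' {D T : Finset ℕ} {X0 X Y : MS S} {G} (h : Gb D T X0 G X) (hq : Quiet X)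
    (ht : Tick X Y) : ∃ Y0 G', Tick X0 Y0 ∧ Gb D T Y0 G' Y := by
  have hT : ∀ s ∈ T, opv (.var s) ∈ X.L := fun s hs => ((h.halts s hs).of_quiet hq).2
  obtain ⟨l, ν, C, h3, h4, h5, h6, h7, h8⟩ := id ht
  have hl : l.Perm (X0.A.toList ++ G.toList) := by
    rw [← Multiset.coe_eq_coe, h3, h.agents, ← Multiset.coe_add, Multiset.coe_toList,
      Multiset.coe_toList]
  obtain ⟨ν', C', h9, h10⟩ := dec_prod_perm (hl.map UProc.future) h4
  rw [List.map_append] at h9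
  obtain ⟨A1, A2, ν1, ν2, C1, C2, h11, h12, hA, rfl, rfl⟩ := dec_prod_append.1 h9
  obtain ⟨rfl, h2⟩ := garbage_future hT (fun a ha => h.garbage a (Multiset.mem_toList.1 ha))
    (fun a ha => (h.quiet.1 hq).2 a (Multiset.mem_toList.1 ha)) h12
  rw [List.append_nil] at h10
  have hY : Tick X0 ⟨A1, ∅, X0.N ∪ ν1.toFinset⟩ :=
    ⟨X0.A.toList, ν1, C1, Multiset.coe_toList _, h11, by
      rw [← fresh_perm h10, ← h.names]; exact h5, fun x hx => h6 x (h10.mem_iff.2 hx), rfl, rfl⟩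
  refine ⟨_, A2, hY, h.of_tick hq hY ht hA h2 ?_⟩
  rw [h8, h.names]
  congr 1
  ext x
  simp [h10.mem_iff]

theorem Gb.steps {D T : Finset ℕ} {X0 X Y : MS S} {G} (h : Gb D T X0 G X)
    (hs : Relation.ReflTransGen MStep X Y) :
    ∃ Y0 G', Relation.ReflTransGen MStep X0 Y0 ∧ Gb D T Y0 G' Y := by
  induction hs with
  | refl => exact ⟨X0, G, .refl, h⟩
  | tail _ h1 ih =>
    obtain ⟨Y0, G', h2, h3⟩ := ih
    obtain ⟨Z0, G'', h4, h5⟩ := h3.step h1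
    exact ⟨Z0, G'', h2.trans h4, h5⟩

theorem Gb.core_steps {D T : Finset ℕ} {X0 X Y0 : MS S} {G} (h : Gb D T X0 G X)
    (hs : Relation.ReflTransGen MStep X0 Y0) :
    ∃ Y, Relation.ReflTransGen MStep X Y ∧ Gb D T Y0 G Y := by
  induction hs with
  | refl => exact ⟨X, .refl, h⟩
  | tail _ h1 ih =>
    obtain ⟨Y, h2, h3⟩ := ih
    obtain ⟨Z, h4, h5⟩ := h3.core_step h1
    exact ⟨Z, h2.tail h4, h5⟩

/-- Residuals have no effect on the observations. -/
theorem Gb.traces {D T : Finset ℕ} {X0 X : MS S} {G} (h : Gb D T X0 G X) : tr ObsM X = tr ObsM X0 := by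
  apply Set.Subset.antisymm
  · refine tr_subset (fun X X0 => ∃ G, Gb D T X0 G X) ?_ ⟨G, h⟩
    rintro X X0 d X' ⟨G, h⟩ ⟨Y, h1, h2, h3, h4⟩
    obtain ⟨Y0, G', h5, h6⟩ := h.steps h1
    have hq := (h6.quiet.1 h2).1
    obtain ⟨X0', G'', h7, h8⟩ := h6.tick' h2 h4
    exact ⟨X0', ⟨Y0, h5, hq, (h6.out (h6.clock.of_quiet hq).2).1 h3, h7⟩, G'', h8⟩
  · refine tr_subset (fun X0 X => ∃ G, Gb D T X0 G X) ?_ ⟨G, h⟩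
    rintro X0 X d X0' ⟨G, h⟩ ⟨Y0, h1, h2, h3, h4⟩
    obtain ⟨Y, h5, h6⟩ := h.core_steps h1
    -- The core is quiet, but the residuals still have to run down before the time unit can end.
    obtain ⟨Z, G', h7, h8, h9⟩ := h6.settle
    have hq := h8.quiet.2 ⟨h2, h9⟩
    obtain ⟨X', G'', h10, h11⟩ := h8.tick hq h4
    exact ⟨X', ⟨Z, h5.trans h7, hq, (h8.out (h8.clock.of_quiet h2).2).2 h3, h10⟩, G'', h11⟩

/-! ### Properties of the encoding -/

theorem substT_upS_shiftS (n : ℕ) (σ : Sub S) (t : Tm S) :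
    substT (upS n σ) (substT (shiftS S n) t) = substT (shiftS S n) (substT σ t) := by
  rw [substT_substT, substT_substT, cmp_shiftS_upS]

theorem tellP_subst {n : ℕ} (p : Pr n) (ts : Fin n → Tm S) (σ : Sub S) :
    (UProc.tellP p ts).subst σ = .tellP p fun i => substT σ (ts i) := by
  have h0 : substC (upS 2 σ) (UProc.op' 0) = UProc.op' 0 := by
    rw [substC_op']; simp [upS, op'_eq]
  have h1 : substC (upS 2 σ) (UProc.op' 1) = UProc.op' 1 := by
    rw [substC_op']; simp [upS, op'_eq]
  simp only [UProc.tellP, UProc.subst, UProc.when, substC_top, upS_zero, h0, h1, substC_atom,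
    substT_upS_shiftS, List.map_nil]

theorem upS_add (n m : ℕ) (σ : Sub S) {i : ℕ} (h : i < m) :
    upS n (upS m σ) (n + i) = .var (n + i) := by
  rw [upS_upS]
  simp [upS, h]

theorem waitC_subst (n : ℕ) (c : Constr S) (P : UProc S) (σ : Sub S) :
    (UProc.waitC n c P).subst σ = .waitC n (substC (upS n σ) c) (P.subst (upS n σ)) := by
  have h0 : substC (upS 2 σ) (UProc.op' 0) = UProc.op' 0 := by
    rw [substC_op']; simp [upS, op'_eq]
  have h1 : substC (upS 2 σ) (UProc.op' 1) = UProc.op' 1 := by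
    rw [substC_op']; simp [upS, op'_eq]
  have h2 : substC (upS n (upS 2 σ)) (UProc.op' n) = UProc.op' n := by
    rw [substC_op', op'_eq]
    exact congrArg opv (upS_add n 2 σ (i := 0) (by omega))
  have h3 : substC (upS n (upS 2 σ)) (UProc.op' (n + 1)) = UProc.op' (n + 1) := by
    rw [substC_op', op'_eq]
    exact congrArg opv (upS_add n 2 σ (i := 1) (by omega))
  simp only [UProc.waitC, UProc.subst, substC_top, h0, h1, substC_inf, h2, h3, substC_substC,
    UProc.subst_subst, cmp_upS_upS, cmp_shiftS_upS, List.map_nil]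

theorem waitP_subst {m : ℕ} (n : ℕ) (p : Pr m) (ts : Fin m → Tm S) (P : UProc S) (σ : Sub S) :
    (UProc.waitP n p ts P).subst σ =
      .waitP n p (fun i => substT (upS n σ) (ts i)) (P.subst (upS n σ)) := by
  rw [UProc.waitP, waitC_subst]
  simp only [UProc.subst, substC_atom, UProc.waitP]

theorem whenever_subst {m : ℕ} (p : Pr m) (ts : Fin m → Tm S) (P : UProc S) (σ : Sub S) :
    (UProc.whenever p ts P).subst σ = .whenever p (fun i => substT σ (ts i)) (P.subst σ) := by
  rw [UProc.whenever, waitP_subst, upS_zero]; rfl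

theorem substT_nm (n : ℕ) (σ : Sub S) {i : ℕ} (h : i < n) : substT (upS n σ) (nm S i) = nm S i := by
  rw [nm, substT_var]
  simp [upS, h, Val.tm]

/-- Communication substitutes in the source and firing an abstraction substitutes in the target;
this identifies the two. -/
theorem enc_subst (P : HProc S) (σ : Sub S) : enc (P.subst σ) = (enc P).subst σ := by
  have fin2 : ∀ (σ : Sub S) (a b : Tm S), (fun i => substT σ (![a, b] i)) =
      ![substT σ a, substT σ b] := by
    intro σ a b; funext i; fin_cases i <;> rfl
  have cons : ∀ {n : ℕ} (σ : Sub S) (a : Tm S) (b : Fin n → Tm S),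
      (fun i => substT σ ((Fin.cons a b : Fin (n + 1) → Tm S) i)) =
      (Fin.cons (substT σ a) fun i => substT σ (b i) : Fin (n + 1) → Tm S) := by
    intro n σ a b; funext i; refine Fin.cases ?_ (fun i => ?_) i <;> rfl
  induction P generalizing σ with
  | request a P ih =>
    simp only [HProc.subst, enc, UProc.subst, tellP_subst, whenever_subst, fin2, ih, substC_top,
      Val.subst_subst, cmp_shiftS_upS, substT_tm, substT_nm 1 σ Nat.zero_lt_one]
  | accept a P ih =>
    simp only [HProc.subst, enc, UProc.subst, waitP_subst, fin2, ih, substC_atom,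
      Val.subst_subst, cmp_shiftS_upS, substT_tm, substT_nm 1 σ Nat.zero_lt_one]
  | send k n es P ih =>
    simp only [HProc.subst, enc, UProc.subst, tellP_subst, whenever_subst, cons, ih, substT_tm]
  | recv k n P ih =>
    simp only [HProc.subst, enc, UProc.subst, waitP_subst, cons, ih, Val.subst_subst, cmp_shiftS_upS, substT_tm,
      substT_nm n σ (Fin.is_lt _)]
  | select k l P ih =>
    simp only [HProc.subst, enc, UProc.subst, tellP_subst, whenever_subst, fin2, ih, substT_tm]
    rfl
  | branch k n ls Ps ih =>
    simp only [HProc.subst, enc, waitP_subst, fin2, ih, prod_subst, List.map_ofFn,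
      Val.subst_subst, cmp_shiftS_upS, substT_tm, substT_nm 1 σ Nat.zero_lt_one]
    congr 3
    funext i
    simp only [Function.comp, UProc.when, UProc.subst, upS_zero, substC_equal, substT_tm,
      substT_nm 1 σ Nat.zero_lt_one, UProc.subst_subst, List.map_nil, cmp_shiftS_upS]
    rfl
  | throwCh k k' P ih =>
    simp only [HProc.subst, enc, UProc.subst, tellP_subst, whenever_subst, fin2, ih, substT_tm]
  | catchCh k P ih =>
    simp only [HProc.subst, enc, UProc.subst, waitP_subst, fin2, ih,
      Val.subst_subst, cmp_shiftS_upS, substT_tm, substT_nm 1 σ Nat.zero_lt_one]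
  | ite e P Q h1 h2 =>
    simp only [HProc.subst, enc, UProc.subst, UProc.when, h1, h2, upS_zero, substC_equal, substT_tm,
      List.map_nil]
    rfl
  | par P Q h1 h2 => simp only [HProc.subst, enc, UProc.subst, h1, h2]
  | inact => rfl
  | nu P ih => simp only [HProc.subst, enc, UProc.subst, ih, substC_top]
  | call X n es => simp only [HProc.subst, enc, UProc.subst, substC_atom]

/-! ### Congruence and shape of encodings -/

theorem Cg.waitC {n : ℕ} {c : Constr S} {P Q : UProc S} (h : Cg P Q) :
    Cg (.waitC n c P) (.waitC n c Q) :=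
  .loc (.par (.refl _) (.par (.refl _) (.bang (.abs (fun _ => Iff.rfl)
    (.par (h.subst _) (.refl _))))))

theorem Cg.waitP {m n : ℕ} {p : Pr m} {ts : Fin m → Tm S} {P Q : UProc S} (h : Cg P Q) :
    Cg (.waitP n p ts P) (.waitP n p ts Q) := .waitC (.par h (.refl _))

theorem Cg.prod_ofFn {n : ℕ} {f g : Fin n → UProc S} (h : ∀ i, Cg (f i) (g i)) :
    Cg (UProc.prod (List.ofFn f)) (UProc.prod (List.ofFn g)) := by
  induction n with
  | zero => simp only [List.ofFn_zero]; exact .refl _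
  | succ n ih =>
    rw [List.ofFn_succ, List.ofFn_succ]
    exact .par (h 0) (ih fun i => h i.succ)

/-- The laws for `nu` on `inact` and for exchanging two `nu` are the reason for the rules `loc_skip`
and `loc_swap` of `Cg`; the congruence of the target calculus does not list them. -/
theorem cg_enc {P Q : HProc S} (h : HProc.SC P Q) : Cg (enc P) (enc Q) := by
  induction h with
  | refl P => exact .refl _
  | symm _ ih => exact .symm ih
  | trans _ _ h1 h2 => exact .trans h1 h2
  | request _ ih => exact .loc (.par (.refl _) (.waitP (.next ih)))
  | accept _ ih => exact .waitP (.par (.refl _) (.next ih))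
  | send _ ih => exact .par (.refl _) (.waitP (.next ih))
  | recv _ ih => exact .waitP (.next ih)
  | select _ ih => exact .par (.refl _) (.waitP (.next ih))
  | branch _ ih =>
    exact .waitP (.prod_ofFn fun i => .abs (fun _ => Iff.rfl) (.next ((ih i).subst _)))
  | throwCh _ ih => exact .par (.refl _) (.waitP (.next ih))
  | catchCh _ ih => exact .waitP (.next ih)
  | ite _ _ h1 h2 =>
    exact .par (.abs (fun _ => Iff.rfl) (.next h1)) (.abs (fun _ => Iff.rfl) (.next h2))
  | par _ _ h1 h2 => exact .par h1 h2
  | nu _ ih => exact .loc ih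
  | par_inact P => exact .par_skip _
  | par_comm P Q => exact .par_comm _ _
  | par_assoc P Q R => exact (Cg.par_assoc _ _ _).symm
  | nu_inact => exact .loc_skip _ _ fun _ _ => id
  | nu_swap P =>
    have := Cg.loc_swap (enc P)
    rw [← enc_subst] at this
    exact this
  | nu_par P Q =>
    refine (Cg.par_comm _ _).trans ((Cg.par_loc _ _ _ _).trans (.loc ((Cg.par_comm _ _).trans ?_)))
    rw [← enc_subst]
    exact .refl _

theorem valid_top : Valid (⊤ : Constr S) := fun _ _ => id

theorem good_tellP {n : ℕ} (p : Pr n) (ts : Fin n → Tm S) : Good true (UProc.tellP p ts) := by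
  refine ⟨fun _ => valid_top, .inl ⟨_, _, _, rfl⟩, ⟨.base _ _ (.inl rfl), .inl ⟨_, _, _, rfl⟩⟩,
    ⟨⟨_, op'_eq 1⟩, .inl ⟨_, _, _, rfl⟩⟩, ⟨.base _ _ (.inl rfl), .inl ⟨_, _, _, rfl⟩⟩⟩

theorem good_waitP {m n : ℕ} {p : Pr m} {ts : Fin m → Tm S} {P : UProc S}
    (hd : n = 0 ∨ (isOutp p = false ∧ ∀ j < n, ∃ i, ts i = Term.var j)) (h : Good true P) :
    Good true (UProc.waitP n p ts P) := by
  refine ⟨fun _ => valid_top, .inl ⟨_, _, _, rfl⟩, ⟨⟨_, op'_eq 1⟩, .inl ⟨_, _, _, rfl⟩⟩, ?_, ?_,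
    .inl ⟨_, _, _, rfl⟩⟩
  · rw [substC_atom]
    exact .atGo p _ (.var n) (det_subst hd _)
  · exact Good.subst (P := .par P (.tell _)) ⟨h, .inl ⟨_, _, _, rfl⟩⟩ _

theorem good_prod {l : List (UProc S)} {b : Bool} (h : ∀ a ∈ l, Good b a) :
    Good b (UProc.prod l) := by
  induction l with
  | nil => trivial
  | cons a l ih => exact ⟨h a (by simp), ih fun b hb => h b (by simp [hb])⟩

theorem good_enc (P : HProc S) : Good true (enc P) := by
  -- The received name is argument `1` of the awaited atom.
  have det1 : ∀ {p : Pr 2} (hp : isOutp p = false) (t : Tm S), 1 = 0 ∨ (isOutp p = false ∧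
      ∀ j < 1, ∃ i, (![t, nm S 0] : Fin 2 → Tm S) i = Term.var j) := by
    refine fun hp t => .inr ⟨hp, fun j hj => ⟨1, ?_⟩⟩
    obtain rfl : j = 0 := by omega
    rfl
  induction P with
  | request a P ih =>
    exact ⟨fun _ => valid_top, good_tellP _ _, good_waitP (P := .next (enc P)) (.inl rfl) ih⟩
  | accept a P ih =>
    exact good_waitP (P := .par _ (.next (enc P))) (det1 rfl _) ⟨.inl ⟨_, _, _, rfl⟩, ih⟩
  | send k n es P ih =>
    exact ⟨good_tellP _ _, good_waitP (P := .next (enc P)) (.inl rfl) ih⟩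
  | recv k n P ih =>
    refine good_waitP (P := .next (enc P)) (.inr ⟨rfl, fun j hj => ⟨(⟨j, hj⟩ : Fin n).succ, ?_⟩⟩) ih
    rfl
  | select k l P ih =>
    exact ⟨good_tellP _ _, good_waitP (P := .next (enc P)) (.inl rfl) ih⟩
  | branch k n ls Ps ih =>
    refine good_waitP (det1 rfl _) (good_prod fun a ha => ?_)
    obtain ⟨i, rfl⟩ := (List.mem_ofFn' _ _).1 ha
    exact ⟨.eq _ _, (ih i).subst (b := true) _⟩
  | throwCh k k' P ih =>
    exact ⟨good_tellP _ _, good_waitP (P := .next (enc P)) (.inl rfl) ih⟩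
  | catchCh k P ih =>
    exact good_waitP (P := .next (enc P)) (det1 rfl _) ih
  | ite e P Q h1 h2 => exact ⟨⟨.eq _ _, h1⟩, .eq _ _, h2⟩
  | par P Q h1 h2 => exact ⟨h1, h2⟩
  | inact => trivial
  | nu P ih => exact ⟨fun _ => valid_top, ih⟩
  | call X n es => exact .inl ⟨_, _, _, rfl⟩

/-- The replicated abstractions for the recursion declarations. -/
def encD (D : Decl S) : List (UProc S) := D.mapIdx fun X d =>
  .bang (.abs d.1 (atom (Pr.call X d.1) (fun i => nm S i)) [] (enc d.2))

theorem program_enc (P : Program S) : P.enc = .par (UProc.prod (encD P.decl)) (enc P.body) := rfl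

theorem good_encD (D : Decl S) : ∀ a ∈ encD D, Good true a := by
  intro a ha
  obtain ⟨i, hi, rfl⟩ := List.mem_mapIdx.1 ha
  exact ⟨.base _ _ (.inr ⟨rfl, fun j hj => ⟨⟨j, hj⟩, rfl⟩⟩), good_enc _⟩

theorem good_program (P : Program S) : Good true P.enc :=
  ⟨good_prod (good_encD P.decl), good_enc P.body⟩

/-- The process that is added to hide the private information in the outputs. -/
def clockK (S : Sig.{u}) : UProc S := .bang (.tell kf)

theorem good_clock : Good true (clockK S) := .inr rfl

theorem obsEquiv_iff (P Q : UProc S) : UProc.ObsEquiv P Q ↔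
    UProc.outputs (.par P (clockK S)) = UProc.outputs (.par Q (clockK S)) := Iff.rfl

/-! ### Evaluation of one time unit -/

/-- `Ev L P R k`: in the final store `L`, the process `P` has the residual processes `R` for the
next time unit; it tells constraints in `L` only, creates no private names, and makes at most `k`
transitions. -/
inductive Ev (L : Set (Constr S)) : UProc S → Multiset (UProc S) → ℕ → Prop
  | skip : Ev L .skip 0 0
  | par {P Q R R' k k'} : Ev L P R k → Ev L Q R' k' → Ev L (.par P Q) (R + R') (k + k')
  | tell {c} : c ∈ L → Ev L (.tell c) 0 1
  | next (P) : Ev L (.next P) {P} 0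
  | unl_pos {c P} : SEnt L c → Ev L (.unl c P) 0 1
  | unl_neg {c P} : ¬ SEnt L c → Ev L (.unl c P) {P} 0
  | bang {P R k} : Ev L P R k → Ev L (.bang P) (R + {.bang P}) (k + 1)
  | exhausted {n c ex P} : (∀ t : Fin n → Val S, SEnt L (substC (instS t) c) → t ∈ ex) →
      Ev L (.abs n c ex P) 0 0
  | fire {n c ex P R R' k k'} (t : Fin n → Val S) : SEnt L (substC (instS t) c) → t ∉ ex →
      Ev L (P.subst (instS t)) R k → Ev L (.abs n c (t :: ex) P) R' k' →
      Ev L (.abs n c ex P) (R + R') (k + k' + 1)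

/-- Evaluation of a multiset of agents. -/
def EvM (L : Set (Constr S)) (A R : Multiset (UProc S)) (k : ℕ) : Prop :=
  ∃ T : Multiset (Multiset (UProc S) × ℕ), Multiset.Rel (fun a x => Ev L a x.1 x.2) A T ∧
    R = (T.map Prod.fst).sum ∧ k = (T.map Prod.snd).sum

theorem EvM.zero (L : Set (Constr S)) : EvM L 0 0 0 := ⟨0, .zero, rfl, rfl⟩

theorem EvM.singleton {L : Set (Constr S)} {a : UProc S} {R k} (h : Ev L a R k) : EvM L {a} R k :=
  ⟨{(R, k)}, Multiset.rel_cons_left.2 ⟨_, 0, h, .zero, rfl⟩, by simp, by simp⟩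

theorem EvM.add {L : Set (Constr S)} {A A' R R' : Multiset (UProc S)} {k k'} (h : EvM L A R k)
    (h' : EvM L A' R' k') : EvM L (A + A') (R + R') (k + k') := by
  obtain ⟨T, h1, rfl, rfl⟩ := h
  obtain ⟨T', h2, rfl, rfl⟩ := h'
  exact ⟨T + T', h1.add h2, by simp, by simp⟩

theorem evM_cons {L : Set (Constr S)} {a : UProc S} {A R : Multiset (UProc S)} {k} :
    EvM L (a ::ₘ A) R k ↔ ∃ R1 k1 R2 k2, Ev L a R1 k1 ∧ EvM L A R2 k2 ∧ R = R1 + R2 ∧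
      k = k1 + k2 := by
  constructor
  · rintro ⟨T, h1, rfl, rfl⟩
    obtain ⟨x, T', h2, h3, rfl⟩ := Multiset.rel_cons_left.1 h1
    exact ⟨_, _, _, _, h2, ⟨T', h3, rfl, rfl⟩, by simp, by simp⟩
  · rintro ⟨R1, k1, R2, k2, h1, h2, rfl, rfl⟩
    exact (EvM.singleton h1).add h2

theorem Ev.dec {L : Set (Constr S)} {Q : UProc S} {R k} (h : Ev L Q R k) {B ν C}
    (hd : Dec Q Val.var B ν C) : ν = [] ∧ EvM L B R k := by
  induction h generalizing B ν C with
  | skip => obtain ⟨rfl, rfl, rfl⟩ := dec_skip_iff.1 hd; exact ⟨rfl, .zero L⟩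
  | par _ _ h1 h2 =>
    obtain ⟨A1, A2, ν1, ν2, C1, C2, h3, h4, rfl, rfl, rfl⟩ := dec_par_iff.1 hd
    obtain ⟨rfl, h5⟩ := h1 h3
    obtain ⟨rfl, h6⟩ := h2 h4
    exact ⟨rfl, h5.add h6⟩
  | _ =>
    obtain ⟨rfl, rfl, rfl⟩ := (dec_agent_iff (by trivial)).1 hd
    rw [UProc.subst_id]
    refine ⟨rfl, .singleton ?_⟩
    first
      | exact .tell ‹_›
      | exact .next _
      | exact .unl_pos ‹_›
      | exact .unl_neg ‹_›
      | exact .bang ‹_›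
      | exact .exhausted ‹_›
      | exact .fire _ ‹_› ‹_› ‹_› ‹_›

theorem Ev.ex_congr {L : Set (Constr S)} {n : ℕ} {c : Constr S} {ex ex' : List (Fin n → Val S)}
    {P : UProc S} {R k} (h : Ev L (.abs n c ex P) R k) (hex : ∀ t, t ∈ ex ↔ t ∈ ex') :
    Ev L (.abs n c ex' P) R k := by
  generalize hQ : UProc.abs n c ex P = Q at h
  induction h generalizing ex ex' with
  | exhausted h1 =>
    cases hQ
    exact .exhausted fun t ht => (hex t).1 (h1 t ht)
  | fire t h1 h2 h3 _ _ ih =>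
    cases hQ
    refine .fire t h1 (fun h => h2 ((hex t).2 h)) h3 (ih (fun u => ?_) rfl)
    simp [hex]
  | _ => cases hQ

/-- The instances of an abstraction may fire in any order: the chosen one is moved to the front, and
the tuples that precede it join the excluded ones. -/
theorem Ev.abs_fire {L : Set (Constr S)} {n : ℕ} {c : Constr S} {ex : List (Fin n → Val S)}
    {P : UProc S} {R k} (h : Ev L (.abs n c ex P) R k) {t : Fin n → Val S}
    (ht : SEnt L (substC (instS t) c)) (hex : t ∉ ex) :
    ∃ R1 R2 k1 k2, Ev L (P.subst (instS t)) R1 k1 ∧ Ev L (.abs n c (t :: ex) P) R2 k2 ∧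
      R = R1 + R2 ∧ k = k1 + k2 + 1 := by
  generalize hQ : UProc.abs n c ex P = Q at h
  induction h generalizing ex with
  | exhausted h1 => cases hQ; exact absurd (h1 t ht) hex
  | fire t' h1 h2 h3 h4 _ ih =>
    cases hQ
    by_cases hte : t = t'
    · subst hte; exact ⟨_, _, _, _, h3, h4, rfl, rfl⟩
    · obtain ⟨R1, R2, k1, k2, h5, h6, rfl, rfl⟩ := ih (ex := t' :: ex) (by simp [hte, hex]) rfl
      refine ⟨R1, _, k1, _, h5, .fire t' h1 (by simp [Ne.symm hte, h2]) h3
        (h6.ex_congr fun u => ?_), add_left_comm _ _ _, by omega⟩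
      simp only [List.mem_cons]; tauto
  | _ => cases hQ

theorem Ev.step {L T : Set (Constr S)} (hT : T ⊆ L) {a Q : UProc S} {e} (hf : Fire T a Q e) {R k}
    (h : Ev L a R k) : e ⊆ L ∧ ∃ k' < k, Ev L Q R k' := by
  cases hf with
  | tell c => cases h with
    | tell h => exact ⟨by simpa using h, 0, by omega, .skip⟩
  | unl h1 => cases h with
    | unl_pos h => exact ⟨by simp, 0, by omega, .skip⟩
    | unl_neg h => exact absurd (h1.mono hT) h
  | bang => cases h with
    | bang h => exact ⟨by simp, _, Nat.lt_succ_self _, .par h (.next _)⟩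
  | abs t h1 h2 =>
    obtain ⟨R1, R2, k1, k2, h3, h4, rfl, rfl⟩ := h.abs_fire (h1.mono hT) h2
    exact ⟨by simp, _, Nat.lt_succ_self _, .par h3 h4⟩

theorem EvM.step {L : Set (Constr S)} {X Y : MS S} (hs : MStep X Y) (hX : X.L ⊆ L) {R k}
    (h : EvM L X.A R k) : Y.L ⊆ L ∧ Y.N = X.N ∧ ∃ k' < k, EvM L Y.A R k' := by
  obtain ⟨a, A0, Q, e, B, ν, C, hA, hf, hd, -, -, rfl⟩ := hs
  rw [hA, evM_cons] at h
  obtain ⟨R1, k1, R2, k2, h1, h2, rfl, rfl⟩ := h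
  obtain ⟨h3, k', h4, h5⟩ := h1.step hX hf
  obtain ⟨rfl, h6⟩ := h5.dec hd
  exact ⟨Set.union_subset hX h3, by simp, _, by omega, h6.add h2⟩

theorem EvM.steps {L : Set (Constr S)} {X Y : MS S} (hs : Relation.ReflTransGen MStep X Y)
    (hX : X.L ⊆ L) {R k} (h : EvM L X.A R k) : Y.L ⊆ L ∧ Y.N = X.N ∧ ∃ k', EvM L Y.A R k' := by
  induction hs with
  | refl => exact ⟨hX, rfl, k, h⟩
  | tail _ h1 ih =>
    obtain ⟨h2, h3, k', h4⟩ := ih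
    obtain ⟨h5, h6, k'', -, h7⟩ := h4.step h1 h2
    exact ⟨h5, h6.trans h3, k'', h7⟩

theorem EvM.exists_quiet {L : Set (Constr S)} {X : MS S} (hX : X.L ⊆ L) {R k}
    (h : EvM L X.A R k) : ∃ Y, Relation.ReflTransGen MStep X Y ∧ Quiet Y := by
  induction k using Nat.strong_induction_on generalizing X with
  | _ k ih =>
    by_cases hq : Quiet X
    · exact ⟨X, .refl, hq⟩
    · simp only [Quiet, not_forall, not_not] at hq
      obtain ⟨a, ha, Q, e, hf⟩ := hq
      obtain ⟨A0, hA⟩ := Multiset.exists_cons_of_mem ha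
      obtain ⟨B, ν, C, hd, hν, hν1⟩ := exists_dec Q Val.var X.N (.inl rfl)
      have hs : MStep X _ := ⟨a, A0, Q, e, B, ν, C, hA, hf, hd, hν, hν1, rfl⟩
      obtain ⟨h1, -, k', hk, h2⟩ := h.step hs hX
      obtain ⟨Y, h3, h4⟩ := ih k' hk h1 h2
      exact ⟨Y, .head hs h3, h4⟩

theorem Ev.future {L : Set (Constr S)} {a : UProc S} (ha : IsAgent a)
    (hq : ∀ Q e, ¬ Fire L a Q e) {R k} (h : Ev L a R k) :
    R = {a.future} ∨ (R = 0 ∧ a.future = .skip) := by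
  cases h with
  | skip => exact ha.elim
  | par => exact ha.elim
  | tell _ => exact absurd (.tell _) (hq _ _)
  | next P => exact .inl rfl
  | unl_pos h => exact absurd (.unl h) (hq _ _)
  | unl_neg _ => exact .inl rfl
  | bang _ => exact absurd .bang (hq _ _)
  | exhausted _ => exact .inr ⟨rfl, rfl⟩
  | fire t h1 h2 _ _ => exact absurd (.abs t h1 h2) (hq _ _)

/-- In a quiet state the evaluation has only to pass to the next unit; exhausted abstractions
contribute nothing on one side and `skip` on the other. -/
theorem EvM.dec_future {L : Set (Constr S)} {l r : List (UProc S)} (hl : ∀ a ∈ l, IsAgent a)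
    (hq : ∀ a ∈ l, ∀ Q e, ¬ Fire L a Q e) {k} (h : EvM L l r k) {B ν C}
    (hd : Dec (UProc.prod r) Val.var B ν C) :
    ∃ ν' C', Dec (UProc.prod (l.map UProc.future)) Val.var B ν' C' ∧ ν.Perm ν' := by
  induction l generalizing r k B ν C with
  | nil =>
    obtain ⟨T, h1, h2, -⟩ := h
    rw [Multiset.coe_nil, Multiset.rel_zero_left] at h1
    subst h1
    simp only [Multiset.map_zero, Multiset.sum_zero, Multiset.coe_eq_zero] at h2
    subst h2
    exact ⟨_, _, hd, .refl _⟩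
  | cons a l ih =>
    rw [← Multiset.cons_coe, evM_cons] at h
    obtain ⟨R1, k1, R2, k2, h1, h2, h3, -⟩ := h
    rw [← Multiset.coe_toList R2] at h2
    rcases h1.future (hl a (by simp)) (hq a (by simp)) with rfl | ⟨rfl, h4⟩
    · have hr : r.Perm (a.future :: R2.toList) := by
        rw [← Multiset.coe_eq_coe, h3, ← Multiset.cons_coe, Multiset.coe_toList,
          Multiset.singleton_add]
      obtain ⟨ν', C', h5, h6⟩ := dec_prod_perm hr hd
      obtain ⟨A1, A2, ν1, ν2, C1, C2, h7, h8, rfl, rfl, rfl⟩ := dec_par_iff.1 h5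
      obtain ⟨ν'', C'', h9, h10⟩ := ih (fun b hb => hl b (by simp [hb]))
        (fun b hb => hq b (by simp [hb])) h2 h8
      exact ⟨_, _, .par h7 h9, h6.trans (h10.append_left _)⟩
    · have hr : r.Perm R2.toList := by
        rw [← Multiset.coe_eq_coe, h3, Multiset.coe_toList, zero_add]
      obtain ⟨ν', C', h5, h6⟩ := dec_prod_perm hr hd
      obtain ⟨ν'', C'', h9, h10⟩ := ih (fun b hb => hl b (by simp [hb]))
        (fun b hb => hq b (by simp [hb])) h2 h5
      refine ⟨[] ++ ν'', ∅ ∪ C'', ?_, h6.trans h10⟩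
      rw [← zero_add B]
      refine Dec.par ?_ h9
      rw [h4]
      exact .skip _

/-- `Will L P c`: in the final store `L`, the process `P` tells `c`. -/
inductive Will (L : Set (Constr S)) : UProc S → Constr S → Prop
  | tell (c) : Will L (.tell c) c
  | left {P Q c} : Will L P c → Will L (.par P Q) c
  | right {P Q c} : Will L Q c → Will L (.par P Q) c
  | bang {P c} : Will L P c → Will L (.bang P) c
  | abs {n g ex P c} (t : Fin n → Val S) : SEnt L (substC (instS t) g) → t ∉ ex →
      Will L (P.subst (instS t)) c → Will L (.abs n g ex P) c

theorem Will.dec {L : Set (Constr S)} {P : UProc S} {c} (h : Will L P c) {B ν C}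
    (hd : Dec P Val.var B ν C) : ∃ a ∈ B, Will L a c := by
  induction h generalizing B ν C with
  | left _ ih =>
    obtain ⟨A1, A2, ν1, ν2, C1, C2, h3, h4, rfl, rfl, rfl⟩ := dec_par_iff.1 hd
    obtain ⟨a, h5, h6⟩ := ih h3
    exact ⟨a, by simp [h5], h6⟩
  | right _ ih =>
    obtain ⟨A1, A2, ν1, ν2, C1, C2, h3, h4, rfl, rfl, rfl⟩ := dec_par_iff.1 hd
    obtain ⟨a, h5, h6⟩ := ih h4
    exact ⟨a, by simp [h5], h6⟩
  | _ =>
    obtain ⟨rfl, rfl, rfl⟩ := (dec_agent_iff (by trivial)).1 hd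
    rw [UProc.subst_id]
    refine ⟨_, Multiset.mem_singleton_self _, ?_⟩
    first
      | exact .tell _
      | exact .bang ‹_›
      | exact .abs _ ‹_› ‹_› ‹_›

theorem MStep.isAgent {X Y : MS S} (hs : MStep X Y) (h : ∀ a ∈ X.A, IsAgent a) :
    ∀ a ∈ Y.A, IsAgent a := by
  obtain ⟨a', A0, Q, e, B, ν, C, hA, -, hd, -, -, rfl⟩ := hs
  intro a ha
  rcases Multiset.mem_add.1 ha with ha | ha
  · exact hd.isAgent a ha
  · exact h a (by simp [hA, ha])

/-- An agent committed to `c` by guards open in the final store stays committed, or hands the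
commitment on, until `c` is told; a quiet state has no such agent. -/
theorem Will.told {X Y : MS S} (hs : Relation.ReflTransGen MStep X Y) (hq : Quiet Y)
    (hag : ∀ a ∈ X.A, IsAgent a) {c : Constr S} (h : c ∈ X.L ∨ ∃ a ∈ X.A, Will Y.L a c) : c ∈ Y.L := by
  induction hs using Relation.ReflTransGen.head_induction_on with
  | refl =>
    rcases h with h | ⟨a, ha, h⟩
    · exact h
    · exfalso
      have hf : ∀ Q e, ¬ Fire Y.L a Q e := hq a ha
      cases h with
      | tell => exact hf _ _ (.tell _)
      | bang => exact hf _ _ .bang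
      | abs t h1 h2 _ => exact hf _ _ (.abs t h1 h2)
      | left h => exact (hag _ ha).elim
      | right h => exact (hag _ ha).elim
  | @head X X' h1 _ ih =>
    apply ih (h1.isAgent hag)
    obtain ⟨a', A0, Q, e, B, ν, C, hA, hf, hd, -, -, rfl⟩ := h1
    rcases h with h | ⟨a, ha, h⟩
    · exact .inl (.inl h)
    · rw [hA, Multiset.mem_cons] at ha
      rcases ha with rfl | ha
      · have key : c ∈ e ∨ Will Y.L Q c := by
          cases hf with
          | tell c => cases h; exact .inl rfl
          | unl => cases h
          | bang => cases h with
            | bang h => exact .inr (.left h)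
          | abs t h1 h2 => cases h with
            | abs t' h3 h4 h5 =>
              by_cases htt : t' = t
              · subst htt; exact .inr (.left h5)
              · exact .inr (.right (.abs t' h3 (by simp [htt, h4]) h5))
        rcases key with h | h
        · exact .inl (.inr h)
        · obtain ⟨b, hb, h6⟩ := h.dec hd
          exact .inr ⟨b, by simp [hb], h6⟩
      · exact .inr ⟨a, by simp [ha], h⟩

/-- Evaluation bounds the final store from above and the hypothesis `hU` from below, so it is `L`
whatever the run was. The next state is then determined by the residual processes, up to the choice
of new names. -/
theorem EvM.tick {L : Set (Constr S)} {X Y : MS S} {k} {r : List (UProc S)} (h : EvM L X.A r k)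
    (h0 : X.L = ∅) (hag : ∀ a ∈ X.A, IsAgent a) (hs : Relation.ReflTransGen MStep X Y)
    (hq : Quiet Y) (hU : L ⊆ Y.L) {B μ C} (hd : Dec (UProc.prod r) Val.var B μ C)
    (hμ : Fresh X.N μ) (hμ1 : ∀ x ∈ μ, x % 4 = 1) : Tick Y ⟨B, ∅, X.N ∪ μ.toFinset⟩ := by
  obtain ⟨h1, h2, k', h3⟩ := h.steps hs (by simp [h0])
  obtain rfl : L = Y.L := hU.antisymm h1
  have hY : ∀ a ∈ Y.A, IsAgent a := by
    clear h h0 hd hμ hμ1 h3 h2 hU h1 hq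
    induction hs with
    | refl => exact hag
    | tail _ h4 ih => exact h4.isAgent ih
  rw [← Multiset.coe_toList Y.A] at h3
  obtain ⟨ν, C', h4, h5⟩ := h3.dec_future (fun a ha => hY a (by simpa using ha))
    (fun a ha => hq a (by simpa using ha)) hd
  refine ⟨_, ν, C', Multiset.coe_toList _, h4, ?_, ?_, rfl, ?_⟩
  · rw [h2]; exact ⟨h5.nodup_iff.1 hμ.1, fun x hx => hμ.2 x (h5.mem_iff.2 hx)⟩
  · exact fun x hx => hμ1 x (h5.mem_iff.2 hx)
  · rw [h2, List.toFinset_eq_of_perm _ _ h5]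

/-! ### The agents of the persistent constructs -/

/-- The agents of a persistent output with the private names `g` and `s`. -/
def tellA (g s : ℕ) {n : ℕ} (p : Pr n) (ts : Fin n → Tm S) : List (UProc S) :=
  [.tell (opv (.var g)), .bang (.when (opv (.var g)) (.tell (atom p ts))),
    .bang (.unl (opv (.var s)) (.tell (opv (.var g)))),
    .bang (.when (atom (Pr.bar p) ts) (.bang (.tell (opv (.var s)))))]

/-- The agents of a persistent input with the private names `g` and `s`. -/
def waitA (g s n : ℕ) (c : Constr S) (P : UProc S) : List (UProc S) :=
  [.tell (opv (.var g)), .bang (.unl (opv (.var s)) (.tell (opv (.var g)))),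
    .bang (.abs n (c ⊓ opv (.var (g + n))) [] (.par P (.bang (.tell (opv (.var (s + n)))))))]

theorem Dec.cast {P : UProc S} {σ : Sub S} {A A' ν ν' C} (h : Dec P σ A ν C) (hA : A = A')
    (hν : ν = ν') : ∃ C', Dec P σ A' ν' C' := by subst hA hν; exact ⟨C, h⟩

theorem dec_tellP {n : ℕ} (p : Pr n) (ts : Fin n → Tm S) (g s : ℕ) :
    ∃ C, Dec (UProc.tellP p ts) Val.var (tellA g s p ts : Multiset (UProc S)) [g, s] C := by
  have h0 : ext ([g, s].map Val.var) (Val.var : Sub S) 0 = .var g := rfl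
  have h1 : ext ([g, s].map Val.var) (Val.var : Sub S) 1 = .var s := rfl
  have h2 : ∀ e : Tm S, substT (ext ([g, s].map Val.var) (Val.var : Sub S))
      (substT (shiftS S 2) e) = e := fun e => by
    rw [substT_substT, cmp_shiftS_ext _ _ _ (by simp), substT_id]
  refine (Dec.loc [g, s] rfl (.par (.agent _ ?_) (.par (.agent _ ?_) (.par (.agent _ ?_)
    (.agent _ ?_))))).cast ?_ rfl
  any_goals trivial
  simp only [UProc.subst, UProc.when, upS_zero, substC_op', h0, h1, substC_atom, h2, tellA,
    List.map_nil]
  rfl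

theorem dec_waitC (n : ℕ) (c : Constr S) (P : UProc S) (g s : ℕ) :
    ∃ C, Dec (UProc.waitC n c P) Val.var (waitA g s n c P : Multiset (UProc S)) [g, s] C := by
  have h0 : ext ([g, s].map Val.var) (Val.var : Sub S) 0 = .var g := rfl
  have h1 : ext ([g, s].map Val.var) (Val.var : Sub S) 1 = .var s := rfl
  have h2 : cmp (upS n (shiftS S 2)) (upS n (ext ([g, s].map Val.var) (Val.var : Sub S))) =
      Val.var := by
    rw [cmp_upS_upS, cmp_shiftS_ext _ _ _ (by simp), upS_var]
  have h3 : upS n (ext ([g, s].map Val.var) (Val.var : Sub S)) n = .var (g + n) := by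
    simp [upS]
    rfl
  have h4 : upS n (ext ([g, s].map Val.var) (Val.var : Sub S)) (n + 1) = .var (s + n) := by
    simp [upS]
    rfl
  refine (Dec.loc [g, s] rfl (.par (.agent _ ?_) (.par (.agent _ ?_) (.agent _ ?_)))).cast ?_ rfl
  any_goals trivial
  simp only [UProc.subst, substC_op', h0, h1, h3, h4, substC_inf, substC_substC, h2, substC_id,
    UProc.subst_subst, UProc.subst_id, waitA, List.map_nil]
  rfl

theorem Has.sent {L : Set (Constr S)} {n : ℕ} {p : Pr n} {ts : Fin n → Tm S} (h : Has L p ts) :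
    SEnt L (atom p ts) := by
  obtain ⟨ts', h, h2⟩ := h
  intro M w hw
  have := hw _ h
  rw [realize_atom] at this ⊢
  convert this using 2 with i
  rw [← realize_nf, h2, realize_nf]

theorem SEnt.mem {L : Set (Constr S)} {c : Constr S} (h : c ∈ L) : SEnt L c :=
  fun _ _ hw => hw c h

theorem EvM.cons {L : Set (Constr S)} {a : UProc S} {A R R' : Multiset (UProc S)} {k k'}
    (h : Ev L a R k) (h' : EvM L A R' k') : EvM L (a ::ₘ A) (R + R') (k + k') :=
  (EvM.singleton h).add h'

theorem EvM.congr {L : Set (Constr S)} {A A' R R' : Multiset (UProc S)} {k} (h : EvM L A R k)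
    (hA : A = A') (hR : R = R') : EvM L A' R' k := hA ▸ hR ▸ h

theorem fin_zero_eq {α : Type*} (t t' : Fin 0 → α) : t = t' := Subsingleton.elim _ _

theorem instS_zero (t : Fin 0 → Val S) : instS t = Val.var := by
  funext i
  simp [instS]

theorem Ev.when_pos {L : Set (Constr S)} {c : Constr S} {P : UProc S} {R k} (hc : SEnt L c)
    (h : Ev L P R k) : Ev L (.when c P) R (k + 1) := by
  have : Ev L (.abs 0 c [] P) (R + 0) (k + 0 + 1) := by
    refine .fire Fin.elim0 (by rwa [instS_zero, substC_id]) (by simp)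
      (by rwa [instS_zero, UProc.subst_id]) (.exhausted fun t _ => ?_)
    simp [fin_zero_eq t Fin.elim0]
  rwa [add_zero, add_zero] at this

theorem Ev.when_neg {L : Set (Constr S)} {c : Constr S} {P : UProc S} (hc : ¬ SEnt L c) :
    Ev L (.when c P) 0 0 :=
  .exhausted fun t h => absurd (by rwa [instS_zero, substC_id] at h) hc

theorem Will.when {L : Set (Constr S)} {c d : Constr S} {P : UProc S} (hc : SEnt L c)
    (h : Will L P d) : Will L (.when c P) d :=
  .abs Fin.elim0 (by rwa [instS_zero, substC_id]) (by simp) (by rwa [instS_zero, UProc.subst_id])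

theorem Ev.abs_once {L : Set (Constr S)} {n : ℕ} {c : Constr S} {P : UProc S} {R k}
    (t : Fin n → Val S) (hc : SEnt L (substC (instS t) c))
    (hu : ∀ t', SEnt L (substC (instS t') c) → t' = t) (h : Ev L (P.subst (instS t)) R k) :
    Ev L (.abs n c [] P) R (k + 1) := by
  have : Ev L (.abs n c [] P) (R + 0) (k + 0 + 1) :=
    .fire t hc (by simp) h (.exhausted fun t' h' => by simp [hu t' h'])
  simpa using this

theorem instS_add {n : ℕ} (t : Fin n → Val S) (x : ℕ) : instS t (x + n) = .var x := by
  simp [instS]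

/-! ### One time unit of a single persistent construct -/

/-- Without acknowledgement the `unless` passes on the `tell` of the go name, and replication
restores the rest. -/
theorem evM_tellA_idle {L : Set (Constr S)} {g s n : ℕ} {p : Pr n} {ts : Fin n → Tm S}
    (hg : opv (.var g) ∈ L) (hp : atom p ts ∈ L) (hs : ¬ SEnt L (opv (.var s)))
    (hb : ¬ SEnt L (atom (Pr.bar p) ts)) :
    ∃ k, EvM L (tellA g s p ts : Multiset (UProc S)) (tellA g s p ts : Multiset (UProc S)) k := by
  refine ⟨_, (EvM.cons (.tell hg) (.cons (.bang (.when_pos (.mem hg) (.tell hp)))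
    (.cons (.bang (.unl_neg hs)) (.cons (.bang (.when_neg hb)) (.zero L))))).congr rfl ?_⟩
  simp only [zero_add, tellA, ← Multiset.singleton_add, ← Multiset.cons_coe,
    Multiset.coe_nil, add_comm, add_left_comm, add_assoc]

/-- The residuals of a persistent output that has been received. -/
def tellG (g s : ℕ) {n : ℕ} (p : Pr n) (ts : Fin n → Tm S) : List (UProc S) :=
  [.bang (.when (opv (.var g)) (.tell (atom p ts))),
    .bang (.unl (opv (.var s)) (.tell (opv (.var g)))),
    .bang (.when (atom (Pr.bar p) ts) (.bang (.tell (opv (.var s))))),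
    .bang (.tell (opv (.var s)))]

/-- The acknowledgement brings out the stop name. The `unless` is then discharged, and no unguarded
`tell` of the go name remains. -/
theorem evM_tellA_fired {L : Set (Constr S)} {g s n : ℕ} {p : Pr n} {ts : Fin n → Tm S}
    (hg : opv (.var g) ∈ L) (hp : atom p ts ∈ L) (hs : opv (.var s) ∈ L)
    (hb : SEnt L (atom (Pr.bar p) ts)) :
    ∃ k, EvM L (tellA g s p ts : Multiset (UProc S)) (tellG g s p ts : Multiset (UProc S)) k := by
  refine ⟨_, (EvM.cons (.tell hg) (.cons (.bang (.when_pos (.mem hg) (.tell hp)))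
    (.cons (.bang (.unl_pos (.mem hs))) (.cons (.bang (.when_pos hb (.bang (.tell hs))))
    (.zero L))))).congr rfl ?_⟩
  simp only [zero_add, tellG, ← Multiset.singleton_add, ← Multiset.cons_coe,
    Multiset.coe_nil, add_comm, add_left_comm]

theorem sent_waitA {L : Set (Constr S)} {g n : ℕ} {c : Constr S} {t : Fin n → Val S} :
    SEnt L (substC (instS t) (c ⊓ opv (.var (g + n)))) ↔
      SEnt L (substC (instS t) c) ∧ SEnt L (opv (.var g)) := by
  rw [substC_inf, sent_inf, substC_opv, Val.subst, instS_add]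

theorem evM_waitA_idle {L : Set (Constr S)} {g s n : ℕ} {c : Constr S} {P : UProc S}
    (hg : opv (.var g) ∈ L) (hs : ¬ SEnt L (opv (.var s)))
    (hc : ∀ t : Fin n → Val S, ¬ SEnt L (substC (instS t) c)) :
    ∃ k, EvM L (waitA g s n c P : Multiset (UProc S)) (waitA g s n c P : Multiset (UProc S)) k := by
  refine ⟨_, (EvM.cons (.tell hg) (.cons (.bang (.unl_neg hs))
    (.cons (.bang (.exhausted fun t h => absurd (sent_waitA.1 h).1 (hc t))) (.zero L)))).congr rfl ?_⟩
  simp only [zero_add, waitA, ← Multiset.singleton_add, ← Multiset.cons_coe,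
    Multiset.coe_nil, add_comm, add_assoc]

/-- The residuals of a persistent input that has been used. -/
def waitG (g s n : ℕ) (c : Constr S) (P : UProc S) : List (UProc S) :=
  [.bang (.unl (opv (.var s)) (.tell (opv (.var g)))), .bang (.tell (opv (.var s))),
    .bang (.abs n (c ⊓ opv (.var (g + n))) [] (.par P (.bang (.tell (opv (.var (s + n)))))))]

/-- Only the tuple `t` satisfies the guard in the final store, so the continuation is released
exactly once. -/
theorem evM_waitA_fired {L : Set (Constr S)} {g s n : ℕ} {c : Constr S} {P : UProc S}
    (hg : opv (.var g) ∈ L) (hs : opv (.var s) ∈ L) (t : Fin n → Val S)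
    (hc : SEnt L (substC (instS t) c)) (hu : ∀ t', SEnt L (substC (instS t') c) → t' = t)
    {R k} (h : Ev L (P.subst (instS t)) R k) :
    ∃ k, EvM L (waitA g s n c P : Multiset (UProc S))
      (R + (waitG g s n c P : Multiset (UProc S))) k := by
  have h2 : Ev L ((UProc.par P (.bang (.tell (opv (.var (s + n)))))).subst (instS t))
      (R + {.bang (.tell (opv (.var s)))}) (k + (1 + 1)) := by
    simp only [UProc.subst, substC_opv, Val.subst, instS_add]
    have := Ev.par h (.bang (.tell hs))
    rwa [zero_add] at this
  refine ⟨_, (EvM.cons (.tell hg) (.cons (.bang (.unl_pos (.mem hs)))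
    (.cons (.bang (.abs_once t (sent_waitA.2 ⟨hc, .mem hg⟩) (fun t' h => hu t' (sent_waitA.1 h).1)
      h2)) (.zero L)))).congr rfl ?_⟩
  simp only [zero_add, waitG, ← Multiset.singleton_add, ← Multiset.cons_coe,
    Multiset.coe_nil, add_comm, add_left_comm, add_assoc]

/-- By `nf_eq_var`, the constraint is entailed only if it was itself told. -/
theorem dead_opv {D : Finset ℕ} {g : ℕ} (hg : g ∈ D) : Dead D 0 (opv (.var g) : Constr S) := by
  intro L hL hD t h
  rw [instS_zero, substC_id, opv, sent_atom hL] at h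
  obtain ⟨ts', h1, h2⟩ := h
  have h3 : ts' 0 = (Val.var g : Val S).tm := nf_eq_var ((h2 0).symm.trans (nf_tm (.var g)))
  refine hD g hg ?_
  have h4 : ts' = ![(Val.var g : Val S).tm] := by
    funext i
    fin_cases i
    exact h3
  rwa [h4] at h1

theorem dead_waitA {D : Finset ℕ} {g n : ℕ} (hg : g ∈ D) (c : Constr S) :
    Dead D n (c ⊓ opv (.var (g + n))) := by
  intro L hL hD t h
  refine dead_opv hg L hL hD Fin.elim0 ?_
  rw [instS_zero, substC_id]
  exact (sent_waitA.1 h).2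

theorem garbage_tellG {D T : Finset ℕ} {g s n : ℕ} {p : Pr n} {ts : Fin n → Tm S} (hg : g ∈ D)
    (hs : s ∈ T) : ∀ a ∈ tellG g s p ts, Garbage D T a := by
  intro a ha
  simp only [tellG, List.mem_cons, List.not_mem_nil, or_false] at ha
  rcases ha with rfl | rfl | rfl | rfl
  · exact .inr ⟨_, .dead (dead_opv hg), .inl rfl⟩
  · exact .inr ⟨_, .unl hs, .inl rfl⟩
  · exact .inr ⟨_, .ack hs, .inl rfl⟩
  · exact .inr ⟨_, .tell hs, .inl rfl⟩

theorem garbage_waitG {D T : Finset ℕ} {g s n : ℕ} {c : Constr S} {P : UProc S} (hg : g ∈ D)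
    (hs : s ∈ T) : ∀ a ∈ waitG g s n c P, Garbage D T a := by
  intro a ha
  simp only [waitG, List.mem_cons, List.not_mem_nil, or_false] at ha
  rcases ha with rfl | rfl | rfl
  · exact .inr ⟨_, .unl hs, .inl rfl⟩
  · exact .inr ⟨_, .tell hs, .inl rfl⟩
  · exact .inr ⟨_, .dead (dead_waitA hg c), .inl rfl⟩

/-! ### Atoms with equal arguments -/

/-- The atoms `c` and `c'` have the same predicate, and arguments with the same value. -/
def Sim (c c' : Constr S) : Prop := ∃ (n : ℕ) (p : Pr n) (ts ts' : Fin n → Tm S),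
  c = atom p ts ∧ c' = atom p ts' ∧ ∀ i, nf (ts i) = nf (ts' i)

theorem atom_sigma {n m : ℕ} {p : Pr n} {p' : Pr m} {ts : Fin n → Tm S} {ts' : Fin m → Tm S}
    (h : atom p ts = atom p' ts') : (⟨n, p⟩ : Σ n, Pr n) = ⟨m, p'⟩ := by
  obtain rfl := atom_arity_inj h
  rw [atom_pred_inj h]

theorem Sim.sigma {n m : ℕ} {p : Pr n} {p' : Pr m} {ts : Fin n → Tm S} {ts' : Fin m → Tm S}
    (h : Sim (atom p ts) (atom p' ts')) : (⟨n, p⟩ : Σ n, Pr n) = ⟨m, p'⟩ := by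
  obtain ⟨k, q, us, us', h1, h2, -⟩ := h
  exact (atom_sigma h1).trans (atom_sigma h2).symm

theorem sim_atom {n : ℕ} {p : Pr n} {ts ts' : Fin n → Tm S} :
    Sim (atom p ts) (atom p ts') ↔ ∀ i, nf (ts i) = nf (ts' i) := by
  constructor
  · rintro ⟨k, q, us, us', h1, h2, h3⟩
    obtain rfl := atom_arity_inj h1
    obtain rfl := atom_pred_inj h1
    obtain rfl := atom_inj h1
    obtain rfl := atom_inj h2
    exact h3
  · exact fun h => ⟨n, p, ts, ts', rfl, rfl, h⟩

theorem Sim.symm {c c' : Constr S} (h : Sim c c') : Sim c' c := by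
  obtain ⟨n, p, ts, ts', rfl, rfl, h⟩ := h
  exact ⟨n, p, ts', ts, rfl, rfl, fun i => (h i).symm⟩

theorem Sim.trans {c c' c'' : Constr S} (h : Sim c c') (h' : Sim c' c'') : Sim c c'' := by
  obtain ⟨n, p, ts, ts', rfl, rfl, h⟩ := h
  obtain ⟨m, q, us, us', h1, rfl, h2⟩ := h'
  obtain rfl := atom_arity_inj h1
  obtain rfl := atom_pred_inj h1
  obtain rfl := atom_inj h1
  exact sim_atom.2 fun i => (h i).trans (h2 i)

theorem Sim.congr {n m : ℕ} {p q : Pr n} {p' q' : Pr m} {ts : Fin n → Tm S} {ts' : Fin m → Tm S}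
    (h : Sim (atom p ts) (atom p' ts')) (hq : (⟨n, q⟩ : Σ n, Pr n) = ⟨m, q'⟩) :
    Sim (atom q ts) (atom q' ts') := by
  cases hq
  cases h.sigma
  exact sim_atom.2 (sim_atom.1 h)

theorem Sim.map (f : ∀ {n : ℕ}, Pr n → Pr n) {n m : ℕ} {p : Pr n} {p' : Pr m} {ts : Fin n → Tm S}
    {ts' : Fin m → Tm S} (h : Sim (atom p ts) (atom p' ts')) :
    Sim (atom (f p) ts) (atom (f p') ts') :=
  h.congr (congrArg (fun x : Σ n, Pr n => (⟨x.1, f x.2⟩ : Σ n, Pr n)) h.sigma)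

theorem has_iff {L : Set (Constr S)} {n : ℕ} {p : Pr n} {ts : Fin n → Tm S} :
    Has L p ts ↔ ∃ c ∈ L, Sim (atom p ts) c := by
  constructor
  · rintro ⟨ts', h, h'⟩
    exact ⟨_, h, sim_atom.2 h'⟩
  · rintro ⟨c, h, k, q, us, us', h1, rfl, h3⟩
    obtain rfl := atom_arity_inj h1
    obtain rfl := atom_pred_inj h1
    obtain rfl := atom_inj h1
    exact ⟨_, h, h3⟩

/-- The acknowledgement of a request, or of a communication on a session channel. -/
def ackOf : {n : ℕ} → Pr n → Pr n
  | _, .req => .acc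
  | _, p => .bar p

/-- A number for the kind of a predicate. -/
def knd : {n : ℕ} → Pr n → ℕ
  | _, .outp' => 0
  | _, .req => 1
  | _, .acc => 2
  | _, .sel => 3
  | _, .outk => 4
  | _, .out _ => 5
  | _, .call _ _ => 9
  | _, .bar p => knd p + 10

/-- The predicates of requests and of communications. -/
def IsBase {n : ℕ} (p : Pr n) : Prop := knd p = 1 ∨ knd p = 3 ∨ knd p = 4 ∨ knd p = 5

theorem knd_ackOf {n : ℕ} {p : Pr n} (h : IsBase p) :
    (knd p = 1 ∧ knd (ackOf p) = 2) ∨ (knd p ≠ 1 ∧ knd (ackOf p) = knd p + 10) := by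
  cases p <;> simp_all [IsBase, ackOf, knd]

theorem sigma_knd {n m : ℕ} {p : Pr n} {p' : Pr m} (h : (⟨n, p⟩ : Σ n, Pr n) = ⟨m, p'⟩) :
    knd p = knd p' := congrArg (fun x : Σ n, Pr n => knd x.2) h

theorem sigma_bar {n m : ℕ} {p : Pr n} {p' : Pr m}
    (h : (⟨n, .bar p⟩ : Σ n, Pr n) = ⟨m, .bar p'⟩) : (⟨n, p⟩ : Σ n, Pr n) = ⟨m, p'⟩ := by
  cases h; rfl

theorem ackOf_cases {n : ℕ} (p : Pr n) : (⟨n, p⟩ : Σ n, Pr n) = ⟨2, .req⟩ ∨ ackOf p = .bar p := by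
  cases p <;> first | exact .inl rfl | exact .inr rfl

/-- The exceptional acknowledgement `acc` has kind 2, whereas overlined predicates have kinds of at
least 10. -/
theorem sigma_bar_ackOf {n m : ℕ} {p : Pr n} {p' : Pr m}
    (h : (⟨n, .bar p⟩ : Σ n, Pr n) = ⟨m, ackOf p'⟩) : (⟨n, p⟩ : Σ n, Pr n) = ⟨m, p'⟩ := by
  rcases ackOf_cases p' with h1 | h1
  · cases h1
    have := sigma_knd h
    simp only [ackOf, knd] at this
    omega
  · exact sigma_bar (h.trans (by rw [h1]))

theorem sigma_ackOf {n m : ℕ} {p : Pr n} {p' : Pr m}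
    (h : (⟨n, ackOf p⟩ : Σ n, Pr n) = ⟨m, ackOf p'⟩) : (⟨n, p⟩ : Σ n, Pr n) = ⟨m, p'⟩ := by
  rcases ackOf_cases p with h1 | h1
  · rcases ackOf_cases p' with h2 | h2
    · exact h1.trans h2.symm
    · cases h1
      have := sigma_knd h
      rw [h2] at this
      simp only [ackOf, knd] at this
      omega
  · exact sigma_bar_ackOf (.trans (by rw [h1]) h)

/-! ### Senders and receivers -/

/-- A process that requests a session, sends, selects, or delegates: the atom that it tells, its
continuation, and its private names. -/
structure Snd (S : Sig.{u}) where
  n : ℕ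
  p : Pr n
  ts : Fin n → Tm S
  C : UProc S
  κ : List ℕ
  g : ℕ
  s : ℕ
  g' : ℕ
  s' : ℕ

/-- A process that accepts a session, receives, branches, or catches: the atom that it waits for, its
continuation, and its private names. -/
structure Rcv (S : Sig.{u}) where
  n : ℕ
  m : ℕ
  p : Pr m
  ts : Fin m → Tm S
  body : UProc S
  h : ℕ
  r : ℕ

/-- The sender that a process describes. -/
inductive IsSnd : HProc S → Snd S → Prop
  | request (a P k g s g' s') : IsSnd (.request a P) ⟨2, .req, ![a.tm, (Val.var k).tm],
      (enc P).subst (instS ![.var k]), [k], g, s, g', s'⟩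
  | send (k n es P g s g' s') : IsSnd (.send k n es P) ⟨n + 1, .out n, Fin.cons k.tm es, enc P, [],
      g, s, g', s'⟩
  | select (k l P g s g' s') : IsSnd (.select k l P) ⟨2, .sel, ![k.tm, (Val.label l).tm], enc P, [],
      g, s, g', s'⟩
  | throwCh (k k' P g s g' s') : IsSnd (.throwCh k k' P) ⟨2, .outk, ![k.tm, k'.tm], enc P, [],
      g, s, g', s'⟩

/-- The body of the encoding of a branching. -/
def branchBody (n : ℕ) (ls : Fin n ↪ S.Label) (Ps : Fin n → HProc S) : UProc S :=
  UProc.prod (List.ofFn fun i : Fin n =>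
    .when (Term.equal (nm S 0) (Val.label (ls i)).tm) (.next ((enc (Ps i)).subst (shiftS S 1))))

/-- The receiver that a process describes. -/
inductive IsRcv : HProc S → Rcv S → Prop
  | accept (a P h r) : IsRcv (.accept a P) ⟨1, 2, .req, ![substT (shiftS S 1) a.tm, nm S 0],
      .par (.tell (atom Pr.acc ![substT (shiftS S 1) a.tm, nm S 0])) (.next (enc P)), h, r⟩
  | recv (k n P h r) : IsRcv (.recv k n P) ⟨n, n + 1, .out n,
      Fin.cons (substT (shiftS S n) k.tm) (fun i => nm S i), .next (enc P), h, r⟩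
  | branch (k n ls Ps h r) : IsRcv (.branch k n ls Ps) ⟨1, 2, .sel,
      ![substT (shiftS S 1) k.tm, nm S 0], branchBody n ls Ps, h, r⟩
  | catchCh (k P h r) : IsRcv (.catchCh k P) ⟨1, 2, .outk, ![substT (shiftS S 1) k.tm, nm S 0],
      .next (enc P), h, r⟩

/-- The continuation of a sender after the acknowledgement. -/
def Snd.cont (x : Snd S) : UProc S :=
  .par (.next x.C) (.tell (atom (.bar (ackOf x.p)) x.ts))

/-- The agents of a sender. -/
def Snd.A (x : Snd S) : List (UProc S) :=
  tellA x.g x.s x.p x.ts ++ waitA x.g' x.s' 0 (atom (ackOf x.p) x.ts) x.cont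

/-- The private names of a sender. -/
def Snd.names (x : Snd S) : List ℕ := x.κ ++ [x.g, x.s, x.g', x.s']

/-- The continuation of a receiver. -/
def Rcv.cont (y : Rcv S) : UProc S := .par y.body (.tell (atom (.bar y.p) y.ts))

/-- The agents of a receiver. -/
def Rcv.A (y : Rcv S) : List (UProc S) := waitA y.h y.r y.n (atom y.p y.ts) y.cont

/-- The private names of a receiver. -/
def Rcv.names (y : Rcv S) : List ℕ := [y.h, y.r]

theorem IsSnd.base {A : HProc S} {x : Snd S} (h : IsSnd A x) : IsBase x.p := by
  cases h <;> simp [IsBase, knd]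

theorem IsRcv.base {A : HProc S} {y : Rcv S} (h : IsRcv A y) : IsBase y.p := by
  cases h <;> simp [IsBase, knd]

theorem IsRcv.dec {B : HProc S} {y : Rcv S} (h : IsRcv B y) :
    ∃ C, Dec (enc B) Val.var (y.A : Multiset (UProc S)) y.names C := by
  cases h <;> exact dec_waitC _ _ _ _ _

theorem dec_sender {n : ℕ} (p : Pr n) (hp : ackOf p = .bar p) (ts : Fin n → Tm S) (P : UProc S)
    (g s g' s' : ℕ) : ∃ C, Dec (.par (.tellP p ts) (.whenever (.bar p) ts (.next P))) Val.var
      ((Snd.A ⟨n, p, ts, P, [], g, s, g', s'⟩ : List (UProc S)) : Multiset (UProc S))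
      [g, s, g', s'] C := by
  obtain ⟨C1, h1⟩ := dec_tellP p ts g s
  obtain ⟨C2, h2⟩ := dec_waitC 0 (atom (.bar p) ts)
    (.par (.next P) (.tell (atom (.bar (.bar p)) ts))) g' s'
  refine ⟨C1 ∪ C2, ?_⟩
  have := Dec.par h1 h2
  rw [Multiset.coe_add] at this
  simp only [Snd.A, Snd.cont, hp]
  exact this

theorem dec_iff_subst {P : UProc S} {σ : Sub S} {A ν C} :
    Dec P σ A ν C ↔ Dec (P.subst σ) Val.var A ν C := by
  rw [dec_subst, cmp_var]

theorem ext_eq_instS (k : ℕ) : ext ([k].map Val.var) (Val.var : Sub S) = instS ![.var k] := by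
  funext i
  cases i with
  | zero => rfl
  | succ i => simp [ext, instS]

theorem substT_shift_instS {n : ℕ} (t : Fin n → Val S) (e : Tm S) :
    substT (instS t) (substT (shiftS S n) e) = e := by
  rw [substT_substT, cmp_shiftS_instS, substT_id]

theorem substT_nm_instS {n : ℕ} (t : Fin n → Val S) (i : Fin n) :
    substT (instS t) (nm S i) = (t i).tm := by
  rw [nm, substT_var]
  simp [instS]

theorem IsSnd.dec {A : HProc S} {x : Snd S} (h : IsSnd A x) :
    ∃ C, Dec (enc A) Val.var (x.A : Multiset (UProc S)) x.names C := by
  cases h with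
  | request a P k g s g' s' =>
    obtain ⟨C1, h1⟩ := dec_tellP Pr.req ![a.tm, (Val.var k : Val S).tm] g s
    obtain ⟨C2, h2⟩ := dec_waitC 0 (atom Pr.acc ![a.tm, (Val.var k : Val S).tm])
      (.par (.next ((enc P).subst (instS ![.var k])))
        (.tell (atom (.bar Pr.acc) ![a.tm, (Val.var k : Val S).tm]))) g' s'
    have h3 := Dec.par h1 h2
    have h4 : (fun i => substT (instS ![(Val.var k : Val S)])
        (![substT (shiftS S 1) a.tm, nm S 0] i)) = ![a.tm, (Val.var k).tm] := by
      funext i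
      fin_cases i
      · exact substT_shift_instS _ _
      · exact substT_nm_instS ![(Val.var k : Val S)] 0
    refine ⟨_, Dec.loc [k] rfl (ν := [g, s, g', s']) (C := C1 ∪ C2) ?_⟩
    · rw [ext_eq_instS, dec_iff_subst]
      simp only [UProc.subst, tellP_subst, whenever_subst, h4]
      rw [Multiset.coe_add] at h3
      exact h3
  | send k n es P g s g' s' => exact dec_sender _ rfl _ _ _ _ _ _
  | select k l P g s g' s' => exact dec_sender _ rfl _ _ _ _ _ _
  | throwCh k k' P g s g' s' => exact dec_sender _ rfl _ _ _ _ _ _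

/-- The atom that the receiver `y` takes when it receives `t`. -/
def Rcv.inst (y : Rcv S) (t : Fin y.n → Val S) : Fin y.m → Tm S :=
  fun i => substT (instS t) (y.ts i)

/-- The receiver `y` can receive `t` from the sender `x`. -/
def Mat (x : Snd S) (y : Rcv S) (t : Fin y.n → Val S) : Prop :=
  Sim (atom x.p x.ts) (atom y.p (y.inst t))

theorem IsRcv.det {B : HProc S} {y : Rcv S} (h : IsRcv B y) (j : Fin y.n) :
    ∃ i, y.ts i = nm S j := by
  cases h with
  | recv k n P h r => exact ⟨j.succ, rfl⟩
  | _ => exact ⟨1, by obtain rfl : j = 0 := Subsingleton.elim _ _; rfl⟩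

/-- Every received name is an argument of the awaited atom, and values are their own normal forms.
-/
theorem Mat.unique {x : Snd S} {y : Rcv S} {B : HProc S} (hy : IsRcv B y) {t t' : Fin y.n → Val S}
    (h : Mat x y t) (h' : Mat x y t') : t = t' := by
  funext j
  obtain ⟨i, hi⟩ := hy.det j
  have := sim_atom.1 (h.symm.trans h') i
  simp only [Rcv.inst, hi, substT_nm_instS, nf_tm] at this
  exact tm_injective this

/-- Matching atoms have the same predicate, hence complementary prefixes; the first arguments give
the same channel, and for data the remaining arguments give evaluation. For a selection the match
says nothing about the offered labels, hence the hypothesis `ho`. -/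
theorem Mat.comm {x : Snd S} {y : Rcv S} {A B : HProc S} (hx : IsSnd A x) (hy : IsRcv B y)
    {t : Fin y.n → Val S} (h : Mat x y t)
    (ho : ∀ k l A' n ls Ps, A = .select k l A' → B = .branch k n ls Ps → ∃ i, ls i = l) :
    ∃ R, HProc.Comm A B R := by
  have hk := sigma_knd h.sigma
  -- Of the sixteen combinations, the kinds of the predicates leave the four complementary ones.
  cases hx <;> cases hy <;> first | (simp [knd] at hk; done) | skip
  · have h0 := sim_atom.1 h 0
    simp only [Rcv.inst, Matrix.cons_val_zero, substT_shift_instS, nf_tm] at h0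
    obtain rfl := tm_injective h0
    exact ⟨_, .link _ _ _⟩
  · rename_i k n es P _ _ _ _ k' m Q _ _
    obtain rfl : n = m := by
      have := congrArg Sigma.fst h.sigma
      simpa using this
    have h0 := sim_atom.1 h 0
    simp only [Rcv.inst, Fin.cons_zero, substT_shift_instS, nf_tm] at h0
    obtain rfl := tm_injective h0
    refine ⟨_, .com _ _ _ t _ _ fun i => ?_⟩
    have h1 := sim_atom.1 h i.succ
    simp only [Rcv.inst, Fin.cons_succ, substT_nm_instS, nf_tm] at h1
    exact (eval_iff _ _).2 h1
  · have h0 := sim_atom.1 h 0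
    simp only [Rcv.inst, Matrix.cons_val_zero, substT_shift_instS, nf_tm] at h0
    obtain rfl := tm_injective h0
    obtain ⟨i, rfl⟩ := ho _ _ _ _ _ _ rfl rfl
    exact ⟨_, .label _ _ _ _ _ _⟩
  · have h0 := sim_atom.1 h 0
    simp only [Rcv.inst, Matrix.cons_val_zero, substT_shift_instS, nf_tm] at h0
    obtain rfl := tm_injective h0
    exact ⟨_, .pass _ _ _ _⟩

/-! ### The reaction of a sender and a receiver -/

theorem ev_prod_single {L : Set (Constr S)} {n : ℕ} (f : Fin n → UProc S) (i : Fin n) {R k}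
    (hi : Ev L (f i) R k) (hj : ∀ j, j ≠ i → Ev L (f j) 0 0) :
    ∃ k, Ev L (UProc.prod (List.ofFn f)) R k := by
  have zero : ∀ {m : ℕ} (f : Fin m → UProc S), (∀ j, Ev L (f j) 0 0) →
      Ev L (UProc.prod (List.ofFn f)) 0 0 := by
    intro m
    induction m with
    | zero => intro f _; rw [List.ofFn_zero]; exact .skip
    | succ m ih =>
      intro f h
      rw [List.ofFn_succ]
      exact .par (R := 0) (R' := 0) (k := 0) (k' := 0) (h 0) (ih _ fun j => h j.succ)
  induction n with
  | zero => exact i.elim0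
  | succ n ih =>
    rw [List.ofFn_succ]
    rcases Fin.eq_zero_or_eq_succ i with rfl | ⟨i', rfl⟩
    · have := Ev.par hi (zero (fun j : Fin n => f j.succ) fun j => hj _ (Fin.succ_ne_zero j))
      rw [add_zero] at this
      exact ⟨_, this⟩
    · obtain ⟨k', h⟩ := ih (fun j => f j.succ) i' hi fun j h => hj _ fun h' => h
        (Fin.succ_injective _ h')
      have := Ev.par (hj 0 (Fin.succ_ne_zero i').symm) h
      rw [zero_add] at this
      exact ⟨_, this⟩

theorem Rcv.cont_subst (y : Rcv S) (t : Fin y.n → Val S) : y.cont.subst (instS t) =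
    .par (y.body.subst (instS t)) (.tell (atom (.bar y.p) (y.inst t))) := by
  rw [Rcv.cont, UProc.subst, UProc.subst, substC_atom]
  rfl

/-- The receiver `y` takes `t` from `x`, goes on as `C'`, and the composition goes on as `R`. -/
structure Reacts (x : Snd S) (y : Rcv S) (t : Fin y.n → Val S) (C' : UProc S) (R : HProc S) :
    Prop where
  mat : Mat x y t
  ev : ∀ L : Set (Constr S), (∀ c ∈ L, TellOK c) → atom (ackOf y.p) (y.inst t) ∈ L →
    ∃ k, Ev L (y.body.subst (instS t)) {C'} k
  will : ∀ L : Set (Constr S), ackOf y.p = .bar y.p ∨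
    Will L (y.body.subst (instS t)) (atom (ackOf y.p) (y.inst t))
  dec : ∀ A1 μ1 C1 A2 μ2 C2, Dec x.C Val.var A1 μ1 C1 → Dec C' Val.var A2 μ2 C2 →
    ∃ C3, Dec (enc R) Val.var (A1 + A2) (x.κ ++ (μ1 ++ μ2)) C3

theorem inst_pair (v : Val S) (k : Val S) : (fun i => substT (instS ![v])
    ((![substT (shiftS S 1) k.tm, nm S 0] : Fin 2 → Tm S) i)) = ![k.tm, v.tm] := by
  funext i
  fin_cases i
  · exact substT_shift_instS _ _
  · exact substT_nm_instS ![v] 0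

/-- The received tuple is what the reduction rule substitutes. For a session establishment it is the
private name of the requester, which becomes the name bound in the reduct. -/
theorem reacts_of_comm {A B R : HProc S} (h : HProc.Comm A B R) {x : Snd S} {y : Rcv S}
    (hx : IsSnd A x) (hy : IsRcv B y) : ∃ t C', Reacts x y t C' R := by
  cases h with
  | link a P Q =>
    cases hx with
    | request a P k g s g' s' =>
      cases hy with
      | accept a Q h r =>
        refine ⟨![.var k], (enc Q).subst (instS ![.var k]), ?_, fun L hL hc => ?_, fun L => .inr ?_,
          fun A1 μ1 C1 A2 μ2 C2 h1 h2 => ?_⟩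
        · exact sim_atom.2 fun i => congrArg nf (congrFun (inst_pair _ _) i).symm
        · simp only [UProc.subst, substC_atom]
          have := Ev.par (.tell hc) (.next ((enc Q).subst (instS ![.var k])))
          rw [zero_add] at this
          exact ⟨_, this⟩
        · simp only [UProc.subst, substC_atom]
          exact .left (.tell _)
        · rw [dec_subst, cmp_var, ← ext_eq_instS] at h1 h2
          exact ⟨_, .loc [k] rfl (.par h1 h2)⟩
  | com k n es cs P Q he =>
    cases hx with
    | send k n es P g s g' s' =>
      cases hy with
      | recv k n Q h r =>
        refine ⟨cs, enc (Q.subst (instS cs)), ?_, fun L hL hc => ⟨0, ?_⟩, fun L => .inl rfl,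
          fun A1 μ1 C1 A2 μ2 C2 h1 h2 => ⟨C1 ∪ C2, by
            have := Dec.par h1 h2; exact this⟩⟩
        · refine sim_atom.2 fun i => ?_
          refine Fin.cases ?_ (fun i => ?_) i
          · simp only [Rcv.inst, Fin.cons_zero, substT_shift_instS]
          · simp only [Rcv.inst, Fin.cons_succ, substT_nm_instS, nf_tm]
            exact (eval_iff _ _).1 (he i)
        · rw [enc_subst]; exact .next _
  | label k n ls Ps i P =>
    cases hx with
    | select k l P g s g' s' =>
      cases hy with
      | branch k n ls Ps h r =>
        refine ⟨![.label (ls i)], enc (Ps i), ?_, fun L hL hc => ?_, fun L => .inl rfl,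
          fun A1 μ1 C1 A2 μ2 C2 h1 h2 => ⟨C1 ∪ C2, by
            have := Dec.par h1 h2; exact this⟩⟩
        · exact sim_atom.2 fun i => congrArg nf (congrFun (inst_pair _ _) i).symm
        · simp only [branchBody, prod_subst, List.map_ofFn]
          have key : ∀ j, (UProc.subst (instS ![Val.label (ls i)]) ∘ fun i : Fin n =>
              UProc.when (Term.equal (nm S 0) (Val.label (ls i)).tm)
              (.next ((enc (Ps i)).subst (shiftS S 1)))) j = UProc.when
                (Term.equal (Val.label (ls i)).tm (Val.label (ls j)).tm) (.next (enc (Ps j))) := by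
            intro j
            simp only [Function.comp, UProc.when, UProc.subst, upS_zero, substC_equal, substT_tm,
              UProc.subst_subst, cmp_shiftS_instS, UProc.subst_id, List.map_nil]
            have := substT_nm_instS ![(Val.label (ls i) : Val S)] 0
            simp only [Fin.val_zero, Matrix.cons_val_zero] at this
            rw [this]
            rfl
          -- The labels of a branching are distinct, so a single `when` opens.
          refine ev_prod_single _ i (R := {enc (Ps i)}) (k := 1) ?_ fun j hj => ?_
          · rw [key]
            exact .when_pos ((sent_equal hL _ _).2 rfl) (.next _)
          · rw [key]
            refine .when_neg fun h => hj ?_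
            have := (sent_equal hL _ _).1 h
            rw [nf_tm, nf_tm] at this
            have := tm_injective this
            simp only [Val.label.injEq] at this
            exact (ls.injective this).symm
  | pass k k' P Q =>
    cases hx with
    | throwCh k k' P g s g' s' =>
      cases hy with
      | catchCh k Q h r =>
        refine ⟨![k'], enc (Q.subst (instS ![k'])), ?_, fun L hL hc => ⟨0, ?_⟩, fun L => .inl rfl,
          fun A1 μ1 C1 A2 μ2 C2 h1 h2 => ⟨C1 ∪ C2, by
            have := Dec.par h1 h2; exact this⟩⟩
        · exact sim_atom.2 fun i => congrArg nf (congrFun (inst_pair _ _) i).symm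
        · rw [enc_subst]; exact .next _

/-! ### Evolution of a process in one time unit -/

/-- In the final store `L`, the process `P`, whose private names are `ν`, tells the constraints in
`U`, and evolves to a process that agrees with `Q` up to residuals of used constructs. -/
def Evolves (L : Set (Constr S)) (P Q : UProc S) (ν : List ℕ) (U : Set (Constr S)) : Prop :=
  ∃ (A : Multiset (UProc S)) (C : Set (Constr S)) (r : List (UProc S)) (k : ℕ) (D T : Finset ℕ),
    Dec P Val.var A ν C ∧ EvM L A r k ∧
    (∀ X Y : MS S, A ≤ X.A → (∀ a ∈ X.A, IsAgent a) → Relation.ReflTransGen MStep X Y → Quiet Y →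
      U ⊆ Y.L) ∧ D ∪ T ⊆ ν.toFinset ∧ Disjoint D T ∧
    -- The next unit of `P` and the process `Q` share the agents `core`. `G1` are the residuals of
    -- used constructs, with go names in `D` and stop names in `T`; `G2` are agents of `Q` that can
    -- never release anything, in any store.
    ∀ F : Finset ℕ, ν.toFinset ⊆ F → ∃ core G1 G2 μ C1 ν' C2,
      Dec (UProc.prod r) Val.var (core + G1) μ C1 ∧ Fresh F μ ∧ (∀ x ∈ μ, x % 4 = 1) ∧
      Dec Q Val.var (core + G2) ν' C2 ∧ ν'.Nodup ∧ (∀ x ∈ ν', x ∈ ν ∨ x ∈ μ) ∧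
      (∀ x ∈ ν', x ∉ D ∪ T) ∧ (∀ a ∈ G1, Garbage D T a) ∧ (∀ a ∈ G2, Garbage ∅ ∅ a) ∧
      ∀ s ∈ T, .bang (.tell (opv (.var s))) ∈ G1

theorem Residual.mono {D T D' T' : Finset ℕ} {a : UProc S} (h : Residual D T a) (hD : D ⊆ D')
    (hT : T ⊆ T') : Residual D' T' a := by
  cases h with
  | dead h => exact .dead fun L hL hg t => h L hL (fun g hg' => hg g (hD hg')) t
  | unl h => exact .unl (hT h)
  | tell h => exact .tell (hT h)
  | ack h => exact .ack (hT h)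

theorem Garbage.mono {D T D' T' : Finset ℕ} {a : UProc S} (h : Garbage D T a) (hD : D ⊆ D')
    (hT : T ⊆ T') : Garbage D' T' a :=
  h.imp (·.mono hD hT) fun ⟨b, h1, h2⟩ => ⟨b, h1.mono hD hT, h2⟩

theorem Evolves.skip (L : Set (Constr S)) : Evolves L .skip .skip [] ∅ :=
  ⟨0, ∅, [], 0, ∅, ∅, .skip _, .zero L, fun _ _ _ _ _ _ => Set.empty_subset _, by simp, by simp,
    fun F _ => ⟨0, 0, 0, [], ∅, [], ∅, .skip _, fresh_nil F, by simp, .skip _, by simp, by simp,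
      by simp, by simp, by simp, by simp⟩⟩

/-- Both sides are evaluated in the same joint final store, so there is no interaction left to
consider; only the names have to be kept apart. -/
theorem Evolves.par {L : Set (Constr S)} {P Q P' Q' : UProc S} {ν ν' : List ℕ}
    {U U' : Set (Constr S)} (h : Evolves L P Q ν U) (h' : Evolves L P' Q' ν' U')
    (hν : (ν ++ ν').Nodup) : Evolves L (.par P P') (.par Q Q') (ν ++ ν') (U ∪ U') := by
  obtain ⟨A, C, r, k, D, T, h1, h2, h3, h4, h5, h6⟩ := h
  obtain ⟨A', C', r', k', D', T', h1', h2', h3', h4', h5', h6'⟩ := h'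
  have hdis : ∀ x ∈ ν, x ∉ ν' := fun x hx hx' => (List.nodup_append'.1 hν).2.2 hx hx'
  have hDT : ∀ x, x ∈ D ∪ T → x ∈ ν := fun x hx => by simpa using h4 hx
  have hDT' : ∀ x, x ∈ D' ∪ T' → x ∈ ν' := fun x hx => by simpa using h4' hx
  refine ⟨A + A', C ∪ C', r ++ r', k + k', D ∪ D', T ∪ T', .par h1 h1',
    (h2.add h2').congr rfl (Multiset.coe_add _ _), fun X Y hA hag hs hq => Set.union_subset
      (h3 X Y ((Multiset.le_add_right _ _).trans hA) hag hs hq)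
      (h3' X Y ((Multiset.le_add_left _ _).trans hA) hag hs hq), ?_, ?_, ?_⟩
  · rw [Finset.union_union_union_comm, List.toFinset_append]
    exact Finset.union_subset_union h4 h4'
  · rw [Finset.disjoint_union_left, Finset.disjoint_union_right, Finset.disjoint_union_right]
    refine ⟨⟨h5, ?_⟩, ?_, h5'⟩ <;> rw [Finset.disjoint_left] <;> intro x hx hx'
    · exact hdis x (hDT x (Finset.mem_union_left _ hx)) (hDT' x (Finset.mem_union_right _ hx'))
    · exact hdis x (hDT x (Finset.mem_union_right _ hx')) (hDT' x (Finset.mem_union_left _ hx))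
  · intro F hF
    rw [List.toFinset_append, Finset.union_subset_iff] at hF
    obtain ⟨c1, G1, G2, μ, C1, ρ, C2, a1, a2, a3, a4, a5, a6, a7, a8, a9, a10⟩ := h6 F hF.1
    obtain ⟨c1', G1', G2', μ', C1', ρ', C2', b1, b2, b3, b4, b5, b6, b7, b8, b9, b10⟩ :=
      h6' (F ∪ μ.toFinset) (hF.2.trans Finset.subset_union_left)
    have e1 : ∀ x ∈ ν, x ∈ F := fun x hx => hF.1 (by simpa using hx)
    have e2 : ∀ x ∈ ν', x ∈ F := fun x hx => hF.2 (by simpa using hx)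
    have e3 : ∀ x ∈ μ, x ∉ F := fun x hx => (a2.2 x hx).2
    have e4 : ∀ x ∈ μ', x ∉ F ∧ x ∉ μ := fun x hx => by
      have := (b2.2 x hx).2
      simpa [not_or] using this
    have e5 : ∀ x ∈ ρ, x ∉ ν' ∧ x ∉ ρ' := fun x hx => by
      have hxF : x ∈ ν ∧ x ∈ F ∨ x ∈ μ ∧ x ∉ F := (a6 x hx).imp (fun h => ⟨h, e1 x h⟩)
        fun h => ⟨h, e3 x h⟩
      have hx2 : x ∉ ν' := fun h => hxF.elim (fun h' => hdis x h'.1 h) fun h' => h'.2 (e2 x h)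
      exact ⟨hx2, fun h => (b6 x h).elim hx2 fun h => hxF.elim (fun h' => (e4 x h).1 h'.2)
        fun h' => (e4 x h).2 h'.1⟩
    have e6 : ∀ x ∈ ρ', x ∉ ν := fun x hx => by
      exact fun h => (b6 x hx).elim (hdis x h) fun h' => (e4 x h').1 (e1 x h)
    refine ⟨c1 + c1', G1 + G1', G2 + G2', μ ++ μ', C1 ∪ C1', ρ ++ ρ', C2 ∪ C2', ?_,
      fresh_append.2 ⟨a2, b2⟩, ?_, ?_, ?_, ?_, ?_, ?_, ?_, ?_⟩
    · exact dec_prod_append.2 ⟨_, _, _, _, _, _, a1, b1, add_add_add_comm _ _ _ _, rfl, rfl⟩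
    · exact fun x hx => (List.mem_append.1 hx).elim (a3 x) (b3 x)
    · rw [add_add_add_comm]; exact .par a4 b4
    · exact List.nodup_append'.2 ⟨a5, b5, fun x hx hx' => (e5 x hx).2 hx'⟩
    · intro x hx
      rw [List.mem_append] at hx
      simp only [List.mem_append]
      rcases hx with hx | hx
      · have := a6 x hx; tauto
      · have := b6 x hx; tauto
    · intro x hx
      rw [Finset.union_union_union_comm, Finset.mem_union, not_or]
      rcases List.mem_append.1 hx with hx | hx
      · exact ⟨a7 x hx, fun h => (e5 x hx).1 (hDT' x h)⟩
      · exact ⟨fun h => e6 x hx (hDT x h), b7 x hx⟩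
    · intro a ha
      rcases Multiset.mem_add.1 ha with ha | ha
      · exact (a8 a ha).mono Finset.subset_union_left Finset.subset_union_left
      · exact (b8 a ha).mono Finset.subset_union_right Finset.subset_union_right
    · intro a ha
      rcases Multiset.mem_add.1 ha with ha | ha
      exacts [a9 a ha, b9 a ha]
    · intro s hs
      rw [Multiset.mem_add]
      exact (Finset.mem_union.1 hs).imp (a10 s) (b10 s)

/-! ### Components of a process -/

theorem dec_prod_agents {l : List (UProc S)} (h : ∀ a ∈ l, IsAgent a) :
    Dec (UProc.prod l) Val.var (l : Multiset (UProc S)) [] ∅ := by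
  induction l with
  | nil => exact .skip _
  | cons a l ih =>
    obtain ⟨C, h1⟩ := (Dec.par (.agent Val.var (h a (by simp))) (ih fun b hb => h b (by simp [hb]))).cast
      (A' := ((a :: l : List (UProc S)) : Multiset (UProc S))) (ν' := [])
      (by rw [UProc.subst_id]; rfl) rfl
    obtain ⟨-, -, rfl⟩ := dec_prod h h1
    exact h1

theorem Evolves.static {L U : Set (Constr S)} {P : UProc S} {l : List (UProc S)} {ν C k}
    (hd : Dec P Val.var (l : Multiset (UProc S)) ν C) (hν : ν.Nodup)
    (hev : EvM L (l : Multiset (UProc S)) (l : Multiset (UProc S)) k)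
    (hU : ∀ X Y : MS S, (l : Multiset (UProc S)) ≤ X.A → (∀ a ∈ X.A, IsAgent a) →
      Relation.ReflTransGen MStep X Y → Quiet Y → U ⊆ Y.L) : Evolves L P P ν U :=
  ⟨_, C, l, k, ∅, ∅, hd, hev, hU, by simp, by simp, fun F _ => ⟨l, 0, 0, [], ∅, ν, C,
    by rw [add_zero]; exact dec_prod_agents hd.isAgent, fresh_nil F, by simp,
    by rwa [add_zero], hν, fun x => .inl, by simp, by simp, by simp, by simp⟩⟩

/-- A component of a process with the reduct that is expected. -/
inductive Item (S : Sig.{u}) : Type u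
  | cond (A A' : HProc S)
  | pair (A B R : HProc S)
  | idle (A : HProc S)
  | proc (P : UProc S)

/-- The encoding of a component. -/
def Item.src : Item S → UProc S
  | cond A _ => enc A
  | pair A B _ => .par (enc A) (enc B)
  | idle A => enc A
  | proc P => P

/-- The encoding of the reduct. -/
def Item.tgt : Item S → UProc S
  | cond _ A' => enc A'
  | pair _ _ R => enc R
  | idle A => enc A
  | proc P => P

/-- The role of a component. -/
inductive Role (S : Sig.{u}) : Type u
  | dull
  | snd (x : Snd S)
  | rcv (y : Rcv S)
  | pair (x : Snd S) (y : Rcv S) (t : Fin y.n → Val S) (C' : UProc S)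

/-- The private names of a component. -/
def Role.names : Role S → List ℕ
  | dull => []
  | snd x => x.names
  | rcv y => y.names
  | pair x y _ _ => x.names ++ y.names

/-- The constraints that a component tells. -/
def Role.told : Role S → Set (Constr S)
  | dull => ∅
  | snd x => {opv (.var x.g), opv (.var x.g'), atom x.p x.ts}
  | rcv y => {opv (.var y.h)}
  | pair x y t _ => {opv (.var x.g), opv (.var x.g'), atom x.p x.ts, opv (.var y.h),
      atom (ackOf y.p) (y.inst t), atom (.bar y.p) (y.inst t), opv (.var y.r), opv (.var x.s),
      opv (.var x.s'), atom (.bar (ackOf x.p)) x.ts}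

/-- A component has a role. -/
inductive Plays : Item S → Role S → Prop
  | cond {A A'} : HProc.IfStep A A' → Plays (.cond A A') .dull
  | stuck {e P Q} : (∀ A', ¬ HProc.IfStep (.ite e P Q) A') → Plays (.idle (.ite e P Q)) .dull
  | inact : Plays (.idle .inact) .dull
  | proc (n X ts Q) : Plays (.proc (.bang (.abs n (atom (.call X n) ts) [] Q))) .dull
  | snd {A x} : IsSnd A x → Plays (.idle A) (.snd x)
  | rcv {B y} : IsRcv B y → Plays (.idle B) (.rcv y)
  | pair {A B R x y t C'} : IsSnd A x → IsRcv B y → Reacts x y t C' R →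
      Plays (.pair A B R) (.pair x y t C')

/-- The final store `L` has no constraints that a component does not expect. -/
def Role.Calm (L : Set (Constr S)) : Role S → Prop
  | dull => True
  | snd x => ¬ SEnt L (opv (.var x.s)) ∧ ¬ SEnt L (opv (.var x.s')) ∧
      ¬ SEnt L (atom (.bar x.p) x.ts) ∧ ¬ SEnt L (atom (ackOf x.p) x.ts)
  | rcv y => ¬ SEnt L (opv (.var y.r)) ∧ ∀ t, ¬ SEnt L (atom y.p (y.inst t))
  | pair _ y t _ => ∀ t', SEnt L (atom y.p (y.inst t')) → t' = t

theorem Has.of_sim {L : Set (Constr S)} {n m : ℕ} {p : Pr n} {p' : Pr m} {ts : Fin n → Tm S}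
    {ts' : Fin m → Tm S} (h : Sim (atom p ts) (atom p' ts')) (hc : atom p' ts' ∈ L) : Has L p ts :=
  has_iff.2 ⟨_, hc, h⟩

theorem sent_inst {L : Set (Constr S)} {y : Rcv S} {t : Fin y.n → Val S} :
    SEnt L (substC (instS t) (atom y.p y.ts)) ↔ SEnt L (atom y.p (y.inst t)) := by
  rw [substC_atom]; rfl

theorem will_waitA {L : Set (Constr S)} {g s n : ℕ} {c d : Constr S} {P : UProc S}
    (hg : opv (.var g) ∈ L) (t : Fin n → Val S) (hc : SEnt L (substC (instS t) c))
    (h : Will L (P.subst (instS t)) d ∨ d = opv (.var s)) : ∃ a ∈ waitA g s n c P, Will L a d := by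
  refine ⟨_, .tail _ (.tail _ (.head _)), .bang (.abs t (sent_waitA.2 ⟨hc, .mem hg⟩)
    (by simp) ?_)⟩
  rcases h with h | rfl
  · exact .left h
  · refine .right ?_
    simp only [UProc.subst, substC_opv, Val.subst, instS_add]
    exact .bang (.tell _)

theorem opv_mem_tellA (g s : ℕ) {n : ℕ} (p : Pr n) (ts : Fin n → Tm S) :
    .tell (opv (.var g)) ∈ tellA g s p ts := by simp [tellA]

theorem opv_mem_waitA (g s n : ℕ) (c : Constr S) (P : UProc S) :
    .tell (opv (.var g)) ∈ waitA g s n c P := by simp [waitA]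

theorem will_tellA {L : Set (Constr S)} {g s n : ℕ} {p : Pr n} {ts : Fin n → Tm S}
    (hg : opv (.var g) ∈ L) : ∃ a ∈ tellA g s p ts, Will L a (atom p ts) :=
  ⟨_, .tail _ (.head _), .bang (.when (.mem hg) (.tell _))⟩

theorem will_tellA_stop {L : Set (Constr S)} {g s n : ℕ} {p : Pr n} {ts : Fin n → Tm S}
    (hb : SEnt L (atom (.bar p) ts)) : ∃ a ∈ tellA g s p ts, Will L a (opv (.var s)) :=
  ⟨_, .tail _ (.tail _ (.tail _ (.head _))), .bang (.when hb (.bang (.tell _)))⟩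

theorem told_of_will {l : List (UProc S)} {X Y : MS S} (hA : (l : Multiset (UProc S)) ≤ X.A)
    (hag : ∀ a ∈ X.A, IsAgent a) (hs : Relation.ReflTransGen MStep X Y) (hq : Quiet Y) {c}
    (h : ∃ a ∈ l, Will Y.L a c) : c ∈ Y.L :=
  Will.told hs hq hag (.inr (h.imp fun _ h => ⟨Multiset.mem_of_le hA h.1, h.2⟩))

/-! ### Evolution of each kind of component -/

theorem evolves_snd {L : Set (Constr S)} {A : HProc S} {x : Snd S} (h : IsSnd A x)
    (hnd : x.names.Nodup) (hU : (Role.snd x).told ⊆ L) (hL : (Role.snd x).Calm L) :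
    Evolves L (enc A) (enc A) x.names (Role.snd x).told := by
  obtain ⟨C, hd⟩ := h.dec
  obtain ⟨h1, h2, h3, h4⟩ := hL
  obtain ⟨k1, e1⟩ := evM_tellA_idle (g := x.g) (s := x.s) (hU (by simp [Role.told]))
    (hU (by simp [Role.told])) h1 h3
  obtain ⟨k2, e2⟩ := evM_waitA_idle (g := x.g') (n := 0) (c := atom (ackOf x.p) x.ts) (P := x.cont)
    (hU (by simp [Role.told])) h2 fun t => by rwa [instS_zero, substC_id]
  refine .static hd hnd (e1.add e2) fun X Y hA hag hs hq => ?_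
  have told := fun c => told_of_will (c := c) hA hag hs hq
  have hg : opv (.var x.g) ∈ Y.L := told _ ⟨_, List.mem_append_left _ (opv_mem_tellA _ _ _ _), .tell _⟩
  rintro c (rfl | rfl | rfl)
  · exact hg
  · exact told _ ⟨_, List.mem_append_right _ (opv_mem_waitA _ _ _ _ _), .tell _⟩
  · obtain ⟨a, h5, h6⟩ := will_tellA (s := x.s) hg
    exact told _ ⟨a, List.mem_append_left _ h5, h6⟩

theorem evolves_rcv {L : Set (Constr S)} {B : HProc S} {y : Rcv S} (h : IsRcv B y)
    (hnd : y.names.Nodup) (hU : (Role.rcv y).told ⊆ L) (hL : (Role.rcv y).Calm L) :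
    Evolves L (enc B) (enc B) y.names (Role.rcv y).told := by
  obtain ⟨C, hd⟩ := h.dec
  obtain ⟨h1, h2⟩ := hL
  obtain ⟨k2, e2⟩ := evM_waitA_idle (g := y.h) (n := y.n) (c := atom y.p y.ts) (P := y.cont)
    (hU (by simp [Role.told])) h1 fun t => by rw [sent_inst]; exact h2 t
  refine .static hd hnd e2 fun X Y hA hag hs hq => ?_
  rintro c rfl
  exact told_of_will hA hag hs hq ⟨_, opv_mem_waitA _ _ _ _ _, .tell _⟩

/-- Since `tt` and `ff` are distinct constants, exactly one of the two guards is open. -/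
theorem evolves_cond {L : Set (Constr S)} (hL : ∀ c ∈ L, TellOK c) {A A' : HProc S}
    (h : HProc.IfStep A A') : Evolves L (enc A) (enc A') [] ∅ := by
  have key : ∀ {P1 P2 : UProc S} {c1 c2 : Constr S} {k}, EvM L {.when c1 P1, .when c2 P2}
      {enc A'} k → Evolves L (.par (.when c1 P1) (.when c2 P2)) (enc A') [] ∅ := by
    intro P1 P2 c1 c2 k he
    refine ⟨_, _, [enc A'], k, ∅, ∅, .par (.agent _ (by trivial)) (.agent _ (by trivial)), ?_,
      fun _ _ _ _ _ _ => Set.empty_subset _, by simp, by simp, fun F _ => ?_⟩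
    · rw [UProc.subst_id, UProc.subst_id]
      exact he
    · obtain ⟨B, μ, C, h1, h2, h3⟩ := exists_dec (enc A') Val.var F (.inl rfl)
      refine ⟨B, 0, 0, μ ++ [], C ∪ ∅, μ, C, .par h1 (.skip _), by rwa [List.append_nil],
        by rwa [List.append_nil], by rwa [add_zero], h2.1, by simp, by simp, by simp, by simp,
        by simp⟩
  cases h with
  | @tt e P Q h =>
    have h1 : SEnt L (Term.equal e (Val.const S.tt).tm) := by
      rw [sent_equal hL, nf_tm]; exact (eval_iff _ _).1 h
    have h2 : ¬ SEnt L (Term.equal e (Val.const S.ff).tm) := by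
      rw [sent_equal hL, nf_tm, (eval_iff _ _).1 h]
      intro h
      have := tm_injective h
      simp only [Val.const.injEq] at this
      exact S.tt_ne_ff this
    exact key (EvM.cons (.when_pos h1 (.next _)) (.singleton (.when_neg h2)))
  | @ff e P Q h =>
    have h1 : SEnt L (Term.equal e (Val.const S.ff).tm) := by
      rw [sent_equal hL, nf_tm]; exact (eval_iff _ _).1 h
    have h2 : ¬ SEnt L (Term.equal e (Val.const S.tt).tm) := by
      rw [sent_equal hL, nf_tm, (eval_iff _ _).1 h]
      intro h
      have := tm_injective h
      simp only [Val.const.injEq] at this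
      exact S.tt_ne_ff this.symm
    exact key ((EvM.cons (.when_neg h2) (.singleton (.when_pos h1 (.next _)))).congr rfl
      (zero_add _))

/-- The guards of a conditional are not replicated, so a stuck conditional disappears after one time
unit whereas the reduct still contains it. Its guards are closed in every store, so the missing
agents count as residuals on the side of the reduct. -/
theorem evolves_stuck {L : Set (Constr S)} (hL : ∀ c ∈ L, TellOK c) {e : Tm S} {P Q : HProc S}
    (h : ∀ A', ¬ HProc.IfStep (.ite e P Q) A') :
    Evolves L (enc (.ite e P Q)) (enc (.ite e P Q)) [] ∅ := by
  have key : ∀ b : S.Const, (¬ Eval e (.const b)) → ∀ L : Set (Constr S), (∀ c ∈ L, TellOK c) →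
      ¬ SEnt L (Term.equal e (Val.const b).tm) := by
    intro b hb L hL
    rw [sent_equal hL, nf_tm]
    exact fun h => hb ((eval_iff _ _).2 h)
  have h1 := key S.tt fun h' => h _ (.tt h')
  have h2 := key S.ff fun h' => h _ (.ff h')
  obtain ⟨C, hd⟩ := (Dec.par (.agent Val.var (a := .when (Term.equal e (Val.const S.tt).tm)
    (.next (enc P))) trivial) (.agent Val.var (a := .when (Term.equal e (Val.const S.ff).tm)
    (.next (enc Q))) trivial)).cast (ν' := []) (by rw [UProc.subst_id, UProc.subst_id]) rfl
  refine ⟨_, _, [], _, ∅, ∅, hd, EvM.cons (.when_neg (h1 L hL)) (.singleton (.when_neg (h2 L hL))),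
    fun _ _ _ _ _ _ => Set.empty_subset _, by simp, by simp, fun F _ => ⟨0, 0, _, [], ∅, [], C,
    .skip _, fresh_nil F, by simp, by rw [zero_add]; exact hd, by simp, by simp, by simp, by simp,
    ?_, by simp⟩⟩
  intro a ha
  simp only [Multiset.mem_add, Multiset.mem_singleton] at ha
  rcases ha with rfl | rfl
  · exact .inl (.dead fun L hL _ t h => h1 L hL (by rwa [instS_zero, substC_id] at h))
  · exact .inl (.dead fun L hL _ t h => h2 L hL (by rwa [instS_zero, substC_id] at h))

theorem Garbage.isAgent {D T : Finset ℕ} {a : UProc S} (h : Garbage D T a) : IsAgent a := by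
  rcases h with h | ⟨b, -, rfl | rfl⟩
  · exact h.isAgent
  · trivial
  · trivial

/-- The residuals of a sender and a receiver that have reacted. -/
def pairG (x : Snd S) (y : Rcv S) : List (UProc S) :=
  tellG x.g x.s x.p x.ts ++ (waitG x.g' x.s' 0 (atom (ackOf x.p) x.ts) x.cont ++
    waitG y.h y.r y.n (atom y.p y.ts) y.cont)

theorem evM_pair {L : Set (Constr S)} (hL : ∀ c ∈ L, TellOK c) {x : Snd S} {y : Rcv S}
    {t : Fin y.n → Val S} {C' : UProc S} {R : HProc S} (hr : Reacts x y t C' R)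
    (hU : (Role.pair x y t C').told ⊆ L) (hc : (Role.pair x y t C').Calm L) :
    ∃ k, EvM L ((x.A : Multiset (UProc S)) + (y.A : Multiset (UProc S)))
      ((x.C :: C' :: pairG x y : List (UProc S)) : Multiset (UProc S)) k := by
  have hU' : ∀ c ∈ (Role.pair x y t C').told, c ∈ L := fun c hc => hU hc
  simp only [Role.told, Set.mem_insert_iff, Set.mem_singleton_iff, forall_eq_or_imp, forall_eq] at hU'
  obtain ⟨u1, u2, u3, u4, u5, u6, u7, u8, u9, u10⟩ := hU'
  obtain ⟨k1, e1⟩ := evM_tellA_fired (ts := x.ts) u1 u3 u8 (Has.of_sim (hr.mat.map Pr.bar) u6).sent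
  have h2 : Ev L (x.cont.subst (instS Fin.elim0)) ({x.C} + 0) (0 + 1) := by
    rw [instS_zero, UProc.subst_id]
    exact .par (.next _) (.tell u10)
  obtain ⟨k2, e2⟩ := evM_waitA_fired (c := atom (ackOf x.p) x.ts) u2 u9 Fin.elim0
    (by rw [instS_zero, substC_id]; exact (Has.of_sim (hr.mat.map ackOf) u5).sent)
    (fun t' _ => fin_zero_eq _ _) h2
  obtain ⟨k3, h3⟩ := hr.ev L hL u5
  have h4 := Ev.par h3 (.tell u6)
  rw [← Rcv.cont_subst] at h4
  obtain ⟨k4, e3⟩ := evM_waitA_fired (c := atom y.p y.ts) u4 u7 t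
    (sent_inst.2 (Has.of_sim hr.mat.symm u3).sent) (fun t' h => hc t' (sent_inst.1 h)) h4
  refine ⟨_, ((e1.add e2).add e3).congr ?_ ?_⟩
  · rw [Multiset.coe_add]; rfl
  · simp only [pairG, ← Multiset.cons_coe, ← Multiset.singleton_add, ← Multiset.coe_add, add_zero]
    abel

/-- The causal order of a reaction: go names, the atom of the sender, the acknowledgements of the
receiver and its stop name, and then the stop names of the sender and its own overlined
acknowledgement. -/
theorem told_pair {x : Snd S} {y : Rcv S} {t : Fin y.n → Val S} {C' : UProc S} {R : HProc S}
    (hr : Reacts x y t C' R) {X Y : MS S}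
    (hA : (x.A : Multiset (UProc S)) + (y.A : Multiset (UProc S)) ≤ X.A)
    (hag : ∀ a ∈ X.A, IsAgent a) (hs : Relation.ReflTransGen MStep X Y) (hq : Quiet Y) :
    (Role.pair x y t C').told ⊆ Y.L := by
  have tx := fun c => told_of_will (c := c) ((Multiset.le_add_right _ _).trans hA) hag hs hq
  have ty := fun c => told_of_will (c := c) ((Multiset.le_add_left _ _).trans hA) hag hs hq
  have tx1 : ∀ c, (∃ a ∈ tellA x.g x.s x.p x.ts, Will Y.L a c) → c ∈ Y.L := fun c ⟨a, h, h'⟩ =>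
    tx c ⟨a, List.mem_append_left _ h, h'⟩
  have tx2 : ∀ c, (∃ a ∈ waitA x.g' x.s' 0 (atom (ackOf x.p) x.ts) x.cont, Will Y.L a c) →
      c ∈ Y.L := fun c ⟨a, h, h'⟩ => tx c ⟨a, List.mem_append_right _ h, h'⟩
  have u1 : opv (.var x.g) ∈ Y.L := tx1 _ ⟨_, opv_mem_tellA _ _ _ _, .tell _⟩
  have u2 : opv (.var x.g') ∈ Y.L := tx2 _ ⟨_, opv_mem_waitA _ _ _ _ _, .tell _⟩
  have u3 : atom x.p x.ts ∈ Y.L := tx1 _ (will_tellA u1)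
  have u4 : opv (.var y.h) ∈ Y.L := ty _ ⟨_, opv_mem_waitA _ _ _ _ _, .tell _⟩
  have hy : SEnt Y.L (substC (instS t) (atom y.p y.ts)) :=
    sent_inst.2 (Has.of_sim hr.mat.symm u3).sent
  have u6 : atom (.bar y.p) (y.inst t) ∈ Y.L := ty _ (will_waitA u4 t hy (.inl (by
    rw [Rcv.cont_subst]; exact .right (.tell _))))
  have u5 : atom (ackOf y.p) (y.inst t) ∈ Y.L := by
    rcases hr.will Y.L with h | h
    · rw [h]; exact u6
    · exact ty _ (will_waitA u4 t hy (.inl (by rw [Rcv.cont_subst]; exact .left h)))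
  have u7 : opv (.var y.r) ∈ Y.L := ty _ (will_waitA u4 t hy (.inr rfl))
  have u8 : opv (.var x.s) ∈ Y.L :=
    tx1 _ (will_tellA_stop (Has.of_sim (hr.mat.map Pr.bar) u6).sent)
  have hx : SEnt Y.L (substC (instS Fin.elim0) (atom (ackOf x.p) x.ts)) := by
    rw [instS_zero, substC_id]; exact (Has.of_sim (hr.mat.map ackOf) u5).sent
  have u9 : opv (.var x.s') ∈ Y.L := tx2 _ (will_waitA u2 _ hx (.inr rfl))
  have u10 : atom (.bar (ackOf x.p)) x.ts ∈ Y.L := tx2 _ (will_waitA u2 _ hx (.inl (by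
    rw [instS_zero, UProc.subst_id]; exact .right (.tell _))))
  simp only [Role.told, Set.insert_subset_iff, Set.singleton_subset_iff]
  exact ⟨u1, u2, u3, u4, u5, u6, u7, u8, u9, u10⟩

theorem evolves_pair {L : Set (Constr S)} (hL : ∀ c ∈ L, TellOK c) {A B R : HProc S} {x : Snd S}
    {y : Rcv S} (hx : IsSnd A x) (hy : IsRcv B y) {t : Fin y.n → Val S} {C' : UProc S}
    (hr : Reacts x y t C' R) (hnd : (x.names ++ y.names).Nodup)
    (hU : (Role.pair x y t C').told ⊆ L) (hc : (Role.pair x y t C').Calm L) :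
    Evolves L (.par (enc A) (enc B)) (enc R) (x.names ++ y.names) (Role.pair x y t C').told := by
  obtain ⟨Cx, hdx⟩ := hx.dec
  obtain ⟨Cy, hdy⟩ := hy.dec
  obtain ⟨k, he⟩ := evM_pair hL hr hU hc
  have hnd' := hnd
  simp only [Snd.names, Rcv.names, List.append_assoc, List.cons_append, List.nil_append] at hnd'
  rw [List.nodup_append'] at hnd'
  obtain ⟨n1, n2, n3⟩ := hnd'
  -- The go names are never told again, the stop names are told from now on; the session name in
  -- `x.κ` belongs to neither set, as it lives on in the reduct.
  refine ⟨_, _, _, k, {x.g, x.g', y.h}, {x.s, x.s', y.r}, .par hdx hdy, he,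
    fun X Y hA hag hs hq => told_pair hr hA hag hs hq, ?_, ?_, fun F hF => ?_⟩
  · intro z hz
    simp only [Finset.mem_union, Finset.mem_insert, Finset.mem_singleton] at hz
    simp only [Snd.names, Rcv.names, List.mem_toFinset, List.mem_append, List.mem_cons,
      List.not_mem_nil, or_false]
    tauto
  · simp only [List.nodup_cons, List.mem_cons, List.not_mem_nil, or_false, not_or] at n2
    simp only [Finset.disjoint_insert_left, Finset.disjoint_singleton_left, Finset.mem_insert,
      Finset.mem_singleton, not_or]
    omega
  · obtain ⟨A1, μ1, C1, a1, a2, a3⟩ := exists_dec x.C Val.var F (.inl rfl)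
    obtain ⟨A2, μ2, C2, b1, b2, b3⟩ := exists_dec C' Val.var (F ∪ μ1.toFinset) (.inl rfl)
    obtain ⟨C3, h3⟩ := hr.dec _ _ _ _ _ _ a1 b1
    have hμ : Fresh F (μ1 ++ μ2) := fresh_append.2 ⟨a2, b2⟩
    have hG : ∀ a ∈ pairG x y, Garbage {x.g, x.g', y.h} {x.s, x.s', y.r} a := by
      intro a ha
      rcases List.mem_append.1 ha with ha | ha
      · exact garbage_tellG (by simp) (by simp) a ha
      rcases List.mem_append.1 ha with ha | ha
      · exact garbage_waitG (by simp) (by simp) a ha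
      · exact garbage_waitG (by simp) (by simp) a ha
    obtain ⟨C4, h4⟩ := (Dec.par a1 (.par b1 (dec_prod_agents fun a ha => (hG a ha).isAgent))).cast
      (add_assoc _ _ _).symm (ν' := μ1 ++ μ2) (by rw [List.append_nil])
    have hκ : ∀ z ∈ x.κ, z ∈ x.names ++ y.names := fun z hz =>
      List.mem_append_left _ (List.mem_append_left _ hz)
    have hF' : ∀ z ∈ x.names ++ y.names, z ∈ F := fun z hz => hF (by simpa using hz)
    refine ⟨A1 + A2, pairG x y, 0, μ1 ++ μ2, C4, x.κ ++ (μ1 ++ μ2), C3, h4, hμ, ?_,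
      by rwa [add_zero], ?_, ?_, ?_, hG, by simp, ?_⟩
    · exact fun z hz => (List.mem_append.1 hz).elim (a3 z) (b3 z)
    · exact List.nodup_append'.2 ⟨n1, hμ.1, fun z hz hz' => (hμ.2 z hz').2 (hF' z (hκ z hz))⟩
    · exact fun z hz => (List.mem_append.1 hz).imp (hκ z) id
    · have key : ∀ z, z ∈ ({x.g, x.g', y.h} ∪ {x.s, x.s', y.r} : Finset ℕ) →
          z ∈ [x.g, x.s, x.g', x.s', y.h, y.r] := by
        intro z hz
        simp only [Finset.mem_union, Finset.mem_insert, Finset.mem_singleton] at hz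
        simp only [List.mem_cons, List.not_mem_nil, or_false]
        tauto
      intro z hz hz'
      rcases List.mem_append.1 hz with hz | hz
      · exact n3 hz (key z hz')
      · refine (hμ.2 z hz).2 (hF' z ?_)
        have := key z hz'
        simp only [Snd.names, Rcv.names, List.append_assoc, List.cons_append, List.nil_append]
        exact List.mem_append_right _ this
    · intro s hs
      simp only [Finset.mem_insert, Finset.mem_singleton] at hs
      rcases hs with rfl | rfl | rfl <;> simp [pairG, tellG, waitG]

theorem evolves_role {L : Set (Constr S)} (hL : ∀ c ∈ L, TellOK c)
    (hcall : ∀ (X n : ℕ) ts, ¬ SEnt L (atom (.call X n) ts)) {w : Item S} {u : Role S}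
    (h : Plays w u) (hnd : u.names.Nodup) (hU : u.told ⊆ L) (hc : u.Calm L) :
    Evolves L w.src w.tgt u.names u.told := by
  cases h with
  | cond h => exact evolves_cond hL h
  | stuck h => exact evolves_stuck hL h
  | inact => exact .skip L
  | proc n X ts Q =>
    refine .static (l := [.bang (.abs n (atom (.call X n) ts) [] Q)]) (C := ∅)
      (k := 0 + 1) ?_ (by simp [Role.names]) ?_ fun _ _ _ _ _ _ => Set.empty_subset _
    · have := Dec.agent (a := .bang (.abs n (atom (.call X n) ts) [] Q)) Val.var trivial
      rwa [UProc.subst_id] at this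
    · have := EvM.singleton (Ev.bang (P := .abs n (atom (.call X n) ts) [] Q) (L := L)
        (.exhausted fun t h => absurd (by rw [substC_atom] at h; exact h) (hcall X n _)))
      rwa [zero_add] at this
  | snd h => exact evolves_snd h hnd hU hc
  | rcv h => exact evolves_rcv h hnd hU hc
  | pair hx hy hr => exact evolves_pair hL hx hy hr hnd hU hc

/-! ### Choice of the private names -/

/-- The names that are told are distinguished from the private names that are not told. -/
def Role.Colored : Role S → Prop
  | dull => True
  | snd x => x.g % 8 = 1 ∧ x.g' % 8 = 1 ∧ x.s % 8 = 5 ∧ x.s' % 8 = 5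
  | rcv y => y.h % 8 = 1 ∧ y.r % 8 = 5
  | pair x y _ _ => x.g % 8 = 1 ∧ x.g' % 8 = 1 ∧ x.s % 8 = 1 ∧ x.s' % 8 = 1 ∧ y.h % 8 = 1 ∧
      y.r % 8 = 1

/-- The local conditions on a component. -/
def Item.OK : Item S → Prop
  | cond A A' => HProc.IfStep A A'
  | pair A B R => HProc.Comm A B R
  | idle A => A.Guarded ∧ ∀ A', ¬ HProc.IfStep A A'
  | proc P => ∃ n X ts Q, P = .bang (.abs n (atom (.call X n) ts) [] Q)

/-- The process is a sender. -/
def IsSender (A : HProc S) : Prop := ∀ k g s g' s', ∃ x : Snd S, IsSnd A x ∧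
  (x.κ = [] ∨ x.κ = [k]) ∧ x.g = g ∧ x.s = s ∧ x.g' = g' ∧ x.s' = s'

/-- The process is a receiver. -/
def IsReceiver (B : HProc S) : Prop := ∀ h r, ∃ y : Rcv S, IsRcv B y ∧ y.h = h ∧ y.r = r

theorem isSender_of_comm {A B R : HProc S} (h : HProc.Comm A B R) : IsSender A ∧ IsReceiver B := by
  constructor
  · intro k g s g' s'
    cases h with
    | link => exact ⟨_, .request _ _ k g s g' s', .inr rfl, rfl, rfl, rfl, rfl⟩
    | com => exact ⟨_, .send _ _ _ _ g s g' s', .inl rfl, rfl, rfl, rfl, rfl⟩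
    | label => exact ⟨_, .select _ _ _ g s g' s', .inl rfl, rfl, rfl, rfl, rfl⟩
    | pass => exact ⟨_, .throwCh _ _ _ g s g' s', .inl rfl, rfl, rfl, rfl, rfl⟩
  · intro h' r
    cases h with
    | link => exact ⟨_, .accept _ _ h' r, rfl, rfl⟩
    | com => exact ⟨_, .recv _ _ _ h' r, rfl, rfl⟩
    | label => exact ⟨_, .branch _ _ _ _ h' r, rfl, rfl⟩
    | pass => exact ⟨_, .catchCh _ _ h' r, rfl, rfl⟩

theorem guarded_cases {A : HProc S} (h : A.Guarded) : A = .inact ∨ (∃ e P Q, A = .ite e P Q) ∨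
    IsSender A ∨ IsReceiver A := by
  cases A with
  | request a P => exact .inr (.inr (.inl fun k g s g' s' =>
      ⟨_, .request _ _ k g s g' s', .inr rfl, rfl, rfl, rfl, rfl⟩))
  | accept a P => exact .inr (.inr (.inr fun h r => ⟨_, .accept _ _ h r, rfl, rfl⟩))
  | send k n es P => exact .inr (.inr (.inl fun k g s g' s' =>
      ⟨_, .send _ _ _ _ g s g' s', .inl rfl, rfl, rfl, rfl, rfl⟩))
  | recv k n P => exact .inr (.inr (.inr fun h r => ⟨_, .recv _ _ _ h r, rfl, rfl⟩))
  | select k l P => exact .inr (.inr (.inl fun k g s g' s' =>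
      ⟨_, .select _ _ _ g s g' s', .inl rfl, rfl, rfl, rfl, rfl⟩))
  | branch k n ls Ps => exact .inr (.inr (.inr fun h r => ⟨_, .branch _ _ _ _ h r, rfl, rfl⟩))
  | throwCh k k' P => exact .inr (.inr (.inl fun k g s g' s' =>
      ⟨_, .throwCh _ _ _ g s g' s', .inl rfl, rfl, rfl, rfl, rfl⟩))
  | catchCh k P => exact .inr (.inr (.inr fun h r => ⟨_, .catchCh _ _ h r, rfl, rfl⟩))
  | ite e P Q => exact .inr (.inl ⟨e, P, Q, rfl⟩)
  | inact => exact .inl rfl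
  | par P Q => exact h.elim
  | nu P => exact h.elim
  | call X n es => exact h.elim

theorem exists_bound (F : Finset ℕ) : ∃ b, ∀ x ∈ F, x < 8 * b := by
  refine ⟨F.sup id + 1, fun x hx => ?_⟩
  have : id x ≤ F.sup id := Finset.le_sup hx
  simp only [id] at this
  omega

theorem fresh_of_bound {F : Finset ℕ} {b : ℕ} (hb : ∀ x ∈ F, x < 8 * b) {l : List ℕ} (h : l.Nodup)
    (hl : ∀ x ∈ l, 8 * b ≤ x ∧ x % 4 = 1) : Fresh F l ∧ ∀ x ∈ l, x % 4 = 1 := by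
  refine ⟨⟨h, fun x hx => ⟨?_, fun hF => ?_⟩⟩, fun x hx => (hl x hx).2⟩
  · have := (hl x hx).2; omega
  · have := hb x hF; have := (hl x hx).1; omega

/-- All names lie beyond `F` and in the class of `1` modulo `4`. Modulo `8` they are `1`, except for
the stop names of idle constructs, which are `5`; this separates them from every name that is told.
-/
theorem exists_role {w : Item S} (h : w.OK) (F : Finset ℕ) : ∃ u, Plays w u ∧ u.Colored ∧
    Fresh F u.names ∧ ∀ x ∈ u.names, x % 4 = 1 := by
  obtain ⟨b, hb⟩ := exists_bound F
  cases w with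
  | cond A A' => exact ⟨_, .cond h, trivial, fresh_nil F, by simp [Role.names]⟩
  | pair A B R =>
    obtain ⟨h1, h2⟩ := isSender_of_comm h
    obtain ⟨x, hx, h3, h4, h5, h6, h7⟩ := h1 (8 * b + 1) (8 * b + 9) (8 * b + 17) (8 * b + 25)
      (8 * b + 33)
    obtain ⟨y, hy, h8, h9⟩ := h2 (8 * b + 41) (8 * b + 49)
    obtain ⟨t, C', hr⟩ := reacts_of_comm h hx hy
    refine ⟨_, .pair hx hy hr, ?_, fresh_of_bound hb ?_ ?_⟩
    · simp only [Role.Colored, h4, h5, h6, h7, h8, h9]; omega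
    · rcases h3 with h3 | h3 <;>
        simp [Role.names, Snd.names, Rcv.names, h3, h4, h5, h6, h7, h8, h9]
    · rcases h3 with h3 | h3 <;>
        simp [Role.names, Snd.names, Rcv.names, h3, h4, h5, h6, h7, h8, h9] <;> omega
  | idle A =>
    obtain ⟨h1, h2⟩ := h
    rcases guarded_cases h1 with rfl | ⟨e, P, Q, rfl⟩ | h1 | h1
    · exact ⟨_, .inact, trivial, fresh_nil F, by simp [Role.names]⟩
    · exact ⟨_, .stuck h2, trivial, fresh_nil F, by simp [Role.names]⟩
    -- The offsets `21` and `37` of the stop names are congruent to `5` modulo `8`.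
    · obtain ⟨x, hx, h3, h4, h5, h6, h7⟩ := h1 (8 * b + 1) (8 * b + 9) (8 * b + 21) (8 * b + 25)
        (8 * b + 37)
      refine ⟨_, .snd hx, ?_, fresh_of_bound hb ?_ ?_⟩
      · simp only [Role.Colored, h4, h5, h6, h7]; omega
      · rcases h3 with h3 | h3 <;> simp [Role.names, Snd.names, h3, h4, h5, h6, h7]
      · rcases h3 with h3 | h3 <;> simp [Role.names, Snd.names, h3, h4, h5, h6, h7] <;> omega
    · obtain ⟨y, hy, h8, h9⟩ := h1 (8 * b + 1) (8 * b + 13)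
      refine ⟨_, .rcv hy, ?_, fresh_of_bound hb ?_ ?_⟩
      · simp only [Role.Colored, h8, h9]; omega
      · simp [Role.names, Rcv.names, h8, h9]
      · simp [Role.names, Rcv.names, h8, h9]; omega
  | proc P =>
    obtain ⟨n, X, ts, Q, rfl⟩ := h
    exact ⟨_, .proc n X ts Q, trivial, fresh_nil F, by simp [Role.names]⟩

theorem exists_roles {ws : List (Item S)} (h : ∀ w ∈ ws, w.OK) (F : Finset ℕ) :
    ∃ zs : List (Item S × Role S), zs.map Prod.fst = ws ∧
      (∀ z ∈ zs, Plays z.1 z.2 ∧ z.2.Colored) ∧ Fresh F (zs.flatMap fun z => z.2.names) ∧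
      ∀ x ∈ zs.flatMap fun z => z.2.names, x % 4 = 1 := by
  induction ws generalizing F with
  | nil => exact ⟨[], rfl, by simp, fresh_nil F, by simp⟩
  | cons w ws ih =>
    obtain ⟨u, h1, h2, h3, h4⟩ := exists_role (h w (by simp)) F
    obtain ⟨zs, rfl, h5, h6, h7⟩ := ih (fun w hw => h w (by simp [hw])) (F ∪ u.names.toFinset)
    refine ⟨(w, u) :: zs, rfl, ?_, ?_, ?_⟩
    · intro z hz
      rcases List.mem_cons.1 hz with rfl | hz
      exacts [⟨h1, h2⟩, h5 z hz]
    · exact fresh_append.2 ⟨h3, h6⟩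
    · intro x hx
      rw [List.flatMap_cons, List.mem_append] at hx
      exact hx.elim (h4 x) (h7 x)

/-! ### The final store -/

/-- The processes of a component that can send. -/
def Item.outs : Item S → List (HProc S)
  | pair A _ _ => [A]
  | idle A => [A]
  | _ => []

/-- The processes of a component that can receive. -/
def Item.ins : Item S → List (HProc S)
  | pair _ B _ => [B]
  | idle A => [A]
  | _ => []

/-- No process of `w` sends to a process of `w'`. -/
def NoCross (w w' : Item S) : Prop := ∀ A ∈ w.outs, ∀ B ∈ w'.ins, ∀ R, ¬ HProc.Comm A B R

/-- The labels that `A` selects are offered by `B`. -/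
def Offers (A B : HProc S) : Prop :=
  ∀ k l A' n ls Ps, A = .select k l A' → B = .branch k n ls Ps → ∃ i, ls i = l

/-- A role that sends. -/
def Role.Sends (u : Role S) (x : Snd S) : Prop := u = .snd x ∨ ∃ y t C', u = .pair x y t C'

/-- A role that receives. -/
def Role.Recvs (u : Role S) (y : Rcv S) : Prop := u = .rcv y ∨ ∃ x t C', u = .pair x y t C'

theorem Plays.sends {w : Item S} {u : Role S} (h : Plays w u) {x} (hx : u.Sends x) :
    ∃ A ∈ w.outs, IsSnd A x := by
  rcases hx with rfl | ⟨y, t, C', rfl⟩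
  · cases h with | snd h => exact ⟨_, by simp [Item.outs], h⟩
  · cases h with | pair h _ _ => exact ⟨_, by simp [Item.outs], h⟩

theorem Plays.recvs {w : Item S} {u : Role S} (h : Plays w u) {y} (hy : u.Recvs y) :
    ∃ B ∈ w.ins, IsRcv B y := by
  rcases hy with rfl | ⟨x, t, C', rfl⟩
  · cases h with | rcv h => exact ⟨_, by simp [Item.ins], h⟩
  · cases h with | pair _ h _ => exact ⟨_, by simp [Item.ins], h⟩

/-- Only the partners in a pair react. -/
def Separate (u u' : Role S) : Prop := ∀ x y t, u.Sends x → u'.Recvs y → Mat x y t →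
  ∃ C', u = .pair x y t C' ∧ u' = .pair x y t C'

theorem separate_of_noCross {w w' : Item S} {u u' : Role S} (h : Plays w u) (h' : Plays w' u')
    (hn : NoCross w w') (ho : ∀ A ∈ w.outs, ∀ B ∈ w'.ins, Offers A B) : Separate u u' := by
  intro x y t hx hy hm
  obtain ⟨A, h1, h2⟩ := h.sends hx
  obtain ⟨B, h3, h4⟩ := h'.recvs hy
  obtain ⟨R, hR⟩ := hm.comm h2 h4 (ho A h1 B h3)
  exact absurd hR (hn A h1 B h3 R)

/-- A single role both sends and receives only if it is a pair, and then `Mat.unique` determines the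
tuple. -/
theorem separate_self {w : Item S} {u : Role S} (h : Plays w u) : Separate u u := by
  intro x y t hx hy hm
  rcases hx with rfl | ⟨y', t', C', rfl⟩
  · rcases hy with h | ⟨_, _, _, h⟩ <;> cases h
  · rcases hy with h1 | ⟨_, _, _, h1⟩
    · cases h1
    · cases h1
      cases h with
      | pair _ hy hr =>
        obtain rfl := hm.unique hy hr.mat
        exact ⟨_, rfl, rfl⟩

theorem separate_of_pairwise {zs : List (Item S × Role S)}
    (hp : ∀ z ∈ zs, Plays z.1 z.2) (hn : (zs.map Prod.fst).Pairwise fun w w' => NoCross w w' ∧ NoCross w' w)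
    (ho : ∀ w ∈ zs.map Prod.fst, ∀ w' ∈ zs.map Prod.fst, ∀ A ∈ w.outs, ∀ B ∈ w'.ins, Offers A B) :
    ∀ z ∈ zs, ∀ z' ∈ zs, Separate z.2 z'.2 := by
  intro z hz z' hz'
  rw [List.pairwise_map] at hn
  have h1 : zs.Pairwise fun z z' => Separate z.2 z'.2 ∧ Separate z'.2 z.2 := by
    refine hn.imp_of_mem fun {z z'} hz hz' h => ?_
    have hw := List.mem_map_of_mem (f := Prod.fst) hz
    have hw' := List.mem_map_of_mem (f := Prod.fst) hz'
    exact ⟨separate_of_noCross (hp z hz) (hp z' hz') h.1 (ho _ hw _ hw'),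
      separate_of_noCross (hp z' hz') (hp z hz) h.2 (ho _ hw' _ hw)⟩
  exact List.Pairwise.forall_of_forall_of_flip
    (R := fun z z' : Item S × Role S => Separate z.2 z'.2) (fun z hz => separate_self (hp z hz))
    (h1.imp fun h => h.1) (h1.imp fun h => h.2) hz hz'

/-- All constraints that are told. -/
def store (zs : List (Item S × Role S)) : Set (Constr S) := { c | ∃ z ∈ zs, c ∈ z.2.told }

/-- Together with the kinds of the predicates, this classification decides which told constraint can
entail a given guard. -/
theorem told_cases {w : Item S} {u : Role S} (h : Plays w u) (hc : u.Colored) {c : Constr S}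
    (hcu : c ∈ u.told) : (∃ i, c = opv (.var i) ∧ i % 8 = 1) ∨
      (∃ x, u.Sends x ∧ c = atom x.p x.ts ∧ IsBase x.p) ∨
      ∃ x y t C', u = .pair x y t C' ∧ IsBase x.p ∧ IsBase y.p ∧ (c = atom (ackOf y.p) (y.inst t) ∨
        c = atom (.bar y.p) (y.inst t) ∨ c = atom (.bar (ackOf x.p)) x.ts) := by
  cases h with
  | snd h =>
    obtain ⟨c1, c2, -, -⟩ := hc
    rcases hcu with rfl | rfl | rfl
    · exact .inl ⟨_, rfl, c1⟩
    · exact .inl ⟨_, rfl, c2⟩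
    · exact .inr (.inl ⟨_, .inl rfl, rfl, h.base⟩)
  | rcv h => obtain rfl := hcu; exact .inl ⟨_, rfl, hc.1⟩
  | pair hx hy hr =>
    obtain ⟨c1, c2, c3, c4, c5, c6⟩ := hc
    rcases hcu with rfl | rfl | rfl | rfl | rfl | rfl | rfl | rfl | rfl | rfl
    · exact .inl ⟨_, rfl, c1⟩
    · exact .inl ⟨_, rfl, c2⟩
    · exact .inr (.inl ⟨_, .inr ⟨_, _, _, rfl⟩, rfl, hx.base⟩)
    · exact .inl ⟨_, rfl, c5⟩
    · exact .inr (.inr ⟨_, _, _, _, rfl, hx.base, hy.base, .inl rfl⟩)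
    · exact .inr (.inr ⟨_, _, _, _, rfl, hx.base, hy.base, .inr (.inl rfl)⟩)
    · exact .inl ⟨_, rfl, c6⟩
    · exact .inl ⟨_, rfl, c3⟩
    · exact .inl ⟨_, rfl, c4⟩
    · exact .inr (.inr ⟨_, _, _, _, rfl, hx.base, hy.base, .inr (.inr rfl)⟩)
  | _ => exact hcu.elim

theorem store_tellOK {zs : List (Item S × Role S)} (h : ∀ z ∈ zs, Plays z.1 z.2 ∧ z.2.Colored) :
    ∀ c ∈ store zs, TellOK c := by
  rintro c ⟨z, hz, hc⟩
  rcases told_cases (h z hz).1 (h z hz).2 hc with ⟨i, rfl, -⟩ | ⟨x, -, rfl, -⟩ |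
    ⟨x, y, t, C', -, -, -, rfl | rfl | rfl⟩ <;> exact .inl ⟨_, _, _, rfl⟩

theorem Sim.knd_eq {n m : ℕ} {p : Pr n} {p' : Pr m} {ts : Fin n → Tm S} {ts' : Fin m → Tm S}
    (h : Sim (atom p ts) (atom p' ts')) : knd p = knd p' := sigma_knd h.sigma

/-- Names told by `outp'` are congruent to `1` modulo `8`. -/
theorem store_outp {zs : List (Item S × Role S)} (h : ∀ z ∈ zs, Plays z.1 z.2 ∧ z.2.Colored)
    {s : ℕ} (hs : s % 8 = 5) : ¬ SEnt (store zs) (opv (.var s)) := by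
  rw [opv, sent_atom (store_tellOK h), has_iff]
  rintro ⟨c, ⟨z, hz, hc⟩, h1⟩
  rcases told_cases (h z hz).1 (h z hz).2 hc with ⟨i, rfl, hi⟩ | ⟨x, -, rfl, hb⟩ |
    ⟨x, y, t, C', -, hb, hb', rfl | rfl | rfl⟩
  · have := sim_atom.1 h1 0
    simp only [Matrix.cons_val_zero, nf_tm] at this
    have := tm_injective this
    simp only [Val.var.injEq] at this
    omega
  · have := h1.knd_eq; simp only [knd, IsBase] at this hb; omega
  · have := h1.knd_eq; have := knd_ackOf hb'; simp only [knd, IsBase] at *; omega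
  · have := h1.knd_eq; simp only [knd] at this; omega
  · have := h1.knd_eq; simp only [knd] at this; omega

theorem store_call {zs : List (Item S × Role S)} (h : ∀ z ∈ zs, Plays z.1 z.2 ∧ z.2.Colored)
    (X n : ℕ) (ts) : ¬ SEnt (store zs) (atom (.call X n) ts) := by
  rw [sent_atom (store_tellOK h), has_iff]
  rintro ⟨c, ⟨z, hz, hc⟩, h1⟩
  rcases told_cases (h z hz).1 (h z hz).2 hc with ⟨i, rfl, hi⟩ | ⟨x, -, rfl, hb⟩ |
    ⟨x, y, t, C', -, hb, hb', rfl | rfl | rfl⟩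
  · have := h1.knd_eq; simp only [knd] at this; omega
  · have := h1.knd_eq; simp only [knd, IsBase] at this hb; omega
  · have := h1.knd_eq; have := knd_ackOf hb'; simp only [knd, IsBase] at *; omega
  · have := h1.knd_eq; simp only [knd] at this; omega
  · have := h1.knd_eq; simp only [knd] at this; omega

theorem store_base {zs : List (Item S × Role S)} (h : ∀ z ∈ zs, Plays z.1 z.2 ∧ z.2.Colored)
    {n : ℕ} {p : Pr n} (hp : IsBase p) {ts : Fin n → Tm S} (hs : SEnt (store zs) (atom p ts)) :
    ∃ z ∈ zs, ∃ x, z.2.Sends x ∧ Sim (atom x.p x.ts) (atom p ts) := by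
  rw [sent_atom (store_tellOK h), has_iff] at hs
  obtain ⟨c, ⟨z, hz, hc⟩, h1⟩ := hs
  rcases told_cases (h z hz).1 (h z hz).2 hc with ⟨i, rfl, hi⟩ | ⟨x, hx, rfl, hb⟩ |
    ⟨x, y, t, C', -, hb, hb', rfl | rfl | rfl⟩
  · have := h1.knd_eq; simp only [knd, IsBase] at this hp; omega
  · exact ⟨z, hz, x, hx, h1.symm⟩
  · have := h1.knd_eq; have := knd_ackOf hb'; simp only [IsBase] at *; omega
  · have := h1.knd_eq; simp only [knd, IsBase] at this hp; omega
  · have := h1.knd_eq; simp only [knd, IsBase] at this hp; omega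

/-- Only pairs tell acknowledgements, and the acknowledgement determines the predicate and the
arguments of the atom that was received. -/
theorem store_ack {zs : List (Item S × Role S)} (h : ∀ z ∈ zs, Plays z.1 z.2 ∧ z.2.Colored)
    {n : ℕ} {p q : Pr n} (hp : IsBase p) (hq : q = .bar p ∨ q = ackOf p) {ts : Fin n → Tm S}
    (hs : SEnt (store zs) (atom q ts)) :
    ∃ z ∈ zs, ∃ x y t C', z.2 = .pair x y t C' ∧ Sim (atom p ts) (atom y.p (y.inst t)) := by
  rw [sent_atom (store_tellOK h), has_iff] at hs
  obtain ⟨c, ⟨z, hz, hc⟩, h1⟩ := hs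
  have hk := knd_ackOf hp
  have hk' : knd q = knd p + 10 ∨ knd q = knd (ackOf p) := by
    rcases hq with rfl | rfl
    exacts [.inl rfl, .inr rfl]
  rcases told_cases (h z hz).1 (h z hz).2 hc with ⟨i, rfl, hi⟩ | ⟨x, hx, rfl, hb⟩ |
    ⟨x, y, t, C', hz', hb, hb', rfl | rfl | rfl⟩
  · have := h1.knd_eq; simp only [knd] at this; omega
  · have := h1.knd_eq; simp only [IsBase] at *; omega
  · refine ⟨z, hz, x, y, t, C', hz', h1.congr ?_⟩
    rcases hq with rfl | rfl
    exacts [sigma_bar_ackOf h1.sigma, sigma_ackOf h1.sigma]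
  · refine ⟨z, hz, x, y, t, C', hz', h1.congr ?_⟩
    rcases hq with rfl | rfl
    exacts [sigma_bar h1.sigma, (sigma_bar_ackOf h1.sigma.symm).symm]
  -- The overlined acknowledgement of the sender has kind `12` or above `20`; acknowledgements of
  -- base predicates have kind `2` or one from `11` to `15`.
  · have := h1.knd_eq; have := knd_ackOf hb; simp only [knd, IsBase] at *; omega

/-- An unexpected entailment would come from an atom told by some sender or acknowledged by some
pair. It would then match a sender with a receiver that is not its partner, against `Separate`. -/
theorem store_calm {zs : List (Item S × Role S)} (h : ∀ z ∈ zs, Plays z.1 z.2 ∧ z.2.Colored)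
    (hs : ∀ z ∈ zs, ∀ z' ∈ zs, Separate z.2 z'.2) : ∀ z ∈ zs, z.2.Calm (store zs) := by
  rintro ⟨w, u⟩ hz
  obtain ⟨hp, hc⟩ := h _ hz
  dsimp only at hp hc ⊢
  cases hp with
  | @snd A x hx =>
    have key : ∀ q, q = .bar x.p ∨ q = ackOf x.p → ¬ SEnt (store zs) (atom q x.ts) := by
      intro q hq h1
      obtain ⟨z', hz', x', y, t, C', h2, h3⟩ := store_ack h hx.base hq h1
      obtain ⟨_, h4, -⟩ := hs _ hz z' hz' x y t (.inl rfl) (.inr ⟨_, _, _, h2⟩) h3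
      cases h4
    exact ⟨store_outp h hc.2.2.1, store_outp h hc.2.2.2, key _ (.inl rfl), key _ (.inr rfl)⟩
  | @rcv B y hy =>
    refine ⟨store_outp h hc.2, fun t h1 => ?_⟩
    obtain ⟨z', hz', x, h2, h3⟩ := store_base h hy.base h1
    obtain ⟨_, -, h4⟩ := hs z' hz' _ hz x y t h2 (.inl rfl) h3
    cases h4
  | @pair A B R x y t C' hx hy hr =>
    intro t' h1
    obtain ⟨z', hz', x', h2, h3⟩ := store_base h hy.base h1
    obtain ⟨_, -, h4⟩ := hs z' hz' _ hz x' y t' h2 (.inr ⟨_, _, _, rfl⟩) h3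
    cases h4
    rfl
  | _ => trivial

theorem evolves_items {zs : List (Item S × Role S)} {L : Set (Constr S)} (hL : ∀ c ∈ L, TellOK c)
    (hcall : ∀ (X n : ℕ) ts, ¬ SEnt L (atom (.call X n) ts))
    (h : ∀ z ∈ zs, Plays z.1 z.2 ∧ z.2.Calm L ∧ z.2.told ⊆ L)
    (hnd : (zs.flatMap fun z => z.2.names).Nodup) :
    Evolves L (UProc.prod (zs.map fun z => z.1.src)) (UProc.prod (zs.map fun z => z.1.tgt))
      (zs.flatMap fun z => z.2.names) (store zs) := by
  induction zs with
  | nil =>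
    have : store ([] : List (Item S × Role S)) = ∅ := by ext; simp [store]
    rw [this]
    exact .skip L
  | cons z zs ih =>
    have h1 := h z (by simp)
    rw [List.flatMap_cons] at hnd
    have h2 := ih (fun z hz => h z (by simp [hz])) (List.nodup_append'.1 hnd).2.1
    have : store (z :: zs) = z.2.told ∪ store zs := by ext; simp [store]
    rw [this]
    exact (evolves_role hL hcall h1.1 (List.nodup_append'.1 hnd).1 h1.2.2 h1.2.1).par h2 hnd

/-- The components of a process evolve to the reducts that are expected. -/
theorem exists_evolves {ws : List (Item S)} (h : ∀ w ∈ ws, w.OK)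
    (hn : ws.Pairwise fun w w' => NoCross w w' ∧ NoCross w' w)
    (ho : ∀ w ∈ ws, ∀ w' ∈ ws, ∀ A ∈ w.outs, ∀ B ∈ w'.ins, Offers A B) (F : Finset ℕ) :
    ∃ (L : Set (Constr S)) (ν : List ℕ), Fresh F ν ∧ (∀ x ∈ ν, x % 4 = 1) ∧
      Evolves L (UProc.prod (ws.map Item.src)) (UProc.prod (ws.map Item.tgt)) ν L := by
  obtain ⟨zs, rfl, h1, h2, h3⟩ := exists_roles h F
  have hs := separate_of_pairwise (fun z hz => (h1 z hz).1) hn ho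
  -- The final store is guessed as the union of what all roles tell; `store_calm` confirms the
  -- guess.
  refine ⟨store zs, _, h2, h3, ?_⟩
  have := evolves_items (store_tellOK h1) (store_call h1) (fun z hz => ⟨(h1 z hz).1,
    store_calm h1 hs z hz, fun c hc => ⟨z, hz, hc⟩⟩) h2.1
  rw [List.map_map, List.map_map]
  exact this

/-! ### Renaming of session processes -/

theorem HProc.subst_subst (P : HProc S) (σ τ : Sub S) :
    (P.subst σ).subst τ = P.subst (cmp σ τ) := by
  induction P generalizing σ τ with
  | _ => simp_all only [HProc.subst, Val.subst_subst, cmp_upS_upS, substT_substT]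

theorem HProc.subst_id (P : HProc S) : P.subst Val.var = P := by
  induction P with
  | _ => simp_all only [HProc.subst, Val.subst_var, upS_var, substT_id]

theorem eval_subst {e : Tm S} {v : Val S} (h : Eval e v) (σ : Sub S) :
    Eval (substT σ e) (v.subst σ) := by
  induction h with
  | var i => rw [substT_var, eval_iff, nf_tm]; rfl
  | const c ts => exact .const c _
  | label l ts => exact .label l _
  | op o ts cs c _ hc ih => exact .op o _ cs c ih hc

theorem comm_subst {A B R : HProc S} (h : HProc.Comm A B R) (σ : Sub S) :
    HProc.Comm (A.subst σ) (B.subst σ) (R.subst σ) := by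
  cases h with
  | link a P Q => exact .link _ _ _
  | com k n es cs P Q h =>
    have := HProc.Comm.com (k.subst σ) n (fun i => substT σ (es i)) (fun i => (cs i).subst σ)
      (P.subst σ) (Q.subst (upS n σ)) fun i => eval_subst (h i) σ
    simpa only [HProc.subst, HProc.subst_subst, cmp_instS] using this
  | label k n ls Ps i P => exact .label _ _ _ _ _ _
  | pass k k' P Q =>
    have := HProc.Comm.pass (k.subst σ) (k'.subst σ) (P.subst σ) (Q.subst (upS 1 σ))
    have h1 : (fun i => ((![k'] : Fin 1 → Val S) i).subst σ) = ![k'.subst σ] := by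
      funext i; fin_cases i; rfl
    simpa only [HProc.subst, HProc.subst_subst, cmp_instS, h1] using this

theorem ifStep_subst {A A' : HProc S} (h : HProc.IfStep A A') (σ : Sub S) :
    HProc.IfStep (A.subst σ) (A'.subst σ) := by
  cases h with
  | tt h => exact .tt (eval_subst h σ)
  | ff h => exact .ff (eval_subst h σ)

theorem guarded_subst {A : HProc S} (h : A.Guarded) (σ : Sub S) : (A.subst σ).Guarded := by
  cases A <;> first | exact h.elim | trivial

theorem exists_left_inverse {ρ : ℕ → ℕ} (h : Function.Injective ρ) :
    ∃ τ : Sub S, ∀ A : HProc S, (A.subst (ren S ρ)).subst τ = A := by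
  refine ⟨ren S (Function.invFun ρ), fun A => ?_⟩
  rw [HProc.subst_subst]
  have : cmp (ren S ρ) (ren S (Function.invFun ρ)) = Val.var := by
    funext i
    exact congrArg Val.var (Function.leftInverse_invFun h i)
  rw [this, HProc.subst_id]

/-- An injective renaming creates no redexes, since its left inverse is a substitution and reduction
is closed under substitution. -/
theorem comm_of_subst {ρ : ℕ → ℕ} (h : Function.Injective ρ) {A B R : HProc S}
    (hc : HProc.Comm (A.subst (ren S ρ)) (B.subst (ren S ρ)) R) : ∃ R', HProc.Comm A B R' := by
  obtain ⟨τ, hτ⟩ := exists_left_inverse (S := S) h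
  have := comm_subst hc τ
  rw [hτ, hτ] at this
  exact ⟨_, this⟩

theorem ifStep_of_subst {ρ : ℕ → ℕ} (h : Function.Injective ρ) {A R : HProc S}
    (hc : HProc.IfStep (A.subst (ren S ρ)) R) : ∃ R', HProc.IfStep A R' := by
  obtain ⟨τ, hτ⟩ := exists_left_inverse (S := S) h
  have := ifStep_subst hc τ
  rw [hτ] at this
  exact ⟨_, this⟩

theorem offers_subst {ρ : ℕ → ℕ} (h : Function.Injective ρ) {A B : HProc S} (ho : Offers A B) :
    Offers (A.subst (ren S ρ)) (B.subst (ren S ρ)) := by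
  intro k l A' n ls Ps hA hB
  cases A <;> simp only [HProc.subst, reduceCtorEq] at hA
  cases B <;> simp only [HProc.subst, reduceCtorEq] at hB
  simp only [HProc.select.injEq] at hA
  obtain ⟨rfl, rfl, rfl⟩ := hA
  injection hB with h1 h2 h3 h4
  subst h2
  cases h3
  obtain rfl := Val.subst_ren_injective h h1
  exact ho _ _ _ _ _ _ rfl rfl

/-! ### Processes in the shape of a normal form -/

theorem enc_prod (l : List (HProc S)) : enc (HProc.prod l) = UProc.prod (l.map enc) := by
  induction l with
  | nil => rfl
  | cons a l ih => exact congrArg (UProc.par (enc a)) ih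

theorem prod_enc_subst (l : List (HProc S)) (σ : Sub S) :
    UProc.prod (l.map fun A => enc (A.subst σ)) = (enc (HProc.prod l)).subst σ := by
  rw [enc_prod, prod_subst, List.map_map]
  congr 2
  funext A
  exact enc_subst A σ

/-- The names for the outer restrictions are fixed once, before the body is known, so that the
program and its reduct are decomposed under the same renaming `ρ`. -/
theorem exists_dec_nus (m : ℕ) {s : ℕ → ℕ} {F : Finset ℕ} (hs : Function.Injective s)
    (hF : ∀ i, s i % 2 = 0 ∨ s i ∈ F) : ∃ τ ρ, Fresh F τ ∧ (∀ x ∈ τ, x % 4 = 1) ∧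
      Function.Injective ρ ∧ ∀ B A ν C, Dec (enc B) (ren S ρ) A ν C →
        ∃ C', Dec (enc (HProc.nus m B)) (ren S s) A (τ ++ ν) C' := by
  induction m generalizing s F with
  | zero => exact ⟨[], s, fresh_nil F, by simp, hs, fun B A ν C h => ⟨C, h⟩⟩
  | succ m ih =>
    obtain ⟨τ, h1, h2, h3⟩ := exists_fresh F 1 (.inl rfl)
    obtain ⟨τ', ρ, h4, h5, h6, h7⟩ := ih (extN_injective hs hF h2) (extN_mem hF (τ := τ))
    refine ⟨τ ++ τ', ρ, fresh_append.2 ⟨h2, h4⟩, fun x hx => (List.mem_append.1 hx).elim (h3 x) (h5 x),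
      h6, fun B A ν C h => ?_⟩
    obtain ⟨C', h8⟩ := h7 B A ν C h
    rw [← ext_ren] at h8
    rw [List.append_assoc]
    exact ⟨_, .loc τ h1 h8⟩

/-- Three groups of components under `m` private names. -/
def shape (m : ℕ) (l1 l2 l3 : List (HProc S)) : HProc S :=
  HProc.nus m (.par (HProc.prod l1) (.par (HProc.prod l2) (HProc.prod l3)))

theorem dec_shape {As : List (UProc S)} (hAs : ∀ a ∈ As, IsAgent a) {l1 l2 l3 : List (HProc S)}
    {m : ℕ} {s ρ : ℕ → ℕ} {τ ν : List ℕ} {A C} (hρ : ∀ B A ν C, Dec (enc B) (ren S ρ) A ν C →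
      ∃ C', Dec (enc (HProc.nus m B)) (ren S s) A (τ ++ ν) C')
    (h : Dec (UProc.prod (As.map (UProc.subst (ren S s)) ++
      (l1.map (fun A => enc (A.subst (ren S ρ))) ++ (l2.map (fun A => enc (A.subst (ren S ρ))) ++
        l3.map (fun A => enc (A.subst (ren S ρ))))))) Val.var A ν C) :
    ∃ C', Dec (.par (UProc.prod As) (enc (shape m l1 l2 l3))) (ren S s) A (τ ++ ν) C' := by
  obtain ⟨A1, A2, ν1, ν2, C1, C2, h1, h2, rfl, rfl, rfl⟩ := dec_prod_append.1 h
  obtain ⟨A3, A4, ν3, ν4, C3, C4, h3, h4, rfl, rfl, rfl⟩ := dec_prod_append.1 h2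
  obtain ⟨A5, A6, ν5, ν6, C5, C6, h5, h6, rfl, rfl, rfl⟩ := dec_prod_append.1 h4
  rw [← prod_subst, ← dec_iff_subst] at h1
  rw [prod_enc_subst, ← dec_iff_subst] at h3 h5 h6
  obtain ⟨-, rfl, -⟩ := dec_prod hAs h1
  obtain ⟨C', h7⟩ := hρ (.par (HProc.prod l1) (.par (HProc.prod l2) (HProc.prod l3))) _ _ _
    (.par h3 (.par h5 h6))
  exact ⟨C1 ∪ C', by have := Dec.par h1 h7; exact this⟩

theorem encD_isAgent (D : Decl S) : ∀ a ∈ encD D, IsAgent a := by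
  intro a ha
  obtain ⟨i, hi, rfl⟩ := List.mem_mapIdx.1 ha
  trivial

/-- The components of a program, the names being renamed. -/
def items (D : Decl S) (s ρ : ℕ → ℕ) (ifs : List (HProc S × HProc S))
    (rdx : List (HProc S × HProc S × HProc S)) (idle : List (HProc S)) : List (Item S) :=
  (encD D).map (fun a => .proc (a.subst (ren S s))) ++
    (ifs.map (fun t => .cond (t.1.subst (ren S ρ)) (t.2.subst (ren S ρ))) ++
    (rdx.map (fun t => .pair (t.1.subst (ren S ρ)) (t.2.1.subst (ren S ρ)) (t.2.2.subst (ren S ρ))) ++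
      idle.map fun A => .idle (A.subst (ren S ρ))))

/-- The conditions on the components of a program: all conditionals and all redexes are listed,
and redexes are disjoint. -/
structure Split (ifs : List (HProc S × HProc S)) (rdx : List (HProc S × HProc S × HProc S))
    (idle : List (HProc S)) : Prop where
  cond : ∀ t ∈ ifs, HProc.IfStep t.1 t.2
  comm : ∀ t ∈ rdx, HProc.Comm t.1 t.2.1 t.2.2
  rest : ∀ A ∈ idle, A.Guarded ∧ (∀ A', ¬ HProc.IfStep A A') ∧ (∀ B ∈ idle, ¬ HProc.Redex A B) ∧
    ∀ t ∈ rdx, ¬ HProc.Redex A t.1 ∧ ¬ HProc.Redex A t.2.1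
  apart : rdx.Pairwise fun t t' => ¬ HProc.Redex t.1 t'.2.1 ∧ ¬ HProc.Redex t'.1 t.2.1
  offers : ∀ A ∈ rdx.map (fun t => t.1) ++ idle, ∀ B ∈ rdx.map (fun t => t.2.1) ++ idle, Offers A B

theorem Split.ok {ifs : List (HProc S × HProc S)} {rdx : List (HProc S × HProc S × HProc S)}
    {idle : List (HProc S)} (h : Split ifs rdx idle) (D : Decl S) (s : ℕ → ℕ) {ρ : ℕ → ℕ}
    (hρ : Function.Injective ρ) : ∀ w ∈ items D s ρ ifs rdx idle, w.OK := by
  intro w hw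
  simp only [items, List.mem_append, List.mem_map] at hw
  rcases hw with ⟨a, ha, rfl⟩ | ⟨t, ht, rfl⟩ | ⟨t, ht, rfl⟩ | ⟨A, hA, rfl⟩
  · obtain ⟨i, hi, rfl⟩ := List.mem_mapIdx.1 ha
    simp only [UProc.subst, substC_atom, List.map_nil]
    exact ⟨_, _, _, _, rfl⟩
  · exact ifStep_subst (h.cond t ht) _
  · exact comm_subst (h.comm t ht) _
  · refine ⟨guarded_subst (h.rest A hA).1 _, fun A' hA' => ?_⟩
    obtain ⟨R, hR⟩ := ifStep_of_subst hρ hA'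
    exact (h.rest A hA).2.1 R hR

theorem Split.noCross {ifs : List (HProc S × HProc S)} {rdx : List (HProc S × HProc S × HProc S)}
    {idle : List (HProc S)} (h : Split ifs rdx idle) (D : Decl S) (s : ℕ → ℕ) {ρ : ℕ → ℕ}
    (hρ : Function.Injective ρ) :
    (items D s ρ ifs rdx idle).Pairwise fun w w' => NoCross w w' ∧ NoCross w' w := by
  have hl : ∀ {w w' : Item S}, w.outs = [] → w.ins = [] → NoCross w w' ∧ NoCross w' w := by
    intro w w' h1 h2
    constructor
    · intro A hA; simp [h1] at hA
    · intro A _ B hB; simp [h2] at hB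
  have key : ∀ {A B : HProc S}, ¬ HProc.Redex A B → ∀ R,
      ¬ HProc.Comm (A.subst (ren S ρ)) (B.subst (ren S ρ)) R ∧
      ¬ HProc.Comm (B.subst (ren S ρ)) (A.subst (ren S ρ)) R := fun h R =>
    ⟨fun hc => h (.inl (comm_of_subst hρ hc)), fun hc => h (.inr (comm_of_subst hρ hc))⟩
  refine List.pairwise_append.2 ⟨?_, List.pairwise_append.2 ⟨?_, List.pairwise_append.2
    ⟨?_, ?_, ?_⟩, ?_⟩, ?_⟩
  · exact List.pairwise_map.2 (List.pairwise_of_forall fun _ _ => hl rfl rfl)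
  · exact List.pairwise_map.2 (List.pairwise_of_forall fun _ _ => hl rfl rfl)
  · refine List.pairwise_map.2 (h.apart.imp fun {t t'} ht => ⟨?_, ?_⟩) <;> intro A hA B hB R <;>
      simp only [Item.outs, Item.ins, List.mem_singleton] at hA hB <;> subst hA hB
    · exact (key ht.1 R).1
    · exact (key ht.2 R).1
  · refine List.pairwise_map.2 ((List.Pairwise.and_mem.1 (List.pairwise_of_forall
      (R := fun _ _ : HProc S => True) fun _ _ => trivial)).imp fun {A B} hAB => ?_)
    have := (h.rest A hAB.1).2.2.1 B hAB.2.1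
    constructor <;> intro A' hA B' hB R <;>
      simp only [Item.outs, Item.ins, List.mem_singleton] at hA hB <;> subst hA hB
    exacts [(key this R).1, (key this R).2]
  · intro w hw w' hw'
    obtain ⟨t, ht, rfl⟩ := List.mem_map.1 hw
    obtain ⟨A, hA', rfl⟩ := List.mem_map.1 hw'
    have := (h.rest A hA').2.2.2 t ht
    constructor <;> intro A' hA B' hB R <;>
      simp only [Item.outs, Item.ins, List.mem_singleton] at hA hB <;> subst hA hB
    exacts [(key this.1 R).2, (key this.2 R).1]
  · intro w hw w' _
    obtain ⟨t, ht, rfl⟩ := List.mem_map.1 hw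
    exact hl rfl rfl
  · intro w hw w' _
    obtain ⟨t, ht, rfl⟩ := List.mem_map.1 hw
    exact hl rfl rfl

theorem Split.items_offers {ifs : List (HProc S × HProc S)}
    {rdx : List (HProc S × HProc S × HProc S)} {idle : List (HProc S)} (h : Split ifs rdx idle)
    (D : Decl S) (s : ℕ → ℕ) {ρ : ℕ → ℕ} (hρ : Function.Injective ρ) :
    ∀ w ∈ items D s ρ ifs rdx idle, ∀ w' ∈ items D s ρ ifs rdx idle, ∀ A ∈ w.outs, ∀ B ∈ w'.ins,
      Offers A B := by
  have h1 : ∀ w ∈ items D s ρ ifs rdx idle, ∀ A ∈ w.outs,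
      ∃ A0 ∈ rdx.map (fun t => t.1) ++ idle, A = A0.subst (ren S ρ) := by
    intro w hw A hA
    simp only [items, List.mem_append, List.mem_map] at hw
    rcases hw with ⟨a, ha, rfl⟩ | ⟨t, ht, rfl⟩ | ⟨t, ht, rfl⟩ | ⟨B, hB, rfl⟩ <;>
      simp only [Item.outs, List.mem_singleton, List.not_mem_nil] at hA
    · exact ⟨_, List.mem_append_left _ (List.mem_map_of_mem ht), hA⟩
    · exact ⟨_, List.mem_append_right _ hB, hA⟩
  have h2 : ∀ w ∈ items D s ρ ifs rdx idle, ∀ A ∈ w.ins,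
      ∃ A0 ∈ rdx.map (fun t => t.2.1) ++ idle, A = A0.subst (ren S ρ) := by
    intro w hw A hA
    simp only [items, List.mem_append, List.mem_map] at hw
    rcases hw with ⟨a, ha, rfl⟩ | ⟨t, ht, rfl⟩ | ⟨t, ht, rfl⟩ | ⟨B, hB, rfl⟩ <;>
      simp only [Item.ins, List.mem_singleton, List.not_mem_nil] at hA
    · exact ⟨_, List.mem_append_left _ (List.mem_map_of_mem ht), hA⟩
    · exact ⟨_, List.mem_append_right _ hB, hA⟩
  intro w hw w' hw' A hA B hB
  obtain ⟨A0, h3, rfl⟩ := h1 w hw A hA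
  obtain ⟨B0, h4, rfl⟩ := h2 w' hw' B hB
  exact offers_subst hρ (h.offers A0 h3 B0 h4)

/-! ### Comparison of the time step with the encoding of the reduct -/

/-- A process may be represented by the agents of any congruent process; here it is the grouped form
of the program. -/
theorem Conf.of_cg {P P' : UProc S} (hc : Cg P' P) (hP : Good true P) (hP' : Good true P')
    {A ν C} (hd : Dec P (ev S) A ν C) (hν : Fresh ∅ ν) {N : Finset ℕ} (hN : ∀ x ∈ ν, x ∈ N) :
    Conf P' ⊤ ⟨A, ∅, N⟩ := by
  obtain ⟨A', ν', C', h1, h2, h3, h4, -⟩ := (decSim_of_cg hc).2 _ _ _ _ _ hd hν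
  exact .of_dec hP' h1 h2 h4 (fun x hx => (h3 x hx).imp_left (hN x)) (.of_dec hP hd hN)

theorem clockK_subst (σ : Sub S) : (clockK S).subst σ = clockK S := by
  simp only [clockK, UProc.subst, substC_kf]

theorem dec_clock (σ : Sub S) : Dec (clockK S) σ {clockK S} [] ∅ := by
  have := Dec.agent (a := clockK S) σ trivial
  rwa [clockK_subst] at this

theorem Conf.par_clock {P : UProc S} {A : Multiset (UProc S)} {N : Finset ℕ}
    (h : Conf P ⊤ ⟨A, ∅, N⟩) : Conf (.par P (clockK S)) ⊤ ⟨A + {clockK S}, ∅, N⟩ := by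
  obtain ⟨A', ν, C, h1, h2, h3, h4, h5, h6, h7, h8⟩ := h
  refine ⟨A' + {clockK S}, ν ++ [], C ∪ ∅, .par h1 (dec_clock _), by rwa [List.append_nil],
    by rwa [List.append_nil], h4.add (MAg.refl (by simp [clockK, IsAgent])),
    by rwa [Set.union_empty], ⟨h6, good_clock⟩, ⟨h7, trivial⟩, fun a ha => ?_, h8.2⟩
  rcases Multiset.mem_add.1 ha with ha | ha
  · exact h8.1 a ha
  · rw [Multiset.mem_singleton.1 ha]
    exact ⟨good_clock, clockK_subst _⟩

theorem WF.sub {A A' : Multiset (UProc S)} {N N' : Finset ℕ} (h : WF (⟨A, ∅, N⟩ : MS S))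
    (hA : ∀ a ∈ A', a ∈ A) (hN : N ⊆ N') : WF (⟨A', ∅, N'⟩ : MS S) :=
  ⟨fun a ha => ⟨(h.1 a (hA a ha)).1, (h.1 a (hA a ha)).2.mono (Nm.mono hN)⟩, by simp⟩

/-- Both states have the traces of their common core. -/
theorem traces_residuals {core G1 G2 : Multiset (UProc S)} {N D T : Finset ℕ}
    (h1 : ∀ a ∈ G1, Garbage D T a) (h2 : ∀ a ∈ G2, Garbage ∅ ∅ a)
    (hs : ∀ s ∈ T, .bang (.tell (opv (.var s))) ∈ G1) (hD : Disjoint D T)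
    (hN : ∀ x ∈ D ∪ T, x % 2 = 1 ∧ x ∈ N)
    (hW : WF (⟨core + G2 + {clockK S}, ∅, N \ (D ∪ T)⟩ : MS S)) :
    tr ObsM (⟨core + G1 + {clockK S}, ∅, N⟩ : MS S) =
      tr ObsM (⟨core + G2 + {clockK S}, ∅, N⟩ : MS S) := by
  have hc : Act kf (core + {clockK S}) ∅ := .inl (by simp [clockK])
  have hW' := hW.sub (A' := core + {clockK S}) (fun a ha => by
    rw [Multiset.mem_add] at ha ⊢
    exact ha.imp_left fun h => Multiset.mem_add.2 (.inl h)) (Finset.Subset.refl _)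
  have g1 : Gb D T ⟨core + {clockK S}, ∅, N⟩ G1 ⟨core + G1 + {clockK S}, ∅, N⟩ :=
    ⟨add_right_comm _ _ _, ⟨∅, by simp, by simp⟩, h1, rfl, hW', hN, hD,
      fun s h => .inl (by simp [hs s h]), hc⟩
  have g2 : Gb ∅ ∅ ⟨core + {clockK S}, ∅, N⟩ G2 ⟨core + G2 + {clockK S}, ∅, N⟩ :=
    ⟨add_right_comm _ _ _, ⟨∅, by simp, by simp⟩, h2, rfl,
      hW'.sub (fun _ => id) (by simp [Finset.sdiff_subset]), by simp, by simp, by simp, hc⟩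
  exact g1.traces.trans g2.traces.symm

/-- The first time unit of the encoding simulates the reduction of all components that reduce. -/
theorem timeStep_of_split {ifs : List (HProc S × HProc S)}
    {rdx : List (HProc S × HProc S × HProc S)} {idle : List (HProc S)} (h : Split ifs rdx idle)
    {m : ℕ} {P Q : Program S} (hdecl : Q.decl = P.decl)
    (hP : HProc.SC P.body (shape m (ifs.map fun t => t.1) (rdx.map fun t => .par t.1 t.2.1) idle))
    (hQ : HProc.SC Q.body (shape m (ifs.map fun t => t.2) (rdx.map fun t => t.2.2) idle)) :
    (∃ R, UProc.TimeStep P.enc R) ∧ ∀ R, UProc.TimeStep P.enc R → UProc.ObsEquiv R Q.enc := by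
  obtain ⟨τ, ρ, t1, t2, t3, t4⟩ := exists_dec_nus (S := S) m ev_injective ev_even
  obtain ⟨L, ν, n1, n2, A, C, r, k, D, T, e1, e2, e3, e4, e5, e6⟩ := exists_evolves
    (h.ok P.decl (2 * ·) t3) (h.noCross P.decl (2 * ·) t3) (h.items_offers P.decl (2 * ·) t3)
    τ.toFinset
  have hag := e1.isAgent
  simp only [items, List.map_append, List.map_map] at e1 e6
  obtain ⟨C1, d1⟩ := dec_shape (l1 := ifs.map fun t => t.1)
    (l2 := rdx.map fun t => .par t.1 t.2.1) (l3 := idle) (encD_isAgent P.decl) t4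
    (by simp only [List.map_map]; exact e1)
  have hfr : Fresh ∅ (τ ++ ν) := fresh_append.2 ⟨t1, by rwa [Finset.empty_union]⟩
  set N : Finset ℕ := (τ ++ ν).toFinset with hN
  have hX : Conf P.enc ⊤ ⟨A, ∅, N⟩ := .of_cg (.par (.refl _) (cg_enc hP))
    (good_program ⟨P.decl, _⟩) (good_program P) d1 hfr fun x hx => by simpa [hN] using hx
  refine ⟨?_, fun R ⟨d, ho⟩ => ?_⟩
  -- The evaluation bounds the number of transitions, so some run ends.
  · obtain ⟨Y, hs, hq⟩ := e2.exists_quiet (X := ⟨A, ∅, N⟩) (Set.empty_subset _)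
    obtain ⟨P', d', h1, h2⟩ := hX.msteps hs
    exact ⟨_, d', P', d', h1, h2.quiet.2 hq, CEquiv.rfl' _, rfl⟩
  · obtain ⟨Y, hs, hq, -, ht⟩ := hX.obs ho
    obtain ⟨core, G1, G2, μ, C2, ν', C3, f1, f2, f3, f4, f5, f6, f7, f8, f9, f10⟩ := e6 N
      (by rw [hN, List.toFinset_append]; exact Finset.subset_union_right)
    have hZ := ht _ (e2.tick (X := ⟨A, ∅, N⟩) rfl hag hs hq (e3 _ _ le_rfl hag hs hq) f1 f2 f3)
    obtain ⟨C4, d2⟩ := dec_shape (l1 := ifs.map fun t => t.2)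
      (l2 := rdx.map fun t => t.2.2) (l3 := idle) (encD_isAgent P.decl) t4
      (by simp only [List.map_map]; exact f4)
    have hνN : ∀ x ∈ ν, x ∈ N := fun x hx => by simp [hN, hx]
    have hτN : ∀ x ∈ τ, x ∈ N := fun x hx => by simp [hN, hx]
    have hDT : ∀ x ∈ D ∪ T, x ∈ ν := fun x hx => by simpa using e4 hx
    have hν' : ∀ x ∈ ν', x % 2 = 1 ∧ x ∉ τ ∧ x ∈ N ∪ μ.toFinset := fun x hx => by
      rcases f6 x hx with h1 | h1
      · have := n1.2 x h1
        exact ⟨this.1, by simpa using this.2, Finset.mem_union_left _ (hνN x h1)⟩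
      · have := f2.2 x h1
        exact ⟨this.1, fun h2 => this.2 (hτN x h2), by simp [h1]⟩
    have hfr' : Fresh ∅ (τ ++ ν') := fresh_append.2 ⟨t1, f5, fun x hx => ⟨(hν' x hx).1, by
      simpa using (hν' x hx).2.1⟩⟩
    -- The names of the encoded reduct avoid those of the residuals, as is required of the core in
    -- `traces_residuals`.
    have hsub : ∀ x ∈ τ ++ ν', x ∈ (N ∪ μ.toFinset) \ (D ∪ T) := by
      intro x hx
      rw [Finset.mem_sdiff]
      rcases List.mem_append.1 hx with hx | hx
      · refine ⟨Finset.mem_union_left _ (hτN x hx), fun h => ?_⟩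
        exact (n1.2 x (hDT x h)).2 (by simpa using hx)
      · exact ⟨(hν' x hx).2.2, f7 x hx⟩
    have d3 := Dec.par d2 (dec_clock (ev S))
    have hg : Good true (.par (Program.enc ⟨P.decl, shape m (ifs.map fun t => t.2)
      (rdx.map fun t => t.2.2) idle⟩) (clockK S)) := ⟨good_program _, good_clock⟩
    have hW := WF.of_dec hg d3 (N := (N ∪ μ.toFinset) \ (D ∪ T)) (by rwa [List.append_nil])
    have hQ' : Conf (.par Q.enc (clockK S)) ⊤ ⟨core + G2 + {clockK S}, ∅, N ∪ μ.toFinset⟩ := by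
      refine .of_cg (.par ?_ (.refl _)) hg ⟨good_program Q, good_clock⟩ d3
        (by rwa [List.append_nil]) fun x hx => (Finset.mem_sdiff.1 (hsub x (by simpa using hx))).1
      rw [program_enc, hdecl]
      exact .par (.refl _) (cg_enc hQ)
    rw [obsEquiv_iff, hZ.par_clock.outputs, hQ'.outputs]
    refine traces_residuals f8 f9 f10 e5 (fun x hx => ⟨(n1.2 x (hDT x hx)).1,
      Finset.mem_union_left _ (hνN x (hDT x hx))⟩) hW

/-! ### Structural congruence and reduction of products -/

theorem HProc.SC.nus {P P' : HProc S} (h : HProc.SC P P') (m : ℕ) :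
    HProc.SC (HProc.nus m P) (HProc.nus m P') := by
  induction m with
  | zero => exact h
  | succ m ih => exact .nu ih

theorem HProc.prod_append (l l' : List (HProc S)) :
    HProc.SC (HProc.prod (l ++ l')) (.par (HProc.prod l) (HProc.prod l')) := by
  induction l with
  | nil => exact (.trans (.symm (.par_inact _)) (.par_comm _ _))
  | cons a l ih => exact .trans (.par (.refl _) ih) (.symm (.par_assoc _ _ _))

theorem HProc.prod_perm {l l' : List (HProc S)} (h : l.Perm l') :
    HProc.SC (HProc.prod l) (HProc.prod l') := by
  induction h with
  | nil => exact .refl _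
  | cons a _ ih => exact .par (.refl a) ih
  | swap a b l =>
    exact .trans (.symm (.par_assoc _ _ _)) (.trans (.par (.par_comm _ _) (.refl _)) (.par_assoc _ _ _))
  | trans _ _ ih ih' => exact .trans ih ih'

theorem HProc.sc_prod_comps (P : HProc S) : HProc.SC P (HProc.prod P.comps) := by
  induction P with
  | par P Q ih ih' => exact .trans (.par ih ih') (.symm (HProc.prod_append _ _))
  | _ => exact .symm (.par_inact _)

theorem HProc.prod_flatMap (l : List (HProc S × HProc S × HProc S)) :
    HProc.SC (HProc.prod (l.flatMap fun t => [t.1, t.2.1]))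
      (HProc.prod (l.map fun t => .par t.1 t.2.1)) := by
  induction l with
  | nil => exact .refl _
  | cons t l ih => exact .trans (.symm (.par_assoc _ _ _)) (.par (.refl _) ih)

/-- Finite sequences of reductions. -/
abbrev Reds (D : Decl S) : HProc S → HProc S → Prop := Relation.ReflTransGen (Red D)

theorem Reds.par {D : Decl S} {P P' Q Q' : HProc S} (h : Reds D P P') (h' : Reds D Q Q') :
    Reds D (.par P Q) (.par P' Q') :=
  (h.lift (fun X => HProc.par X Q) fun _ _ hr => Red.par hr).trans
    (h'.lift (fun X => HProc.par P' X) fun _ _ hr =>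
      .str (.par_comm _ _) (Red.par hr) (.par_comm _ _))

/-- Restrictions shift the declaration, so the reductions are needed for every declaration; those of
a round never unfold a call. -/
theorem Reds.nus {P P' : HProc S} (h : ∀ D, Reds D P P') (m : ℕ) (D : Decl S) :
    Reds D (HProc.nus m P) (HProc.nus m P') := by
  induction m generalizing D with
  | zero => exact h D
  | succ m ih => exact (ih D.shift).lift HProc.nu fun _ _ hr => Red.scop hr

theorem Reds.prod {ι : Type*} {D : Decl S} {f g : ι → HProc S} {l : List ι}
    (h : ∀ t ∈ l, Red D (f t) (g t)) : Reds D (HProc.prod (l.map f)) (HProc.prod (l.map g)) := by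
  induction l with
  | nil => exact .refl
  | cons t l ih =>
    exact Reds.par (.single (h t List.mem_cons_self)) (ih fun t ht => h t (List.mem_cons_of_mem _ ht))

/-! ### Grouping the components of an evenly paired program -/

theorem not_redex_self (A : HProc S) : ¬ HProc.Redex A A := by
  rintro (⟨R, h⟩ | ⟨R, h⟩) <;> cases h

theorem countP_le_one {α : Type*} (p : α → Bool) (l : List α)
    (h : ∀ i j : Fin l.length, p (l.get i) → p (l.get j) → i = j) : l.countP p ≤ 1 := by
  induction l with
  | nil => simp
  | cons a l ih =>
    by_cases ha : p a
    · have : l.countP p = 0 := by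
        rw [List.countP_eq_zero]
        intro b hb hpb
        obtain ⟨i, rfl⟩ := List.get_of_mem hb
        exact absurd (h 0 i.succ ha hpb) (Fin.succ_ne_zero i).symm
      simp [this, ha]
    · rw [List.countP_cons_of_neg ha]
      exact ih fun i j hi hj => Fin.succ_injective _ (h i.succ j.succ hi hj)

theorem exists_ifSteps {l : List (HProc S)} (h : ∀ A ∈ l, ∃ A', HProc.IfStep A A') :
    ∃ ifs : List (HProc S × HProc S), ifs.map (fun t => t.1) = l ∧
      ∀ t ∈ ifs, HProc.IfStep t.1 t.2 := by
  choose! f hf using h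
  exact ⟨l.map fun A => (A, f A), by simp [Function.comp_def], by simpa using hf⟩

/-- The hypothesis `hc` says, with multiplicities, that a component has at most one partner. A redex
is removed from the list, both members having no partner among the rest, and the rest is split by
induction. Once no redex remains, the components are sorted into conditionals that reduce and idle
ones. -/
theorem exists_split {l : List (HProc S)} (hg : ∀ A ∈ l, A.Guarded)
    (hc : ∀ A ∈ l, ∀ B B' r, l.Perm (B :: B' :: r) → HProc.Redex A B → ¬ HProc.Redex A B')
    (ho : ∀ A ∈ l, ∀ B ∈ l, Offers A B) :
    ∃ ifs rdx idle, Split ifs rdx idle ∧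
      l.Perm (ifs.map (fun t => t.1) ++ (rdx.flatMap (fun t => [t.1, t.2.1]) ++ idle)) := by
  induction hn : l.length using Nat.strong_induction_on generalizing l with
  | _ n ih =>
  subst hn
  by_cases hex : ∃ A ∈ l, ∃ B ∈ l, ∃ R, HProc.Comm A B R
  · obtain ⟨A, hA, B, hB, R, hR⟩ := hex
    obtain ⟨r₀, h0⟩ : ∃ r₀, l.Perm (A :: r₀) := by
      classical exact ⟨_, List.perm_cons_erase hA⟩
    obtain ⟨r, h1⟩ : ∃ r, l.Perm (A :: B :: r) := by
      rcases List.mem_cons.1 (h0.mem_iff.1 hB) with rfl | hB'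
      · exact absurd (.inl ⟨R, hR⟩) (not_redex_self _)
      · classical exact ⟨_, h0.trans ((List.perm_cons_erase hB').cons A)⟩
    have hsub : ∀ C ∈ r, C ∈ l := fun C hC =>
      h1.mem_iff.2 (List.mem_cons_of_mem _ (List.mem_cons_of_mem _ hC))
    -- A further partner `C` of `A` would stand beside `B` in a rearrangement of the list, against
    -- `hc`.
    have hAr : ∀ C ∈ r, ¬ HProc.Redex A C := fun C hC => by
      obtain ⟨r', hr'⟩ : ∃ r', r.Perm (C :: r') := by classical exact ⟨_, List.perm_cons_erase hC⟩
      refine hc A hA B C (A :: r') ?_ (.inl ⟨R, hR⟩)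
      exact h1.trans (((hr'.cons B).cons A).trans
        ((List.Perm.swap _ _ _).trans ((List.Perm.swap _ _ _).cons B)))
    have hBr : ∀ C ∈ r, ¬ HProc.Redex B C := fun C hC => by
      obtain ⟨r', hr'⟩ : ∃ r', r.Perm (C :: r') := by classical exact ⟨_, List.perm_cons_erase hC⟩
      refine hc B hB A C (B :: r') ?_ (.inr ⟨R, hR⟩)
      exact h1.trans (((hr'.cons B).cons A).trans ((List.Perm.swap _ _ _).cons A))
    obtain ⟨ifs, rdx, idle, hs, hp⟩ := ih r.length (by rw [h1.length_eq]; simp)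
      (fun C hC => hg C (hsub C hC))
      (fun C hC D D' r' hr' => hc C (hsub C hC) D D' (A :: B :: r')
        (h1.trans (((hr'.cons B).cons A).trans (by
          have e : (A :: B :: D :: D' :: r') = [A, B] ++ ([D, D'] ++ r') := rfl
          have e' : (D :: D' :: A :: B :: r') = [D, D'] ++ ([A, B] ++ r') := rfl
          rw [e, e', ← List.append_assoc, ← List.append_assoc]
          exact List.perm_append_comm.append_right r'))))
      (fun C hC D hD => ho C (hsub C hC) D (hsub D hD)) rfl
    have hidle : ∀ C ∈ idle, C ∈ r := fun C hC => hp.mem_iff.2 (by simp [hC])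
    have hrdx : ∀ t ∈ rdx, t.1 ∈ r ∧ t.2.1 ∈ r := fun t ht =>
      ⟨hp.mem_iff.2 (by simp only [List.mem_append, List.mem_flatMap]; exact .inr (.inl ⟨t, ht, by simp⟩)),
        hp.mem_iff.2 (by simp only [List.mem_append, List.mem_flatMap]; exact .inr (.inl ⟨t, ht, by simp⟩))⟩
    refine ⟨ifs, (A, B, R) :: rdx, idle, ⟨hs.cond, ?_, ?_, ?_, ?_⟩, ?_⟩
    · exact List.forall_mem_cons.2 ⟨hR, hs.comm⟩
    · intro C hC
      obtain ⟨g1, g2, g3, g4⟩ := hs.rest C hC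
      exact ⟨g1, g2, g3, List.forall_mem_cons.2 ⟨⟨fun h => hAr C (hidle C hC) h.symm,
        fun h => hBr C (hidle C hC) h.symm⟩, g4⟩⟩
    · exact List.pairwise_cons.2 ⟨fun t ht => ⟨hAr _ (hrdx t ht).2,
        fun h => hBr _ (hrdx t ht).1 h.symm⟩, hs.apart⟩
    · intro C hC D hD
      refine ho C ?_ D ?_
      · simp only [List.map_cons, List.cons_append, List.mem_cons, List.mem_append, List.mem_map] at hC
        rcases hC with rfl | ⟨t, ht, rfl⟩ | hC
        exacts [hA, hsub _ (hrdx t ht).1, hsub _ (hidle _ hC)]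
      · simp only [List.map_cons, List.cons_append, List.mem_cons, List.mem_append, List.mem_map] at hD
        rcases hD with rfl | ⟨t, ht, rfl⟩ | hD
        exacts [hB, hsub _ (hrdx t ht).2, hsub _ (hidle _ hD)]
    · refine h1.trans (((hp.cons B).cons A).trans ?_)
      simp only [List.flatMap_cons, List.cons_append, List.nil_append]
      exact ((List.perm_middle.symm.cons A).trans List.perm_middle.symm)
  · push Not at hex
    classical
    let p : HProc S → Bool := fun A => decide (∃ A', HProc.IfStep A A')
    obtain ⟨ifs, h1, h2⟩ := exists_ifSteps (l := l.filter p) fun A hA => by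
      simpa [p] using (List.mem_filter.1 hA).2
    have hm : ∀ A ∈ l.filter (fun A => !p A), A ∈ l := fun A hA => (List.mem_filter.1 hA).1
    refine ⟨ifs, [], l.filter (fun A => !p A), ⟨h2, by simp, fun A hA => ⟨hg A (hm A hA), ?_, ?_,
      by simp⟩, .nil, fun A hA B hB => ho A (hm A hA) B (hm B hB)⟩, ?_⟩
    · simpa [p] using (List.mem_filter.1 hA).2
    · rintro B hB (⟨R, h⟩ | ⟨R, h⟩)
      exacts [hex A (hm A hA) B (hm B hB) R h, hex B (hm B hB) A (hm A hA) R h]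
    · rw [h1]
      exact (List.filter_append_perm p l).symm

theorem sc_shape {m : ℕ} {B : HProc S} {ifs : List (HProc S × HProc S)}
    {rdx : List (HProc S × HProc S × HProc S)} {idle : List (HProc S)}
    (h : B.comps.Perm (ifs.map (fun t => t.1) ++ (rdx.flatMap (fun t => [t.1, t.2.1]) ++ idle))) :
    HProc.SC (HProc.nus m B)
      (shape m (ifs.map fun t => t.1) (rdx.map fun t => .par t.1 t.2.1) idle) := by
  refine HProc.SC.nus (.trans (HProc.sc_prod_comps B) (.trans (HProc.prod_perm h)
    (.trans (HProc.prod_append _ _) (.par (.refl _) (.trans (HProc.prod_append _ _)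
      (.par (HProc.prod_flatMap _) (.refl _)))))) ) m

theorem reds_shape {ifs : List (HProc S × HProc S)}
    {rdx : List (HProc S × HProc S × HProc S)} {idle : List (HProc S)} (h : Split ifs rdx idle)
    (m : ℕ) (D : Decl S) :
    Reds D (shape m (ifs.map fun t => t.1) (rdx.map fun t => .par t.1 t.2.1) idle)
      (shape m (ifs.map fun t => t.2) (rdx.map fun t => t.2.2) idle) :=
  Reds.nus (fun _ => Reds.par (Reds.prod fun t ht => .ite (h.cond t ht))
    (Reds.par (Reds.prod fun t ht => .comm (h.comm t ht)) .refl)) m D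

theorem Reds.of_sc {D : Decl S} {P Q R : HProc S} (h : HProc.SC P Q) (h' : Reds D Q R) :
    ∃ R', Reds D P R' ∧ HProc.SC R' R := by
  induction h' with
  | refl => exact ⟨P, .refl, h⟩
  | tail _ hr ih =>
    obtain ⟨R', h1, h2⟩ := ih
    exact ⟨_, h1.tail (.str h2 hr (.refl _)), .refl _⟩

/-- The canonical outermost reduction of an evenly paired program. -/
theorem exists_split_of_evenlyPaired {P : Program S} (hnf : P.NormalForm) (hpair : P.EvenlyPaired) :
    ∃ m ifs rdx idle, Split ifs rdx idle ∧
      HProc.SC P.body (shape m (ifs.map fun t => t.1) (rdx.map fun t => .par t.1 t.2.1) idle) := by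
  obtain ⟨m, B, hB, hg⟩ := hnf
  obtain ⟨h1, h2⟩ := hpair m B hB hg
  obtain ⟨ifs, rdx, idle, hs, hp⟩ := exists_split hg (fun A hA C C' r hr hC hC' => by
    classical
    obtain ⟨i, rfl⟩ := List.get_of_mem hA
    -- Even pairing speaks of positions; as a count it is invariant under permutations of the
    -- components.
    have := countP_le_one (fun X => decide (HProc.Redex (B.comps.get i) X)) B.comps
      fun j j' hj hj' => h1 i j j' (of_decide_eq_true hj) (of_decide_eq_true hj')
    rw [hr.countP_eq, List.countP_cons_of_pos (by simpa using hC),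
      List.countP_cons_of_pos (by simpa using hC')] at this
    omega) (fun A hA C hC k l A' n ls Ps e e' => by
      subst e e'
      exact h2 k l A' n ls Ps hA hC)
  exact ⟨m, ifs, rdx, idle, hs, by rw [hB]; exact sc_shape hp⟩

theorem Split.outermost {ifs : List (HProc S × HProc S)}
    {rdx : List (HProc S × HProc S × HProc S)} {idle : List (HProc S)} (h : Split ifs rdx idle)
    {m : ℕ} {P : Program S}
    (hP : HProc.SC P.body (shape m (ifs.map fun t => t.1) (rdx.map fun t => .par t.1 t.2.1) idle)) :
    Program.Outermost P
      ⟨P.decl, shape m (ifs.map fun t => t.2) (rdx.map fun t => t.2.2) idle⟩ :=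
  ⟨rfl, Reds.of_sc hP (reds_shape h m P.decl), m, ifs, rdx, idle, hP, .refl _, h.cond, h.comm, h.rest⟩

/-! ### Consequences of determinacy -/

theorem program_sc_refl (P : Program S) : Program.SC P P := ⟨rfl, .refl _⟩

theorem outermost_trans_sc {P Q Q' : Program S} (h : Program.Outermost P Q)
    (h' : Program.SC Q Q') : Program.Outermost P Q' := by
  obtain ⟨h1, ⟨P', h2, h3⟩, m, ifs, rdx, idle, h4, h5, h6⟩ := h
  exact ⟨h'.1.symm.trans h1, ⟨P', h2, .trans h3 h'.2⟩, m, ifs, rdx, idle, h4,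
    .trans (.symm h'.2) h5, h6⟩

theorem deterministic_unique {P Q Q' : Program S} (h : P.Deterministic)
    (hQ : Program.Outermost P Q) (hQ' : Program.Outermost P Q') : Program.SC Q Q' := by
  refine h 1 (fun i => if i = 0 then P else Q) (fun i => if i = 0 then P else Q') (program_sc_refl _) (program_sc_refl _)
    ?_ ?_ 1 le_rfl
  all_goals
    intro i hi
    obtain rfl : i = 0 := by omega
    simpa

/-- Sequences from `Q` become sequences from `P` when `P` is put in front. -/
theorem deterministic_outermost {P Q : Program S} (h : P.Deterministic)
    (hQ : Program.Outermost P Q) : Q.Deterministic := by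
  intro n s t hs ht hs' ht' i hi
  refine h (n + 1) (fun i => i.casesOn P s) (fun i => i.casesOn P t) (program_sc_refl _) (program_sc_refl _) ?_ ?_
    (i + 1) (by omega)
  · rintro (_ | j) hj
    · exact outermost_trans_sc hQ hs
    · exact hs' j (by omega)
  · rintro (_ | j) hj
    · exact outermost_trans_sc hQ ht
    · exact ht' j (by omega)

end Corr

theorem theorem1 {S : Sig.{u}} (P : Program S) (hnf : P.NormalForm) (hdet : P.Deterministic)
    (hpair : P.EvenlyPaired) :
    (∀ Q : Program S, Program.Outermost P Q →
      ∃ R : UProc S, UProc.TimeStep P.enc R ∧ UProc.ObsEquiv R Q.enc) ∧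
    (∀ R' : UProc S, UProc.TimeStep P.enc R' →
      ∃ Q : Program S, Program.Outermost P Q ∧ Q.Deterministic ∧ UProc.ObsEquiv Q.enc R') := by
  obtain ⟨m, ifs, rdx, idle, hs, hP⟩ := Corr.exists_split_of_evenlyPaired hnf hpair
  have hQ₁ := hs.outermost hP
  refine ⟨fun Q hQ => ?_, fun R' hR' => ?_⟩
  -- By determinacy the given reduct is congruent to the one in which all listed conditionals and
  -- redexes have reduced.
  · have hQ' := (Corr.deterministic_unique hdet hQ hQ₁).2
    obtain ⟨⟨R, hR⟩, h⟩ := Corr.timeStep_of_split hs hQ.1 hP hQ'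
    exact ⟨R, hR, h R hR⟩
  -- The same reduct answers every time step, since all time steps lead to equivalent processes.
  · refine ⟨_, hQ₁, Corr.deterministic_outermost hdet hQ₁, ?_⟩
    have h := Corr.timeStep_of_split (P := P)
      (Q := ⟨P.decl, Corr.shape m (ifs.map fun t => t.2) (rdx.map fun t => t.2.2) idle⟩)
      hs rfl hP (.refl _)
    exact Eq.symm (h.2 R' hR')
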